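/- Graphs are simple and may be infinite. For a perfect matching $M$ of a graph $G$, let $\mathrm{Perf}(G,M)$ be the set of perfect matchings of $G$ whose symmetric difference with $M$ is finite. $G$ is *matching covered* (with respect to $M$) if it is connected and every edge lies in some element of $\mathrm{Perf}(G,M)$. Fix such $G$ and $M$. For $X\subseteq V(G)$ let $\partial(X)$ be the set of edges with exactly one endpoint in $X$; $X$ is a *tight set* and $\partial(X)$ a *tight cut* if every $M'\in \mathrm{Perf}(G,M)$ has exactly one edge in $\partial(X)$. A tight set $X$ is *trivial* if $|X|=1$ or $|V(G)\setminus X|=1$. Two cuts are *nested* if they have the form $\partial(X_1),\partial(X_2)$ with $X_1\cap X_2=\emptyset$. A matching covered graph all of whose tight sets are trivial is called a *BoB* (brick or brace). A *tight set partition* is a partition $\mathcal P$ of $V(G)$ into tight sets; its *collapse* is the graph on $\mathcal P$ in which distinct $P,Q$ are adjacent iff some edge of $G$ joins them, and $M$ induces on it the perfect matching of those pairs $PQ$ that are joined by an edge of $M$. Tightness in the collapse refers to this matching. Let $\mathcal C$ be an inclusion-maximal family of pairwise nested tight cuts of $G$. A *torso* of $\mathcal C$ is the collapse of a tight set partition $\mathcal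 P$ with $|\mathcal P|\ge 4$ such that $\partial(P)\in\mathcal C$ for all $P\in\mathcal P$ and the collapse is a BoB. It is a *$C_4$-torso* if it is a cycle of length 4, and a *non-$C_4$-torso* otherwise. A set $S$ is *passable* for $P$ if $P\setminus S$ and $P\cup S$ are tight. A *torsoid* in $G$ is a pair $(H,\varepsilon)$ such that: 1. $H$ is a matching covered graph on at least 4 vertices that is a BoB or a (finite) cycle, where the matching of $H$ is the one induced by $M$: it consists of the edges $vw$ of $H$ such that $M$ has an edge from $v$ to $\varepsilon(vw)\cup w$ (equivalently, from $w$ to $\varepsilon(vw)\cup v$); 2. the vertices of $H$ are tight sets of $G$, and $\varepsilon$ maps $E(H)$ to subsets of $V(G)$; 3. the vertices of $H$ and the sets $\varepsilon(e)$, $e \in E(H)$, are pairwise disjoint with union $V(G)$ (sets $\varepsilon(e)$ may be empty); 4. for every edge $vw$ of $H$ there is an edge of $G$ from $v\cup\varepsilon(vw)$ to $w$, and $\varepsilon(vw)$ is the largest among all subsets of $v\cup\varepsilon(vw)\cup w$ that are passable for both $v$ and $w$; 5. for distinct non-adjacent vertices $v,w$ of $H$ there is no edge of $G$ from $v$ to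 $w$; 6. if $H$ is a cycle and $v$ is a vertex of $H$ with neighbours $u\ne w$, then there is no partition of $\varepsilon(uv)\cup v\cup\varepsilon(vw)$ into tight sets $P_1,P_2,P_3$ such that both $u\cup P_1\cup P_2$ and $P_2\cup P_3\cup w$ are tight. The torsoid is *cyclic* if $H$ is a cycle and *noncyclic* otherwise. A torso *cleaves* a torsoid $(H,\varepsilon)$ if every vertex of the torso includes a vertex of $H$ as a subset. **Theorem.** Every torso of $\mathcal C$ cleaves exactly one torsoid in $G$. Let $\kappa_{\mathcal C}$ be the map sending each torso of $\mathcal C$ to the torsoid it cleaves. Then the $\kappa_{\mathcal C}$-preimage of every noncyclic torsoid consists of exactly one torso, which is a non-$C_4$-torso; and the $\kappa_{\mathcal C}$-preimage of every cyclic torsoid with $n$ vertices consists of exactly $\frac n2-1$ torsos, all of which are $C_4$-torsos. -/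

import Mathlib

namespace TightCuts

variable {V : Type*}

/-- The perfect matchings of `G` that have finite symmetric difference to `M`. -/
def perfectMatchings (G : SimpleGraph V) (M : G.Subgraph) : Set G.Subgraph :=
  {M' | M'.IsPerfectMatching ∧ (symmDiff M'.edgeSet M.edgeSet).Finite}

/-- `G` is connected, and it is matching covered with respect to the perfect matching `M`. -/
structure IsMatchingCovered (G : SimpleGraph V) (M : G.Subgraph) : Prop where
  connected : G.Connected
  isPerfectMatching : M.IsPerfectMatching
  covered : ∀ e ∈ G.edgeSet, ∃ M' ∈ perfectMatchings G M, e ∈ M'.edgeSet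

/-- The cut induced by `X`: the edges with exactly one endpoint in `X`. -/
def cut (G : SimpleGraph V) (X : Set V) : Set (Sym2 V) :=
  {e | e ∈ G.edgeSet ∧ ∃ x ∈ X, ∃ y ∉ X, e = s(x, y)}

/-- `X` is a tight set of `G` (with respect to `M`). -/
def IsTight (G : SimpleGraph V) (M : G.Subgraph) (X : Set V) : Prop :=
  ∀ M' ∈ perfectMatchings G M, (M'.edgeSet ∩ cut G X).encard = 1

/-- `C` is a tight cut of `G` (with respect to `M`). -/
def IsTightCut (G : SimpleGraph V) (M : G.Subgraph) (C : Set (Sym2 V)) : Prop :=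
  ∃ X : Set V, IsTight G M X ∧ C = cut G X

/-- Two cuts are nested if they are induced by disjoint vertex sets. -/
def Nested (G : SimpleGraph V) (C₁ C₂ : Set (Sym2 V)) : Prop :=
  ∃ X₁ X₂ : Set V, Disjoint X₁ X₂ ∧ C₁ = cut G X₁ ∧ C₂ = cut G X₂

/-- `𝒞` is an inclusion-maximal family of pairwise nested tight cuts. -/
def IsMaximalNestedFamily (G : SimpleGraph V) (M : G.Subgraph)
    (𝒞 : Set (Set (Sym2 V))) : Prop :=
  Maximal (fun 𝒟 : Set (Set (Sym2 V)) =>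
    (∀ C ∈ 𝒟, IsTightCut G M C) ∧ 𝒟.Pairwise (Nested G)) 𝒞

/-- `G` is a brick or a brace: it is matching covered with respect to `M`, and each of its tight
sets is trivial. -/
def IsBrickOrBrace (G : SimpleGraph V) (M : G.Subgraph) : Prop :=
  IsMatchingCovered G M ∧ ∀ X : Set V, IsTight G M X → X.encard = 1 ∨ Xᶜ.encard = 1

/-- `G` is a (finite) cycle. -/
def IsCycleGraph (G : SimpleGraph V) : Prop :=
  ∃ n : ℕ, 3 ≤ n ∧ Nonempty (G ≃g SimpleGraph.cycleGraph n)

/-- `G` is a cycle of length four. -/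
def IsC4 (G : SimpleGraph V) : Prop :=
  Nonempty (G ≃g SimpleGraph.cycleGraph 4)

/-- A partition of the vertex set into tight sets. -/
def IsTightSetPartition (G : SimpleGraph V) (M : G.Subgraph) (P : Set (Set V)) : Prop :=
  Setoid.IsPartition P ∧ ∀ X ∈ P, IsTight G M X

/-- The collapse of a partition `P`: its vertices are the classes of `P`, and two distinct classes
are adjacent if some edge of `G` joins them. -/
def collapse (G : SimpleGraph V) (P : Set (Set V)) : SimpleGraph P where
  Adj X Y := X ≠ Y ∧ ∃ x ∈ X.1, ∃ y ∈ Y.1, G.Adj x y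
  symm := ⟨fun _ _ ⟨hne, x, hx, y, hy, h⟩ => ⟨hne.symm, y, hy, x, hx, h.symm⟩⟩
  loopless := ⟨fun _ h => h.1 rfl⟩

/-- The matching that `M` induces on the collapse of `P`. -/
def collapseMatching {G : SimpleGraph V} (M : G.Subgraph) (P : Set (Set V)) :
    (collapse G P).Subgraph where
  verts := Set.univ
  Adj X Y := X ≠ Y ∧ ∃ x ∈ X.1, ∃ y ∈ Y.1, M.Adj x y
  adj_sub := fun ⟨hne, x, hx, y, hy, h⟩ => ⟨hne, x, hx, y, hy, M.adj_sub h⟩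
  edge_vert := fun _ => Set.mem_univ _
  symm := ⟨fun _ _ ⟨hne, x, hx, y, hy, h⟩ => ⟨hne.symm, y, hy, x, hx, h.symm⟩⟩

/-- A maximal star of `𝒞`: a tight set partition of size at least four whose collapse is a brick or
a brace and all of whose classes induce cuts in `𝒞`. -/
structure IsMaximalStar (G : SimpleGraph V) (M : G.Subgraph) (𝒞 : Set (Set (Sym2 V)))
    (P : Set (Set V)) : Prop where
  isTightSetPartition : IsTightSetPartition G M P
  four_le : 4 ≤ P.encard
  isBrickOrBrace : IsBrickOrBrace (collapse G P) (collapseMatching M P)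
  cut_mem : ∀ X ∈ P, cut G X ∈ 𝒞

/-- A torso of `𝒞`. It is the collapse of a maximal star, and so it is determined by its vertex set,
the star. -/
structure Torso (G : SimpleGraph V) (M : G.Subgraph) (𝒞 : Set (Set (Sym2 V))) where
  star : Set (Set V)
  isMaximalStar : IsMaximalStar G M 𝒞 star

/-- The torso as a graph. -/
def Torso.graph {G : SimpleGraph V} {M : G.Subgraph} {𝒞 : Set (Set (Sym2 V))}
    (S : Torso G M 𝒞) : SimpleGraph S.star :=
  collapse G S.star

/-- `S` is passable for `P`. -/
def IsPassable (G : SimpleGraph V) (M : G.Subgraph) (S P : Set V) : Prop :=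
  IsTight G M (P \ S) ∧ IsTight G M (P ∪ S)

/-- The matching that `M` induces on a graph `H` whose vertices are disjoint vertex sets of `G` and
whose edges `e` carry vertex sets `ε e` of `G`: it contains the edge `vw` of `H` if `M` has an edge
from `v` to `ε vw ∪ w` or from `w` to `ε vw ∪ v`. (For a torsoid these two conditions are
equivalent, and this matching is the one that `M` induces on the collapse of any tight set partition
obtained by adding each `ε vw` to one of `v`, `w`.) -/
def inducedMatching {G : SimpleGraph V} (M : G.Subgraph) {W : Set (Set V)} (H : SimpleGraph W)
    (ε : H.edgeSet → Set V) : H.Subgraph where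
  verts := Set.univ
  Adj v w := ∃ e : H.edgeSet, e.1 = s(v, w) ∧
    ((∃ x ∈ v.1, ∃ y ∈ ε e ∪ w.1, M.Adj x y) ∨ (∃ x ∈ w.1, ∃ y ∈ ε e ∪ v.1, M.Adj x y))
  adj_sub := by
    rintro v w ⟨e, he, -⟩
    have h := e.2
    rw [he] at h
    exact h
  edge_vert := fun _ => Set.mem_univ _
  symm := ⟨fun _ _ ⟨e, he, h⟩ => ⟨e, he.trans Sym2.eq_swap, h.symm⟩⟩

/-- A torsoid `(H, ε)` in `G`, where `H` is `graph` with vertex set `verts` and `ε` is `edgeSets`. -/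
structure Torsoid (G : SimpleGraph V) (M : G.Subgraph) where
  verts : Set (Set V)
  graph : SimpleGraph verts
  edgeSets : graph.edgeSet → Set V
  four_le : 4 ≤ verts.encard
  isMatchingCovered : IsMatchingCovered graph (inducedMatching M graph edgeSets)
  brickOrBrace_or_cycle :
    IsBrickOrBrace graph (inducedMatching M graph edgeSets) ∨ IsCycleGraph graph
  isTight : ∀ v ∈ verts, IsTight G M v
  /- The vertices of `H` and the sets `ε e` form a near partition of the vertex set of `G`: they are
  disjoint and cover it, and sets `ε e` may be empty. -/
  disjoint_verts : verts.Pairwise Disjoint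
  disjoint_edgeSets : Pairwise fun e f => Disjoint (edgeSets e) (edgeSets f)
  disjoint_verts_edgeSets : ∀ v ∈ verts, ∀ e, Disjoint v (edgeSets e)
  cover : ⋃₀ verts ∪ ⋃ e, edgeSets e = Set.univ
  exists_edge : ∀ (v w : verts) (h : graph.Adj v w),
    ∃ x ∈ v.1 ∪ edgeSets ⟨s(v, w), h⟩, ∃ y ∈ w.1, G.Adj x y
  isGreatest : ∀ (v w : verts) (h : graph.Adj v w),
    IsGreatest {S : Set V | S ⊆ v.1 ∪ edgeSets ⟨s(v, w), h⟩ ∪ w.1 ∧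
      IsPassable G M S v.1 ∧ IsPassable G M S w.1} (edgeSets ⟨s(v, w), h⟩)
  no_edge : ∀ v w : verts, v ≠ w → ¬ graph.Adj v w → ∀ x ∈ v.1, ∀ y ∈ w.1, ¬ G.Adj x y
  no_refinement : IsCycleGraph graph →
    ∀ (u v w : verts) (huv : graph.Adj u v) (hvw : graph.Adj v w), u ≠ w →
      ¬ ∃ P₁ P₂ P₃ : Set V, IsTight G M P₁ ∧ IsTight G M P₂ ∧ IsTight G M P₃ ∧
        Disjoint P₁ P₂ ∧ Disjoint P₁ P₃ ∧ Disjoint P₂ P₃ ∧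
        P₁ ∪ P₂ ∪ P₃ = edgeSets ⟨s(u, v), huv⟩ ∪ v.1 ∪ edgeSets ⟨s(v, w), hvw⟩ ∧
        IsTight G M (u.1 ∪ P₁ ∪ P₂) ∧ IsTight G M (P₂ ∪ P₃ ∪ w.1)

/-- A torsoid is cyclic if its graph is a cycle. -/
def Torsoid.IsCyclic {G : SimpleGraph V} {M : G.Subgraph} (T : Torsoid G M) : Prop :=
  IsCycleGraph T.graph

/-- The torso `S` cleaves the torsoid `T` if every vertex of `S` contains a vertex of `T`. -/
def Torso.Cleaves {G : SimpleGraph V} {M : G.Subgraph} {𝒞 : Set (Set (Sym2 V))}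
    (S : Torso G M 𝒞) (T : Torsoid G M) : Prop :=
  ∀ X ∈ S.star, ∃ v ∈ T.verts, v ⊆ X

end TightCuts

/-!
The statement is about the elements of `Perf(G, M)` only, since these cover `G`. Each of them is
encoded as the involution that sends a vertex to its partner, and a `MatchingSystem` records what
is needed of this family: any two members differ in finitely many vertices, every proper nonempty
set is left by some member, and members can be glued. By finiteness of the differences, the number
of matching edges in a cut has a well-defined parity `par` whenever it is finite, and a set is
tight if its parity is odd and no member leaves it by more than two edges (`tight_of_par`). This
replaces counting vertices, which is not available in infinite graphs, and gives the usual
uncrossing of tight sets. A partition into tight sets induces a matching system on its classes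
(`collapseSystem`), and a tight set `X` leaves there the tight trace `hat`, formed by the classes
that `X` meets in an odd set.

A torsoid is encoded by the map `q` that labels the elements of a vertex `i` with `s(i, i)` and
those of the set carried by an edge `ij` with `s(i, j)`. Distributing each edge set over its two
ends so that the classes stay tight yields a `Compat`ible partition, and all these partitions
induce the same matchings. The maximality conditions in the definition of a torsoid make the edge
sets contain every set that is passable for two classes of any compatible partition (`Full`). The
reason is that passable sets at a class towards two different neighbours meet in an even set, and
then not at all (`Pass.inter_eq_empty`). In a noncyclic torsoid this holds because every class has
a third neighbour; in a cyclic one an odd overlap would split a class into three tight sets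
(`Ring.split_of_overlap`), contrary to the last condition in the definition. Together with the
observation that in bricks, braces and cycles a class outside a tight set has at most one neighbour
inside (`Sparse`), unless it is the only class outside, fullness controls all tight sets: if
neither the hat nor its complement is a single class, a tight set contains the nodes in its hat,
avoids the other nodes, and consists otherwise of vertices from edge sets at its hat
(`Good.node_subset`, `Good.node_disjoint`, `Good.exists_mem_hat`).

*Every torso cleaves a torsoid.* A brick or brace is a cycle of length four or every vertex has at
least three neighbours (`Braced.branching_or_ring`). In the latter case one moves the largest
passable sets from the classes to the edges (`trim`). In the former case the cycle is first refined
by splitting classes into three as long as possible. This ends, because a matching of one of the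
two types differs from one of the other type at a vertex of every class (`Ring.exists_unsplit`).

*It cleaves only one.* If `r` cleaves `q`, then `r` is a coarsening of a compatible partition
(`Good.exists_refinement`). A brick or brace has no proper coarsening, so for noncyclic torsoids
the classes of `r` are the nodes, enlarged by parts of edge sets. For two cyclic torsoids one
obtains two refinements of the same cycle. If a class of one of them had a hat with more than one
class in the other, it could be split (`Ring.split_of_hat`), so the classes correspond. By
fullness, torsoids with corresponding classes agree (`Good.eq_map`). A torso does not cleave
torsoids of both kinds, as its vertices have two neighbours in the one case and at least three in
the other.

*Torsos of a given torsoid.* Suppose that the nodes are partitioned in such a way that the hat of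
each member of the maximal nested family, or its complement, lies inside one part. Then the members
determine how to distribute the edge sets so that the parts become members of the family
(`Good.exists_star`). For noncyclic torsoids all members have trivial hats, which gives a torso;
two torsos refine each other and hence agree. For a cyclic torsoid fix a node `o`. The hats of
members that avoid `o`, together with the singletons and the set of all nodes other than `o`, form
a laminar family on these `n - 1` nodes. The torsos correspond to the hats with more than one node,
and the maximal hats properly below such a hat are three in number (`Cyclic.hats_of_starMap`,
`Cyclic.exists_starMap`), because the torso is a cycle of length four. A laminar family in which
every set with more than one element splits into three has `(n - 2) / 2` such sets on `n - 1`
points (`two_mul_ncard_add_one`).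
-/

/-! ### Matching systems, parity and uncrossing -/

namespace TightCuts

/-- The vertices of `A` that the map `f` sends out of `A`. -/
def exits {V : Type*} (f : V → V) (A : Set V) : Set V := {x | x ∈ A ∧ f x ∉ A}

/-- A matching system: a nonempty family of fixed-point-free involutions (perfect matchings, each
encoded as the map that sends a vertex to its partner) that pairwise differ in only finitely many
vertices, such that every proper nonempty set is left by one of them, and that contains every
involution which agrees with members of the family pointwise and differs from one of them in
only finitely many vertices. -/
structure MatchingSystem (V : Type*) where
  carrier : Set (V → V)
  nonempty : carrier.Nonempty
  invol : ∀ f ∈ carrier, ∀ x, f (f x) = x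
  ne : ∀ f ∈ carrier, ∀ x, f x ≠ x
  fin : ∀ f ∈ carrier, ∀ g ∈ carrier, {x | f x ≠ g x}.Finite
  conn : ∀ A : Set V, A.Nonempty → A ≠ Set.univ → ∃ f ∈ carrier, ∃ x ∈ A, f x ∉ A
  glue : ∀ f₀ ∈ carrier, ∀ F : V → V, (∀ x, F (F x) = x) → (∀ x, ∃ f ∈ carrier, F x = f x) →
    {x | F x ≠ f₀ x}.Finite → F ∈ carrier

namespace MatchingSystem

variable {V : Type*} (𝓢 : MatchingSystem V)

/-- `X` is tight if every matching of the system has exactly one edge leaving `X`. -/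
def Tight (X : Set V) : Prop := ∀ f ∈ 𝓢.carrier, ∃ x, exits f X = {x}

/-- A matching of the system, fixed as a reference. -/
noncomputable def base : V → V := 𝓢.nonempty.some

theorem base_mem : 𝓢.base ∈ 𝓢.carrier := 𝓢.nonempty.some_mem

/-- The cut of `A` contains only finitely many edges of a (equivalently, of each) matching. -/
def FinCut (A : Set V) : Prop := (exits 𝓢.base A).Finite

/-- The parity of the number of matching edges in the cut of `A`. It does not depend on the
matching; it is meaningful only if `FinCut A` holds. -/
noncomputable def par (A : Set V) : ZMod 2 := ((exits 𝓢.base A).ncard : ZMod 2)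

variable {𝓢} {f g : V → V} {A B X Y : Set V}

theorem exits_compl (hf : f ∈ 𝓢.carrier) : exits f Aᶜ = f '' exits f A := by
  ext x
  constructor
  · rintro ⟨h1, h2⟩
    exact ⟨f x, ⟨by simpa using h2, by rw [𝓢.invol f hf]; exact h1⟩, 𝓢.invol f hf x⟩
  · rintro ⟨y, ⟨h1, h2⟩, rfl⟩
    exact ⟨h2, by rw [𝓢.invol f hf]; simpa using h1⟩

theorem exits_inter_subset : exits f (A ∩ B) ⊆ exits f A ∪ exits f B := by
  rintro x ⟨⟨h1, h2⟩, h3⟩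
  by_cases h : f x ∈ A
  · exact Or.inr ⟨h2, fun h' => h3 ⟨h, h'⟩⟩
  · exact Or.inl ⟨h1, h⟩

theorem exits_union_subset : exits f (A ∪ B) ⊆ exits f A ∪ exits f B := by
  rintro x ⟨h1 | h1, h3⟩
  · exact Or.inl ⟨h1, fun h => h3 (Or.inl h)⟩
  · exact Or.inr ⟨h1, fun h => h3 (Or.inr h)⟩

/-- A finite set that is invariant under a fixed-point-free involution is even. -/
theorem ncard_eq_zero_of_invariant (hf : f ∈ 𝓢.carrier) {S : Set V} (hS : S.Finite)
    (h : ∀ x ∈ S, f x ∈ S) : (S.ncard : ZMod 2) = 0 := by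
  classical
  rw [Set.ncard_eq_toFinset_card S hS, ← Finset.sum_const_zero (s := hS.toFinset), ← mul_one
    (Nat.cast _), ← nsmul_eq_mul, ← Finset.sum_const, Finset.sum_const_zero]
  refine Finset.sum_involution (fun x _ => f x) ?_ ?_ ?_ ?_
  · intro a _; decide
  · intro a _ _; exact 𝓢.ne f hf a
  · intro a ha; simpa using h a (by simpa using ha)
  · intro a _; exact 𝓢.invol f hf a

/-- Whether a cut contains finitely many edges of a matching, and the parity of their number, is
the same for all members of the system: outside the finite set where two members differ they have
the same exits, and inside this set each of them pairs up the vertices of `A` that are not exits. -/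
theorem exits_finite_and_parity (hf : f ∈ 𝓢.carrier) (hg : g ∈ 𝓢.carrier)
    (hA : (exits f A).Finite) :
    (exits g A).Finite ∧ ((exits g A).ncard : ZMod 2) = (exits f A).ncard := by
  set D := {x | f x ≠ g x} with hD
  have hDf : D.Finite := 𝓢.fin f hf g hg
  have hDf' : ∀ x ∈ D, f x ∈ D := by
    intro x hx h
    apply hx
    rw [𝓢.invol f hf] at h
    calc f x = g (g (f x)) := (𝓢.invol g hg _).symm
      _ = g x := by rw [← h]
  have hDg' : ∀ x ∈ D, g x ∈ D := by
    intro x hx h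
    apply hx
    rw [𝓢.invol g hg] at h
    calc f x = f (f (g x)) := by rw [h]
      _ = g x := 𝓢.invol f hf _
  -- outside `D` the two matchings agree
  have hout : exits f A \ D = exits g A \ D := by
    ext x
    simp only [exits, Set.mem_sdiff, Set.mem_ofPred_eq, hD, not_not]
    constructor <;> rintro ⟨⟨h1, h2⟩, h3⟩
    · exact ⟨⟨h1, h3 ▸ h2⟩, h3⟩
    · exact ⟨⟨h1, h3 ▸ h2⟩, h3⟩
  -- modulo 2, the exits in `D` are as many as the vertices of `A ∩ D`: the remaining ones are
  -- paired up
  have key : ∀ h ∈ 𝓢.carrier, (∀ x ∈ D, h x ∈ D) →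
      ((exits h A ∩ D).ncard : ZMod 2) = (A ∩ D).ncard := by
    intro h hh hhD
    have h1 := ncard_eq_zero_of_invariant hh (S := (A ∩ D) \ exits h A)
      ((hDf.inter_of_right A).sdiff) (by
        rintro x ⟨⟨h1, h2⟩, h3⟩
        have : h x ∈ A := by
          by_contra hc; exact h3 ⟨h1, hc⟩
        refine ⟨⟨this, hhD x h2⟩, fun hc => hc.2 ?_⟩
        rwa [𝓢.invol h hh])
    have h2 := Set.ncard_sdiff_add_ncard_of_subset (s := exits h A ∩ D) (t := A ∩ D)
      (fun x hx => ⟨hx.1.1, hx.2⟩) (hDf.inter_of_right A)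
    have h3 : (A ∩ D) \ (exits h A ∩ D) = (A ∩ D) \ exits h A := by
      ext x; simp only [Set.mem_sdiff, Set.mem_inter_iff]; tauto
    rw [h3] at h2
    rw [← h2]; push_cast; rw [h1, zero_add]
  have hgf : (exits g A).Finite := by
    rw [← Set.sdiff_union_inter (exits g A) D, ← hout]
    exact (hA.sdiff).union (hDf.inter_of_right _)
  refine ⟨hgf, ?_⟩
  rw [← Set.ncard_inter_add_ncard_sdiff_eq_ncard _ D hgf,
    ← Set.ncard_inter_add_ncard_sdiff_eq_ncard (exits f A) D hA, hout]
  push_cast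
  rw [key f hf hDf', key g hg hDg']

theorem FinCut.par_eq (h : 𝓢.FinCut A) (hf : f ∈ 𝓢.carrier) : 𝓢.par A = (exits f A).ncard :=
  (exits_finite_and_parity 𝓢.base_mem hf h).2.symm

theorem finCut_of_finite (hf : f ∈ 𝓢.carrier) (h : (exits f A).Finite) : 𝓢.FinCut A :=
  (exits_finite_and_parity hf 𝓢.base_mem h).1

theorem FinCut.union (hA : 𝓢.FinCut A) (hB : 𝓢.FinCut B) : 𝓢.FinCut (A ∪ B) :=
  (Set.Finite.union hA hB).subset exits_union_subset

theorem FinCut.inter (hA : 𝓢.FinCut A) (hB : 𝓢.FinCut B) : 𝓢.FinCut (A ∩ B) :=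
  (Set.Finite.union hA hB).subset exits_inter_subset

theorem FinCut.compl (hA : 𝓢.FinCut A) : 𝓢.FinCut Aᶜ := by
  rw [FinCut, exits_compl 𝓢.base_mem]; exact Set.Finite.image _ hA

theorem FinCut.diff (hA : 𝓢.FinCut A) (hB : 𝓢.FinCut B) : 𝓢.FinCut (A \ B) :=
  hA.inter hB.compl

theorem Tight.finCut (h : 𝓢.Tight A) : 𝓢.FinCut A := by
  obtain ⟨x, hx⟩ := h _ 𝓢.base_mem
  rw [FinCut, hx]; exact Set.finite_singleton x

theorem Tight.par (h : 𝓢.Tight A) : 𝓢.par A = 1 := by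
  obtain ⟨x, hx⟩ := h _ 𝓢.base_mem
  rw [MatchingSystem.par, hx, Set.ncard_singleton, Nat.cast_one]

theorem invol_injective (hf : f ∈ 𝓢.carrier) : Function.Injective f :=
  Function.Involutive.injective (𝓢.invol f hf)

/-- Parity is additive on disjoint unions: the edges between the two parts are counted twice. -/
theorem par_union_of_disjoint (hA : 𝓢.FinCut A) (hB : 𝓢.FinCut B) (h : Disjoint A B) :
    𝓢.par (A ∪ B) = 𝓢.par A + 𝓢.par B := by
  set f := 𝓢.base
  have hf : f ∈ 𝓢.carrier := 𝓢.base_mem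
  have hAB : ∀ x, x ∈ A → x ∉ B := fun x h1 h2 => Set.disjoint_left.1 h h1 h2
  set C : Set V := {x | x ∈ A ∧ f x ∈ B}
  set C' : Set V := {x | x ∈ B ∧ f x ∈ A}
  have hCA : C ⊆ exits f A := fun x hx => ⟨hx.1, fun h' => hAB _ h' hx.2⟩
  have hCB : C' ⊆ exits f B := fun x hx => ⟨hx.1, fun h' => hAB _ hx.2 h'⟩
  have hCC : C' = f '' C := by
    ext x
    constructor
    · rintro ⟨h1, h2⟩
      exact ⟨f x, ⟨h2, by rw [𝓢.invol f hf]; exact h1⟩, 𝓢.invol f hf x⟩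
    · rintro ⟨y, ⟨h1, h2⟩, rfl⟩
      exact ⟨h2, by rw [𝓢.invol f hf]; exact h1⟩
  have hcard : C'.ncard = C.ncard := by
    rw [hCC, Set.ncard_image_of_injective _ (invol_injective hf)]
  have e : exits f (A ∪ B) = (exits f A \ C) ∪ (exits f B \ C') := by
    ext x
    simp only [exits, C, C', Set.mem_union, Set.mem_ofPred_eq, Set.mem_sdiff]
    tauto
  have hd : Disjoint (exits f A \ C) (exits f B \ C') :=
    Set.disjoint_left.2 fun x h1 h2 => hAB x h1.1.1 h2.1.1
  rw [par, par, par, e, Set.ncard_union_eq hd (Set.Finite.sdiff hA) (Set.Finite.sdiff hB),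
    ← Set.ncard_sdiff_add_ncard_of_subset hCA hA, ← Set.ncard_sdiff_add_ncard_of_subset hCB hB, hcard]
  push_cast
  have : (C.ncard : ZMod 2) + C.ncard = 0 := CharTwo.add_self_eq_zero _
  linear_combination this * (-1 : ZMod 2)

theorem par_inter_add_diff (hA : 𝓢.FinCut A) (hB : 𝓢.FinCut B) :
    𝓢.par (A ∩ B) + 𝓢.par (A \ B) = 𝓢.par A := by
  rw [← par_union_of_disjoint (hA.inter hB) (hA.diff hB) (Set.disjoint_left.2 fun x h1 h2 =>
    h2.2 h1.2), Set.inter_union_sdiff]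

theorem zmod_two_cases (a : ZMod 2) : a = 0 ∨ a = 1 := by
  revert a; decide

theorem par_ne_one_iff : 𝓢.par A ≠ 1 ↔ 𝓢.par A = 0 := by
  rcases zmod_two_cases (𝓢.par A) with h | h <;> rw [h] <;> decide

theorem par_diff (hA : 𝓢.FinCut A) (hB : 𝓢.FinCut B) :
    𝓢.par (A \ B) = 𝓢.par A + 𝓢.par (A ∩ B) := by
  rw [← par_inter_add_diff hA hB]
  have : 𝓢.par (A ∩ B) + 𝓢.par (A ∩ B) = 0 := CharTwo.add_self_eq_zero _
  linear_combination this * (-1 : ZMod 2)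

theorem par_union (hA : 𝓢.FinCut A) (hB : 𝓢.FinCut B) :
    𝓢.par (A ∪ B) = 𝓢.par A + 𝓢.par B + 𝓢.par (A ∩ B) := by
  have h := par_union_of_disjoint hA (hB.diff hA) Set.disjoint_sdiff_right
  rw [Set.union_sdiff_self, par_diff hB hA, Set.inter_comm] at h
  rw [h]; ring

theorem exists_exits_eq_singleton {S : Set V} {a b : V} (h : S ⊆ {a, b})
    (h1 : (S.ncard : ZMod 2) = 1) : ∃ x, S = {x} := by
  have hfin : ({a, b} : Set V).Finite := by simp
  have h2 : S.ncard ≤ 2 := (Set.ncard_le_ncard h hfin).trans (by simpa using Set.ncard_insert_le a {b})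
  rw [← Set.ncard_eq_one]
  interval_cases hn : S.ncard
  · simp at h1
  · rfl
  · exact absurd h1 (by decide)

/-- An odd set with at most two exits under each matching is tight. -/
theorem tight_of_par (hA : 𝓢.par A = 1) (h : ∀ f ∈ 𝓢.carrier, ∃ a b, exits f A ⊆ {a, b}) :
    𝓢.Tight A := by
  have hfin : 𝓢.FinCut A := by
    obtain ⟨a, b, hab⟩ := h _ 𝓢.base_mem
    exact Set.Finite.subset (by simp) hab
  intro f hf
  obtain ⟨a, b, hab⟩ := h f hf
  exact exists_exits_eq_singleton hab ((hfin.par_eq hf).symm.trans hA)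

theorem exits_eq_empty_of_par (hA : 𝓢.par A = 0) (hf : f ∈ 𝓢.carrier) {a : V}
    (h : exits f A ⊆ {a}) : exits f A = ∅ := by
  rcases Set.subset_singleton_iff_eq.1 h with h | h
  · exact h
  · exfalso
    have h1 := (finCut_of_finite hf (A := A) (by rw [h]; simp)).par_eq hf
    rw [h, hA, Set.ncard_singleton] at h1
    exact absurd h1 (by decide)

theorem par_eq_zero_of_exits (hf : f ∈ 𝓢.carrier) (h : exits f A = ∅) :
    𝓢.FinCut A ∧ 𝓢.par A = 0 := by
  have h1 := finCut_of_finite hf (A := A) (by rw [h]; simp)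
  exact ⟨h1, by rw [h1.par_eq hf, h]; simp⟩

theorem par_eq_one_of_exits (hf : f ∈ 𝓢.carrier) {a : V} (h : exits f A = {a}) :
    𝓢.FinCut A ∧ 𝓢.par A = 1 := by
  have h1 := finCut_of_finite hf (A := A) (by rw [h]; simp)
  exact ⟨h1, by rw [h1.par_eq hf, h]; simp⟩

theorem eq_empty_of_exits (h : ∀ f ∈ 𝓢.carrier, exits f A = ∅) (hA : A ≠ Set.univ) : A = ∅ := by
  by_contra hne
  obtain ⟨f, hf, x, hx, hfx⟩ := 𝓢.conn A (Set.nonempty_iff_ne_empty.2 hne) hA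
  exact Set.eq_empty_iff_forall_notMem.1 (h f hf) x ⟨hx, hfx⟩

theorem mem_of_exits_eq_empty (h : exits f A = ∅) {x : V} (hx : x ∈ A) : f x ∈ A := by
  by_contra hc
  exact Set.eq_empty_iff_forall_notMem.1 h x ⟨hx, hc⟩

theorem eq_of_mem_exits {a x : V} (h : exits f A = {a}) (hx : x ∈ A) (hfx : f x ∉ A) : x = a := by
  have : x ∈ exits f A := ⟨hx, hfx⟩
  rwa [h] at this

theorem mem_exits_of_eq {a : V} (h : exits f A = {a}) : a ∈ A ∧ f a ∉ A := by
  have : a ∈ exits f A := by rw [h]; rfl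
  exact this

theorem Tight.compl (h : 𝓢.Tight A) : 𝓢.Tight Aᶜ := by
  intro f hf
  obtain ⟨x, hx⟩ := h f hf
  exact ⟨f x, by rw [exits_compl hf, hx, Set.image_singleton]⟩

theorem Tight.nonempty (h : 𝓢.Tight A) : A.Nonempty := by
  obtain ⟨x, hx⟩ := h _ 𝓢.base_mem
  exact ⟨x, (mem_exits_of_eq hx).1⟩

theorem Tight.ne_univ (h : 𝓢.Tight A) : A ≠ Set.univ := by
  rintro rfl
  obtain ⟨x, hx⟩ := h _ 𝓢.base_mem
  exact (mem_exits_of_eq hx).2 trivial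

/-- Uncrossing: if two tight sets meet in an odd set, then their intersection is tight. -/
theorem Tight.inter (hX : 𝓢.Tight X) (hY : 𝓢.Tight Y) (h : 𝓢.par (X ∩ Y) = 1) :
    𝓢.Tight (X ∩ Y) := by
  refine tight_of_par h fun f hf => ?_
  obtain ⟨a, ha⟩ := hX f hf
  obtain ⟨b, hb⟩ := hY f hf
  refine ⟨a, b, exits_inter_subset.trans ?_⟩
  rw [ha, hb]; rfl

/-- Uncrossing: if two tight sets meet in an even set, then their differences are tight. -/
theorem Tight.diff (hX : 𝓢.Tight X) (hY : 𝓢.Tight Y) (h : 𝓢.par (X ∩ Y) = 0) :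
    𝓢.Tight (X \ Y) := by
  rw [Set.sdiff_eq]
  refine hX.inter hY.compl ?_
  rw [← Set.sdiff_eq, par_diff hX.finCut hY.finCut, h, hX.par, add_zero]

/-- Uncrossing: if two tight sets meet in an odd set, then their union is tight. -/
theorem Tight.union (hX : 𝓢.Tight X) (hY : 𝓢.Tight Y) (h : 𝓢.par (X ∩ Y) = 1) :
    𝓢.Tight (X ∪ Y) := by
  refine tight_of_par ?_ fun f hf => ?_
  · rw [par_union hX.finCut hY.finCut, h, hX.par, hY.par]; decide
  · obtain ⟨a, ha⟩ := hX f hf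
    obtain ⟨b, hb⟩ := hY f hf
    refine ⟨a, b, exits_union_subset.trans ?_⟩
    rw [ha, hb]; rfl

/-- Two matchings leave both or neither of two sets in the same way if the sets agree wherever the
matchings differ. -/
theorem exits_congr (hf : f ∈ 𝓢.carrier) (hg : g ∈ 𝓢.carrier)
    (h1 : ∀ x, f x ≠ g x → (x ∈ A ↔ x ∈ B)) (h2 : exits g A = exits g B) :
    exits f A = exits f B := by
  have key : ∀ x, f x ≠ g x → (f x ∈ A ↔ f x ∈ B) := by
    intro x hx
    refine h1 (f x) fun h => hx ?_
    rw [𝓢.invol f hf] at h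
    calc f x = g (g (f x)) := (𝓢.invol g hg _).symm
      _ = g x := by rw [← h]
  ext x
  by_cases hx : f x = g x
  · have := Set.ext_iff.1 h2 x
    simpa only [exits, Set.mem_ofPred_eq, hx] using this
  · simp only [exits, Set.mem_ofPred_eq, h1 x hx, key x hx]

/-- A limit of tight sets is tight, provided that one matching leaves all of them, and the limit,
through the same edge. This is where it matters that two matchings differ only finitely. -/
theorem tight_of_approx (hg : g ∈ 𝓢.carrier) {a : V} (hX : exits g X = {a})
    (h : ∀ D : Set V, D.Finite → ∃ X', 𝓢.Tight X' ∧ exits g X' = {a} ∧ ∀ x ∈ D, x ∈ X ↔ x ∈ X') :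
    𝓢.Tight X := by
  intro f hf
  obtain ⟨X', h1, h2, h3⟩ := h _ (𝓢.fin f hf g hg)
  obtain ⟨x, hx⟩ := h1 f hf
  exact ⟨x, by rw [← hx]; exact exits_congr hf hg h3 (hX.trans h2.symm)⟩

end MatchingSystem

end TightCuts

/-! ### Collapses and hats -/

namespace TightCuts

/-- The class of index `i` of the partition into the fibres of `p`. -/
def cls {V ι : Type*} (p : V → ι) (i : ι) : Set V := {x | p x = i}

@[simp] theorem mem_cls {V ι : Type*} {p : V → ι} {i : ι} {x : V} : x ∈ cls p i ↔ p x = i := Iff.rfl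

open Classical in
/-- The partner of the class `i` under the matching that `f` induces on the fibres of `p`. The
value is `i` itself if `f` does not leave the class; this does not happen for tight classes. -/
noncomputable def mate {V ι : Type*} (p : V → ι) (f : V → V) (i : ι) : ι :=
  if h : (exits f (cls p i)).Nonempty then p (f h.some) else i

namespace MatchingSystem

variable {V : Type*} {ι : Type*} {𝓢 : MatchingSystem V} {f g : V → V} {A B X Y : Set V}
  {p : V → ι} {i j k : ι}

variable (𝓢) in
/-- The fibres of `p` form a partition into tight sets. -/
def TightFibers (p : V → ι) : Prop := ∀ i, 𝓢.Tight (cls p i)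

/-- The edge by which `f` leaves the class `i`. -/
theorem TightFibers.exists_exit (hp : 𝓢.TightFibers p) (hf : f ∈ 𝓢.carrier) (i : ι) :
    ∃ x, p x = i ∧ p (f x) = mate p f i ∧ mate p f i ≠ i ∧ exits f (cls p i) = {x} := by
  obtain ⟨x, hx⟩ := hp i f hf
  have h : (exits f (cls p i)).Nonempty := ⟨x, by rw [hx]; rfl⟩
  have h1 : h.some = x := by
    have := h.some_mem
    exact Set.mem_singleton_iff.1 (hx.subset this)
  have h2 := mem_exits_of_eq hx
  have h3 : mate p f i = p (f x) := by rw [mate, dif_pos h, h1]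
  exact ⟨x, h2.1, h3.symm, by rw [h3]; exact h2.2, hx⟩

theorem TightFibers.surjective (hp : 𝓢.TightFibers p) : Function.Surjective p := fun i => by
  obtain ⟨x, hx, _⟩ := hp.exists_exit 𝓢.base_mem i
  exact ⟨x, hx⟩

theorem TightFibers.mate_eq (hp : 𝓢.TightFibers p) (hf : f ∈ 𝓢.carrier) {x : V}
    (h : p (f x) ≠ p x) : mate p f (p x) = p (f x) := by
  obtain ⟨y, h1, h2, h3, h4⟩ := hp.exists_exit hf (p x)
  rw [← h2, eq_of_mem_exits h4 (x := x) rfl h]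

theorem TightFibers.mate_ne (hp : 𝓢.TightFibers p) (hf : f ∈ 𝓢.carrier) (i : ι) :
    mate p f i ≠ i := by
  obtain ⟨y, h1, h2, h3, h4⟩ := hp.exists_exit hf i
  exact h3

theorem TightFibers.apply_or (hp : 𝓢.TightFibers p) (hf : f ∈ 𝓢.carrier) (x : V) :
    p (f x) = p x ∨ p (f x) = mate p f (p x) := by
  by_cases h : p (f x) = p x
  · exact Or.inl h
  · exact Or.inr (hp.mate_eq hf h).symm

theorem TightFibers.mate_mate (hp : 𝓢.TightFibers p) (hf : f ∈ 𝓢.carrier) (i : ι) :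
    mate p f (mate p f i) = i := by
  obtain ⟨y, h1, h2, h3, h4⟩ := hp.exists_exit hf i
  have h5 : f (f y) = y := 𝓢.invol f hf y
  have := hp.mate_eq hf (x := f y) (by rw [h5, h1, h2]; exact h3.symm)
  rwa [h5, h1, h2] at this

theorem TightFibers.mate_eq_comm (hp : 𝓢.TightFibers p) (hf : f ∈ 𝓢.carrier) :
    mate p f i = j ↔ mate p f j = i :=
  ⟨fun h => h ▸ hp.mate_mate hf i, fun h => h ▸ hp.mate_mate hf j⟩

/-- A matched pair of classes is closed under the matching. -/
theorem TightFibers.pair_closed (hp : 𝓢.TightFibers p) (hf : f ∈ 𝓢.carrier) {x : V}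
    (hx : p x = i ∨ p x = mate p f i) : p (f x) = i ∨ p (f x) = mate p f i := by
  rcases hp.apply_or hf x with h | h
  · rw [h]; exact hx
  · rw [h]
    rcases hx with hx | hx
    · rw [hx]; exact Or.inr rfl
    · rw [hx, hp.mate_mate hf]; exact Or.inl rfl

theorem TightFibers.pair_closed' (hp : 𝓢.TightFibers p) (hf : f ∈ 𝓢.carrier) {x : V}
    (hm : mate p f i = j) (hx : p x = i ∨ p x = j) : p (f x) = i ∨ p (f x) = j := by
  subst hm; exact hp.pair_closed hf hx

/-- The exits of a union of classes correspond to the exits in the induced matching. -/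
theorem TightFibers.exits_preimage (hp : 𝓢.TightFibers p) (hf : f ∈ 𝓢.carrier) (I : Set ι) :
    exits (mate p f) I = p '' exits f (p ⁻¹' I) := by
  ext i
  constructor
  · rintro ⟨h1, h2⟩
    obtain ⟨y, h3, h4, h5, h6⟩ := hp.exists_exit hf i
    exact ⟨y, ⟨by rw [Set.mem_preimage, h3]; exact h1, by rw [Set.mem_preimage, h4]; exact h2⟩, h3⟩
  · rintro ⟨x, ⟨h1, h2⟩, rfl⟩
    refine ⟨h1, ?_⟩
    rwa [hp.mate_eq hf (x := x) (fun h => h2 (by rw [Set.mem_preimage, h]; exact h1))]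

theorem TightFibers.injOn_exits_preimage (hp : 𝓢.TightFibers p) (hf : f ∈ 𝓢.carrier) (I : Set ι) :
    Set.InjOn p (exits f (p ⁻¹' I)) := by
  rintro x ⟨h1, h2⟩ y ⟨h3, h4⟩ hxy
  obtain ⟨z, -, -, -, h6⟩ := hp.exists_exit hf (p x)
  rw [eq_of_mem_exits h6 (x := x) rfl (fun h => h2 (by rw [Set.mem_preimage, mem_cls.1 h]; exact h1)),
    eq_of_mem_exits h6 (x := y) hxy.symm
      (fun h => h4 (by rw [Set.mem_preimage, mem_cls.1 h]; exact h1))]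

/-- The matching system that `𝓢` induces on the fibres of `p`. That it is closed under glueing means
that finitely many changes of the induced matching can be lifted to `𝓢`, class by class. -/
noncomputable def collapseSystem (𝓢 : MatchingSystem V) (p : V → ι) (hp : 𝓢.TightFibers p) :
    MatchingSystem ι where
  carrier := {m | ∃ f ∈ 𝓢.carrier, m = mate p f}
  nonempty := ⟨_, _, 𝓢.base_mem, rfl⟩
  invol := by rintro _ ⟨f, hf, rfl⟩ i; exact hp.mate_mate hf i
  ne := by rintro _ ⟨f, hf, rfl⟩ i; exact hp.mate_ne hf i
  fin := by
    rintro _ ⟨f, hf, rfl⟩ _ ⟨g, hg, rfl⟩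
    refine ((𝓢.fin f hf g hg).image p).subset fun i hi => ?_
    obtain ⟨x, h1, h2, h3, -⟩ := hp.exists_exit hf i
    refine ⟨x, fun h => hi ?_, h1⟩
    rw [← h2, h, ← h1]
    refine (hp.mate_eq hg ?_).symm
    rw [← h, h2, h1]; exact h3
  conn := by
    intro A hA hA'
    obtain ⟨f, hf, x, h1, h2⟩ := 𝓢.conn (p ⁻¹' A) (hA.preimage hp.surjective) (fun h => hA' (by
      rw [← Set.image_preimage_eq A hp.surjective, h, Set.image_univ, hp.surjective.range_eq]))
    refine ⟨_, ⟨f, hf, rfl⟩, p x, h1, ?_⟩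
    rwa [hp.mate_eq hf fun h => h2 (by rw [Set.mem_preimage, h]; exact h1)]
  glue := by
    classical
    rintro _ ⟨f₀, hf₀, rfl⟩ N hN hNc hNf
    -- For every edge of `N` choose a member of `𝓢` that induces it. The choice is made on
    -- unordered pairs, so that the two classes joined by an edge receive the same member.
    have hch : ∀ e : Sym2 ι, ∃ f ∈ 𝓢.carrier, ∀ i, e = s(i, N i) → mate p f i = N i := by
      intro e
      by_cases h : ∃ i, e = s(i, N i)
      · obtain ⟨i, rfl⟩ := h
        obtain ⟨_, ⟨f, hf, rfl⟩, h⟩ := hNc i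
        refine ⟨f, hf, fun j hj => ?_⟩
        rw [Sym2.eq_iff] at hj
        rcases hj with ⟨rfl, -⟩ | ⟨hj1, hj2⟩
        · exact h.symm
        · rw [← hj1, hp.mate_eq_comm hf]
          exact h.symm.trans hj2
      · exact ⟨f₀, hf₀, fun i hi => absurd ⟨i, hi⟩ h⟩
    choose Φ hΦ hΦN using hch
    -- the finite set of classes at which `N` differs from the reference matching
    set B := {i | N i ≠ mate p f₀ i}
    have hB : ∀ i, N i ∈ B → i ∈ B := by
      intro i hi h
      apply hi
      rw [h, hp.mate_mate hf₀, ← h, hN]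
    have hB' : ∀ i, i ∈ B → N i ∈ B := fun i hi => hB _ (by rwa [hN])
    let φ : ι → V → V := fun i => Φ s(i, N i)
    have hφN : ∀ i, φ (N i) = φ i := fun i => by simp only [φ, hN, Sym2.eq_swap]
    have hφ : ∀ i, φ i ∈ 𝓢.carrier := fun i => hΦ _
    have hφm : ∀ i, mate p (φ i) i = N i := fun i => hΦN _ i rfl
    -- use the chosen members on the classes in `B` and the reference `f₀` elsewhere
    let F : V → V := fun x => if p x ∈ B then φ (p x) x else f₀ x
    have hF1 : ∀ x, p x ∈ B → F x = φ (p x) x := fun x hx => if_pos hx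
    have hF2 : ∀ x, p x ∉ B → F x = f₀ x := fun x hx => if_neg hx
    have hFF : ∀ x, F (F x) = x := by
      intro x
      by_cases hx : p x ∈ B
      · rw [hF1 x hx]
        rcases hp.apply_or (hφ (p x)) x with h | h
        · rw [hF1 _ (by rwa [h]), h, 𝓢.invol _ (hφ _)]
        · rw [hφm] at h
          rw [hF1 _ (by rw [h]; exact hB' _ hx), h, hφN, 𝓢.invol _ (hφ _)]
      · rw [hF2 x hx]
        have hx' : p (f₀ x) ∉ B := by
          rcases hp.apply_or hf₀ x with h | h
          · rwa [h]
          · have h' : N (p x) = mate p f₀ (p x) := not_not.1 hx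
            rw [h, ← h']
            exact fun h'' => hx (hB _ h'')
        rw [hF2 _ hx', 𝓢.invol _ hf₀]
    -- only finitely many members are used, hence `F` differs from `f₀` in finitely many vertices
    have hFc : F ∈ 𝓢.carrier := by
      refine 𝓢.glue f₀ hf₀ F hFF (fun x => ?_) ?_
      · by_cases hx : p x ∈ B
        · exact ⟨_, hφ _, hF1 x hx⟩
        · exact ⟨_, hf₀, hF2 x hx⟩
      · refine (hNf.biUnion fun i _ => 𝓢.fin (φ i) (hφ i) f₀ hf₀).subset fun x hx => ?_
        have hxB : p x ∈ B := by
          by_contra hc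
          exact hx (hF2 x hc)
        refine Set.mem_biUnion (x := p x) hxB ?_
        rw [Set.mem_ofPred_eq, ← hF1 x hxB]
        exact hx
    refine ⟨F, hFc, funext fun i => ?_⟩
    by_cases hi : i ∈ B
    · obtain ⟨x, h1, h2, h3, -⟩ := hp.exists_exit (hφ i) i
      have h4 : F x = φ i x := by rw [hF1 x (by rwa [h1]), h1]
      have h5 : p (F x) = N i := by rw [h4, h2, hφm]
      rw [← h5, ← h1]
      exact (hp.mate_eq hFc (by rw [h4, h2, h1]; exact h3)).symm
    · obtain ⟨x, h1, h2, h3, -⟩ := hp.exists_exit hf₀ i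
      have h4 : F x = f₀ x := hF2 x (by rwa [h1])
      have h5 : p (F x) = N i := by rw [h4, h2]; exact (not_not.1 hi).symm
      rw [← h5, ← h1]
      exact (hp.mate_eq hFc (by rw [h4, h2, h1]; exact h3)).symm

/-- A set of classes is tight in the collapse if and only if their union is tight. -/
theorem TightFibers.tight_collapse_iff (hp : 𝓢.TightFibers p) (I : Set ι) :
    (𝓢.collapseSystem p hp).Tight I ↔ 𝓢.Tight (p ⁻¹' I) := by
  constructor
  · intro h f hf
    obtain ⟨i, hi⟩ := h _ ⟨f, hf, rfl⟩
    rw [hp.exits_preimage hf] at hi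
    have : i ∈ p '' exits f (p ⁻¹' I) := by rw [hi]; rfl
    obtain ⟨x, hx, rfl⟩ := this
    refine ⟨x, Set.eq_singleton_iff_unique_mem.2 ⟨hx, fun y hy => ?_⟩⟩
    have : p y ∈ p '' exits f (p ⁻¹' I) := ⟨y, hy, rfl⟩
    rw [hi] at this
    exact hp.injOn_exits_preimage hf I hy hx this
  · rintro h _ ⟨f, hf, rfl⟩
    obtain ⟨x, hx⟩ := h f hf
    exact ⟨p x, by rw [hp.exits_preimage hf, hx, Set.image_singleton]⟩

variable (𝓢) in
/-- The classes that `X` meets in an odd set. This is the trace that a tight set leaves in the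
collapse; by `TightFibers.tight_hat` it is tight again. -/
def hat (p : V → ι) (X : Set V) : Set ι := {i | 𝓢.par (X ∩ cls p i) = 1}

theorem mem_hat : i ∈ 𝓢.hat p X ↔ 𝓢.par (X ∩ cls p i) = 1 := Iff.rfl

theorem notMem_hat : i ∉ 𝓢.hat p X ↔ 𝓢.par (X ∩ cls p i) = 0 := by
  rw [mem_hat]; exact par_ne_one_iff

theorem TightFibers.hat_compl (hp : 𝓢.TightFibers p) (hX : 𝓢.Tight X) :
    𝓢.hat p Xᶜ = (𝓢.hat p X)ᶜ := by
  ext i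
  rw [Set.mem_compl_iff, notMem_hat, mem_hat, Set.inter_comm, ← Set.sdiff_eq,
    par_diff (hp i).finCut hX.finCut, (hp i).par, Set.inter_comm]
  constructor
  · intro h; linear_combination h
  · intro h; linear_combination h

theorem TightFibers.par_inter_pair (hp : 𝓢.TightFibers p) (hX : 𝓢.Tight X) (hij : i ≠ j) :
    𝓢.par (X ∩ (cls p i ∪ cls p j)) = 𝓢.par (X ∩ cls p i) + 𝓢.par (X ∩ cls p j) := by
  rw [Set.inter_union_distrib_left]
  refine par_union_of_disjoint (hX.finCut.inter (hp i).finCut) (hX.finCut.inter (hp j).finCut) ?_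
  exact Set.disjoint_left.2 fun x h1 h2 => hij (h1.2.symm.trans h2.2)

/-- A matched pair of classes is separated by the hat of a tight set if and only if the matching
edge that leaves the tight set starts in one of the two classes. -/
theorem TightFibers.par_add_par_mate (hp : 𝓢.TightFibers p) (hX : 𝓢.Tight X) (hf : f ∈ 𝓢.carrier)
    {a : V} (ha : exits f X = {a}) (i : ι) :
    𝓢.par (X ∩ cls p i) + 𝓢.par (X ∩ cls p (mate p f i)) = 1 ↔ p a = i ∨ p a = mate p f i := by
  have hne := (hp.mate_ne hf i).symm
  rw [← hp.par_inter_pair hX hne]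
  have hsub : exits f (X ∩ (cls p i ∪ cls p (mate p f i))) ⊆ {a} := by
    rintro x ⟨⟨h1, h2⟩, h3⟩
    refine eq_of_mem_exits ha h1 fun h4 => h3 ⟨h4, hp.pair_closed hf h2⟩
  constructor
  · intro h
    by_contra hc
    have he : exits f (X ∩ (cls p i ∪ cls p (mate p f i))) = ∅ := by
      rcases Set.subset_singleton_iff_eq.1 hsub with h' | h'
      · exact h'
      · exact absurd (mem_exits_of_eq h').1.2 hc
    rw [(par_eq_zero_of_exits hf he).2] at h
    exact absurd h (by decide)
  · intro h
    refine (par_eq_one_of_exits hf (a := a) ?_).2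
    refine hsub.antisymm ?_
    rintro x rfl
    have := mem_exits_of_eq ha
    exact ⟨⟨this.1, h⟩, fun h' => this.2 h'.1⟩

theorem TightFibers.hat_crossing (hp : 𝓢.TightFibers p) (hX : 𝓢.Tight X) (hf : f ∈ 𝓢.carrier)
    {a : V} (ha : exits f X = {a}) (hi : i ∈ 𝓢.hat p X) (hi' : mate p f i ∉ 𝓢.hat p X) :
    p a = i ∨ p a = mate p f i := by
  rw [← hp.par_add_par_mate hX hf ha, mem_hat.1 hi, notMem_hat.1 hi', add_zero]

theorem TightFibers.hat_noncrossing (hp : 𝓢.TightFibers p) (hX : 𝓢.Tight X) (hf : f ∈ 𝓢.carrier)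
    {a : V} (ha : exits f X = {a}) (h : i ∈ 𝓢.hat p X ↔ mate p f i ∈ 𝓢.hat p X) :
    p a ≠ i ∧ p a ≠ mate p f i := by
  rw [← not_or, ← hp.par_add_par_mate hX hf ha]
  intro h1
  rcases zmod_two_cases (𝓢.par (X ∩ cls p i)) with h2 | h2 <;>
    rcases zmod_two_cases (𝓢.par (X ∩ cls p (mate p f i))) with h3 | h3 <;>
    rw [mem_hat, mem_hat, h2, h3] at h <;> rw [h2, h3] at h1 <;> revert h h1 <;> decide

/-- The set of classes that a tight set meets in an odd set is tight in the collapse. -/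
theorem TightFibers.tight_hat (hp : 𝓢.TightFibers p) (hX : 𝓢.Tight X) :
    𝓢.Tight (p ⁻¹' 𝓢.hat p X) := by
  rw [← hp.tight_collapse_iff]
  rintro _ ⟨f, hf, rfl⟩
  obtain ⟨a, ha⟩ := hX f hf
  have h1 : 𝓢.par (X ∩ cls p (p a)) + 𝓢.par (X ∩ cls p (mate p f (p a))) = 1 :=
    (hp.par_add_par_mate hX hf ha _).2 (Or.inl rfl)
  have hm := hp.mate_mate hf (p a)
  have huniq : ∀ i, i ∈ exits (mate p f) (𝓢.hat p X) → i = p a ∨ i = mate p f (p a) := by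
    rintro i ⟨h3, h4⟩
    rcases hp.hat_crossing hX hf ha h3 h4 with h | h
    · exact Or.inl h.symm
    · rw [h, hp.mate_mate hf]; exact Or.inr rfl
  by_cases h2 : p a ∈ 𝓢.hat p X
  · have h3 : mate p f (p a) ∉ 𝓢.hat p X := by
      rw [notMem_hat]; rw [mem_hat.1 h2] at h1; linear_combination h1
    refine ⟨p a, Set.eq_singleton_iff_unique_mem.2 ⟨⟨h2, h3⟩, fun i hi => ?_⟩⟩
    rcases huniq i hi with h | h
    · exact h
    · subst h; exact absurd hi.1 h3
  · have h3 : mate p f (p a) ∈ 𝓢.hat p X := by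
      rw [mem_hat]; rw [notMem_hat.1 h2] at h1; linear_combination h1
    refine ⟨mate p f (p a), Set.eq_singleton_iff_unique_mem.2 ⟨⟨h3, by rwa [hm]⟩, fun i hi => ?_⟩⟩
    rcases huniq i hi with h | h
    · subst h; exact absurd hi.1 h2
    · exact h

theorem TightFibers.hat_nonempty (hp : 𝓢.TightFibers p) (hX : 𝓢.Tight X) :
    (𝓢.hat p X).Nonempty := by
  obtain ⟨x, hx⟩ := (hp.tight_hat hX).nonempty
  exact ⟨_, hx⟩

/-- With at least three classes, no two classes are matched to each other by every matching. -/
theorem TightFibers.exists_mate_ne (hp : 𝓢.TightFibers p) (h3 : ∀ i j : ι, ∃ k, k ≠ i ∧ k ≠ j)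
    (i j : ι) : ∃ f ∈ 𝓢.carrier, mate p f i ≠ j := by
  by_contra! hc
  obtain ⟨k, hki, hkj⟩ := h3 i j
  have : ({i, j} : Set ι) = ∅ := by
    refine eq_empty_of_exits (𝓢 := 𝓢.collapseSystem p hp) ?_ ?_
    · rintro _ ⟨f, hf, rfl⟩
      refine Set.eq_empty_iff_forall_notMem.2 ?_
      rintro x ⟨rfl | rfl, h2⟩
      · exact h2 (Or.inr (hc f hf))
      · exact h2 (Or.inl ((hp.mate_eq_comm hf).1 (hc f hf)))
    · intro h
      have : k ∈ ({i, j} : Set ι) := by rw [h]; trivial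
      rcases this with h | h
      · exact hki h
      · exact hkj h
  exact Set.eq_empty_iff_forall_notMem.1 this i (Or.inl rfl)

end MatchingSystem

end TightCuts

/-! ### Passable sets -/

namespace TightCuts

namespace MatchingSystem

variable {V : Type*} {ι : Type*} {𝓢 : MatchingSystem V} {f g : V → V} {A B S T W X Y : Set V}
  {p : V → ι} {i j k : ι}

variable (𝓢) in
/-- `S` is passable for both `A` and `B`. -/
def Pass (A B S : Set V) : Prop :=
  𝓢.Tight (A \ S) ∧ 𝓢.Tight (A ∪ S) ∧ 𝓢.Tight (B \ S) ∧ 𝓢.Tight (B ∪ S)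

theorem Pass.symm (h : 𝓢.Pass A B S) : 𝓢.Pass B A S := ⟨h.2.2.1, h.2.2.2, h.1, h.2.1⟩

theorem exits_union_of_inactive {a : V} (hA : exits f A = {a}) (hW : exits f W = ∅)
    (ha : f a ∉ W) : exits f (A ∪ W) = {a} := by
  have h := mem_exits_of_eq hA
  refine Set.eq_singleton_iff_unique_mem.2 ⟨⟨Or.inl h.1, fun h' => h'.elim h.2 ha⟩, ?_⟩
  rintro x ⟨h1 | h1, h2⟩
  · exact eq_of_mem_exits hA h1 fun h' => h2 (Or.inl h')
  · exact absurd (Or.inr (mem_of_exits_eq_empty hW h1)) h2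

theorem exits_diff_of_inactive (hf : f ∈ 𝓢.carrier) {a : V} (hA : exits f A = {a})
    (hW : exits f W = ∅) (ha : f a ∉ W) : exits f (A \ W) = {a} := by
  have h := mem_exits_of_eq hA
  refine Set.eq_singleton_iff_unique_mem.2
    ⟨⟨⟨h.1, fun h' => ha (mem_of_exits_eq_empty hW h')⟩, fun h' => h.2 h'.1⟩, ?_⟩
  rintro x ⟨⟨h1, h3⟩, h2⟩
  refine eq_of_mem_exits hA h1 fun h' => h2 ⟨h', fun h'' => h3 ?_⟩
  have := mem_of_exits_eq_empty hW h''
  rwa [𝓢.invol f hf] at this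

theorem par_eq_zero_of_union (hA : 𝓢.Tight A) (hAS : 𝓢.Tight (A ∪ S)) (hd : Disjoint A S) :
    𝓢.FinCut S ∧ 𝓢.par S = 0 := by
  have h1 : S = (A ∪ S) \ A := by
    rw [Set.union_sdiff_left, hd.symm.sdiff_eq_left]
  have hS : 𝓢.FinCut S := by rw [h1]; exact hAS.finCut.diff hA.finCut
  refine ⟨hS, ?_⟩
  have := par_union_of_disjoint hA.finCut hS hd
  rw [hAS.par, hA.par] at this
  linear_combination this * (-1 : ZMod 2)

/-- If `S` can be added to either of two disjoint tight sets, then a matching either does not leave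
`S` or it leaves it by exactly two edges, one to each of the two tight sets. -/
theorem link_exits (hAS : Disjoint A S) (hBS : Disjoint B S) (hAB : Disjoint A B)
    (hA : 𝓢.Tight A) (hB : 𝓢.Tight B) (hAS' : 𝓢.Tight (A ∪ S)) (hBS' : 𝓢.Tight (B ∪ S))
    (hf : f ∈ 𝓢.carrier) :
    exits f S = ∅ ∨ ∃ s t, exits f S = {s, t} ∧ f s ∈ A ∧ f t ∈ B := by
  have hpar := (par_eq_zero_of_union hA hAS' hAS).2
  obtain ⟨a, ha⟩ := hA f hf
  obtain ⟨b, hb⟩ := hB f hf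
  obtain ⟨a', ha'⟩ := hAS' f hf
  obtain ⟨b', hb'⟩ := hBS' f hf
  -- the number of exits of `S` is even, so one exit never comes alone
  have hsecond : ∀ x ∈ exits f S, ∃ y ∈ exits f S, y ≠ x := by
    intro x hx
    by_contra! hc
    have := exits_eq_empty_of_par hpar hf (a := x) hc
    rw [this] at hx; exact hx
  have hgoA : ∀ x ∈ exits f S, f x ∉ A → x = a' := fun x hx h =>
    eq_of_mem_exits ha' (Or.inr hx.1) fun h' => h'.elim h hx.2
  have hgoB : ∀ x ∈ exits f S, f x ∉ B → x = b' := fun x hx h =>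
    eq_of_mem_exits hb' (Or.inr hx.1) fun h' => h'.elim h hx.2
  have hgo : ∀ x ∈ exits f S, f x ∈ A ∨ f x ∈ B := by
    intro x hx
    by_contra! hc
    obtain ⟨y, hy, hyx⟩ := hsecond x hx
    have h1 : f y ∈ A := by
      by_contra h; exact hyx ((hgoA y hy h).trans (hgoA x hx hc.1).symm)
    have h2 : f y ∈ B := by
      by_contra h; exact hyx ((hgoB y hy h).trans (hgoB x hx hc.2).symm)
    exact Set.disjoint_left.1 hAB h1 h2
  -- at most one exit of `S` leads to `A`, as `A` is tight, and likewise for `B`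
  have hAu : ∀ x ∈ exits f S, f x ∈ A → f x = a := fun x hx h =>
    eq_of_mem_exits ha h (by rw [𝓢.invol f hf]; exact fun h' => Set.disjoint_left.1 hAS h' hx.1)
  have hBu : ∀ x ∈ exits f S, f x ∈ B → f x = b := fun x hx h =>
    eq_of_mem_exits hb h (by rw [𝓢.invol f hf]; exact fun h' => Set.disjoint_left.1 hBS h' hx.1)
  have hinj := invol_injective hf
  have key : ∀ x ∈ exits f S, ∀ y ∈ exits f S, f x ∈ A → f y ∈ B → exits f S = {x, y} := by
    intro x hx y hy h1 h2
    refine Set.Subset.antisymm (fun z hz => ?_) (by rintro z (rfl | rfl); exacts [hx, hy])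
    rcases hgo z hz with h | h
    · exact Or.inl (hinj ((hAu z hz h).trans (hAu x hx h1).symm))
    · exact Or.inr (hinj ((hBu z hz h).trans (hBu y hy h2).symm))
  rcases (exits f S).eq_empty_or_nonempty with h | ⟨x, hx⟩
  · exact Or.inl h
  · right
    obtain ⟨y, hy, hyx⟩ := hsecond x hx
    rcases hgo x hx with h1 | h1 <;> rcases hgo y hy with h2 | h2
    · exact absurd (hinj ((hAu y hy h2).trans (hAu x hx h1).symm)) hyx
    · exact ⟨x, y, key x hx y hy h1 h2, h1, h2⟩
    · exact ⟨y, x, key y hy x hx h2 h1, h2, h1⟩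
    · exact absurd (hinj ((hBu y hy h2).trans (hBu x hx h1).symm)) hyx

theorem Pass.exits_cases (h : 𝓢.Pass A B S) (hAB : Disjoint A B) (hf : f ∈ 𝓢.carrier) :
    exits f S = ∅ ∨ ∃ s t, exits f S = {s, t} ∧ f s ∈ A \ S ∧ f t ∈ B \ S := by
  refine link_exits Set.disjoint_sdiff_left Set.disjoint_sdiff_left
    (hAB.mono Set.sdiff_subset Set.sdiff_subset) h.1 h.2.2.1 ?_ ?_ hf
  · rw [Set.sdiff_union_self]; exact h.2.1
  · rw [Set.sdiff_union_self]; exact h.2.2.2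

theorem disjoint_cls (hij : i ≠ j) : Disjoint (cls p i) (cls p j) :=
  Set.disjoint_left.2 fun _ h1 h2 => hij (h1.symm.trans h2)

/-- A matching that leaves a set passable for two classes matches the two classes. -/
theorem Pass.inactive (hp : 𝓢.TightFibers p) (h : 𝓢.Pass (cls p i) (cls p j) S)
    (hS : S ⊆ cls p i ∪ cls p j) (hij : i ≠ j) (hf : f ∈ 𝓢.carrier) (hm : mate p f i ≠ j) :
    exits f S = ∅ := by
  rcases h.exits_cases (disjoint_cls hij) hf with h1 | ⟨s, t, h1, h2, h3⟩
  · exact h1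
  · exfalso
    obtain ⟨e, he1, he2, he3, he4⟩ := hp.exists_exit hf i
    have hout : f e ∉ cls p i ∪ cls p j := by
      rintro (h' | h')
      · exact he3 (he2.symm.trans h')
      · exact hm (he2.symm.trans h')
    have hs : s ∈ S := by
      have : s ∈ exits f S := by rw [h1]; exact Or.inl rfl
      exact this.1
    by_cases heS : e ∈ S
    · have : e ∈ exits f S := ⟨heS, fun h' => hout (hS h')⟩
      rw [h1] at this
      rcases this with rfl | rfl
      · exact hout (Or.inl h2.1)
      · exact hout (Or.inr h3.1)
    · obtain ⟨c, hc⟩ := h.1 f hf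
      have e1 := eq_of_mem_exits hc (x := e) ⟨he1, heS⟩ fun h' => hout (Or.inl h'.1)
      have e2 := eq_of_mem_exits hc h2 (by rw [𝓢.invol f hf]; exact fun h' => h'.2 hs)
      rw [e1, ← e2, 𝓢.invol f hf] at hout
      exact hout (hS hs)

theorem TightFibers.exits_union_inactive (hp : 𝓢.TightFibers p) (hS : S ⊆ cls p i ∪ cls p j)
    (hf : f ∈ 𝓢.carrier) (hm : mate p f i ≠ j) (h : exits f S = ∅) {e : V}
    (he : exits f (cls p i) = {e}) :
    exits f (cls p i ∪ S) = {e} ∧ exits f (cls p i \ S) = {e} := by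
  obtain ⟨e', he1, he2, he3, he4⟩ := hp.exists_exit hf i
  obtain rfl : e = e' := Set.singleton_injective (he.symm.trans he4)
  have : f e ∉ S := fun h' => by
    rcases hS h' with h | h
    · exact he3 (he2.symm.trans h)
    · exact hm (he2.symm.trans h)
  exact ⟨exits_union_of_inactive he h this, exits_diff_of_inactive hf he h this⟩

theorem pass_empty (hA : 𝓢.Tight A) (hB : 𝓢.Tight B) : 𝓢.Pass A B ∅ := by
  simp only [Pass, Set.sdiff_empty, Set.union_empty]; exact ⟨hA, hA, hB, hB⟩

theorem exits_inactive_union (hA : exits f A = ∅) (hB : exits f B = ∅) : exits f (A ∪ B) = ∅ := by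
  rw [← Set.subset_empty_iff]
  refine exits_union_subset.trans ?_
  rw [hA, hB, Set.union_empty]

theorem Pass.union_aux (hp : 𝓢.TightFibers p) (h3 : ∀ i j : ι, ∃ k, k ≠ i ∧ k ≠ j)
    (hij : i ≠ j) (hS : S ⊆ cls p i ∪ cls p j) (hT : T ⊆ cls p i ∪ cls p j)
    (h : 𝓢.Pass (cls p i) (cls p j) S) (h' : 𝓢.Pass (cls p i) (cls p j) T) :
    𝓢.Tight (cls p i \ (S ∪ T)) ∧ 𝓢.Tight (cls p i ∪ (S ∪ T)) := by
  obtain ⟨g, hg, hgm⟩ := hp.exists_mate_ne h3 i j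
  obtain ⟨e, he⟩ := hp i g hg
  have hin := exits_inactive_union (h.inactive hp hS hij hg hgm) (h'.inactive hp hT hij hg hgm)
  have hex := hp.exits_union_inactive (Set.union_subset hS hT) hg hgm hin he
  constructor
  · refine tight_of_par (par_eq_one_of_exits hg hex.2).2 fun f hf => ?_
    obtain ⟨a, ha⟩ := h.1 f hf
    obtain ⟨b, hb⟩ := h'.1 f hf
    refine ⟨a, b, ?_⟩
    rw [← Set.sdiff_inter_sdiff]
    refine exits_inter_subset.trans ?_
    rw [ha, hb]; rfl
  · refine tight_of_par (par_eq_one_of_exits hg hex.1).2 fun f hf => ?_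
    obtain ⟨a, ha⟩ := h.2.1 f hf
    obtain ⟨b, hb⟩ := h'.2.1 f hf
    refine ⟨a, b, ?_⟩
    rw [Set.union_union_distrib_left]
    refine exits_union_subset.trans ?_
    rw [ha, hb]; rfl

/-- The sets that are passable for two classes are closed under unions. At least three classes
are needed: some matching must leave both passable sets inactive. -/
theorem Pass.union (hp : 𝓢.TightFibers p) (h3 : ∀ i j : ι, ∃ k, k ≠ i ∧ k ≠ j)
    (hij : i ≠ j) (hS : S ⊆ cls p i ∪ cls p j) (hT : T ⊆ cls p i ∪ cls p j)
    (h : 𝓢.Pass (cls p i) (cls p j) S) (h' : 𝓢.Pass (cls p i) (cls p j) T) :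
    𝓢.Pass (cls p i) (cls p j) (S ∪ T) := by
  obtain ⟨h1, h2⟩ := union_aux hp h3 hij hS hT h h'
  obtain ⟨h4, h5⟩ := union_aux hp h3 hij.symm (Set.union_comm _ _ ▸ hS) (Set.union_comm _ _ ▸ hT)
    h.symm h'.symm
  exact ⟨h1, h2, h4, h5⟩

/-- A union of sets with a property that is closed under finite unions agrees on any finite set with
a set that has the property. -/
theorem exists_approx_sUnion {P : Set V → Prop} (h0 : P ∅) (hU : ∀ A B, P A → P B → P (A ∪ B))
    {𝒰 : Set (Set V)} (h𝒰 : ∀ U ∈ 𝒰, P U) {D : Set V} (hD : D.Finite) :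
    ∃ U, P U ∧ U ⊆ ⋃₀ 𝒰 ∧ ∀ x ∈ D, x ∈ ⋃₀ 𝒰 ↔ x ∈ U := by
  induction D, hD using Set.Finite.induction_on with
  | empty => exact ⟨∅, h0, Set.empty_subset _, fun x hx => hx.elim⟩
  | @insert a s _ _ ih =>
    obtain ⟨U, h1, h2, h3⟩ := ih
    by_cases ha : a ∈ ⋃₀ 𝒰
    · obtain ⟨U', hU', haU'⟩ := ha
      refine ⟨U ∪ U', hU _ _ h1 (h𝒰 _ hU'), Set.union_subset h2 (Set.subset_sUnion_of_mem hU'), ?_⟩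
      rintro x (rfl | hx)
      · exact ⟨fun _ => Or.inr haU', fun _ => ⟨U', hU', haU'⟩⟩
      · refine ⟨fun h => Or.inl ((h3 x hx).1 h), ?_⟩
        rintro (h | h)
        · exact h2 h
        · exact ⟨U', hU', h⟩
    · refine ⟨U, h1, h2, ?_⟩
      rintro x (rfl | hx)
      · exact ⟨fun h => absurd h ha, fun h => h2 h⟩
      · exact h3 x hx

theorem exits_sUnion_inactive {𝒰 : Set (Set V)} (h : ∀ U ∈ 𝒰, exits f U = ∅) :
    exits f (⋃₀ 𝒰) = ∅ := by
  refine Set.eq_empty_iff_forall_notMem.2 ?_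
  rintro x ⟨⟨U, hU, hx⟩, h2⟩
  exact h2 ⟨U, hU, mem_of_exits_eq_empty (h U hU) hx⟩

/-- Infinite unions of passable sets are passable, by approximation with finite unions. -/
theorem pass_sUnion_aux (hp : 𝓢.TightFibers p) (h3 : ∀ i j : ι, ∃ k, k ≠ i ∧ k ≠ j)
    (hij : i ≠ j) {𝒰 : Set (Set V)}
    (h : ∀ S ∈ 𝒰, S ⊆ cls p i ∪ cls p j ∧ 𝓢.Pass (cls p i) (cls p j) S) :
    𝓢.Tight (cls p i \ ⋃₀ 𝒰) ∧ 𝓢.Tight (cls p i ∪ ⋃₀ 𝒰) := by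
  obtain ⟨g, hg, hgm⟩ := hp.exists_mate_ne h3 i j
  obtain ⟨e, he⟩ := hp i g hg
  have hin := exits_sUnion_inactive fun S hS => (h S hS).2.inactive hp (h S hS).1 hij hg hgm
  have hex := hp.exits_union_inactive (Set.sUnion_subset fun S hS => (h S hS).1) hg hgm hin he
  have happ := fun D hD => exists_approx_sUnion (V := V) (D := D)
    (P := fun S => S ⊆ cls p i ∪ cls p j ∧ 𝓢.Pass (cls p i) (cls p j) S)
    ⟨Set.empty_subset _, pass_empty (hp i) (hp j)⟩
    (fun A B hA hB => ⟨Set.union_subset hA.1 hB.1, hA.2.union hp h3 hij hA.1 hB.1 hB.2⟩) h hD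
  constructor
  · refine tight_of_approx hg hex.2 fun D hD => ?_
    obtain ⟨U, ⟨h1, h2⟩, h4, h5⟩ := happ D hD
    refine ⟨_, h2.1, (hp.exits_union_inactive h1 hg hgm (h2.inactive hp h1 hij hg hgm) he).2, ?_⟩
    intro x hx
    rw [Set.mem_sdiff, Set.mem_sdiff, h5 x hx]
  · refine tight_of_approx hg hex.1 fun D hD => ?_
    obtain ⟨U, ⟨h1, h2⟩, h4, h5⟩ := happ D hD
    refine ⟨_, h2.2.1, (hp.exits_union_inactive h1 hg hgm (h2.inactive hp h1 hij hg hgm) he).1, ?_⟩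
    intro x hx
    rw [Set.mem_union, Set.mem_union, h5 x hx]

variable (𝓢) in
/-- The largest subset of two classes that is passable for both of them. -/
def maxPass (p : V → ι) (i j : ι) : Set V :=
  ⋃₀ {S | S ⊆ cls p i ∪ cls p j ∧ 𝓢.Pass (cls p i) (cls p j) S}

theorem maxPass_comm : 𝓢.maxPass p i j = 𝓢.maxPass p j i := by
  have h : ∀ i j, {S | S ⊆ cls p i ∪ cls p j ∧ 𝓢.Pass (cls p i) (cls p j) S} ⊆
      {S | S ⊆ cls p j ∪ cls p i ∧ 𝓢.Pass (cls p j) (cls p i) S} := fun i j S hS =>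
    ⟨Set.union_comm _ _ ▸ hS.1, hS.2.symm⟩
  exact congrArg Set.sUnion ((h i j).antisymm (h j i))

theorem maxPass_subset : 𝓢.maxPass p i j ⊆ cls p i ∪ cls p j :=
  Set.sUnion_subset fun _ h => h.1

theorem subset_maxPass (hS : S ⊆ cls p i ∪ cls p j) (h : 𝓢.Pass (cls p i) (cls p j) S) :
    S ⊆ 𝓢.maxPass p i j := Set.subset_sUnion_of_mem ⟨hS, h⟩

theorem TightFibers.pass_maxPass (hp : 𝓢.TightFibers p) (h3 : ∀ i j : ι, ∃ k, k ≠ i ∧ k ≠ j)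
    (hij : i ≠ j) : 𝓢.Pass (cls p i) (cls p j) (𝓢.maxPass p i j) := by
  obtain ⟨h1, h2⟩ := pass_sUnion_aux hp h3 hij (𝒰 := {S | S ⊆ cls p i ∪ cls p j ∧
    𝓢.Pass (cls p i) (cls p j) S}) fun S hS => hS
  obtain ⟨h4, h5⟩ := pass_sUnion_aux hp h3 hij.symm (𝒰 := {S | S ⊆ cls p j ∪ cls p i ∧
    𝓢.Pass (cls p j) (cls p i) S}) fun S hS => hS
  refine ⟨h1, h2, ?_, ?_⟩
  · rw [maxPass_comm]; exact h4
  · rw [maxPass_comm]; exact h5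

/-- Passable sets towards two different classes that meet in an even set are disjoint, as no
matching leaves their intersection by more than one edge. -/
theorem Pass.inter_eq_empty (hp : 𝓢.TightFibers p) (hij : i ≠ j) (hik : i ≠ k) (hjk : j ≠ k)
    (hS : S ⊆ cls p i ∪ cls p j) (hT : T ⊆ cls p i ∪ cls p k)
    (h : 𝓢.Pass (cls p i) (cls p j) S) (h' : 𝓢.Pass (cls p i) (cls p k) T)
    (hpar : 𝓢.par (S ∩ T) = 0) : S ∩ T = ∅ := by
  refine eq_empty_of_exits (𝓢 := 𝓢) (fun f hf => ?_) (fun hu => ?_)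
  -- A matching that does not match `i` to `k` does not leave `T`. So it leaves `S ∩ T` only by
  -- leaving `S` and staying in `T`, and hence only towards `cls p i \ S`, which is tight.
  · have key : ∀ {j k : ι} {S T : Set V}, j ≠ k → i ≠ j → i ≠ k → S ⊆ cls p i ∪ cls p j →
        T ⊆ cls p i ∪ cls p k → 𝓢.Pass (cls p i) (cls p j) S → 𝓢.Pass (cls p i) (cls p k) T →
        mate p f i ≠ k → ∃ a, exits f (S ∩ T) ⊆ {a} := by
      intro j k S T hjk hij hik hS hT h h' hm
      have hin := h'.inactive hp hT hik hf hm
      obtain ⟨a, ha⟩ := h.1 f hf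
      refine ⟨f a, ?_⟩
      rintro x ⟨⟨h1, h2⟩, h3⟩
      have hfx := mem_of_exits_eq_empty hin h2
      have hfxS : f x ∉ S := fun h => h3 ⟨h, hfx⟩
      rcases h.exits_cases (disjoint_cls hij) hf with hc | ⟨s, t, h4, h5, h6⟩
      · exact absurd (mem_of_exits_eq_empty hc h1) hfxS
      have hx : x ∈ exits f S := ⟨h1, hfxS⟩
      have hfxi : f x ∈ cls p i \ S := by
        rw [h4] at hx
        rcases hx with rfl | rfl
        · exact h5
        · rcases hT hfx with h | h
          · exact ⟨h, hfxS⟩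
          · exact absurd (h6.1.symm.trans h) hjk
      have := eq_of_mem_exits ha hfxi (by rw [𝓢.invol f hf]; exact fun h' => h'.2 h1)
      rw [Set.mem_singleton_iff, ← this, 𝓢.invol f hf]
    by_cases hm : mate p f i = k
    · obtain ⟨a, ha⟩ := key (S := T) (T := S) hjk.symm hik hij hT hS h' h
        (by rw [hm]; exact hjk.symm)
      rw [Set.inter_comm] at ha
      exact exits_eq_empty_of_par hpar hf ha
    · obtain ⟨a, ha⟩ := key hjk hij hik hS hT h h' hm
      exact exits_eq_empty_of_par hpar hf ha
  · have h1 : (Set.univ : Set V) ⊆ cls p i := by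
      rw [← hu]
      rintro x ⟨h1, h2⟩
      rcases hS h1 with h3 | h3
      · exact h3
      · rcases hT h2 with h4 | h4
        · exact h4
        · exact absurd (h3.symm.trans h4) hjk
    exact (hp i).ne_univ (Set.univ_subset_iff.1 h1)

end MatchingSystem

end TightCuts

/-! ### Torsoids as labellings of the vertices -/

namespace TightCuts

/-- The vertices that `q` labels by `s(i, j)`. For a labelling `q` that encodes a torsoid, this is
the edge set of `ij` if `i ≠ j`, and `ed q i i` is the vertex `i` of the torsoid. -/
def ed {V ι : Type*} (q : V → Sym2 ι) (i j : ι) : Set V := {x | q x = s(i, j)}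

@[simp] theorem mem_ed {V ι : Type*} {q : V → Sym2 ι} {i j : ι} {x : V} :
    x ∈ ed q i j ↔ q x = s(i, j) := Iff.rfl

theorem ed_comm {V ι : Type*} {q : V → Sym2 ι} {i j : ι} : ed q i j = ed q j i := by
  ext x; rw [mem_ed, mem_ed, Sym2.eq_swap]

namespace MatchingSystem

variable {V : Type*} {ι : Type*} {𝓢 : MatchingSystem V} {f g : V → V} {A B S T U W X Y : Set V}
  {p p' : V → ι} {q : V → Sym2 ι} {i j k : ι}

variable (𝓢) in
/-- A labelling `q` of the vertices by unordered pairs is a pretorsoid if each node `ed q i i` is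
tight and stays so when one set `ed q i j` is added to it. The maximality conditions of a torsoid
are not part of this. That there are at least three nodes is stated in the form in which it is
used; by `TightFibers.exists_fourth` there are then at least four. -/
structure PreTorsoid (q : V → Sym2 ι) : Prop where
  three : ∀ i j : ι, ∃ k, k ≠ i ∧ k ≠ j
  tight : ∀ i j, 𝓢.Tight (ed q i i ∪ ed q i j)

variable (𝓢) in
/-- A partition `p` is compatible with a pretorsoid if it arises by splitting each edge set between
the two nodes at its ends in such a way that tightness is preserved. -/
structure Compat (q : V → Sym2 ι) (p : V → ι) : Prop where
  mem : ∀ x, p x ∈ q x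
  tight : ∀ i j, 𝓢.Tight (ed q i i ∪ (ed q i j ∩ cls p i))

theorem PreTorsoid.node (hq : 𝓢.PreTorsoid q) (i : ι) : 𝓢.Tight (ed q i i) := by
  simpa using hq.tight i i

theorem disjoint_ed {a b c d : ι} (h : s(a, b) ≠ s(c, d)) : Disjoint (ed q a b) (ed q c d) :=
  Set.disjoint_left.2 fun _ h1 h2 => h (h1.symm.trans h2)

/-- A matching leaves an edge set by no edge, or by two edges that lead to the two ends. -/
theorem PreTorsoid.edge_exits (hq : 𝓢.PreTorsoid q) (hij : i ≠ j) (hf : f ∈ 𝓢.carrier) :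
    exits f (ed q i j) = ∅ ∨
      ∃ s t, exits f (ed q i j) = {s, t} ∧ f s ∈ ed q i i ∧ f t ∈ ed q j j := by
  refine link_exits ?_ ?_ ?_ (hq.node i) (hq.node j) (hq.tight i j) ?_ hf
  · exact disjoint_ed (by simp [hij])
  · exact disjoint_ed (by simp [hij.symm])
  · exact disjoint_ed (by simp [hij])
  · rw [ed_comm (i := i)]; exact hq.tight j i

/-- `f` matches the node `i` of the pretorsoid to the node `j`: the edge of `f` that leaves the
node `i` leads to the node `j` or to the edge set of `ij`. -/
def NodeMatch (q : V → Sym2 ι) (f : V → V) (i j : ι) : Prop :=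
  i ≠ j ∧ ∃ a, exits f (ed q i i) = {a} ∧ (q (f a) = s(j, j) ∨ q (f a) = s(i, j))

/-- Every matching matches every node to some node, as the edge that leaves the node cannot end
in an edge set that does not belong to the node. -/
theorem PreTorsoid.exists_nodeMatch (hq : 𝓢.PreTorsoid q) (hf : f ∈ 𝓢.carrier) (i : ι) :
    ∃ j, NodeMatch q f i j := by
  obtain ⟨a, ha⟩ := hq.node i f hf
  obtain ⟨ha1, ha2⟩ := mem_exits_of_eq ha
  obtain ⟨⟨b, c⟩, hbc⟩ : ∃ e : ι × ι, q (f a) = s(e.1, e.2) := by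
    induction hq' : q (f a) with
    | _ x y => exact ⟨(x, y), rfl⟩
  simp only at hbc
  by_cases hb : b = c
  · subst hb
    refine ⟨b, ?_, a, ha, Or.inl hbc⟩
    rintro rfl
    exact ha2 hbc
  · have hffa : f (f a) = a := 𝓢.invol f hf a
    have hmem : ∀ {d}, q a = s(d, d) → d = i := by
      intro d hd
      have h : q a = s(i, i) := ha1
      rw [h] at hd
      simpa using hd.symm
    rcases hq.edge_exits hb hf with h | ⟨s, t, h1, h2, h3⟩
    · have := mem_of_exits_eq_empty h (x := f a) hbc
      rw [hffa, mem_ed] at this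
      have h : q a = s(i, i) := ha1
      rw [h] at this
      simp at this
      exact absurd (this.elim (fun h => h.1.symm.trans h.2) fun h => h.2.symm.trans h.1) hb
    · have hx : f a ∈ exits f (ed q b c) := by
        refine ⟨hbc, ?_⟩
        rw [hffa, mem_ed, show q a = s(i, i) from ha1]
        intro h
        simp at h
        exact hb (h.elim (fun h => h.1.symm.trans h.2) fun h => h.2.symm.trans h.1)
      rw [h1] at hx
      rcases hx with hx | hx
      · rw [← hx, hffa] at h2
        obtain rfl := hmem h2
        exact ⟨c, hb, a, ha, Or.inr hbc⟩
      · rw [Set.mem_singleton_iff] at hx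
        rw [← hx, hffa] at h3
        obtain rfl := hmem h3
        exact ⟨b, Ne.symm hb, a, ha, Or.inr (hbc.trans Sym2.eq_swap)⟩

/-- A matching that matches the node `i` to `j` does not leave the other edge sets at `i`. -/
theorem PreTorsoid.edge_inactive (hq : 𝓢.PreTorsoid q) (hf : f ∈ 𝓢.carrier)
    (h : NodeMatch q f i j) (hkj : k ≠ j) (hki : k ≠ i) : exits f (ed q i k) = ∅ := by
  obtain ⟨hij, a, h1, h2⟩ := h
  rcases hq.edge_exits hki.symm hf with h3 | ⟨s, t, h3, h4, h5⟩
  · exact h3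
  · exfalso
    have hs : s ∈ exits f (ed q i k) := by rw [h3]; exact Or.inl rfl
    have : f s = a := by
      refine eq_of_mem_exits h1 h4 ?_
      rw [𝓢.invol f hf, mem_ed, show q s = s(i, k) from hs.1]
      simp [hki]
    have hq' : q (f a) = s(i, k) := by rw [← this, 𝓢.invol f hf]; exact hs.1
    rw [hq'] at h2
    rcases h2 with h2 | h2
    · simp at h2; exact hij h2.1
    · simp at h2; rcases h2 with h2 | h2
      · exact hkj h2
      · exact hki h2.2

theorem Compat.eq_or (hc : 𝓢.Compat q p) {x : V} (h : q x = s(i, j)) : p x = i ∨ p x = j := by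
  have := hc.mem x
  rw [h] at this
  simpa using this

theorem Compat.node_subset (hc : 𝓢.Compat q p) : ed q i i ⊆ cls p i := fun x hx => by
  simpa using hc.eq_or hx

theorem Compat.part_inactive (hc : 𝓢.Compat q p) (hq : 𝓢.PreTorsoid q) (hf : f ∈ 𝓢.carrier)
    (h : NodeMatch q f i j) (hkj : k ≠ j) (hki : k ≠ i) :
    exits f (ed q i k ∩ cls p i) = ∅ := by
  have hin := hq.edge_inactive hf h hkj hki
  obtain ⟨hij, a, h1, h2⟩ := h
  obtain ⟨b, hb⟩ := hc.tight i k f hf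
  have ha := mem_exits_of_eq h1
  have hfa : q (f a) ≠ s(i, k) := by
    rcases h2 with h2 | h2 <;> rw [h2] <;> intro h3 <;> simp at h3
    · exact hij (h3.elim (fun h => h.1.symm) fun h => h.2.symm)
    · rcases h3 with h3 | h3
      · exact hkj h3.symm
      · exact hki h3.1.symm
  have hab : a = b := eq_of_mem_exits hb (Or.inl ha.1) fun h => h.elim ha.2 fun h => hfa h.1
  refine Set.eq_empty_iff_forall_notMem.2 ?_
  rintro x ⟨h3, h4⟩
  have h5 : f x ∈ ed q i k := mem_of_exits_eq_empty hin h3.1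
  have h6 : x = b := eq_of_mem_exits hb (Or.inr h3) fun h => by
    rcases h with h | h
    · rw [mem_ed] at h h5
      rw [h5] at h; simp at h; exact hki h
    · exact h4 h
  rw [← hab] at h6
  subst h6
  exact hfa h5

/-- Compatible partitions are partitions into tight sets, and the matching that `f` induces on their
classes is the one that `f` induces on the nodes. -/
theorem Compat.exits_cls (hc : 𝓢.Compat q p) (hq : 𝓢.PreTorsoid q) (hf : f ∈ 𝓢.carrier)
    (h : NodeMatch q f i j) :
    ∃ b, exits f (ed q i i ∪ (ed q i j ∩ cls p i)) = {b} ∧ exits f (cls p i) = {b} ∧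
      p (f b) = j := by
  have hin := fun k (hkj : k ≠ j) (hki : k ≠ i) => hc.part_inactive hq hf h hkj hki
  obtain ⟨hij, a, h1, h2⟩ := h
  obtain ⟨b, hb⟩ := hc.tight i j f hf
  obtain ⟨hb1, hb2⟩ := mem_exits_of_eq hb
  -- The class `i` is the set in the first conclusion together with the parts that it receives
  -- from edge sets `ed q i k` with `k ≠ j`. By `part_inactive` the matching does not leave those
  -- parts.
  have hcases : ∀ x, p x = i → x ∈ ed q i i ∪ (ed q i j ∩ cls p i) ∨
      ∃ k, k ≠ j ∧ k ≠ i ∧ x ∈ ed q i k ∩ cls p i := by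
    intro x hx
    have hm := hc.mem x
    rw [hx] at hm
    obtain ⟨k, hk⟩ := hm
    by_cases hkj : k = j
    · subst hkj; exact Or.inl (Or.inr ⟨hk, hx⟩)
    by_cases hki : k = i
    · subst hki; exact Or.inl (Or.inl hk)
    exact Or.inr ⟨k, hkj, hki, hk, hx⟩
  have hbi : p b = i := hb1.elim (fun h => hc.node_subset h) fun h => h.2
  have hfb : p (f b) ≠ i := by
    intro h
    rcases hcases _ h with h' | ⟨k, hkj, hki, h'⟩
    · exact hb2 h'
    · have := mem_of_exits_eq_empty (hin k hkj hki) h'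
      rw [𝓢.invol f hf] at this
      rcases hb1 with h3 | h3
      · have e1 : q b = s(i, i) := h3
        rw [mem_ed.1 this.1] at e1; simp at e1; exact hki e1
      · have e1 : q b = s(i, j) := h3.1
        rw [mem_ed.1 this.1] at e1; simp at e1
        rcases e1 with e1 | e1
        · exact hkj e1
        · exact hki e1.2
  refine ⟨b, hb, Set.eq_singleton_iff_unique_mem.2 ⟨⟨hbi, hfb⟩, ?_⟩, ?_⟩
  · rintro x ⟨h3, h4⟩
    rcases hcases x h3 with h5 | ⟨k, hkj, hki, h5⟩
    · refine eq_of_mem_exits hb h5 fun h => h4 ?_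
      exact h.elim (fun h => hc.node_subset h) fun h => h.2
    · exact absurd (mem_of_exits_eq_empty (hin k hkj hki) h5).2 h4
  · rcases hb1 with h3 | h3
    · have hab : b = a := eq_of_mem_exits h1 h3 fun h => hb2 (Or.inl h)
      rw [← hab] at h2
      rcases h2 with h2 | h2
      · simpa using hc.eq_or h2
      · exact (hc.eq_or h2).resolve_left hfb
    · by_cases h4 : q (f b) = s(i, j)
      · exact (hc.eq_or h4).resolve_left hfb
      · have hx : b ∈ exits f (ed q i j) := ⟨h3.1, h4⟩
        rcases hq.edge_exits hij hf with h5 | ⟨s, t, h5, h6, h7⟩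
        · rw [h5] at hx; exact hx.elim
        · rw [h5] at hx
          rcases hx with rfl | rfl
          · exact absurd (hc.node_subset h6) hfb
          · exact hc.node_subset h7

theorem Compat.tightFibers (hc : 𝓢.Compat q p) (hq : 𝓢.PreTorsoid q) : 𝓢.TightFibers p := by
  intro i f hf
  obtain ⟨j, hj⟩ := hq.exists_nodeMatch hf i
  obtain ⟨b, -, h, -⟩ := hc.exits_cls hq hf hj
  exact ⟨b, h⟩

theorem Compat.mate_eq_iff (hc : 𝓢.Compat q p) (hq : 𝓢.PreTorsoid q) (hf : f ∈ 𝓢.carrier) :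
    mate p f i = j ↔ NodeMatch q f i j := by
  have key : ∀ j, NodeMatch q f i j → mate p f i = j := by
    intro j hj
    obtain ⟨b, -, h1, h2⟩ := hc.exits_cls hq hf hj
    obtain ⟨b', h3, h4, h5, h6⟩ := (hc.tightFibers hq).exists_exit hf i
    obtain rfl : b = b' := Set.singleton_injective (h1.symm.trans h6)
    exact h4.symm.trans h2
  constructor
  · rintro rfl
    obtain ⟨j, hj⟩ := hq.exists_nodeMatch hf i
    rwa [key j hj]
  · exact key j

theorem Compat.nodeMatch (hc : 𝓢.Compat q p) (hq : 𝓢.PreTorsoid q) (hf : f ∈ 𝓢.carrier) (i : ι) :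
    NodeMatch q f i (mate p f i) := (hc.mate_eq_iff hq hf).1 rfl

theorem Compat.mate_eq_mate (hc : 𝓢.Compat q p) (hc' : 𝓢.Compat q p') (hq : 𝓢.PreTorsoid q)
    (hf : f ∈ 𝓢.carrier) : mate p f = mate p' f :=
  funext fun _ => (hc.mate_eq_iff hq hf).2 (hc'.nodeMatch hq hf _)

/-- An edge set is left only by matchings that match its two ends. -/
theorem Compat.edge_inactive (hc : 𝓢.Compat q p) (hq : 𝓢.PreTorsoid q) (hf : f ∈ 𝓢.carrier)
    (hij : i ≠ j) (hm : mate p f i ≠ j) : exits f (ed q i j) = ∅ :=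
  hq.edge_inactive hf (hc.nodeMatch hq hf i) hm.symm hij.symm

/-- Edge sets are even. -/
theorem PreTorsoid.ed_par (hq : 𝓢.PreTorsoid q) (hij : i ≠ j) :
    𝓢.FinCut (ed q i j) ∧ 𝓢.par (ed q i j) = 0 :=
  par_eq_zero_of_union (hq.node i) (hq.tight i j) (disjoint_ed (by simp [hij]))

theorem PreTorsoid.disjoint_node (hij : i ≠ j) (hU : U ⊆ ed q i j) : Disjoint (ed q i i) U :=
  (disjoint_ed (by simp [hij])).mono_right hU

/-- If a part of an edge set can be added to one end, then the rest can be added to the other. -/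
theorem PreTorsoid.tight_rest (hq : 𝓢.PreTorsoid q) (hij : i ≠ j) (hU : U ⊆ ed q i j)
    (h : 𝓢.Tight (ed q i i ∪ U)) : 𝓢.Tight (ed q j j ∪ (ed q i j \ U)) := by
  have hU0 := par_eq_zero_of_union (hq.node i) h (disjoint_node hij hU)
  have h1 : 𝓢.Tight (ed q j j ∪ ed q i j) := by rw [ed_comm (i := i)]; exact hq.tight j i
  have hdi : Disjoint (ed q j j) (ed q i i) := disjoint_ed (by simp [hij.symm])
  have hdj : Disjoint (ed q j j) U := (disjoint_ed (by simp [hij.symm])).mono_right hU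
  have hde : Disjoint (ed q i j) (ed q i i) := disjoint_ed (by simp [hij.symm])
  have e1 : (ed q j j ∪ ed q i j) ∩ (ed q i i ∪ U) = U := by
    ext x
    have h2 : x ∈ ed q j j → x ∉ ed q i i := fun h => Set.disjoint_left.1 hdi h
    have h4 : x ∈ ed q i j → x ∉ ed q i i := fun h => Set.disjoint_left.1 hde h
    have h5 : x ∈ U → x ∈ ed q i j := fun h => hU h
    simp only [Set.mem_inter_iff, Set.mem_union]
    tauto
  have e2 : (ed q j j ∪ ed q i j) \ (ed q i i ∪ U) = ed q j j ∪ (ed q i j \ U) := by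
    ext x
    have h2 : x ∈ ed q j j → x ∉ ed q i i := fun h => Set.disjoint_left.1 hdi h
    have h3 : x ∈ ed q j j → x ∉ U := fun h => Set.disjoint_left.1 hdj h
    have h4 : x ∈ ed q i j → x ∉ ed q i i := fun h => Set.disjoint_left.1 hde h
    simp only [Set.mem_sdiff, Set.mem_union]
    tauto
  rw [← e2]
  exact h1.diff h (by rw [e1]; exact hU0.2)

/-- Assigning each edge set as a whole to one of its ends gives a compatible partition. -/
theorem PreTorsoid.compat_orientation (hq : 𝓢.PreTorsoid q) {σ : Sym2 ι → ι} (hσ : ∀ e, σ e ∈ e) :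
    𝓢.Compat q (σ ∘ q) := by
  refine ⟨fun x => hσ _, fun i j => ?_⟩
  by_cases h : σ s(i, j) = i
  · have : ed q i j ∩ cls (σ ∘ q) i = ed q i j := Set.inter_eq_left.2 fun x hx => by
      rw [mem_cls, Function.comp, mem_ed.1 hx, h]
    rw [this]; exact hq.tight i j
  · have : ed q i j ∩ cls (σ ∘ q) i = ∅ := Set.eq_empty_iff_forall_notMem.2 fun x hx => by
      apply h
      have := hx.2
      rwa [mem_cls, Function.comp, mem_ed.1 hx.1] at this
    rw [this, Set.union_empty]; exact hq.node i

open Classical in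
/-- Reassigning one edge set as a whole to one of its ends keeps a partition compatible. -/
theorem Compat.update (hc : 𝓢.Compat q p) (hq : 𝓢.PreTorsoid q) (hij : i ≠ j) :
    𝓢.Compat q (fun x => if q x = s(i, j) then i else p x) := by
  refine ⟨fun x => ?_, fun a b => ?_⟩
  · split_ifs with h
    · rw [h]; simp
    · exact hc.mem x
  · by_cases hab : s(a, b) = s(i, j)
    · by_cases ha : a = i
      · subst ha
        obtain rfl : b = j := by simpa [hij] using hab
        have : ed q a b ∩ cls (fun x => if q x = s(a, b) then a else p x) a = ed q a b :=
          Set.inter_eq_left.2 fun x hx => by rw [mem_cls, if_pos (mem_ed.1 hx)]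
        rw [this]; exact hq.tight a b
      · have : ed q a b ∩ cls (fun x => if q x = s(i, j) then i else p x) a = ∅ :=
          Set.eq_empty_iff_forall_notMem.2 fun x hx => by
            have h1 := hx.2
            rw [mem_cls, if_pos ((mem_ed.1 hx.1).trans hab)] at h1
            exact ha h1.symm
        rw [this, Set.union_empty]; exact hq.node a
    · have : ed q a b ∩ cls (fun x => if q x = s(i, j) then i else p x) a = ed q a b ∩ cls p a := by
        ext x
        refine and_congr_right fun hx => ?_
        rw [mem_cls, mem_cls, if_neg (by rw [mem_ed.1 hx]; exact hab)]
      rw [this]; exact hc.tight a b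

theorem Compat.ed_subset (hc : 𝓢.Compat q p) : ed q i j ⊆ cls p i ∪ cls p j :=
  fun _ hx => hc.eq_or hx

theorem Compat.cls_union_ed (hc : 𝓢.Compat q p) (hq : 𝓢.PreTorsoid q) (hij : i ≠ j) :
    𝓢.Tight (cls p i ∪ ed q i j) := by
  classical
  have := (hc.update hq hij).tightFibers hq i
  convert this using 1
  ext x
  simp only [mem_cls, Set.mem_union, mem_ed]
  split_ifs with h <;> simp [h]

theorem Compat.cls_diff_ed (hc : 𝓢.Compat q p) (hq : 𝓢.PreTorsoid q) (hij : i ≠ j) :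
    𝓢.Tight (cls p i \ ed q i j) := by
  classical
  have := (hc.update hq hij.symm).tightFibers hq i
  convert this using 1
  ext x
  simp only [mem_cls, Set.mem_sdiff, mem_ed, Sym2.eq_swap (a := j)]
  split_ifs with h <;> simp [h, hij.symm]

theorem Compat.pass_ed (hc : 𝓢.Compat q p) (hq : 𝓢.PreTorsoid q) (hij : i ≠ j) :
    𝓢.Pass (cls p i) (cls p j) (ed q i j) :=
  ⟨hc.cls_diff_ed hq hij, hc.cls_union_ed hq hij, by rw [ed_comm]; exact hc.cls_diff_ed hq hij.symm,
    by rw [ed_comm]; exact hc.cls_union_ed hq hij.symm⟩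

variable (𝓢) in
/-- A pretorsoid is full if its edge sets contain every set that is passable for two classes of a
compatible partition. This is the form in which the maximality conditions of a torsoid are used. -/
def Full (q : V → Sym2 ι) : Prop :=
  ∀ p, 𝓢.Compat q p → ∀ i j, i ≠ j → ∀ S ⊆ cls p i ∪ cls p j,
    𝓢.Pass (cls p i) (cls p j) S → S ⊆ ed q i j

theorem Compat.mem_cls_of_notMem_ed (hc : 𝓢.Compat q p) (hx : p x = i) :
    ∃ k, q x = s(i, k) := by
  have hm := hc.mem x
  rw [hx] at hm
  obtain ⟨k, hk⟩ := hm
  exact ⟨k, hk⟩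

theorem exits_eq_of_inactive_add (hf : f ∈ 𝓢.carrier) (hW : exits f W = ∅) {a : V}
    (h : exits f (A ∪ W) = {a}) (hd : Disjoint A W) : exits f A = {a} := by
  have h1 := mem_exits_of_eq h
  have h2 := exits_diff_of_inactive hf h hW fun h' => h1.2 (Or.inr h')
  rwa [Set.union_sdiff_right, hd.sdiff_eq_left] at h2

theorem sUnion_edges_inactive (hc : 𝓢.Compat q p) (hq : 𝓢.PreTorsoid q) (hf : f ∈ 𝓢.carrier)
    (i : ι) : exits f {x | p x = i ∧ ∃ k, k ≠ mate p f i ∧ k ≠ i ∧ q x = s(i, k)} = ∅ := by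
  refine Set.eq_empty_iff_forall_notMem.2 ?_
  rintro x ⟨⟨h1, k, hkj, hki, h2⟩, h3⟩
  have h4 := mem_of_exits_eq_empty (hc.part_inactive hq hf (hc.nodeMatch hq hf i) hkj hki)
    (x := x) ⟨h2, h1⟩
  exact h3 ⟨h4.2, k, hkj, hki, h4.1⟩

/-- A set that contains the edge set `ed q i j` and is passable for two classes of a compatible
partition is passable for the two nodes, provided that it lies between them. -/
theorem Compat.tight_node_of_pass (hc : 𝓢.Compat q p) (hq : 𝓢.PreTorsoid q) (hij : i ≠ j)
    (hS : S ⊆ ed q i i ∪ ed q i j ∪ ed q j j) (hE : ed q i j ⊆ S)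
    (h : 𝓢.Pass (cls p i) (cls p j) S) :
    𝓢.Tight (ed q i i \ S) ∧ 𝓢.Tight (ed q i i ∪ S) := by
  have hp := hc.tightFibers hq
  have hSc : S ⊆ cls p i ∪ cls p j := hS.trans (Set.union_subset (Set.union_subset
    (hc.node_subset.trans Set.subset_union_left) hc.ed_subset)
    (hc.node_subset.trans Set.subset_union_right))
  have hSk : ∀ x ∈ S, ∀ k, k ≠ i → k ≠ j → q x ≠ s(i, k) := by
    intro x hx k hki hkj h'
    rcases hS hx with (h1 | h1) | h1 <;> rw [mem_ed, h'] at h1 <;> simp at h1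
    · exact hki h1
    · rcases h1 with h1 | h1
      · exact hkj h1
      · exact hki h1.2
    · exact hij h1.1
  have hcover : ∀ x, p x = i → x ∉ ed q i i → x ∉ S → ∃ k, k ≠ i ∧ k ≠ j ∧ q x = s(i, k) := by
    intro x hx h1 h2
    obtain ⟨k, hk⟩ := hc.mem_cls_of_notMem_ed hx
    refine ⟨k, ?_, ?_, hk⟩
    · rintro rfl; exact h1 hk
    · rintro rfl; exact h2 (hE hk)
  have main : ∀ f ∈ 𝓢.carrier, (∃ a, exits f (ed q i i \ S) = {a}) ∧
      ∃ a, exits f (ed q i i ∪ S) = {a} := by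
    intro f hf
    -- If `f` matches `i` to `j`, it does not leave the part `W` of the class `i` that comes from
    -- other edge sets, and removing `W` from the class turns tightness of classes into tightness
    -- of nodes. Otherwise `f` does not leave `S` at all.
    by_cases hm : mate p f i = j
    · set W := {x | p x = i ∧ ∃ k, k ≠ mate p f i ∧ k ≠ i ∧ q x = s(i, k)} with hWdef
      have hW : exits f W = ∅ := sUnion_edges_inactive hc hq hf i
      have hWS : ∀ x ∈ W, x ∉ S := by
        rintro x ⟨h1, k, hkj, hki, h2⟩ hxS
        exact hSk x hxS k hki (hm ▸ hkj) h2
      have hWn : ∀ x ∈ W, x ∉ ed q i i := by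
        rintro x ⟨h1, k, hkj, hki, h2⟩ hx
        rw [mem_ed, h2] at hx; simp at hx; exact hki hx
      have hWc : ∀ x, p x = i → x ∉ ed q i i → x ∉ S → x ∈ W := by
        intro x h1 h2 h3
        obtain ⟨k, hki, hkj, hk⟩ := hcover x h1 h2 h3
        exact ⟨h1, k, hm ▸ hkj, hki, hk⟩
      have e1 : (ed q i i \ S) ∪ W = cls p i \ S := by
        ext x
        constructor
        · rintro (⟨h1, h2⟩ | h1)
          · exact ⟨hc.node_subset h1, h2⟩
          · exact ⟨h1.1, hWS x h1⟩
        · rintro ⟨h1, h2⟩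
          by_cases h3 : x ∈ ed q i i
          · exact Or.inl ⟨h3, h2⟩
          · exact Or.inr (hWc x h1 h3 h2)
      have e2 : (ed q i i ∪ S) ∪ W = cls p i ∪ S := by
        ext x
        constructor
        · rintro ((h1 | h1) | h1)
          · exact Or.inl (hc.node_subset h1)
          · exact Or.inr h1
          · exact Or.inl h1.1
        · rintro (h1 | h1)
          · by_cases h3 : x ∈ ed q i i
            · exact Or.inl (Or.inl h3)
            · by_cases h2 : x ∈ S
              · exact Or.inl (Or.inr h2)
              · exact Or.inr (hWc x h1 h3 h2)
          · exact Or.inl (Or.inr h1)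
      constructor
      · obtain ⟨a, ha⟩ := h.1 f hf
        rw [← e1] at ha
        refine ⟨a, exits_eq_of_inactive_add hf hW ha ?_⟩
        exact Set.disjoint_left.2 fun x h2 h3 => hWn x h3 h2.1
      · obtain ⟨a, ha⟩ := h.2.1 f hf
        rw [← e2] at ha
        refine ⟨a, exits_eq_of_inactive_add hf hW ha ?_⟩
        exact Set.disjoint_left.2 fun x h2 h3 => h2.elim (hWn x h3) (hWS x h3)
    · have hin := h.inactive hp hSc hij hf hm
      obtain ⟨-, a, h1, h2⟩ := hc.nodeMatch hq hf i
      have hmi := hp.mate_ne hf i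
      have hfa : f a ∉ S := by
        intro h3
        rcases h2 with h2 | h2
        · rcases hS h3 with (h4 | h4) | h4 <;> rw [mem_ed, h2] at h4 <;> simp at h4
          · exact hmi h4
          · exact hmi (h4.elim (fun h => h.1) fun h => h.2)
          · exact hm h4
        · exact hSk _ h3 _ hmi hm h2
      exact ⟨⟨a, exits_diff_of_inactive hf h1 hin hfa⟩, ⟨a, exits_union_of_inactive h1 hin hfa⟩⟩
  exact ⟨fun f hf => (main f hf).1, fun f hf => (main f hf).2⟩

/-- A pretorsoid is full if its edge sets are largest among the sets passable for two nodes, and if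
passable sets meet the edge sets in even sets. -/
theorem PreTorsoid.full (hq : 𝓢.PreTorsoid q)
    (hmax : ∀ f ∈ 𝓢.carrier, ∀ i j, NodeMatch q f i j → ∀ S ⊆ ed q i i ∪ ed q i j ∪ ed q j j,
      𝓢.Pass (ed q i i) (ed q j j) S → S ⊆ ed q i j)
    (heven : ∀ p, 𝓢.Compat q p → ∀ i j k, i ≠ j → i ≠ k → j ≠ k → ∀ S ⊆ cls p i ∪ cls p j,
      𝓢.Pass (cls p i) (cls p j) S → 𝓢.par (S ∩ ed q i k) = 0) : 𝓢.Full q := by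
  intro p hc i j hij S hS h
  have hp := hc.tightFibers hq
  by_cases hadj : ∃ f ∈ 𝓢.carrier, mate p f i = j
  · obtain ⟨f, hf, hfm⟩ := hadj
    -- by the parity assumption `S` avoids the edge sets that lead away from `i` and `j`
    have hdis : ∀ {i j : ι}, i ≠ j → S ⊆ cls p i ∪ cls p j → 𝓢.Pass (cls p i) (cls p j) S →
        ∀ k, k ≠ i → k ≠ j → ∀ x ∈ S, q x ≠ s(i, k) := by
      intro i j hij hS h k hki hkj x hx hxk
      have := h.inter_eq_empty hp hij hki.symm hkj.symm hS hc.ed_subset (hc.pass_ed hq hki.symm)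
        (heven p hc i j k hij hki.symm hkj.symm S hS h)
      exact Set.eq_empty_iff_forall_notMem.1 this x ⟨hx, hxk⟩
    have hSE : S ∪ ed q i j ⊆ ed q i i ∪ ed q i j ∪ ed q j j := by
      rintro x (hx | hx)
      · rcases hS hx with h1 | h1
        · obtain ⟨k, hk⟩ := hc.mem_cls_of_notMem_ed h1
          by_cases hki : k = i
          · subst hki; exact Or.inl (Or.inl hk)
          by_cases hkj : k = j
          · subst hkj; exact Or.inl (Or.inr hk)
          exact absurd hk (hdis hij hS h k hki hkj x hx)
        · obtain ⟨k, hk⟩ := hc.mem_cls_of_notMem_ed h1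
          by_cases hkj : k = j
          · subst hkj; exact Or.inr hk
          by_cases hki : k = i
          · subst hki; exact Or.inl (Or.inr (hk.trans Sym2.eq_swap))
          exact absurd hk (hdis hij.symm (Set.union_comm _ _ ▸ hS) h.symm k hkj hki x hx)
      · exact Or.inl (Or.inr hx)
    -- now `S ∪ ed q i j` lies between the two nodes, where maximality applies
    have hpass := h.union hp hq.three hij hS hc.ed_subset (hc.pass_ed hq hij)
    have h1 := hc.tight_node_of_pass hq hij hSE Set.subset_union_right hpass
    have h2 := hc.tight_node_of_pass hq hij.symm (S := S ∪ ed q i j)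
      (by rw [ed_comm (i := j) (j := i)]
          exact hSE.trans fun x hx => by simp only [Set.mem_union] at hx ⊢; tauto)
      (by rw [ed_comm (i := j)]; exact Set.subset_union_right) hpass.symm
    exact Set.subset_union_left.trans (hmax f hf i j ((hc.mate_eq_iff hq hf).1 hfm) _ hSE
      ⟨h1.1, h1.2, h2.1, h2.2⟩)
  · push Not at hadj
    have : S = ∅ := by
      refine eq_empty_of_exits (fun f hf => h.inactive hp hS hij hf (hadj f hf)) ?_
      rintro rfl
      obtain ⟨k, hki, hkj⟩ := hq.three i j
      obtain ⟨x, hx⟩ := hp.surjective k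
      rcases hS (Set.mem_univ x) with h | h
      · exact hki (hx.symm.trans h)
      · exact hkj (hx.symm.trans h)
    rw [this]; exact Set.empty_subset _

end MatchingSystem

end TightCuts

/-! ### Trimming a partition, and tight sets in good labellings -/

namespace TightCuts

namespace MatchingSystem

variable {V : Type*} {ι : Type*} {𝓢 : MatchingSystem V} {f g : V → V} {A B S T U W X Y : Set V}
  {p p' : V → ι} {q : V → Sym2 ι} {i j k : ι}

theorem Compat.span_subset (hc : 𝓢.Compat q p) :
    ed q i i ∪ ed q i j ∪ ed q j j ⊆ cls p i ∪ cls p j :=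
  Set.union_subset (Set.union_subset (hc.node_subset.trans Set.subset_union_left) hc.ed_subset)
    (hc.node_subset.trans Set.subset_union_right)

/-- A matching that leaves a set passable for two nodes matches the two nodes. -/
theorem Compat.pass_nodes_inactive (hc : 𝓢.Compat q p) (hq : 𝓢.PreTorsoid q) (hij : i ≠ j)
    (hS : S ⊆ ed q i i ∪ ed q i j ∪ ed q j j) (h : 𝓢.Pass (ed q i i) (ed q j j) S)
    (hf : f ∈ 𝓢.carrier) (hm : mate p f i ≠ j) : exits f S = ∅ := by
  rcases h.exits_cases (disjoint_ed (by simp [hij])) hf with h1 | ⟨s, t, h1, h2, h3⟩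
  · exact h1
  · exfalso
    have hs : s ∈ S := by
      have : s ∈ exits f S := by rw [h1]; exact Or.inl rfl
      exact this.1
    have ht : t ∈ S := by
      have : t ∈ exits f S := by rw [h1]; exact Or.inr rfl
      exact this.1
    -- if `f` left `S`, it would map the union of `S` with the two nodes to itself
    have hcl : ∀ x ∈ ed q i i ∪ S ∪ ed q j j, f x ∈ ed q i i ∪ S ∪ ed q j j := by
      intro x hx
      by_cases hxS : x ∈ S
      · by_contra hc
        have : x ∈ exits f S := ⟨hxS, fun h' => hc (Or.inl (Or.inr h'))⟩
        rw [h1] at this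
        rcases this with rfl | rfl
        · exact hc (Or.inl (Or.inl h2.1))
        · exact hc (Or.inr h3.1)
      · rcases hx with (hx | hx) | hx
        · obtain ⟨c, hcc⟩ := h.1 f hf
          by_contra hc
          have e1 := eq_of_mem_exits hcc (x := x) ⟨hx, hxS⟩ fun h' => hc (Or.inl (Or.inl h'.1))
          have e2 := eq_of_mem_exits hcc h2 (by rw [𝓢.invol f hf]; exact fun h' => h'.2 hs)
          rw [e1, ← e2, 𝓢.invol f hf] at hc
          exact hc (Or.inl (Or.inr hs))
        · exact absurd hx hxS
        · obtain ⟨c, hcc⟩ := h.2.2.1 f hf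
          by_contra hc
          have e1 := eq_of_mem_exits hcc (x := x) ⟨hx, hxS⟩ fun h' => hc (Or.inr h'.1)
          have e2 := eq_of_mem_exits hcc h3 (by rw [𝓢.invol f hf]; exact fun h' => h'.2 ht)
          rw [e1, ← e2, 𝓢.invol f hf] at hc
          exact hc (Or.inl (Or.inr ht))
    obtain ⟨hmi, a, h4, h5⟩ := hc.nodeMatch hq hf i
    have ha := mem_exits_of_eq h4
    have h6 : f a ∈ ed q i i ∪ ed q i j ∪ ed q j j := by
      rcases hcl a (Or.inl (Or.inl ha.1)) with (h | h) | h
      · exact Or.inl (Or.inl h)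
      · exact hS h
      · exact Or.inr h
    rcases h6 with (h6 | h6) | h6
    · exact ha.2 h6
    · rw [mem_ed] at h6
      rcases h5 with h5 | h5 <;> rw [h6] at h5 <;> simp at h5
      · exact hmi h5.1
      · rcases h5 with h5 | h5
        · exact hm h5.symm
        · exact hmi h5.1
    · rw [mem_ed] at h6
      rcases h5 with h5 | h5 <;> rw [h6] at h5 <;> simp at h5
      · exact hm h5.symm
      · exact hij (h5.elim (fun h => h.1.symm) fun h => h.2.symm)

theorem Compat.pass_cls_of_nodes_aux (hc : 𝓢.Compat q p) (hq : 𝓢.PreTorsoid q) (hij : i ≠ j)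
    (hS : S ⊆ ed q i i ∪ ed q i j ∪ ed q j j) (h : 𝓢.Pass (ed q i i) (ed q j j) S) :
    𝓢.Tight (cls p i \ (S ∪ ed q i j)) ∧ 𝓢.Tight (cls p i ∪ (S ∪ ed q i j)) := by
  have hp := hc.tightFibers hq
  -- parities are read off from a matching `g` that does not match `i` to `j`: it leaves neither
  -- `S` nor the edge set
  obtain ⟨g, hg, hgm⟩ := hp.exists_mate_ne hq.three i j
  obtain ⟨e, he⟩ := hp i g hg
  have hin := exits_inactive_union (hc.pass_nodes_inactive hq hij hS h hg hgm)
    (hc.edge_inactive hq hg hij hgm)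
  have hex := hp.exits_union_inactive (Set.union_subset (hS.trans hc.span_subset) hc.ed_subset)
    hg hgm hin he
  constructor
  · refine tight_of_par (par_eq_one_of_exits hg hex.2).2 fun f hf => ?_
    by_cases hm : mate p f i = j
    · obtain ⟨b, hb⟩ := h.1 f hf
      refine ⟨b, b, ?_⟩
      set W := {x | p x = i ∧ ∃ k, k ≠ mate p f i ∧ k ≠ i ∧ q x = s(i, k)}
      have hW : exits f W = ∅ := sUnion_edges_inactive hc hq hf i
      have e1 : cls p i \ (S ∪ ed q i j) = (ed q i i \ S) ∪ W := by
        ext x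
        constructor
        · rintro ⟨h1, h2⟩
          obtain ⟨k, hk⟩ := hc.mem_cls_of_notMem_ed h1
          by_cases hki : k = i
          · subst hki; exact Or.inl ⟨hk, fun h => h2 (Or.inl h)⟩
          refine Or.inr ⟨h1, k, ?_, hki, hk⟩
          rintro rfl
          exact h2 (Or.inr (hm ▸ hk))
        · rintro (⟨h1, h2⟩ | ⟨h1, k, hkm, hki, hk⟩)
          · refine ⟨hc.node_subset h1, fun h => h.elim h2 fun h => hij ?_⟩
            rw [mem_ed, mem_ed.1 h1] at h; simpa using h
          · rw [hm] at hkm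
            have hne : x ∉ ed q i j := by
              rw [mem_ed, hk]; simp only [Sym2.eq_iff]; tauto
            refine ⟨h1, fun h => h.elim (fun h => ?_) hne⟩
            rcases hS h with (h | h) | h
            · rw [mem_ed, hk] at h; simp at h; exact hki h
            · exact hne h
            · rw [mem_ed, hk] at h; simp at h; exact hij h.1
      rw [e1]
      refine exits_union_subset.trans ?_
      rw [hW, hb]; simp
    · obtain ⟨e, he⟩ := hp i f hf
      refine ⟨e, e, ?_⟩
      rw [(hp.exits_union_inactive (Set.union_subset (hS.trans hc.span_subset) hc.ed_subset) hf hm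
        (exits_inactive_union (hc.pass_nodes_inactive hq hij hS h hf hm)
          (hc.edge_inactive hq hf hij hm)) he).2]
      simp
  · refine tight_of_par (par_eq_one_of_exits hg hex.1).2 fun f hf => ?_
    obtain ⟨a, ha⟩ := h.2.1 f hf
    obtain ⟨b, hb⟩ := hc.cls_union_ed hq hij f hf
    refine ⟨a, b, ?_⟩
    have e1 : cls p i ∪ (S ∪ ed q i j) = (ed q i i ∪ S) ∪ (cls p i ∪ ed q i j) := by
      ext x
      have := fun h => hc.node_subset (i := i) (a := x) h
      simp only [Set.mem_union] at *; tauto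
    rw [e1]
    refine exits_union_subset.trans ?_
    rw [ha, hb]; rfl

/-- A set that is passable for two nodes is, together with the edge set of the two nodes,
passable for the corresponding classes of every compatible partition. -/
theorem Compat.pass_cls_of_nodes (hc : 𝓢.Compat q p) (hq : 𝓢.PreTorsoid q) (hij : i ≠ j)
    (hS : S ⊆ ed q i i ∪ ed q i j ∪ ed q j j) (h : 𝓢.Pass (ed q i i) (ed q j j) S) :
    𝓢.Pass (cls p i) (cls p j) (S ∪ ed q i j) := by
  have h1 := hc.pass_cls_of_nodes_aux hq hij hS h
  have h2 := hc.pass_cls_of_nodes_aux hq hij.symm (S := S)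
    (by rw [ed_comm (i := j) (j := i)]
        exact hS.trans fun x hx => by simp only [Set.mem_union] at hx ⊢; tauto) h.symm
  rw [ed_comm (i := j)] at h2
  exact ⟨h1.1, h1.2, h2.1, h2.2⟩

open Classical in
variable (𝓢) in
/-- The labelling obtained from a partition `p` into tight sets by moving from any two classes
the largest set passable for both of them to a new edge set. The choice of the second class is
immaterial if the largest passable sets at a class are disjoint. -/
noncomputable def trim (p : V → ι) (x : V) : Sym2 ι :=
  if h : ∃ j, j ≠ p x ∧ x ∈ 𝓢.maxPass p (p x) j then s(p x, h.choose) else s(p x, p x)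

section Trim

variable (hdis : ∀ i j k, i ≠ j → i ≠ k → j ≠ k → 𝓢.maxPass p i j ∩ 𝓢.maxPass p i k = ∅)

include hdis

theorem ed_trim (hij : i ≠ j) : ed (𝓢.trim p) i j = 𝓢.maxPass p i j := by
  have key : ∀ {i j : ι} {x : V}, i ≠ j → p x = i → x ∈ 𝓢.maxPass p i j →
      𝓢.trim p x = s(i, j) := by
    rintro i j x hij rfl hx
    have h : ∃ j, j ≠ p x ∧ x ∈ 𝓢.maxPass p (p x) j := ⟨j, hij.symm, hx⟩
    rw [trim, dif_pos h]
    by_contra hc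
    have h1 : h.choose ≠ j := fun h' => hc (by rw [h'])
    exact Set.eq_empty_iff_forall_notMem.1
      (hdis (p x) h.choose j h.choose_spec.1.symm hij h1) x ⟨h.choose_spec.2, hx⟩
  ext x
  constructor
  · intro h
    rw [mem_ed, trim] at h
    split_ifs at h with h'
    · rw [Sym2.eq_iff] at h
      have := h'.choose_spec.2
      rcases h with ⟨h1, h2⟩ | ⟨h1, h2⟩
      · rwa [h2, h1] at this
      · rw [h2, h1] at this
        rwa [maxPass_comm]
    · simp at h; exact absurd (h.elim (fun h => h.1.symm.trans h.2) fun h => h.2.symm.trans h.1) hij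
  · intro h
    rcases maxPass_subset h with h' | h'
    · exact key hij h' h
    · rw [mem_ed, key hij.symm h' (by rwa [maxPass_comm]), Sym2.eq_swap]

theorem mem_node_trim {x : V} :
    x ∈ ed (𝓢.trim p) i i ↔ p x = i ∧ ∀ j, j ≠ i → x ∉ 𝓢.maxPass p i j := by
  constructor
  · intro h
    have hp : p x = i := by
      rw [mem_ed, trim] at h
      split_ifs at h <;> simp at h
      · exact h.1
      · exact h
    refine ⟨hp, fun j hj hx => ?_⟩
    rw [← ed_trim hdis hj.symm, mem_ed, mem_ed.1 h] at hx
    simp at hx; exact hj hx.symm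
  · rintro ⟨rfl, h⟩
    rw [mem_ed, trim, dif_neg]
    rintro ⟨j, hj, hx⟩
    exact h j hj hx

/-- If the largest passable sets at each class are disjoint, the trimmed labelling is a
pretorsoid, and the partition that it was obtained from is compatible with it. -/
theorem TightFibers.trim_aux (hp : 𝓢.TightFibers p) (h3 : ∀ i j : ι, ∃ k, k ≠ i ∧ k ≠ j) :
    𝓢.PreTorsoid (𝓢.trim p) ∧ 𝓢.Compat (𝓢.trim p) p := by
  have hpass := fun {i j : ι} (hij : i ≠ j) => hp.pass_maxPass h3 hij
  have hdis' : ∀ {i j k : ι} {x : V}, i ≠ j → i ≠ k → j ≠ k → x ∈ 𝓢.maxPass p i j →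
      x ∉ 𝓢.maxPass p i k := fun hij hik hjk h1 h2 =>
    Set.eq_empty_iff_forall_notMem.1 (hdis _ _ _ hij hik hjk) _ ⟨h1, h2⟩
  -- the vertices of the class `i` that belong to edge sets towards classes other than the partner
  -- of `i`; the matching does not leave them
  set W : (V → V) → ι → Set V := fun f i =>
    {x | p x = i ∧ ∃ k, k ≠ mate p f i ∧ k ≠ i ∧ x ∈ 𝓢.maxPass p i k} with hWdef
  have hpart : ∀ f ∈ 𝓢.carrier, ∀ i k, k ≠ mate p f i → k ≠ i → ∀ x, p x = i →
      x ∈ 𝓢.maxPass p i k → p (f x) = i ∧ f x ∈ 𝓢.maxPass p i k := by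
    intro f hf i k hkm hki x hx hxk
    have h1 := mem_of_exits_eq_empty
      ((hpass hki.symm).inactive hp maxPass_subset hki.symm hf hkm.symm) hxk
    refine ⟨?_, h1⟩
    rcases maxPass_subset h1 with h | h
    · exact h
    · exfalso
      apply hkm
      rw [← hx, hp.mate_eq hf (x := x)]
      · exact h.symm
      · rw [mem_cls.1 h, hx]; exact hki
  have hW : ∀ f ∈ 𝓢.carrier, ∀ i, exits f (W f i) = ∅ := by
    intro f hf i
    refine Set.eq_empty_iff_forall_notMem.2 ?_
    rintro x ⟨⟨h1, k, hkm, hki, hk⟩, h2⟩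
    obtain ⟨h4, h5⟩ := hpart f hf i k hkm hki x h1 hk
    exact h2 ⟨h4, k, hkm, hki, h5⟩
  have hWm : ∀ f ∈ 𝓢.carrier, ∀ i x, x ∈ W f i → x ∉ 𝓢.maxPass p i (mate p f i) := by
    rintro f hf i x ⟨h1, k, hkm, hki, hk⟩ h2
    exact hdis' hki.symm (hp.mate_ne hf i).symm hkm hk h2
  -- for the matching `f`, the node `i` arises from the class `i` by removing the tight part
  -- towards the partner of `i` and then the set `W f i`, which `f` does not leave
  have hnode : ∀ f ∈ 𝓢.carrier, ∀ i,
      ed (𝓢.trim p) i i = (cls p i \ 𝓢.maxPass p i (mate p f i)) \ W f i := by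
    intro f hf i
    ext x
    rw [mem_node_trim hdis]
    constructor
    · rintro ⟨h1, h2⟩
      exact ⟨⟨h1, h2 _ (hp.mate_ne hf i)⟩, fun h => by
        obtain ⟨_, k, _, hki, hk⟩ := h
        exact h2 k hki hk⟩
    · rintro ⟨⟨h1, h2⟩, h3⟩
      refine ⟨h1, fun k hki hk => ?_⟩
      by_cases hkm : k = mate p f i
      · subst hkm; exact h2 hk
      · exact h3 ⟨h1, k, hkm, hki, hk⟩
  have tnode : ∀ f ∈ 𝓢.carrier, ∀ i, ∃ a, exits f (ed (𝓢.trim p) i i) = {a} := by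
    intro f hf i
    obtain ⟨a, ha⟩ := (hpass (hp.mate_ne hf i).symm).1 f hf
    refine ⟨a, ?_⟩
    rw [hnode f hf]
    refine exits_diff_of_inactive hf ha (hW f hf i) fun h => ?_
    exact (mem_exits_of_eq ha).2 ⟨h.1, hWm f hf i _ h⟩
  have tunion : ∀ f ∈ 𝓢.carrier, ∀ i (U : Set V), exits f U = ∅ → (∀ x ∈ U, x ∉ ed (𝓢.trim p) i i) →
      ∃ a, exits f (ed (𝓢.trim p) i i ∪ U) = {a} := by
    intro f hf i U hU hd
    obtain ⟨a, ha⟩ := tnode f hf i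
    refine ⟨a, exits_union_of_inactive ha hU fun h => ?_⟩
    have := mem_of_exits_eq_empty hU h
    rw [𝓢.invol f hf] at this
    exact hd a this (mem_exits_of_eq ha).1
  have hnd : ∀ {i j : ι} {x : V}, i ≠ j → x ∈ 𝓢.maxPass p i j → x ∉ ed (𝓢.trim p) i i :=
    fun hij hx h => ((mem_node_trim hdis).1 h).2 _ hij.symm hx
  refine ⟨⟨h3, fun i j f hf => ?_⟩, ⟨fun x => ?_, fun i j f hf => ?_⟩⟩
  · by_cases hij : i = j
    · subst hij; rw [Set.union_self]; exact tnode f hf i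
    rw [ed_trim hdis hij]
    by_cases hm : j = mate p f i
    · obtain ⟨a, ha⟩ := (hpass hij).2.1 f hf
      refine ⟨a, ?_⟩
      have e1 : ed (𝓢.trim p) i i ∪ 𝓢.maxPass p i j = (cls p i ∪ 𝓢.maxPass p i j) \ W f i := by
        rw [hnode f hf, ← hm]
        ext x
        have := hWm f hf i x
        rw [← hm] at this
        simp only [Set.mem_union, Set.mem_sdiff]
        tauto
      rw [e1]
      exact exits_diff_of_inactive hf ha (hW f hf i) fun h =>
        (mem_exits_of_eq ha).2 (Or.inl h.1)
    · exact tunion f hf i _ ((hpass hij).inactive hp maxPass_subset hij hf (Ne.symm hm))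
        fun x hx => hnd hij hx
  · rw [trim]
    split_ifs <;> simp
  · by_cases hij : i = j
    · subst hij; rw [Set.union_eq_left.2 Set.inter_subset_left]; exact tnode f hf i
    rw [ed_trim hdis hij]
    by_cases hm : j = mate p f i
    · obtain ⟨a, ha⟩ := hp i f hf
      refine ⟨a, ?_⟩
      have e1 : ed (𝓢.trim p) i i ∪ (𝓢.maxPass p i j ∩ cls p i) = cls p i \ W f i := by
        rw [hnode f hf, ← hm]
        ext x
        have := hWm f hf i x
        rw [← hm] at this
        simp only [Set.mem_union, Set.mem_sdiff, Set.mem_inter_iff]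
        tauto
      rw [e1]
      exact exits_diff_of_inactive hf ha (hW f hf i) fun h => (mem_exits_of_eq ha).2 h.1
    · refine tunion f hf i _ ?_ fun x hx => hnd hij hx.1
      refine Set.eq_empty_iff_forall_notMem.2 ?_
      rintro x ⟨⟨h1, h2⟩, h4⟩
      obtain ⟨h5, h6⟩ := hpart f hf i j hm (Ne.symm hij) x h2 h1
      exact h4 ⟨h6, h5⟩

theorem TightFibers.preTorsoid_trim (hp : 𝓢.TightFibers p)
    (h3 : ∀ i j : ι, ∃ k, k ≠ i ∧ k ≠ j) : 𝓢.PreTorsoid (𝓢.trim p) := (hp.trim_aux hdis h3).1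

theorem TightFibers.compat_trim (hp : 𝓢.TightFibers p)
    (h3 : ∀ i j : ι, ∃ k, k ≠ i ∧ k ≠ j) : 𝓢.Compat (𝓢.trim p) p := (hp.trim_aux hdis h3).2

/-- The edge sets of the trimmed labelling are largest among the sets passable for two nodes. -/
theorem TightFibers.trim_greatest (hp : 𝓢.TightFibers p) (h3 : ∀ i j : ι, ∃ k, k ≠ i ∧ k ≠ j)
    (hij : i ≠ j) (hS : S ⊆ ed (𝓢.trim p) i i ∪ ed (𝓢.trim p) i j ∪ ed (𝓢.trim p) j j)
    (h : 𝓢.Pass (ed (𝓢.trim p) i i) (ed (𝓢.trim p) j j) S) : S ⊆ ed (𝓢.trim p) i j := by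
  have hc := hp.compat_trim hdis h3
  have h1 := hc.pass_cls_of_nodes (hp.preTorsoid_trim hdis h3) hij hS h
  rw [ed_trim hdis hij] at h1 ⊢
  refine Set.subset_union_left.trans (subset_maxPass (Set.union_subset ?_ maxPass_subset) h1)
  exact hS.trans hc.span_subset

end Trim

theorem TightFibers.pair_union (hp : 𝓢.TightFibers p) (hf : f ∈ 𝓢.carrier) {e : V}
    (he : exits f (cls p i) = {e}) (hS : S ⊆ cls p j) (hm : mate p f i ≠ j)
    (hin : exits f S = ∅) : exits f (cls p i ∪ S) = {e} :=
  (hp.exits_union_inactive (hS.trans Set.subset_union_right) hf hm hin he).1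

/-- The part of a tight set `Y` in a class outside the hat of `Y`. -/
theorem TightFibers.inter_cls_inactive (hp : 𝓢.TightFibers p) (hY : 𝓢.Tight Y)
    (hj : j ∉ 𝓢.hat p Y) (hf : f ∈ 𝓢.carrier) (hm : mate p f j ∉ 𝓢.hat p Y) :
    exits f (Y ∩ cls p j) = ∅ := by
  obtain ⟨a, ha⟩ := hY f hf
  obtain ⟨e, he⟩ := hp j f hf
  have h1 := hp.hat_noncrossing hY hf ha (i := j) (by tauto)
  refine exits_eq_empty_of_par (notMem_hat.1 hj) hf (a := e) ?_
  rintro x ⟨⟨h2, h3⟩, h4⟩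
  refine eq_of_mem_exits he h3 fun h5 => h4 ⟨?_, h5⟩
  by_contra h6
  exact h1.1 ((congrArg p (eq_of_mem_exits ha h2 h6)).symm.trans h3)

/-- If `j` lies outside the hat of `Y` and is matched to at most one class `i` of the hat, then the
part of `Y` in the class `j` is passable for the classes `i` and `j`. -/
theorem TightFibers.pass_inter_cls (hp : 𝓢.TightFibers p) (hY : 𝓢.Tight Y)
    (hj : j ∉ 𝓢.hat p Y) (hi : i ∈ 𝓢.hat p Y)
    (hu : ∀ f ∈ 𝓢.carrier, mate p f j ∈ 𝓢.hat p Y → mate p f j = i) :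
    𝓢.Pass (cls p i) (cls p j) (Y ∩ cls p j) := by
  have hij : i ≠ j := fun h => hj (h ▸ hi)
  have hd : Disjoint (cls p i) (Y ∩ cls p j) := (disjoint_cls hij).mono_right Set.inter_subset_right
  have hjY : 𝓢.Tight (cls p j \ Y) := (hp j).diff hY (by rw [Set.inter_comm]; exact notMem_hat.1 hj)
  have e1 : cls p j \ (Y ∩ cls p j) = cls p j \ Y := by
    ext x; simp only [Set.mem_sdiff, Set.mem_inter_iff]; tauto
  refine ⟨?_, ?_, ?_, ?_⟩
  · rw [hd.sdiff_eq_left]; exact hp i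
  · refine tight_of_par ?_ fun f hf => ?_
    · rw [par_union_of_disjoint (hp i).finCut (hY.finCut.inter (hp j).finCut) hd, (hp i).par,
        notMem_hat.1 hj, add_zero]
    · by_cases hm : mate p f i = j
      · obtain ⟨a, ha⟩ := hjY f hf
        refine ⟨f a, f a, ?_⟩
        rintro x ⟨h1, h2⟩
        have h3 : p x = i ∨ p x = j := h1.imp id fun h => h.2
        have h4 : f x ∈ cls p j \ Y := by
          have h5 := hp.pair_closed' hf hm h3
          refine ⟨h5.resolve_left fun h => h2 (Or.inl h), fun h => h2 (Or.inr ⟨h, ?_⟩)⟩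
          exact h5.resolve_left fun h => h2 (Or.inl h)
        have h5 := eq_of_mem_exits ha h4 (by
          rw [𝓢.invol f hf]
          rintro ⟨h5, h6⟩
          rcases h1 with h1 | h1
          · exact hij (h1.symm.trans h5)
          · exact h6 h1.1)
        rw [← h5, 𝓢.invol f hf]; simp
      · obtain ⟨e, he⟩ := hp i f hf
        refine ⟨e, e, ?_⟩
        rw [hp.pair_union hf he Set.inter_subset_right hm]
        · simp
        · refine hp.inter_cls_inactive hY hj hf fun h => hm ?_
          exact (hp.mate_eq_comm hf).1 (hu f hf h)
  · rw [e1]; exact hjY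
  · rw [Set.union_eq_left.2 Set.inter_subset_right]; exact hp j

variable (𝓢) in
/-- A class outside a tight set of classes is the only such class or it is matched to at most one
class inside. This holds in bricks, braces and cycles. -/
def Sparse (p : V → ι) : Prop :=
  ∀ I : Set ι, 𝓢.Tight (p ⁻¹' I) → ∀ j ∉ I, Iᶜ = {j} ∨
    ∀ f ∈ 𝓢.carrier, ∀ g ∈ 𝓢.carrier, mate p f j ∈ I → mate p g j ∈ I → mate p f j = mate p g j

variable (𝓢) in
/-- The properties of a torsoid on which its relation to arbitrary tight sets is based. -/
structure Good (q : V → Sym2 ι) : Prop extends 𝓢.PreTorsoid q where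
  full : 𝓢.Full q
  sparse : ∀ p, 𝓢.Compat q p → 𝓢.Sparse p

/-- A tight set meets the classes outside its hat only in edge sets that lead to its hat. -/
theorem Good.mem_edge (hq : 𝓢.Good q) (hc : 𝓢.Compat q p) (hY : 𝓢.Tight Y)
    (hj : j ∉ 𝓢.hat p Y) (hj' : (𝓢.hat p Y)ᶜ ≠ {j}) :
    Y ∩ cls p j = ∅ ∨ ∃ i ∈ 𝓢.hat p Y, Y ∩ cls p j ⊆ ed q i j := by
  have hp := hc.tightFibers hq.toPreTorsoid
  by_cases h : ∃ f ∈ 𝓢.carrier, mate p f j ∈ 𝓢.hat p Y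
  · obtain ⟨f, hf, hfm⟩ := h
    right
    refine ⟨_, hfm, hq.full p hc _ _ (hp.mate_ne hf j) _
      (Set.inter_subset_right.trans Set.subset_union_right) ?_⟩
    refine hp.pass_inter_cls hY hj hfm fun g hg hgm => ?_
    exact ((hq.sparse p hc _ (hp.tight_hat hY) j hj).resolve_left hj') g hg f hf hgm hfm
  · push Not at h
    left
    refine eq_empty_of_exits (fun f hf => hp.inter_cls_inactive hY hj hf (h f hf)) fun hu => ?_
    exact hY.ne_univ (Set.univ_subset_iff.1 (hu ▸ Set.inter_subset_left))

theorem Good.exists_mem_hat (hq : 𝓢.Good q) (hc : 𝓢.Compat q p) (hY : 𝓢.Tight Y)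
    (hY' : ∀ j, (𝓢.hat p Y)ᶜ ≠ {j}) {x : V} (hx : x ∈ Y) : ∃ i ∈ 𝓢.hat p Y, i ∈ q x := by
  by_cases h : p x ∈ 𝓢.hat p Y
  · exact ⟨_, h, hc.mem x⟩
  · rcases hq.mem_edge hc hY h (hY' _) with h1 | ⟨i, hi, h1⟩
    · exact absurd (show x ∈ Y ∩ cls p (p x) from ⟨hx, rfl⟩)
        (Set.eq_empty_iff_forall_notMem.1 h1 x)
    · refine ⟨i, hi, ?_⟩
      rw [mem_ed.1 (h1 ⟨hx, rfl⟩)]; simp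

/-- A tight set is disjoint from the nodes outside its hat. -/
theorem Good.node_disjoint (hq : 𝓢.Good q) (hc : 𝓢.Compat q p) (hY : 𝓢.Tight Y)
    (hj : j ∉ 𝓢.hat p Y) (hj' : (𝓢.hat p Y)ᶜ ≠ {j}) : Disjoint Y (ed q j j) := by
  refine Set.disjoint_left.2 fun x h1 h2 => ?_
  rcases hq.mem_edge hc hY hj hj' with h | ⟨i, hi, h⟩
  · exact Set.eq_empty_iff_forall_notMem.1 h x ⟨h1, hc.node_subset h2⟩
  · have := h ⟨h1, hc.node_subset h2⟩
    rw [mem_ed, mem_ed.1 h2] at this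
    simp at this
    exact hj (this ▸ hi)

/-- A tight set contains the nodes in its hat. -/
theorem Good.node_subset (hq : 𝓢.Good q) (hc : 𝓢.Compat q p) (hY : 𝓢.Tight Y)
    (hj : j ∈ 𝓢.hat p Y) (hj' : 𝓢.hat p Y ≠ {j}) : ed q j j ⊆ Y := by
  have h1 := (hc.tightFibers hq.toPreTorsoid).hat_compl hY
  have := hq.node_disjoint hc hY.compl (j := j) (by rw [h1]; simpa using hj)
    (by rwa [h1, compl_compl])
  exact Set.disjoint_compl_left_iff_subset.1 this

end MatchingSystem

end TightCuts

/-! ### Rings, bricks and braces -/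

namespace TightCuts

namespace MatchingSystem

variable {V : Type*} {ι κ : Type*} {𝓢 : MatchingSystem V} {f g h : V → V} {t : Set (V → V)}
  {A B S T U W X Y P₁ P₂ P₃ : Set V} {p : V → ι} {p' : V → κ} {q : V → Sym2 ι} {i j k : ι}

theorem TightFibers.exits_mate (hp : 𝓢.TightFibers p) {I : Set ι} (hI : 𝓢.Tight (p ⁻¹' I))
    (hf : f ∈ 𝓢.carrier) : ∃ a, exits (mate p f) I = {a} :=
  (hp.tight_collapse_iff I).2 hI _ ⟨f, hf, rfl⟩

theorem TightFibers.tight_of_exits_mate (hp : 𝓢.TightFibers p) {I : Set ι}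
    (h : ∀ f ∈ 𝓢.carrier, ∃ a, exits (mate p f) I = {a}) : 𝓢.Tight (p ⁻¹' I) := by
  rw [← hp.tight_collapse_iff]
  rintro _ ⟨f, hf, rfl⟩
  exact h f hf

/-- A set of classes that is closed under taking mates is trivial. -/
theorem TightFibers.eq_empty_of_closed (hp : 𝓢.TightFibers p) {I : Set ι} (hI : I ≠ Set.univ)
    (h : ∀ f ∈ 𝓢.carrier, ∀ i ∈ I, mate p f i ∈ I) : I = ∅ := by
  by_contra hne
  obtain ⟨_, ⟨f, hf, rfl⟩, x, h1, h2⟩ := (𝓢.collapseSystem p hp).conn I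
    (Set.nonempty_iff_ne_empty.2 hne) hI
  exact h2 (h f hf x h1)

/-- If all crossings of a tight set of classes are at the same class `i`, the set is `{i}`. -/
theorem TightFibers.eq_singleton_of_crossing (hp : 𝓢.TightFibers p) {I : Set ι}
    (hI : 𝓢.Tight (p ⁻¹' I)) (hi : i ∈ I) (h : ∀ f ∈ 𝓢.carrier, mate p f i ∉ I) : I = {i} := by
  have : I \ {i} = ∅ := by
    refine hp.eq_empty_of_closed (fun h => ?_) fun f hf x hx => ?_
    · have : i ∈ I \ {i} := h ▸ Set.mem_univ i
      exact this.2 rfl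
    · obtain ⟨a, ha⟩ := hp.exits_mate hI hf
      have h1 : i = a := eq_of_mem_exits ha hi (h f hf)
      refine ⟨?_, fun h2 => ?_⟩
      · by_contra h2
        exact hx.2 ((eq_of_mem_exits ha hx.1 h2).trans h1.symm)
      · rw [Set.mem_singleton_iff, hp.mate_eq_comm hf] at h2
        exact h f hf (h2 ▸ hx.1)
  exact Set.Subset.antisymm (Set.sdiff_eq_empty.1 this) (by simpa using hi)

/-- A partition into tight sets has no exactly three classes: one of three classes would have no
partner. -/
theorem TightFibers.exists_fourth (hp : 𝓢.TightFibers p) (h3 : ∀ i j : ι, ∃ k, k ≠ i ∧ k ≠ j)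
    (i j k : ι) : ∃ l, l ≠ i ∧ l ≠ j ∧ l ≠ k := by
  by_contra hc
  push Not at hc
  by_cases hij : i = j
  · obtain ⟨l, h1, h2⟩ := h3 i k
    exact h2 (hc l h1 (hij ▸ h1))
  by_cases hk : k = i ∨ k = j
  · obtain ⟨l, h1, h2⟩ := h3 i j
    have := hc l h1 h2
    rcases hk with hk | hk
    · exact h1 (this.trans hk)
    · exact h2 (this.trans hk)
  push Not at hk
  have e1 : (cls p k)ᶜ = cls p i ∪ cls p j := by
    ext x
    constructor
    · intro hx
      by_contra hx'
      rw [Set.mem_union, not_or] at hx'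
      exact hx (hc _ hx'.1 hx'.2)
    · rintro (hx | hx) hx'
      · exact hk.1 (hx'.symm.trans hx)
      · exact hk.2 (hx'.symm.trans hx)
  have h1 := par_union_of_disjoint (hp i).finCut (hp j).finCut (disjoint_cls hij)
  rw [← e1, (hp k).compl.par, (hp i).par, (hp j).par] at h1
  exact absurd h1 (by decide)

variable (𝓢) in
/-- The collapse of `p` is a cycle: a member of the system induces one of two matchings on the
classes, depending on whether it belongs to `t`, and these two matchings are disjoint. Rings for
the same set `t` have their cyclic structures aligned. -/
structure Ring (t : Set (V → V)) (p : V → ι) : Prop where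
  three : ∀ i j : ι, ∃ k, k ≠ i ∧ k ≠ j
  fibers : 𝓢.TightFibers p
  mate_eq : ∀ f ∈ 𝓢.carrier, ∀ g ∈ 𝓢.carrier, ∀ i, mate p f i = mate p g i ↔ (f ∈ t ↔ g ∈ t)

theorem Ring.exists_other (hp : 𝓢.Ring t p) (hf : f ∈ 𝓢.carrier) (i : ι) :
    ∃ g ∈ 𝓢.carrier, ¬ (f ∈ t ↔ g ∈ t) := by
  obtain ⟨g, hg, h⟩ := hp.fibers.exists_mate_ne hp.three i (mate p f i)
  exact ⟨g, hg, fun h' => h ((hp.mate_eq f hf g hg i).2 h').symm⟩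

theorem Ring.mate_of_ne (hp : 𝓢.Ring t p) (hf : f ∈ 𝓢.carrier) (hg : g ∈ 𝓢.carrier)
    (hfg : mate p f i ≠ mate p g i) (hh : h ∈ 𝓢.carrier) :
    mate p h = mate p f ∨ mate p h = mate p g := by
  rw [Ne, hp.mate_eq f hf g hg] at hfg
  by_cases h1 : h ∈ t ↔ f ∈ t
  · exact Or.inl (funext fun x => (hp.mate_eq h hh f hf x).2 h1)
  · exact Or.inr (funext fun x => (hp.mate_eq h hh g hg x).2 (by tauto))

theorem Ring.sparse (hp : 𝓢.Ring t p) : 𝓢.Sparse p := by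
  intro I hI j hj
  by_contra hc
  push Not at hc
  obtain ⟨h1, f, hf, g, hg, h2, h3, h4⟩ := hc
  refine h1 (hp.fibers.eq_singleton_of_crossing (by simpa using hI.compl) hj fun h hh => ?_)
  rcases hp.mate_of_ne hf hg h4 hh with h5 | h5 <;> rw [h5] <;> simpa

variable (𝓢) in
/-- A tight set of classes of `p` contains only one class or misses only one class: the collapse
is a brick or a brace. -/
def Braced (p : V → ι) : Prop :=
  ∀ I : Set ι, 𝓢.Tight (p ⁻¹' I) → (∃ i, I = {i}) ∨ ∃ i, Iᶜ = {i}

theorem Braced.sparse (hb : 𝓢.Braced p) : 𝓢.Sparse p := by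
  intro I hI j hj
  rcases hb I hI with ⟨i, rfl⟩ | ⟨i, h⟩
  · exact Or.inr fun f _ g _ h1 h2 => h1.trans h2.symm
  · left
    have : j ∈ Iᶜ := hj
    rw [h] at this ⊢
    rw [this]

/-- A class together with its only two neighbours. -/
theorem TightFibers.tight_triple (hp : 𝓢.TightFibers p) (hji : j ≠ i) (hki : k ≠ i) (hjk : j ≠ k)
    (hm : ∀ f ∈ 𝓢.carrier, mate p f i = j ∨ mate p f i = k) : 𝓢.Tight (p ⁻¹' {i, j, k}) := by
  refine hp.tight_of_exits_mate fun f hf => ?_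
  rcases hm f hf with h | h
  · have h' : mate p f j = i := (hp.mate_eq_comm hf).1 h
    refine ⟨k, Set.eq_singleton_iff_unique_mem.2 ⟨⟨by simp, ?_⟩, ?_⟩⟩
    · rintro (h4 | h4 | h4)
      · rw [hp.mate_eq_comm hf, h] at h4; exact hjk h4
      · rw [hp.mate_eq_comm hf, h'] at h4; exact hki h4.symm
      · exact hp.mate_ne hf k h4
    · rintro x ⟨rfl | rfl | rfl, h5⟩
      · simp [h] at h5
      · simp [h'] at h5
      · rfl
  · have h' : mate p f k = i := (hp.mate_eq_comm hf).1 h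
    refine ⟨j, Set.eq_singleton_iff_unique_mem.2 ⟨⟨by simp, ?_⟩, ?_⟩⟩
    · rintro (h4 | h4 | h4)
      · rw [hp.mate_eq_comm hf, h] at h4; exact hjk h4.symm
      · exact hp.mate_ne hf j h4
      · rw [Set.mem_singleton_iff, hp.mate_eq_comm hf, h'] at h4; exact hji h4.symm
    · rintro x ⟨rfl | rfl | rfl, h5⟩
      · simp [h] at h5
      · rfl
      · simp [h'] at h5

/-- In a brick or brace a class with at most two neighbours forces the collapse to be a cycle of
length four. -/
theorem Braced.ring_of_mates (hp : 𝓢.TightFibers p) (hb : 𝓢.Braced p)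
    (h3 : ∀ i j : ι, ∃ k, k ≠ i ∧ k ≠ j) (hjk : j ≠ k)
    (hm : ∀ f ∈ 𝓢.carrier, mate p f i = j ∨ mate p f i = k) :
    𝓢.Ring {f | mate p f i = j} p ∧ j ≠ i ∧ k ≠ i ∧ ∃ l, l ≠ i ∧ l ≠ j ∧ l ≠ k ∧
      ∀ x, x = i ∨ x = j ∨ x = k ∨ x = l := by
  obtain ⟨f₁, hf₁, h1⟩ := hp.exists_mate_ne h3 i k
  obtain ⟨f₂, hf₂, h2⟩ := hp.exists_mate_ne h3 i j
  have h1' := (hm f₁ hf₁).resolve_right h1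
  have h2' := (hm f₂ hf₂).resolve_left h2
  have hji : j ≠ i := h1' ▸ hp.mate_ne hf₁ i
  have hki : k ≠ i := h2' ▸ hp.mate_ne hf₂ i
  -- the union of the three classes `i`, `j`, `k` is tight, so only one class `l` is left
  have hT := hp.tight_triple hji hki hjk hm
  obtain ⟨l, hl⟩ : ∃ l, ({i, j, k} : Set ι)ᶜ = {l} := by
    rcases hb _ hT with ⟨x, hx⟩ | h
    · exfalso
      have e1 : i ∈ ({x} : Set ι) := hx ▸ (show i ∈ ({i, j, k} : Set ι) by simp)
      have e2 : j ∈ ({x} : Set ι) := hx ▸ (show j ∈ ({i, j, k} : Set ι) by simp)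
      exact hji (Eq.trans e2 (Eq.symm e1))
    · exact h
  have hl' : l ∉ ({i, j, k} : Set ι) := by
    have : l ∈ ({i, j, k} : Set ι)ᶜ := hl ▸ rfl
    exact this
  simp only [Set.mem_insert_iff, Set.mem_singleton_iff, not_or] at hl'
  obtain ⟨hli, hlj, hlk⟩ := hl'
  have hall : ∀ x, x = i ∨ x = j ∨ x = k ∨ x = l := by
    intro x
    by_cases hx : x ∈ ({i, j, k} : Set ι)
    · rcases hx with h | h | h
      · exact Or.inl h
      · exact Or.inr (Or.inl h)
      · exact Or.inr (Or.inr (Or.inl h))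
    · have : x ∈ ({i, j, k} : Set ι)ᶜ := hx
      rw [hl] at this
      exact Or.inr (Or.inr (Or.inr this))
  -- the partner of `i` determines the whole induced matching on the four classes
  have val1 : ∀ f ∈ 𝓢.carrier, mate p f i = j → mate p f j = i ∧ mate p f k = l ∧ mate p f l = k := by
    intro f hf h
    have h' : mate p f j = i := (hp.mate_eq_comm hf).1 h
    have h'' : mate p f k = l := by
      rcases hall (mate p f k) with h4 | h4 | h4 | h4
      · rw [hp.mate_eq_comm hf, h] at h4; exact absurd h4 hjk
      · rw [hp.mate_eq_comm hf, h'] at h4; exact absurd h4.symm hki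
      · exact absurd h4 (hp.mate_ne hf k)
      · exact h4
    exact ⟨h', h'', (hp.mate_eq_comm hf).1 h''⟩
  have val2 : ∀ f ∈ 𝓢.carrier, mate p f i = k → mate p f k = i ∧ mate p f j = l ∧ mate p f l = j := by
    intro f hf h
    have h' : mate p f k = i := (hp.mate_eq_comm hf).1 h
    have h'' : mate p f j = l := by
      rcases hall (mate p f j) with h4 | h4 | h4 | h4
      · rw [hp.mate_eq_comm hf, h] at h4; exact absurd h4 hjk.symm
      · exact absurd h4 (hp.mate_ne hf j)
      · rw [hp.mate_eq_comm hf, h'] at h4; exact absurd h4.symm hji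
      · exact h4
    exact ⟨h', h'', (hp.mate_eq_comm hf).1 h''⟩
  refine ⟨⟨h3, hp, fun f hf g hg x => ?_⟩, hji, hki, l, hli, hlj, hlk, hall⟩
  simp only [Set.mem_ofPred_eq]
  rcases hm f hf with h4 | h4 <;> rcases hm g hg with h5 | h5
  · obtain ⟨a1, a2, a3⟩ := val1 f hf h4
    obtain ⟨b1, b2, b3⟩ := val1 g hg h5
    rcases hall x with rfl | rfl | rfl | rfl <;> simp_all
  · obtain ⟨a1, a2, a3⟩ := val1 f hf h4
    obtain ⟨b1, b2, b3⟩ := val2 g hg h5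
    refine iff_of_false ?_ (by rw [h4, h5]; simp [hjk.symm])
    rcases hall x with hx | hx | hx | hx <;> grind
  · obtain ⟨a1, a2, a3⟩ := val2 f hf h4
    obtain ⟨b1, b2, b3⟩ := val1 g hg h5
    refine iff_of_false ?_ (by rw [h4, h5]; simp [hjk.symm])
    rcases hall x with hx | hx | hx | hx <;> grind
  · obtain ⟨a1, a2, a3⟩ := val2 f hf h4
    obtain ⟨b1, b2, b3⟩ := val2 g hg h5
    rcases hall x with rfl | rfl | rfl | rfl <;> simp_all

/-- If every class has at most two neighbours, the collapse is a ring. -/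
theorem TightFibers.ring_of_two_mates (hp : 𝓢.TightFibers p)
    (h3 : ∀ i j : ι, ∃ k, k ≠ i ∧ k ≠ j)
    (h2 : ∀ i, ∃ a b, ∀ f ∈ 𝓢.carrier, mate p f i = a ∨ mate p f i = b) :
    ∃ t, 𝓢.Ring t p := by
  -- the set of classes at which two induced matchings agree is closed under taking mates
  have agree : ∀ f ∈ 𝓢.carrier, ∀ g ∈ 𝓢.carrier, ∀ i, mate p f i = mate p g i →
      mate p f = mate p g := by
    intro f hf g hg i hi
    by_contra hne
    have : {x | mate p f x = mate p g x} = ∅ := by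
      refine hp.eq_empty_of_closed (fun h => hne (funext fun x => ?_)) fun h hh x hx => ?_
      · have : x ∈ {x | mate p f x = mate p g x} := h ▸ Set.mem_univ x
        exact this
      · by_contra hc
        have hx : mate p f x = mate p g x := hx
        have hc : mate p f (mate p h x) ≠ mate p g (mate p h x) := hc
        have e1 : mate p h (mate p h x) = x := hp.mate_mate hh x
        -- the classes `mate p f y`, `mate p g y`, `mate p h y` of `y` are distinct
        have e2 : mate p f (mate p h x) ≠ x := by
          intro h'
          rw [hp.mate_eq_comm hf] at h'
          have := (hp.mate_eq_comm hg).1 (hx.symm.trans h')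
          exact hc (((hp.mate_eq_comm hf).1 h').trans this.symm)
        have e3 : mate p g (mate p h x) ≠ x := by
          intro h'
          rw [hp.mate_eq_comm hg] at h'
          have := (hp.mate_eq_comm hf).1 (hx.trans h')
          exact hc (this.trans ((hp.mate_eq_comm hg).1 h').symm)
        obtain ⟨a, b, hab⟩ := h2 (mate p h x)
        rcases hab f hf with h4 | h4 <;> rcases hab g hg with h5 | h5 <;>
          rcases hab h hh with h6 | h6 <;> grind
    have h' : i ∈ {x | mate p f x = mate p g x} := hi
    rw [this] at h'
    exact h'
  refine ⟨{f | mate p f = mate p 𝓢.base}, h3, hp, fun f hf g hg i => ?_⟩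
  simp only [Set.mem_ofPred_eq]
  constructor
  · intro h
    rw [agree f hf g hg i h]
  · intro h
    by_cases h4 : mate p f = mate p 𝓢.base
    · rw [h4, h.1 h4]
    · have h5 : mate p g ≠ mate p 𝓢.base := fun h' => h4 (h.2 h')
      obtain ⟨a, b, hab⟩ := h2 i
      have h6 : mate p f i ≠ mate p 𝓢.base i := fun h' => h4 (agree f hf _ 𝓢.base_mem i h')
      have h7 : mate p g i ≠ mate p 𝓢.base i := fun h' => h5 (agree g hg _ 𝓢.base_mem i h')
      rcases hab f hf with h8 | h8 <;> rcases hab g hg with h9 | h9 <;>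
        rcases hab _ 𝓢.base_mem with h10 | h10 <;> simp_all

end MatchingSystem

end TightCuts

/-! ### Splitting a class of a ring -/

namespace TightCuts

namespace MatchingSystem

variable {V : Type*} {ι κ : Type*} {𝓢 : MatchingSystem V} {f g h : V → V} {t : Set (V → V)}
  {A B S T U W X Y P₁ P₂ P₃ : Set V} {p : V → ι} {p' : V → κ} {q : V → Sym2 ι} {i j k : ι}

variable (𝓢) in
/-- A partition of the class `i` into three tight sets by which the ring `p` can be refined: `P₁`
and `P₃` are the outer parts, facing the two neighbours of `i`. -/
structure Split (p : V → ι) (i : ι) (P₁ P₂ P₃ : Set V) : Prop where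
  tight₁ : 𝓢.Tight P₁
  tight₂ : 𝓢.Tight P₂
  tight₃ : 𝓢.Tight P₃
  disjoint₁₂ : Disjoint P₁ P₂
  disjoint₁₃ : Disjoint P₁ P₃
  disjoint₂₃ : Disjoint P₂ P₃
  union_eq : P₁ ∪ P₂ ∪ P₃ = cls p i
  exists_mates : ∃ f ∈ 𝓢.carrier, ∃ g ∈ 𝓢.carrier, mate p f i ≠ mate p g i ∧
    𝓢.Tight (cls p (mate p f i) ∪ P₁ ∪ P₂) ∧ 𝓢.Tight (P₂ ∪ P₃ ∪ cls p (mate p g i))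

/-- A criterion for splitting a class of a ring in terms of the two types. -/
theorem Ring.split_of_types (hp : 𝓢.Ring t p) (hf : f ∈ 𝓢.carrier) (h1 : P₁ ⊆ cls p i)
    (h2 : P₂ ⊆ cls p i) (hd : Disjoint P₁ P₂) (ht : 𝓢.Tight P₂)
    (hF : ∀ h ∈ 𝓢.carrier, (h ∈ t ↔ f ∈ t) → exits h P₁ = exits h (cls p i))
    (hG : ∀ h ∈ 𝓢.carrier, ¬ (h ∈ t ↔ f ∈ t) → exits h (P₁ ∪ P₂) = ∅) :
    𝓢.Split p i P₁ P₂ (cls p i \ (P₁ ∪ P₂)) := by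
  obtain ⟨g, hg, hfg⟩ := hp.exists_other hf i
  have hpt := hp.fibers
  obtain ⟨y, hy⟩ := hpt i f hf
  obtain ⟨c1, p1⟩ := par_eq_one_of_exits hf ((hF f hf Iff.rfl).trans hy)
  obtain ⟨c2, p2⟩ := And.intro ht.finCut ht.par
  have c3 := (hpt i).finCut.diff (c1.union c2)
  -- parities of the three parts
  have p12 : 𝓢.par (P₁ ∪ P₂) = 0 := by
    rw [par_union_of_disjoint c1 c2 hd, p1, p2]; decide
  have p3 : 𝓢.par (cls p i \ (P₁ ∪ P₂)) = 1 := by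
    rw [par_diff (hpt i).finCut (c1.union c2), Set.inter_eq_right.2 (Set.union_subset h1 h2), p12,
      (hpt i).par, add_zero]
  have hsub : P₁ ∪ P₂ ⊆ cls p i := Set.union_subset h1 h2
  have t1 : 𝓢.Tight P₁ := by
    refine tight_of_par p1 fun h hh => ?_
    by_cases hty : h ∈ t ↔ f ∈ t
    · obtain ⟨y, hy⟩ := hpt i h hh
      exact ⟨y, y, by rw [hF h hh hty, hy]; simp⟩
    · obtain ⟨b, hb⟩ := ht h hh
      refine ⟨h b, h b, ?_⟩
      rintro x ⟨hx, hx'⟩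
      have h3 := (mem_of_exits_eq_empty (hG h hh hty) (Or.inl hx)).resolve_left hx'
      have := eq_of_mem_exits hb h3
        (by rw [𝓢.invol h hh]; exact fun h' => Set.disjoint_left.1 hd hx h')
      rw [← this, 𝓢.invol h hh]; simp
  refine ⟨t1, ht, ?_, hd, ?_, ?_, ?_, f, hf, g, hg, ?_, ?_, ?_⟩
  -- Tightness of a set of odd parity follows from the fact that no matching leaves it by more
  -- than one edge. This is checked for the third part and then for the two unions with
  -- neighbouring classes, separately for the two types of matchings.
  · refine tight_of_par p3 fun h hh => ?_
    obtain ⟨y, hy⟩ := hpt i h hh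
    by_cases hty : h ∈ t ↔ f ∈ t
    · obtain ⟨b, hb⟩ := ht h hh
      have hy1 := (hF h hh hty).trans hy
      refine ⟨h b, h b, ?_⟩
      rintro x ⟨hx, hx'⟩
      have hxi : h x ∈ cls p i := by
        by_contra hc
        have := eq_of_mem_exits hy hx.1 hc
        exact hx.2 (Or.inl (this ▸ (mem_exits_of_eq hy1).1))
      have h3 : h x ∈ P₁ ∪ P₂ := by
        by_contra hc
        exact hx' ⟨hxi, hc⟩
      rcases h3 with h3 | h3
      · exfalso
        have := eq_of_mem_exits hy1 h3 (by rw [𝓢.invol h hh]; exact fun h' => hx.2 (Or.inl h'))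
        have h4 := (mem_exits_of_eq hy).2
        rw [← this, 𝓢.invol h hh] at h4
        exact h4 hx.1
      · have := eq_of_mem_exits hb h3 (by rw [𝓢.invol h hh]; exact fun h' => hx.2 (Or.inr h'))
        rw [← this, 𝓢.invol h hh]; simp
    · refine ⟨y, y, ?_⟩
      rintro x ⟨hx, hx'⟩
      have hxi : h x ∉ cls p i := by
        intro hc
        have h3 : h x ∈ P₁ ∪ P₂ := by
          by_contra hc'
          exact hx' ⟨hc, hc'⟩
        have := mem_of_exits_eq_empty (hG h hh hty) h3
        rw [𝓢.invol h hh] at this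
        exact hx.2 this
      simp [eq_of_mem_exits hy hx.1 hxi]
  · exact (Set.disjoint_sdiff_left.mono_right Set.subset_union_left).symm
  · exact (Set.disjoint_sdiff_left.mono_right Set.subset_union_right).symm
  · exact Set.union_sdiff_cancel hsub
  · rw [Ne, hp.mate_eq f hf g hg]; exact hfg
  · have hji := hpt.mate_ne hf i
    have hdj : Disjoint (cls p (mate p f i)) (P₁ ∪ P₂) := (disjoint_cls hji).mono_right hsub
    rw [Set.union_assoc]
    refine tight_of_par ?_ fun h hh => ?_
    · rw [par_union_of_disjoint (hpt _).finCut (c1.union c2) hdj, (hpt _).par, p12, add_zero]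
    by_cases hty : h ∈ t ↔ f ∈ t
    · obtain ⟨b, hb⟩ := ht h hh
      obtain ⟨y, hy⟩ := hpt i h hh
      have hy1 := (hF h hh hty).trans hy
      have hm : mate p h i = mate p f i := (hp.mate_eq h hh f hf i).2 hty
      refine ⟨b, b, ?_⟩
      rintro x ⟨hx, hx'⟩
      have hxc : p (h x) = i ∨ p (h x) = mate p f i :=
        hpt.pair_closed' hh hm (hx.elim Or.inr fun h' => Or.inl (hsub h'))
      have hxi : h x ∈ cls p i := hxc.resolve_right fun h => hx' (Or.inl h)
      rcases hx with hx | hx | hx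
      · exfalso
        have := eq_of_mem_exits hy hxi (by
          rw [𝓢.invol h hh]; exact fun h' => hji (Eq.trans (Eq.symm hx) h'))
        exact hx' (Or.inr (Or.inl (this ▸ (mem_exits_of_eq hy1).1)))
      · exfalso
        have := eq_of_mem_exits hy1 hx fun h' => hx' (Or.inr (Or.inl h'))
        exact (mem_exits_of_eq hy).2 (this ▸ hxi)
      · simp [eq_of_mem_exits hb hx fun h' => hx' (Or.inr (Or.inr h'))]
    · obtain ⟨e, he⟩ := hpt (mate p f i) h hh
      refine ⟨e, e, ?_⟩
      rintro x ⟨hx, hx'⟩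
      rcases hx with hx | hx
      · simp [eq_of_mem_exits he hx fun h' => hx' (Or.inl h')]
      · exact absurd (Or.inr (mem_of_exits_eq_empty (hG h hh hty) hx)) hx'
  · have hki := hpt.mate_ne hg i
    have e1 : P₂ ∪ cls p i \ (P₁ ∪ P₂) = cls p i \ P₁ := by
      ext x
      have := fun h => h2 (a := x) h
      have := fun h : x ∈ P₁ => Set.disjoint_left.1 hd h
      simp only [Set.mem_union, Set.mem_sdiff] at *; tauto
    rw [e1]
    have hdk : Disjoint (cls p i \ P₁) (cls p (mate p g i)) :=
      (disjoint_cls hki.symm).mono_left Set.sdiff_subset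
    refine tight_of_par ?_ fun h hh => ?_
    · rw [par_union_of_disjoint ((hpt _).finCut.diff c1) (hpt _).finCut hdk, (hpt _).par,
        par_diff (hpt _).finCut c1, Set.inter_eq_right.2 h1, p1, (hpt _).par]
      decide
    obtain ⟨e, he⟩ := hpt (mate p g i) h hh
    obtain ⟨y, hy⟩ := hpt i h hh
    by_cases hty : h ∈ t ↔ f ∈ t
    · have hy1 := (hF h hh hty).trans hy
      refine ⟨e, e, ?_⟩
      rintro x ⟨hx, hx'⟩
      rcases hx with hx | hx
      · exfalso
        have hxi : h x ∈ cls p i := by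
          by_contra hc
          have := eq_of_mem_exits hy hx.1 hc
          exact hx.2 (this ▸ (mem_exits_of_eq hy1).1)
        have h3 : h x ∈ P₁ := by
          by_contra hc
          exact hx' (Or.inl ⟨hxi, hc⟩)
        have := eq_of_mem_exits hy1 h3 (by rw [𝓢.invol h hh]; exact hx.2)
        have h4 := (mem_exits_of_eq hy).2
        rw [← this, 𝓢.invol h hh] at h4
        exact h4 hx.1
      · simp [eq_of_mem_exits he hx fun h' => hx' (Or.inr h')]
    · obtain ⟨a, ha⟩ := t1 h hh
      have hm : mate p h i = mate p g i := (hp.mate_eq h hh g hg i).2 (by tauto)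
      refine ⟨h a, h a, ?_⟩
      rintro x ⟨hx, hx'⟩
      have hxc : p (h x) = i ∨ p (h x) = mate p g i :=
        hpt.pair_closed' hh hm (hx.elim (fun h => Or.inl h.1) Or.inr)
      have hxi : h x ∈ cls p i := hxc.resolve_right fun h => hx' (Or.inr h)
      have h3 : h x ∈ P₁ := by
        by_contra hc
        exact hx' (Or.inl ⟨hxi, hc⟩)
      have := eq_of_mem_exits ha h3 (by
        rw [𝓢.invol h hh]
        intro h4
        rcases hx with hx | hx
        · exact hx.2 h4
        · exact hki (hx.symm.trans (h1 h4)))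
      rw [← this, 𝓢.invol h hh]; simp

/-- If a class `i` of a ring splits an aligned ring in two paths with at least two classes each,
then the class `i` can be split. -/
theorem Ring.split_of_hat (hp : 𝓢.Ring t p) (hp' : 𝓢.Ring t p')
    (h1 : ∀ a, 𝓢.hat p' (cls p i) ≠ {a}) (h2 : ∀ a, (𝓢.hat p' (cls p i))ᶜ ≠ {a}) :
    ∃ P₁ P₂ P₃, 𝓢.Split p i P₁ P₂ P₃ := by
  have hY := hp.fibers i
  have hpt := hp'.fibers
  set Y := cls p i with hYdef
  set I := 𝓢.hat p' Y with hI
  have hIt : 𝓢.Tight (p' ⁻¹' I) := hpt.tight_hat hY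
  set f := 𝓢.base
  have hf : f ∈ 𝓢.carrier := 𝓢.base_mem
  -- The hat `I` is a path of the ring `p'` with at least two classes. Its last class `a` is
  -- matched to the class `a'` outside by `f`, and to the class `b` inside by `g`.
  obtain ⟨a, ha⟩ := hpt.exits_mate hIt hf
  obtain ⟨haI, haI'⟩ := mem_exits_of_eq ha
  obtain ⟨g, hg, hfg⟩ := hp'.exists_other hf a
  have hab : mate p' g a ≠ mate p' f a := fun h => hfg ((hp'.mate_eq f hf g hg a).1 h.symm)
  have hbI : mate p' g a ∈ I := by
    by_contra hc
    refine h1 a (hpt.eq_singleton_of_crossing hIt haI fun h hh => ?_)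
    rcases hp'.mate_of_ne hf hg hab.symm hh with h5 | h5 <;> rw [h5] <;> assumption
  set b := mate p' g a with hb
  set a' := mate p' f a with ha'
  have hba : b ≠ a := hpt.mate_ne hg a
  have haa' : a' ≠ a := hpt.mate_ne hf a
  have hga' : mate p' g a' ∉ I := by
    intro hc
    refine h2 a' (hpt.eq_singleton_of_crossing (by simpa using hIt.compl) haI' fun h hh => ?_)
    have : mate p' f a' ≠ mate p' g a' := by
      rw [Ne, hp'.mate_eq f hf g hg]; exact hfg
    rcases hp'.mate_of_ne hf hg this hh with h5 | h5 <;> rw [h5]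
    · rw [ha', hpt.mate_mate hf]; simpa using haI
    · simpa using hc
  have hfb : mate p' f b ∈ I := by
    by_contra hc
    exact hba (eq_of_mem_exits ha hbI hc)
  have hgb : mate p' g b = a := hpt.mate_mate hg a
  have hgbI : mate p' g b ∈ I := hgb ▸ haI
  -- the class `b` and its neighbours lie inside the hat
  have hbY : cls p' b ⊆ Y := by
    have h5 : Yᶜ ∩ cls p' b = ∅ := by
      refine eq_empty_of_exits (𝓢 := 𝓢) (fun h hh => ?_) fun hu => ?_
      · have hc := hpt.hat_compl hY
        refine hpt.inter_cls_inactive hY.compl (by rw [hc]; simpa using hbI) hh ?_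
        rw [hc]
        have : mate p' f b ≠ mate p' g b := by
          rw [Ne, hp'.mate_eq f hf g hg]; exact hfg
        rcases hp'.mate_of_ne hf hg this hh with h5 | h5 <;> rw [h5] <;> simpa
      · exact hY.compl.ne_univ (Set.univ_subset_iff.1 (hu ▸ Set.inter_subset_left))
    intro x hx
    by_contra hc
    exact Set.eq_empty_iff_forall_notMem.1 h5 x ⟨hc, hx⟩
  have hf_mate : ∀ h ∈ 𝓢.carrier, (h ∈ t ↔ f ∈ t) → ∀ x, mate p' h x = mate p' f x :=
    fun h hh hty x => (hp'.mate_eq h hh f hf x).2 hty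
  have hg_mate : ∀ h ∈ 𝓢.carrier, ¬ (h ∈ t ↔ f ∈ t) → ∀ x, mate p' h x = mate p' g x :=
    fun h hh hty x => (hp'.mate_eq h hh g hg x).2 (by tauto)
  -- the first part consists of the vertices of `Y` in the end class `a` and in its outer
  -- neighbour `a'`, and the second part is the class `b`
  refine ⟨_, _, _, hp.split_of_types (P₁ := Y ∩ (cls p' a ∪ cls p' a')) (P₂ := cls p' b) hf
    Set.inter_subset_left hbY ?_ (hpt b) ?_ ?_⟩
  · refine Set.disjoint_left.2 ?_
    rintro x ⟨-, hx | hx⟩ hx'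
    · exact hba (hx'.symm.trans hx)
    · exact hab (hx'.symm.trans hx)
  · intro h hh hty
    obtain ⟨y, hy⟩ := hY h hh
    have h5 := hpt.hat_crossing hY hh hy haI (by rw [hf_mate h hh hty]; exact haI')
    rw [hf_mate h hh hty] at h5
    rw [hy]
    refine Set.eq_singleton_iff_unique_mem.2 ⟨⟨⟨(mem_exits_of_eq hy).1, h5⟩,
      fun h6 => (mem_exits_of_eq hy).2 h6.1⟩, ?_⟩
    rintro x ⟨hx, hx'⟩
    refine eq_of_mem_exits hy hx.1 fun h6 => hx' ⟨h6, ?_⟩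
    exact hpt.pair_closed' hh (hf_mate h hh hty a) hx.2
  · intro h hh hty
    obtain ⟨y, hy⟩ := hY h hh
    have hma : mate p' h a = b := hg_mate h hh hty a
    have h5 := hpt.hat_noncrossing hY hh hy (i := a) (by
      rw [hma]; exact iff_of_true haI hbI)
    rw [hma] at h5
    have h6 := hpt.inter_cls_inactive hY haI' hh (by rw [hg_mate h hh hty]; exact hga')
    refine Set.eq_empty_iff_forall_notMem.2 ?_
    rintro x ⟨hx, hx'⟩
    by_cases hxa : x ∈ Y ∩ cls p' a'
    · have := mem_of_exits_eq_empty h6 hxa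
      exact hx' (Or.inl ⟨this.1, Or.inr this.2⟩)
    have hx1 : x ∈ Y ∧ (p' x = a ∨ p' x = b) := by
      rcases hx with ⟨h7, h8 | h8⟩ | h7
      · exact ⟨h7, Or.inl h8⟩
      · exact absurd ⟨h7, h8⟩ hxa
      · exact ⟨hbY h7, Or.inr h7⟩
    have h7 := hpt.pair_closed' hh hma hx1.2
    by_cases h8 : h x ∈ Y
    · rcases h7 with h7 | h7
      · exact hx' (Or.inl ⟨h8, Or.inl h7⟩)
      · exact hx' (Or.inr h7)
    · have := eq_of_mem_exits hy hx1.1 h8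
      rw [← this] at h5
      rcases hx1.2 with h9 | h9
      · exact h5.1 h9
      · exact h5.2 h9

/-- Overlapping passable sets at a class of a ring split the class. -/
theorem Ring.split_of_overlap (hp : 𝓢.Ring t p) (hij : i ≠ j) (hik : i ≠ k) (hjk : j ≠ k)
    (hS : S ⊆ cls p i ∪ cls p j) (hT : T ⊆ cls p i ∪ cls p k)
    (hSp : 𝓢.Pass (cls p i) (cls p j) S) (hTp : 𝓢.Pass (cls p i) (cls p k) T)
    (hpar : 𝓢.par (S ∩ T) = 1) : ∃ P₁ P₂ P₃, 𝓢.Split p i P₁ P₂ P₃ := by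
  have hpt := hp.fibers
  have hSi : ∀ h ∈ 𝓢.carrier, mate p h i ≠ j → exits h S = ∅ := fun h hh hm =>
    hSp.inactive hpt hS hij hh hm
  have hTi : ∀ h ∈ 𝓢.carrier, mate p h i ≠ k → exits h T = ∅ := fun h hh hm =>
    hTp.inactive hpt hT hik hh hm
  -- the class `i` has only the neighbours `j` and `k`, as otherwise the overlap would be even
  have hm : ∀ h ∈ 𝓢.carrier, mate p h i ≠ j → mate p h i = k := by
    intro h hh hm
    by_contra hc
    have h3 : exits h (S ∩ T) = ∅ := by
      refine Set.subset_empty_iff.1 (exits_inter_subset.trans ?_)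
      rw [hSi h hh hm, hTi h hh hc]; simp
    rw [(par_eq_zero_of_exits hh h3).2] at hpar
    exact absurd hpar (by decide)
  obtain ⟨f, hf, hfk⟩ := hpt.exists_mate_ne hp.three i k
  have hfj : mate p f i = j := by
    by_contra hc
    exact hfk (hm f hf hc)
  have hP2 : S ∩ T ⊆ cls p i := by
    rintro x ⟨h1, h2⟩
    rcases hS h1 with h3 | h3
    · exact h3
    · rcases hT h2 with h4 | h4
      · exact h4
      · exact absurd (Eq.trans (Eq.symm h3) h4) hjk
  have key : ∀ h ∈ 𝓢.carrier, mate p h i = j → ∃ y e, exits h (cls p i) = {y} ∧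
      exits h (cls p i \ S) = {e} ∧ (∀ x ∈ T ∩ cls p i, h x ∈ T ∩ cls p i) := by
    intro h hh hmj
    obtain ⟨y, hy⟩ := hpt i h hh
    obtain ⟨e, he⟩ := hSp.1 h hh
    refine ⟨y, e, hy, he, ?_⟩
    rintro x ⟨h1, h2⟩
    have h3 := mem_of_exits_eq_empty (hTi h hh (hmj ▸ hjk)) h1
    refine ⟨h3, (hT h3).resolve_right fun h4 => ?_⟩
    rcases hpt.pair_closed' hh hmj (Or.inl h2) with h5 | h5
    · exact hik (Eq.trans (Eq.symm h5) h4)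
    · exact hjk (Eq.trans (Eq.symm h5) h4)
  have key' : ∀ h ∈ 𝓢.carrier, mate p h i ≠ j → ∃ e, exits h (cls p i \ T) = {e} ∧
      (∀ x ∈ S ∩ cls p i, h x ∈ S ∩ cls p i) := by
    intro h hh hmj
    obtain ⟨e, he⟩ := hTp.1 h hh
    refine ⟨e, he, ?_⟩
    rintro x ⟨h1, h2⟩
    have h3 := mem_of_exits_eq_empty (hSi h hh hmj) h1
    refine ⟨h3, (hS h3).resolve_right fun h4 => ?_⟩
    rcases hpt.pair_closed' hh (hm h hh hmj) (Or.inl h2) with h5 | h5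
    · exact hij (Eq.trans (Eq.symm h5) h4)
    · exact hjk (Eq.trans (Eq.symm h4) h5)
  -- the overlap is tight and serves as the middle part; the first part is the rest of `S` in the
  -- class `i`
  have ht2 : 𝓢.Tight (S ∩ T) := by
    refine tight_of_par hpar fun h hh => ?_
    by_cases hmj : mate p h i = j
    · obtain ⟨y, e, hy, he, hcl⟩ := key h hh hmj
      refine ⟨h e, h e, ?_⟩
      rintro x ⟨hx, hx'⟩
      have h1 := hcl x ⟨hx.2, hP2 hx⟩
      have := eq_of_mem_exits he (x := h x) ⟨h1.2, fun h' => hx' ⟨h', h1.1⟩⟩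
        (by rw [𝓢.invol h hh]; exact fun h' => h'.2 hx.1)
      rw [← this, 𝓢.invol h hh]; simp
    · obtain ⟨e, he, hcl⟩ := key' h hh hmj
      refine ⟨h e, h e, ?_⟩
      rintro x ⟨hx, hx'⟩
      have h1 := hcl x ⟨hx.1, hP2 hx⟩
      have := eq_of_mem_exits he (x := h x) ⟨h1.2, fun h' => hx' ⟨h1.1, h'⟩⟩
        (by rw [𝓢.invol h hh]; exact fun h' => h'.2 hx.2)
      rw [← this, 𝓢.invol h hh]; simp
  have hty : ∀ h ∈ 𝓢.carrier, (h ∈ t ↔ f ∈ t) ↔ mate p h i = j := by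
    intro h hh
    rw [← hp.mate_eq h hh f hf i, hfj]
  refine ⟨_, _, _, hp.split_of_types (P₁ := (S ∩ cls p i) \ T) hf
    (Set.sdiff_subset.trans Set.inter_subset_right) hP2 ?_ ht2 ?_ ?_⟩
  · exact Set.disjoint_sdiff_left.mono_right Set.inter_subset_right
  · intro h hh hh'
    obtain ⟨y, e, hy, he, hcl⟩ := key h hh ((hty h hh).1 hh')
    obtain ⟨hy1, hy2⟩ := mem_exits_of_eq hy
    -- the exit `y` of the class lies in the first part, and the parity of this part rules out
    -- further exits
    have hyT : y ∉ T := fun h' => hy2 (hcl y ⟨h', hy1⟩).2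
    have hyS : y ∈ S := by
      by_contra hc
      have hye : y = e := eq_of_mem_exits he ⟨hy1, hc⟩ fun h' => hy2 h'.1
      have h3 : exits h (S ∩ T) = ∅ := by
        refine Set.eq_empty_iff_forall_notMem.2 ?_
        rintro x ⟨hx, hx'⟩
        have h1 := hcl x ⟨hx.2, hP2 hx⟩
        have h4 := eq_of_mem_exits he (x := h x) ⟨h1.2, fun h' => hx' ⟨h', h1.1⟩⟩
          (by rw [𝓢.invol h hh]; exact fun h' => h'.2 hx.1)
        rw [← hye] at h4
        exact hyT (h4 ▸ h1.1)
      rw [(par_eq_zero_of_exits hh h3).2] at hpar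
      exact absurd hpar (by decide)
    rw [hy]
    have hmem : y ∈ exits h ((S ∩ cls p i) \ T) := ⟨⟨⟨hyS, hy1⟩, hyT⟩, fun h' => hy2 h'.1.2⟩
    have hsub : exits h ((S ∩ cls p i) \ T) ⊆ {y, h e} := by
      rintro x ⟨hx, hx'⟩
      by_cases hxi : h x ∈ cls p i
      · by_cases hxS : h x ∈ S
        · exfalso
          have hxT : h x ∈ T := by
            by_contra hc
            exact hx' ⟨⟨hxS, hxi⟩, hc⟩
          have := (hcl _ ⟨hxT, hxi⟩).1
          rw [𝓢.invol h hh] at this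
          exact hx.2 this
        · have := eq_of_mem_exits he (x := h x) ⟨hxi, hxS⟩
            (by rw [𝓢.invol h hh]; exact fun h' => h'.2 hx.1.1)
          rw [← this, 𝓢.invol h hh]; simp
      · exact Or.inl (eq_of_mem_exits hy hx.1.2 hxi)
    have hc0 : 𝓢.FinCut ((S ∩ cls p i) \ T) :=
      finCut_of_finite hh ((Set.toFinite _).subset hsub)
    have hc1 : 𝓢.FinCut (S ∩ cls p i) := by
      have : (S ∩ cls p i) = ((S ∩ cls p i) \ T) ∪ (S ∩ T) := by
        ext x
        have := fun h => hP2 (a := x) h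
        simp only [Set.mem_union, Set.mem_sdiff, Set.mem_inter_iff] at *; tauto
      rw [this]
      exact hc0.union ht2.finCut
    have hpS : 𝓢.par (S ∩ cls p i) = 0 := by
      have h3 := par_diff (hpt i).finCut hc1
      have e1 : cls p i \ (S ∩ cls p i) = cls p i \ S := by
        ext x; simp only [Set.mem_sdiff, Set.mem_inter_iff]; tauto
      rw [e1, hSp.1.par, Set.inter_eq_right.2 Set.inter_subset_right, (hpt i).par] at h3
      simpa using h3
    have hp1 : 𝓢.par ((S ∩ cls p i) \ T) = 1 := by
      have h3 := par_inter_add_diff hc1 (B := S ∩ T) ht2.finCut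
      have e1 : (S ∩ cls p i) ∩ (S ∩ T) = S ∩ T := by
        ext x
        have := fun h => hP2 (a := x) h
        simp only [Set.mem_inter_iff] at *; tauto
      have e2 : (S ∩ cls p i) \ (S ∩ T) = (S ∩ cls p i) \ T := by
        ext x; simp only [Set.mem_sdiff, Set.mem_inter_iff]; tauto
      rw [e1, e2, hpar, hpS] at h3
      rcases zmod_two_cases (𝓢.par ((S ∩ cls p i) \ T)) with h4 | h4
      · rw [h4] at h3; exact absurd h3 (by decide)
      · exact h4
    rw [hc0.par_eq hh] at hp1
    obtain ⟨x, hx⟩ := exists_exits_eq_singleton hsub hp1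
    rw [hx] at hmem ⊢
    rw [Set.mem_singleton_iff.1 hmem]
  · intro h hh hh'
    obtain ⟨e, he, hcl⟩ := key' h hh (fun h' => hh' ((hty h hh).2 h'))
    have e1 : (S ∩ cls p i) \ T ∪ S ∩ T = S ∩ cls p i := by
      ext x
      have := fun h => hP2 (a := x) h
      simp only [Set.mem_union, Set.mem_sdiff, Set.mem_inter_iff] at *; tauto
    rw [e1]
    exact Set.eq_empty_iff_forall_notMem.2 fun x hx => hx.2 (hcl x hx.1)

end MatchingSystem

end TightCuts

/-! ### Refining rings -/

namespace TightCuts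

namespace MatchingSystem

variable {V : Type*} {ι κ : Type*} {𝓢 : MatchingSystem V} {f g h : V → V} {t : Set (V → V)}
  {A B S T U W X Y P₁ P₂ P₃ : Set V} {p : V → ι} {p' : V → κ} {q : V → Sym2 ι} {i j k : ι}

theorem TightFibers.mate_eq_of (hp : 𝓢.TightFibers p) (hf : f ∈ 𝓢.carrier) {x : V} (h1 : p x = i)
    (h2 : p (f x) = j) (h3 : j ≠ i) : mate p f i = j := by
  subst h1 h2; exact hp.mate_eq hf h3

/-- A matching that does not match the class `i` to its neighbour `k` leaves `i` through the part
`P₁` that faces the other neighbour. -/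
theorem Split.exits_aux (hp : 𝓢.TightFibers p) (t1 : 𝓢.Tight P₁) (t2 : 𝓢.Tight P₂)
    (hu : P₁ ∪ P₂ ∪ P₃ = cls p i) (hd : Disjoint P₁ P₂) (hd' : Disjoint P₁ P₃)
    (hk : 𝓢.Tight (P₂ ∪ P₃ ∪ cls p k))
    (hh : h ∈ 𝓢.carrier) (hm : mate p h i ≠ k) (hki : k ≠ i) :
    exits h P₁ = exits h (cls p i) ∧ exits h (P₂ ∪ P₃) = ∅ := by
  obtain ⟨y, hy1, hy2, hy3, hy⟩ := hp.exists_exit hh i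
  obtain ⟨e1, he1⟩ := t1 h hh
  obtain ⟨e2, he2⟩ := t2 h hh
  obtain ⟨z, hz1, hz2, hz3, hz⟩ := hp.exists_exit hh k
  obtain ⟨c, hc⟩ := hk h hh
  have hsub : ∀ x, x ∈ P₁ ∨ x ∈ P₂ ∨ x ∈ P₃ ↔ p x = i := by
    intro x
    have : x ∈ P₁ ∪ P₂ ∪ P₃ ↔ x ∈ cls p i := by rw [hu]
    simpa [or_assoc] using this
  have hyi : p (h y) ≠ i := by rw [hy2]; exact hy3
  -- otherwise the tight set `P₂ ∪ P₃ ∪ cls p k` would have an exit at the class `i` and one at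
  -- `k`
  have hP1 : y ∈ P₁ := by
    by_contra hc'
    have h1 : y ∈ P₂ ∪ P₃ := ((hsub y).2 hy1).resolve_left hc'
    have h2 : y = c := by
      refine eq_of_mem_exits hc (Or.inl h1) ?_
      rintro (h2 | h2)
      · exact hyi ((hsub _).1 (Or.inr h2))
      · exact hm (hy2.symm.trans h2)
    have h3 : z = c := by
      refine eq_of_mem_exits hc (Or.inr hz1) ?_
      rintro (h3 | h3)
      · have h4 : p (h z) = i := (hsub _).1 (Or.inr h3)
        rw [hz2, hp.mate_eq_comm hh] at h4
        exact hm h4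
      · rw [mem_cls, hz2] at h3; exact hz3 h3
    rw [h2, ← h3, hz1] at hy1
    exact hki hy1
  have hye : y = e1 := eq_of_mem_exits he1 hP1 fun h' => hyi ((hsub _).1 (Or.inl h'))
  refine ⟨by rw [hy, he1, hye], Set.eq_empty_iff_forall_notMem.2 ?_⟩
  have hno : ∀ x ∈ P₂ ∪ P₃, h x ∉ P₁ ∧ p (h x) = i := by
    intro x hx
    have hxi : p x = i := (hsub _).1 (Or.inr hx)
    have hx1 : x ∉ P₁ := fun h' => hx.elim (Set.disjoint_left.1 hd h') (Set.disjoint_left.1 hd' h')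
    refine ⟨fun h' => ?_, ?_⟩
    · have := eq_of_mem_exits he1 h' (by rw [𝓢.invol h hh]; exact hx1)
      rw [← hye] at this
      rw [← this, 𝓢.invol h hh] at hyi
      exact hyi hxi
    · by_contra h'
      exact hx1 (eq_of_mem_exits hy hxi h' ▸ hP1)
  rintro x ⟨hx, hx'⟩
  have := hno x hx
  exact hx' (((hsub _).2 this.2).resolve_left this.1)

/-- The matching that `h` induces on the refined partition: one of the outer parts inherits the
partner of the class `i`, and the other outer part is matched to the middle part. -/
theorem Split.mate_aux {p' : V → ι ⊕ Bool} (hp : 𝓢.TightFibers p) (hp' : 𝓢.TightFibers p')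
    (hl : ∀ l, l ≠ i → cls p' (Sum.inl l) = cls p l) (b : Bool) (hh : h ∈ 𝓢.carrier)
    (h1 : exits h (cls p' (Sum.inr b)) = exits h (cls p i))
    (h2 : exits h (cls p' (Sum.inl i) ∪ cls p' (Sum.inr !b)) = ∅) :
    mate p' h (Sum.inr b) = Sum.inl (mate p h i) ∧ mate p' h (Sum.inl (mate p h i)) = Sum.inr b ∧
    mate p' h (Sum.inl i) = Sum.inr !b ∧ mate p' h (Sum.inr !b) = Sum.inl i ∧
    ∀ l, l ≠ i → l ≠ mate p h i → mate p' h (Sum.inl l) = Sum.inl (mate p h l) := by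
  have hv : ∀ l x, l ≠ i → (p' x = Sum.inl l ↔ p x = l) := by
    intro l x hli
    have : x ∈ cls p' (Sum.inl l) ↔ x ∈ cls p l := by rw [hl l hli]
    exact this
  have a1 : mate p' h (Sum.inr b) = Sum.inl (mate p h i) := by
    obtain ⟨y, hy1, hy2, hy3, hy⟩ := hp.exists_exit hh i
    have h3 : y ∈ cls p' (Sum.inr b) := (mem_exits_of_eq (h1.trans hy)).1
    refine hp'.mate_eq_of hh h3 ((hv _ _ hy3).2 hy2) (by simp)
  have a2 : mate p' h (Sum.inl i) = Sum.inr !b := by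
    obtain ⟨e, he1, he2, he3, he⟩ := hp'.exists_exit hh (Sum.inl i)
    have h3 := mem_of_exits_eq_empty h2 (x := e) (Or.inl he1)
    rw [← he2]
    rcases h3 with h3 | h3
    · rw [mem_cls, he2] at h3; exact absurd h3 he3
    · exact h3
  refine ⟨a1, (hp'.mate_eq_comm hh).1 a1, a2, (hp'.mate_eq_comm hh).1 a2, fun l h3 h4 => ?_⟩
  obtain ⟨x, hx1, hx2, hx3, hx⟩ := hp.exists_exit hh l
  have h5 : mate p h l ≠ i := fun h' => h4 ((hp.mate_eq_comm hh).1 h').symm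
  exact hp'.mate_eq_of hh ((hv l x h3).2 hx1) ((hv _ _ h5).2 hx2) (by simpa using hx3)

open Classical in
/-- The partition obtained from `p` by splitting off the sets `P₁` and `P₃` as new classes. If
they are parts of the class `i`, then its old index is kept by the rest of this class. -/
noncomputable def splitMap (p : V → ι) (P₁ P₃ : Set V) (x : V) : ι ⊕ Bool :=
  if x ∈ P₁ then Sum.inr false else if x ∈ P₃ then Sum.inr true else Sum.inl (p x)

theorem Split.cls_splitMap (hs : 𝓢.Split p i P₁ P₂ P₃) :
    cls (splitMap p P₁ P₃) (Sum.inr false) = P₁ ∧ cls (splitMap p P₁ P₃) (Sum.inr true) = P₃ ∧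
    cls (splitMap p P₁ P₃) (Sum.inl i) = P₂ ∧
    ∀ l, l ≠ i → cls (splitMap p P₁ P₃) (Sum.inl l) = cls p l := by
  have hsub : ∀ x, x ∈ P₁ ∨ x ∈ P₂ ∨ x ∈ P₃ ↔ p x = i := by
    intro x
    have : x ∈ P₁ ∪ P₂ ∪ P₃ ↔ x ∈ cls p i := by rw [hs.union_eq]
    simpa [or_assoc] using this
  have h12 := fun x (h : x ∈ P₁) => Set.disjoint_left.1 hs.disjoint₁₂ h
  have h13 := fun x (h : x ∈ P₁) => Set.disjoint_left.1 hs.disjoint₁₃ h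
  have h23 := fun x (h : x ∈ P₂) => Set.disjoint_left.1 hs.disjoint₂₃ h
  refine ⟨?_, ?_, ?_, fun l hl => ?_⟩ <;> ext x <;> have h0 := hsub x <;> have h1 := h12 x <;>
    have h2 := h13 x <;> have h3 := h23 x <;> rw [mem_cls, splitMap] <;> split_ifs <;>
    simp only [Sum.inr.injEq, Sum.inl.injEq, false_iff, mem_cls, Bool.true_eq_false,
      Bool.false_eq_true, true_iff] at * <;> first | tauto | grind

/-- A ring can be refined along a split class. -/
theorem Split.ring (hs : 𝓢.Split p i P₁ P₂ P₃) (hp : 𝓢.Ring t p) :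
    𝓢.Ring t (splitMap p P₁ P₃) := by
  obtain ⟨c1, c3, c2, hl⟩ := hs.cls_splitMap
  set p' := splitMap p P₁ P₃
  have hpt := hp.fibers
  have hp' : 𝓢.TightFibers p' := by
    rintro (l | _ | _)
    · by_cases h : l = i
      · subst h; rw [c2]; exact hs.tight₂
      · rw [hl l h]; exact hpt l
    · rw [c1]; exact hs.tight₁
    · rw [c3]; exact hs.tight₃
  obtain ⟨f, hf, g, hg, hfg, htf, htg⟩ := hs.exists_mates
  -- A matching of the type of `f` leaves the class `i` through `P₁`, and one of the other type
  -- through `P₃`. In either case `Split.mate_aux` gives the induced matching on the new classes.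
  have hF : ∀ h ∈ 𝓢.carrier, (h ∈ t ↔ f ∈ t) → _ := fun h hh hty =>
    Split.mate_aux hpt hp' hl false hh
      (by
        rw [c1]
        exact (Split.exits_aux hpt hs.tight₁ hs.tight₂ hs.union_eq hs.disjoint₁₂ hs.disjoint₁₃
          htg hh (by rw [(hp.mate_eq h hh f hf i).2 hty]; exact hfg) (hpt.mate_ne hg i)).1)
      (by
        rw [Bool.not_false, c2, c3]
        exact (Split.exits_aux hpt hs.tight₁ hs.tight₂ hs.union_eq hs.disjoint₁₂ hs.disjoint₁₃
          htg hh (by rw [(hp.mate_eq h hh f hf i).2 hty]; exact hfg) (hpt.mate_ne hg i)).2)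
  have hfgt : ¬ (f ∈ t ↔ g ∈ t) := by rwa [← hp.mate_eq f hf g hg i]
  have hG' : ∀ h ∈ 𝓢.carrier, ¬ (h ∈ t ↔ f ∈ t) →
      exits h P₃ = exits h (cls p i) ∧ exits h (P₂ ∪ P₁) = ∅ := by
    intro h hh hty
    refine Split.exits_aux hpt hs.tight₃ hs.tight₂ (k := mate p f i) ?_ hs.disjoint₂₃.symm
      hs.disjoint₁₃.symm ?_ hh ?_ (hpt.mate_ne hf i)
    · rw [← hs.union_eq, Set.union_comm, Set.union_comm P₃, ← Set.union_assoc]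
    · rw [Set.union_comm, Set.union_comm P₂, ← Set.union_assoc]; exact htf
    · rw [Ne, hp.mate_eq h hh f hf i]; exact hty
  have hG : ∀ h ∈ 𝓢.carrier, ¬ (h ∈ t ↔ f ∈ t) → _ := fun h hh hty =>
    Split.mate_aux hpt hp' hl true hh (by rw [c3]; exact (hG' h hh hty).1)
      (by rw [Bool.not_true, c2, c1]; exact (hG' h hh hty).2)
  refine ⟨fun a b => ?_, hp', fun h hh h' hh' b => ?_⟩
  · obtain ⟨x, hx1, hx2⟩ := hp.three (Sum.elim id (fun _ => i) a) (Sum.elim id (fun _ => i) b)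
    by_cases hxa : Sum.inl x ≠ a ∧ Sum.inl x ≠ b
    · exact ⟨_, hxa⟩
    · exfalso
      apply hxa
      constructor
      · rintro rfl; exact hx1 rfl
      · rintro rfl; exact hx2 rfl
  -- compare two induced matchings class by class, according to their types
  · by_cases h1 : h ∈ t ↔ f ∈ t <;> by_cases h2 : h' ∈ t ↔ f ∈ t
    · obtain ⟨a1, a2, a3, a4, a5⟩ := hF h hh h1
      obtain ⟨b1, b2, b3, b4, b5⟩ := hF h' hh' h2
      have hm : ∀ l, mate p h l = mate p h' l := fun l => (hp.mate_eq h hh h' hh' l).2 (by tauto)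
      refine iff_of_true ?_ (by tauto)
      rcases b with l | _ | _
      · by_cases hli : l = i
        · rw [hli, a3, b3]
        by_cases hlm : l = mate p h i
        · rw [hlm, a2, hm, b2]
        · rw [a5 l hli hlm, b5 l hli (by rwa [← hm]), hm]
      · rw [a1, b1, hm]
      · exact a4.trans b4.symm
    · obtain ⟨a1, a2, a3, a4, a5⟩ := hF h hh h1
      obtain ⟨b1, b2, b3, b4, b5⟩ := hG h' hh' h2
      have hm : ∀ l, mate p h l ≠ mate p h' l := fun l => by
        rw [Ne, hp.mate_eq h hh h' hh' l]; tauto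
      refine iff_of_false ?_ (by tauto)
      rcases b with l | _ | _
      · by_cases hli : l = i
        · rw [hli, a3, b3]; simp
        by_cases hlm : l = mate p h i
        · rw [hlm, a2, b5 _ (hpt.mate_ne hh i) (hm i)]; simp
        · rw [a5 l hli hlm]
          by_cases hlm' : l = mate p h' i
          · rw [hlm', b2]; simp
          · rw [b5 l hli hlm']; simpa using hm l
      · simp only [Bool.not_true] at b4
        rw [a1, b4]; simpa using hpt.mate_ne hh i
      · simp only [Bool.not_false] at a4
        rw [a4, b1]; simpa using (hpt.mate_ne hh' i).symm
    · obtain ⟨a1, a2, a3, a4, a5⟩ := hG h hh h1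
      obtain ⟨b1, b2, b3, b4, b5⟩ := hF h' hh' h2
      have hm : ∀ l, mate p h l ≠ mate p h' l := fun l => by
        rw [Ne, hp.mate_eq h hh h' hh' l]; tauto
      refine iff_of_false ?_ (by tauto)
      rcases b with l | _ | _
      · by_cases hli : l = i
        · rw [hli, a3, b3]; simp
        by_cases hlm : l = mate p h i
        · rw [hlm, a2, b5 _ (hpt.mate_ne hh i) (hm i)]; simp
        · rw [a5 l hli hlm]
          by_cases hlm' : l = mate p h' i
          · rw [hlm', b2]; simp
          · rw [b5 l hli hlm']; simpa using hm l
      · simp only [Bool.not_true] at a4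
        rw [a4, b1]; simpa using (hpt.mate_ne hh' i).symm
      · simp only [Bool.not_false] at b4
        rw [a1, b4]; simpa using (hpt.mate_ne hh i)
    · obtain ⟨a1, a2, a3, a4, a5⟩ := hG h hh h1
      obtain ⟨b1, b2, b3, b4, b5⟩ := hG h' hh' h2
      have hm : ∀ l, mate p h l = mate p h' l := fun l => (hp.mate_eq h hh h' hh' l).2 (by tauto)
      refine iff_of_true ?_ (by tauto)
      rcases b with l | _ | _
      · by_cases hli : l = i
        · rw [hli, a3, b3]
        by_cases hlm : l = mate p h i
        · rw [hlm, a2, hm, b2]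
        · rw [a5 l hli hlm, b5 l hli (by rwa [← hm]), hm]
      · exact a4.trans b4.symm
      · rw [a1, b1, hm]

theorem Compat.par_edge_inter_cls (hc : 𝓢.Compat q p) (hq : 𝓢.PreTorsoid q) (hij : i ≠ j) :
    𝓢.par (ed q i j ∩ cls p i) = 0 := by
  have h1 : Disjoint (ed q i i) (ed q i j ∩ cls p i) :=
    PreTorsoid.disjoint_node hij Set.inter_subset_left
  exact (par_eq_zero_of_union (hq.node i) (hc.tight i j) h1).2

variable (𝓢) in
/-- The ring `q` cannot be refined: no node together with its two edge sets is the union of three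
tight sets that fit between the two neighbouring nodes. -/
def Unsplit (q : V → Sym2 ι) : Prop :=
  ∀ i j k, j ≠ k → (∃ f ∈ 𝓢.carrier, NodeMatch q f i j) → (∃ f ∈ 𝓢.carrier, NodeMatch q f i k) →
    ¬ ∃ P₁ P₂ P₃ : Set V, 𝓢.Tight P₁ ∧ 𝓢.Tight P₂ ∧ 𝓢.Tight P₃ ∧
      Disjoint P₁ P₂ ∧ Disjoint P₁ P₃ ∧ Disjoint P₂ P₃ ∧
      P₁ ∪ P₂ ∪ P₃ = ed q i j ∪ ed q i i ∪ ed q i k ∧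
      𝓢.Tight (ed q j j ∪ P₁ ∪ P₂) ∧ 𝓢.Tight (P₂ ∪ P₃ ∪ ed q k k)

/-- Edge sets between nodes that are never matched are empty. -/
theorem Compat.ed_eq_empty (hc : 𝓢.Compat q p) (hq : 𝓢.PreTorsoid q) (hij : i ≠ j)
    (h : ∀ f ∈ 𝓢.carrier, mate p f i ≠ j) : ed q i j = ∅ := by
  refine eq_empty_of_exits (fun f hf => hc.edge_inactive hq hf hij (h f hf)) fun hu => ?_
  obtain ⟨x, hx⟩ := (hq.node i).nonempty
  have h1 : x ∈ ed q i j := hu ▸ Set.mem_univ x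
  rw [mem_ed, mem_ed.1 hx] at h1
  simp at h1
  exact hij h1

open Classical in
/-- The orientation in which all edge sets at `i` belong to the class of `i`, and all edge sets that
meet a set `N` of nodes belong to the class of their other end, if possible. -/
theorem exists_orientation (i : ι) (N : Set ι) : ∃ σ : Sym2 ι → ι, (∀ e, σ e ∈ e) ∧
    (∀ j, σ s(i, j) = i) ∧ ∀ j ∈ N, ∀ k, k ≠ j → k ∉ N → σ s(j, k) = k ∨ j = i := by
  have : ∀ e : Sym2 ι, ∃ a ∈ e, (i ∈ e → a = i) ∧ (i ∉ e → (∃ b ∈ e, b ∉ N) → a ∉ N) := by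
    intro e
    by_cases h : i ∈ e
    · exact ⟨i, h, fun _ => rfl, fun h' => absurd h h'⟩
    · by_cases h' : ∃ b ∈ e, b ∉ N
      · obtain ⟨b, hb, hb'⟩ := h'
        exact ⟨b, hb, fun h' => absurd h' h, fun _ _ => hb'⟩
      · induction e with | _ x y => exact ⟨x, by simp, fun h' => absurd h' h, fun _ h'' => absurd h'' h'⟩
  choose σ h1 h2 h3 using this
  refine ⟨σ, h1, fun j => h2 _ (by simp), fun j hj k hkj hk => ?_⟩
  by_cases hi : i ∈ s(j, k)
  · rcases Sym2.mem_iff.1 hi with h | h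
    · exact Or.inr h.symm
    · exact Or.inl ((h2 _ hi).trans h)
  · left
    have h4 := h3 _ hi ⟨k, by simp, hk⟩
    rcases Sym2.mem_iff.1 (h1 s(j, k)) with h | h
    · rw [h] at h4; exact absurd hj h4
    · exact h

theorem Ring.compat (hp : 𝓢.Ring t p) {p' : V → ι} (hc : 𝓢.Compat q p) (hc' : 𝓢.Compat q p')
    (hq : 𝓢.PreTorsoid q) : 𝓢.Ring t p' := by
  refine ⟨hp.three, hc'.tightFibers hq, fun f hf g hg i => ?_⟩
  rw [← hc.mate_eq_mate hc' hq hf, ← hc.mate_eq_mate hc' hq hg]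
  exact hp.mate_eq f hf g hg i

theorem Ring.setOf_mem (hp : 𝓢.Ring t p) (hc : 𝓢.Compat q p) (hq : 𝓢.PreTorsoid q)
    (hf : f ∈ 𝓢.carrier) (hg : g ∈ 𝓢.carrier) (hfg : mate p f i ≠ mate p g i) :
    {x | i ∈ q x} = ed q i (mate p f i) ∪ ed q i i ∪ ed q i (mate p g i) := by
  ext x
  constructor
  · intro hx
    obtain ⟨l, hl⟩ := hx
    by_cases h1 : l = i
    · subst h1; exact Or.inl (Or.inr hl)
    by_cases h2 : l = mate p f i
    · subst h2; exact Or.inl (Or.inl hl)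
    by_cases h3 : l = mate p g i
    · subst h3; exact Or.inr hl
    have : ed q i l = ∅ := by
      refine hc.ed_eq_empty hq (Ne.symm h1) fun h hh h4 => ?_
      rcases hp.mate_of_ne hf hg hfg hh with h5 | h5
      · exact h2 (by rw [← h4, h5])
      · exact h3 (by rw [← h4, h5])
    exact absurd (show x ∈ ed q i l from hl) (Set.eq_empty_iff_forall_notMem.1 this x)
  · rintro ((hx | hx) | hx) <;> rw [mem_ed] at hx <;> rw [Set.mem_ofPred_eq, hx] <;> simp

/-- There is a compatible partition in which the class of the node `i` consists of the node and its
edge sets, and its neighbours form classes by themselves. -/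
theorem Ring.exists_star_orientation (hp : 𝓢.Ring t p) (hc : 𝓢.Compat q p) (hq : 𝓢.PreTorsoid q)
    (i : ι) : ∃ σ : Sym2 ι → ι, (∀ e, σ e ∈ e) ∧ cls (σ ∘ q) i = {x | i ∈ q x} ∧
      ∀ f ∈ 𝓢.carrier, cls (σ ∘ q) (mate p f i) = ed q (mate p f i) (mate p f i) := by
  have hpt := hp.fibers
  obtain ⟨σ, h1, h2, h3⟩ := exists_orientation i {j | ∃ f ∈ 𝓢.carrier, mate p f i = j}
  have hc' : 𝓢.Compat q (σ ∘ q) := hq.compat_orientation h1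
  refine ⟨σ, h1, ?_, fun f hf => ?_⟩
  · ext x
    constructor
    · rintro hx
      have := hc'.mem x
      rwa [mem_cls.1 hx] at this
    · rintro ⟨l, hl⟩
      rw [mem_cls, Function.comp_apply, hl, h2]
  · refine Set.Subset.antisymm (fun x hx => ?_) hc'.node_subset
    obtain ⟨l, hl⟩ := hc'.mem_cls_of_notMem_ed hx
    by_cases hl1 : l = mate p f i
    · rw [hl1] at hl; exact hl
    exfalso
    rw [mem_cls, Function.comp_apply, hl] at hx
    by_cases hl2 : ∃ g ∈ 𝓢.carrier, mate p g i = l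
    · obtain ⟨g, hg, rfl⟩ := hl2
      have : ed q (mate p f i) (mate p g i) = ∅ := by
        refine hc.ed_eq_empty hq (Ne.symm hl1) fun h hh h4 => ?_
        rcases hp.mate_of_ne hf hg (Ne.symm hl1) hh with h5 | h5
        · rw [h5, hpt.mate_mate hf] at h4; exact hpt.mate_ne hg i h4.symm
        · rw [h5] at h4
          exact hpt.mate_ne hf i ((invol_injective (𝓢 := 𝓢.collapseSystem p hpt) ⟨g, hg, rfl⟩) h4)
      exact Set.eq_empty_iff_forall_notMem.1 this x hl
    · rcases h3 _ ⟨f, hf, rfl⟩ l hl1 hl2 with h | h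
      · exact hl1 (h.symm.trans hx)
      · exact hpt.mate_ne hf i h

/-- If the nodes of a ring `q` are unsplit, no class of a compatible partition can be split. -/
theorem Unsplit.not_split (hu : 𝓢.Unsplit q) (hp : 𝓢.Ring t p) (hc : 𝓢.Compat q p)
    (hq : 𝓢.PreTorsoid q) (hs : 𝓢.Split p i P₁ P₂ P₃) : False := by
  -- In this partition the class `i` is the node with all its edge sets. It contains the outer
  -- parts `P₁` and `P₃` of the given class, so its hat in the refined ring has more than one
  -- class and `split_of_hat` applies.
  obtain ⟨σ, h1, h2, h3⟩ := hp.exists_star_orientation hc hq i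
  have hc' := hq.compat_orientation h1
  have hp' := hp.compat hc hc' hq
  obtain ⟨c1, c3, c2, hl⟩ := hs.cls_splitMap
  have hr := hs.ring hp
  have hsub : cls p i ⊆ cls (σ ∘ q) i := by
    rw [h2]
    intro x hx
    have := hc.mem x
    rwa [mem_cls.1 hx] at this
  obtain ⟨Q₁, Q₂, Q₃, hQ⟩ := hp'.split_of_hat (i := i) hr (by
      intro a ha
      have e1 : Sum.inr false ∈ 𝓢.hat (splitMap p P₁ P₃) (cls (σ ∘ q) i) := by
        rw [mem_hat, c1, Set.inter_eq_right.2]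
        · exact hs.tight₁.par
        · refine Set.Subset.trans ?_ hsub
          rw [← hs.union_eq]; exact Set.subset_union_left.trans Set.subset_union_left
      have e2 : Sum.inr true ∈ 𝓢.hat (splitMap p P₁ P₃) (cls (σ ∘ q) i) := by
        rw [mem_hat, c3, Set.inter_eq_right.2]
        · exact hs.tight₃.par
        · refine Set.Subset.trans ?_ hsub
          rw [← hs.union_eq]; exact Set.subset_union_right
      rw [ha] at e1 e2
      have := Eq.trans e1 (Eq.symm e2)
      simp at this) (by
      intro a ha
      have e : ∀ l, l ≠ i → Sum.inl l ∈ (𝓢.hat (splitMap p P₁ P₃) (cls (σ ∘ q) i))ᶜ := by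
        intro l hli
        rw [Set.mem_compl_iff, notMem_hat, hl l hli]
        have e1 : cls (σ ∘ q) i ∩ cls p l = ed q l i ∩ cls p l := by
          rw [h2]
          ext x
          simp only [Set.mem_inter_iff, Set.mem_ofPred_eq, mem_ed, mem_cls]
          constructor
          · rintro ⟨h4, h5⟩
            refine ⟨?_, h5⟩
            have h6 := hc.mem x
            rw [h5] at h6
            exact (Sym2.mem_and_mem_iff hli).1 ⟨h6, h4⟩
          · rintro ⟨h4, h5⟩
            rw [h4]; simp [h5]
        rw [e1, hc.par_edge_inter_cls hq hli]
      obtain ⟨l, hl1, -⟩ := hp.three i i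
      obtain ⟨l', hl1', hl2'⟩ := hp.three i l
      have e1 := e l hl1
      have e2 := e l' hl1'
      rw [ha] at e1 e2
      have := Eq.trans e1 (Eq.symm e2)
      exact hl2' (Sum.inl.inj this).symm)
  obtain ⟨f, hf, g, hg, hfg, hT1, hT2⟩ := hQ.exists_mates
  have hmm : ∀ {f}, f ∈ 𝓢.carrier → mate p f = mate (σ ∘ q) f := fun hf => hc.mate_eq_mate hc' hq hf
  rw [← hmm hf, h3 f hf] at hT1
  rw [← hmm hg, h3 g hg] at hT2
  rw [← hmm hf, ← hmm hg] at hfg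
  refine hu i _ _ hfg ⟨f, hf, hc.nodeMatch hq hf i⟩ ⟨g, hg, hc.nodeMatch hq hg i⟩
    ⟨Q₁, Q₂, Q₃, hQ.tight₁, hQ.tight₂, hQ.tight₃, hQ.disjoint₁₂, hQ.disjoint₁₃, hQ.disjoint₂₃, ?_,
      hT1, hT2⟩
  rw [hQ.union_eq, h2, hp.setOf_mem hc hq hf hg hfg]

/-- If no class of one compatible partition of a finite ring can be split, the nodes are unsplit. -/
theorem Ring.unsplit [Finite ι] (hp : 𝓢.Ring t p) (hc : 𝓢.Compat q p) (hq : 𝓢.PreTorsoid q)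
    (h : ∀ i P₁ P₂ P₃, ¬ 𝓢.Split p i P₁ P₂ P₃) : 𝓢.Unsplit q := by
  rintro i j k hjk ⟨f, hf, hfm⟩ ⟨g, hg, hgm⟩ ⟨P₁, P₂, P₃, t1, t2, t3, d12, d13, d23, hu, hT1, hT2⟩
  rw [← hc.mate_eq_iff hq hf] at hfm
  rw [← hc.mate_eq_iff hq hg] at hgm
  subst hfm hgm
  obtain ⟨σ, h1, h2, h3⟩ := hp.exists_star_orientation hc hq i
  have hc' := hq.compat_orientation h1
  have hp' := hp.compat hc hc' hq
  have hmm : ∀ {f}, f ∈ 𝓢.carrier → mate p f = mate (σ ∘ q) f := fun hf => hc.mate_eq_mate hc' hq hf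
  have hs : 𝓢.Split (σ ∘ q) i P₁ P₂ P₃ := by
    refine ⟨t1, t2, t3, d12, d13, d23, ?_, f, hf, g, hg, ?_, ?_, ?_⟩
    · rw [hu, h2, hp.setOf_mem hc hq hf hg hjk]
    · rwa [← hmm hf, ← hmm hg]
    · rwa [← hmm hf, h3 f hf]
    · rwa [← hmm hg, h3 g hg]
  have hr := hs.ring hp'
  obtain ⟨c1, c3, c2, hl⟩ := hs.cls_splitMap
  -- The refined ring has more classes than `p`. By pigeonhole some class of `p` has a hat with
  -- more than one class in the refined ring, and can be split by `split_of_hat`.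
  have hex : ∀ c, ∃ l, c ∈ 𝓢.hat (splitMap (σ ∘ q) P₁ P₃) (cls p l) := by
    intro c
    obtain ⟨l, hl⟩ := hp.fibers.hat_nonempty (hr.fibers c)
    exact ⟨l, by rw [mem_hat, Set.inter_comm]; exact hl⟩
  choose F hF using hex
  have hnot : ¬ Function.Injective F := by
    intro hinj
    have := Fintype.ofFinite ι
    have := Fintype.card_le_of_injective F hinj
    simp at this
  rw [Function.Injective] at hnot
  push Not at hnot
  obtain ⟨c, c', hcc, hne⟩ := hnot
  have hFc := hF c
  have hFc' := hF c'
  rw [← hcc] at hFc'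
  obtain ⟨Q₁, Q₂, Q₃, hQ⟩ := hp.split_of_hat (i := F c) hr (by
    intro a ha
    rw [ha] at hFc hFc'
    exact hne (Eq.trans hFc (Eq.symm hFc'))) (by
    intro a ha
    have e : ∀ l, l ≠ i → l ≠ F c → Sum.inl l ∈ (𝓢.hat (splitMap (σ ∘ q) P₁ P₃) (cls p (F c)))ᶜ := by
      intro l hli hlF
      rw [Set.mem_compl_iff, notMem_hat, hl l hli]
      by_cases hs : σ s(F c, l) = l
      · have e1 : cls p (F c) ∩ cls (σ ∘ q) l = ed q (F c) l ∩ cls p (F c) := by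
          ext x
          simp only [Set.mem_inter_iff, mem_ed, mem_cls, Function.comp_apply]
          constructor
          · rintro ⟨h4, h5⟩
            refine ⟨?_, h4⟩
            have h6 := hc.mem x
            rw [h4] at h6
            exact (Sym2.mem_and_mem_iff hlF.symm).1 ⟨h6, h5 ▸ h1 (q x)⟩
          · rintro ⟨h4, h5⟩
            exact ⟨h5, by rw [h4, hs]⟩
        rw [e1, hc.par_edge_inter_cls hq hlF.symm]
      · have e1 : cls p (F c) ∩ cls (σ ∘ q) l = ∅ := by
          refine Set.eq_empty_iff_forall_notMem.2 ?_
          rintro x ⟨h4, h5⟩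
          rw [mem_cls, Function.comp_apply] at h5
          have h6 := hc.mem x
          rw [mem_cls.1 h4] at h6
          have := (Sym2.mem_and_mem_iff hlF.symm).1 ⟨h6, h5 ▸ h1 (q x)⟩
          rw [this] at h5
          exact hs h5
        rw [e1]
        exact (par_eq_zero_of_exits hf (by ext; simp [exits])).2
    obtain ⟨l, hl1, hl2⟩ := hp.three i (F c)
    obtain ⟨l', hl1', hl2', hl3'⟩ := hp.fibers.exists_fourth hp.three i (F c) l
    have e1 := e l hl1 hl2
    have e2 := e l' hl1' hl2'
    rw [ha] at e1 e2
    have := Eq.trans e1 (Eq.symm e2)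
    exact hl3' (Sum.inl.inj this).symm)
  exact h _ _ _ _ hQ

end MatchingSystem

end TightCuts

/-! ### Fullness from maximality -/

namespace TightCuts

namespace MatchingSystem

variable {V : Type*} {ι κ : Type*} {𝓢 : MatchingSystem V} {f g h : V → V} {t : Set (V → V)}
  {A B S T U W X Y P₁ P₂ P₃ : Set V} {p : V → ι} {r : V → κ} {q : V → Sym2 ι} {i j k : ι}

theorem tight_preimage_congr {p p' : V → ι} (hp : 𝓢.TightFibers p) (hp' : 𝓢.TightFibers p')
    (h : ∀ f ∈ 𝓢.carrier, mate p f = mate p' f) {I : Set ι} (hI : 𝓢.Tight (p ⁻¹' I)) :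
    𝓢.Tight (p' ⁻¹' I) :=
  hp'.tight_of_exits_mate fun f hf => by rw [← h f hf]; exact hp.exits_mate hI hf

theorem Braced.congr {p p' : V → ι} (hb : 𝓢.Braced p) (hp : 𝓢.TightFibers p)
    (hp' : 𝓢.TightFibers p') (h : ∀ f ∈ 𝓢.carrier, mate p f = mate p' f) : 𝓢.Braced p' :=
  fun I hI => hb I (tight_preimage_congr hp' hp (fun f hf => (h f hf).symm) hI)

variable (𝓢) in
/-- The edge sets of `q` are largest among the sets that are passable for both ends. -/
def Maxed (q : V → Sym2 ι) : Prop :=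
  ∀ f ∈ 𝓢.carrier, ∀ i j, NodeMatch q f i j →
    ∀ S ⊆ ed q i i ∪ ed q i j ∪ ed q j j, 𝓢.Pass (ed q i i) (ed q j j) S → S ⊆ ed q i j

variable (𝓢) in
/-- Every class has at least three neighbours in the collapse. -/
def Branching (p : V → ι) : Prop :=
  ∀ i j k, ∃ f ∈ 𝓢.carrier, mate p f i ≠ j ∧ mate p f i ≠ k

/-- Passable sets at a class of an unsplit ring meet in even sets, as an odd overlap would split
the class. -/
theorem good_of_ring (hq : 𝓢.PreTorsoid q) (hm : 𝓢.Maxed q) (hc : 𝓢.Compat q p)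
    (hp : 𝓢.Ring t p) (hu : 𝓢.Unsplit q) : 𝓢.Good q where
  toPreTorsoid := hq
  sparse p' hc' := (hp.compat hc hc' hq).sparse
  full := by
    refine hq.full hm fun p' hc' i j k hij hik hjk S hS h => ?_
    rw [← par_ne_one_iff]
    intro hpar
    obtain ⟨P₁, P₂, P₃, hs⟩ := (hp.compat hc hc' hq).split_of_overlap hij hik hjk hS hc'.ed_subset h
      (hc'.pass_ed hq hik) hpar
    exact hu.not_split (hp.compat hc hc' hq) hc' hq hs

/-- Passable sets at a class with at least three neighbours meet in even sets: some matching
matches the class to none of the two neighbours that the passable sets lead to, and does not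
leave either set. -/
theorem good_of_braced (hq : 𝓢.PreTorsoid q) (hm : 𝓢.Maxed q) (hc : 𝓢.Compat q p)
    (hb : 𝓢.Braced p) (hbr : 𝓢.Branching p) : 𝓢.Good q where
  toPreTorsoid := hq
  sparse p' hc' := (hb.congr (hc.tightFibers hq) (hc'.tightFibers hq)
    fun _ hf => hc.mate_eq_mate hc' hq hf).sparse
  full := by
    refine hq.full hm fun p' hc' i j k hij hik hjk S hS h => ?_
    obtain ⟨f, hf, h1, h2⟩ := hbr i j k
    rw [hc.mate_eq_mate hc' hq hf] at h1 h2
    refine (par_eq_zero_of_exits hf ?_).2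
    refine Set.subset_empty_iff.1 (exits_inter_subset.trans ?_)
    rw [h.inactive (hc'.tightFibers hq) hS hij hf h1, hc'.edge_inactive hq hf hik h2]
    simp

theorem TightFibers.maxed_trim (hp : 𝓢.TightFibers p) (h3 : ∀ i j : ι, ∃ k, k ≠ i ∧ k ≠ j)
    (hdis : ∀ i j k, i ≠ j → i ≠ k → j ≠ k → 𝓢.maxPass p i j ∩ 𝓢.maxPass p i k = ∅) :
    𝓢.Maxed (𝓢.trim p) :=
  fun _ _ _ _ h _ hS hS' => hp.trim_greatest hdis h3 h.1 hS hS'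

theorem TightFibers.maxPass_disjoint (hp : 𝓢.TightFibers p) (h3 : ∀ i j : ι, ∃ k, k ≠ i ∧ k ≠ j)
    (h : ∀ i j k, i ≠ j → i ≠ k → j ≠ k → ∀ S T, S ⊆ cls p i ∪ cls p j → T ⊆ cls p i ∪ cls p k →
      𝓢.Pass (cls p i) (cls p j) S → 𝓢.Pass (cls p i) (cls p k) T → 𝓢.par (S ∩ T) = 0) :
    ∀ i j k, i ≠ j → i ≠ k → j ≠ k → 𝓢.maxPass p i j ∩ 𝓢.maxPass p i k = ∅ :=
  fun i j k hij hik hjk => Pass.inter_eq_empty hp hij hik hjk maxPass_subset maxPass_subset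
    (hp.pass_maxPass h3 hij) (hp.pass_maxPass h3 hik)
    (h i j k hij hik hjk _ _ maxPass_subset maxPass_subset (hp.pass_maxPass h3 hij)
      (hp.pass_maxPass h3 hik))

theorem Ring.exists_trim [Finite ι] (hp : 𝓢.Ring t p)
    (h : ∀ i P₁ P₂ P₃, ¬ 𝓢.Split p i P₁ P₂ P₃) :
    ∃ q : V → Sym2 ι, 𝓢.PreTorsoid q ∧ 𝓢.Maxed q ∧ 𝓢.Compat q p ∧ 𝓢.Unsplit q := by
  have hdis := hp.fibers.maxPass_disjoint hp.three fun i j k hij hik hjk S T hS hT hSp hTp => by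
    rw [← par_ne_one_iff]
    intro hpar
    obtain ⟨P₁, P₂, P₃, hs⟩ := hp.split_of_overlap hij hik hjk hS hT hSp hTp hpar
    exact h _ _ _ _ hs
  have hq := hp.fibers.preTorsoid_trim hdis hp.three
  have hc := hp.fibers.compat_trim hdis hp.three
  exact ⟨_, hq, hp.fibers.maxed_trim hp.three hdis, hc, hp.unsplit hc hq h⟩

theorem Branching.exists_trim (hb : 𝓢.Branching p) (hp : 𝓢.TightFibers p)
    (h3 : ∀ i j : ι, ∃ k, k ≠ i ∧ k ≠ j) :
    ∃ q : V → Sym2 ι, 𝓢.PreTorsoid q ∧ 𝓢.Maxed q ∧ 𝓢.Compat q p := by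
  have hdis := hp.maxPass_disjoint h3 fun i j k hij hik hjk S T hS hT hSp hTp => by
    obtain ⟨f, hf, h1, h2⟩ := hb i j k
    refine (par_eq_zero_of_exits hf ?_).2
    refine Set.subset_empty_iff.1 (exits_inter_subset.trans ?_)
    rw [hSp.inactive hp hS hij hf h1, hTp.inactive hp hT hik hf h2]
    simp
  exact ⟨_, hp.preTorsoid_trim hdis h3, hp.maxed_trim h3 hdis, hp.compat_trim hdis h3⟩

/-- A brick or brace is a cycle of length four, or all its vertices have at least three
neighbours. -/
theorem Braced.branching_or_ring (hb : 𝓢.Braced p) (hp : 𝓢.TightFibers p)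
    (h3 : ∀ i j : ι, ∃ k, k ≠ i ∧ k ≠ j) : 𝓢.Branching p ∨ ∃ t, 𝓢.Ring t p := by
  by_cases h : 𝓢.Branching p
  · exact Or.inl h
  right
  simp only [Branching, not_forall, not_exists, not_and] at h
  obtain ⟨i, j, k, h⟩ := h
  have h' : ∀ f ∈ 𝓢.carrier, mate p f i = j ∨ mate p f i = k := fun f hf => by
    by_cases h1 : mate p f i = j
    · exact Or.inl h1
    · exact Or.inr (not_not.1 (h f hf h1))
  by_cases hjk : j = k
  · obtain ⟨f, hf, h1⟩ := hp.exists_mate_ne h3 i j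
    exact absurd ((h' f hf).elim id fun h => h.trans hjk.symm) h1
  · exact ⟨_, (Braced.ring_of_mates hp hb h3 hjk h').1⟩

theorem PreTorsoid.exists_compat (hq : 𝓢.PreTorsoid q) :
    ∃ σ : Sym2 ι → ι, (∀ e, σ e ∈ e) ∧ 𝓢.Compat q (σ ∘ q) := by
  have h : ∀ e : Sym2 ι, e.out.1 ∈ e := fun e => Sym2.out_fst_mem e
  exact ⟨_, h, hq.compat_orientation h⟩

/-- A tight set that meets an edge set of the torsoid in an odd set lies inside the edge set, or its
complement does. -/
theorem Good.subset_or_compl_subset (hq : 𝓢.Good q) (hY : 𝓢.Tight Y) (hij : i ≠ j)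
    (hpar : 𝓢.par (Y ∩ ed q i j) = 1) : Y ⊆ ed q i j ∨ Yᶜ ⊆ ed q i j := by
  classical
  obtain ⟨σ, -, hc⟩ := hq.toPreTorsoid.exists_compat
  have hE := hq.toPreTorsoid.ed_par hij
  have hparc : 𝓢.par (Yᶜ ∩ ed q i j) = 1 := by
    have := par_inter_add_diff hE.1 hY.finCut
    rw [Set.inter_comm, hpar, hE.2] at this
    rw [Set.inter_comm, ← Set.sdiff_eq]
    rcases zmod_two_cases (𝓢.par (ed q i j \ Y)) with h | h
    · rw [h] at this; exact absurd this (by decide)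
    · exact h
  have hne : ∀ {Y : Set V}, 𝓢.par (Y ∩ ed q i j) = 1 → (Y ∩ ed q i j).Nonempty := by
    intro Y h
    rw [Set.nonempty_iff_ne_empty]
    intro h'
    rw [h', (par_eq_zero_of_exits 𝓢.base_mem (by ext; simp [exits])).2] at h
    exact absurd h (by decide)
  -- the hat is `{i}` or its complement is, if the edge set is allotted to `i`
  have key1 : ∀ {p : V → ι} {i j : ι} {Y : Set V}, i ≠ j → 𝓢.Compat q p → (∀ x, q x = s(i, j) → p x = i) →
      𝓢.Tight Y → 𝓢.par (Y ∩ ed q i j) = 1 → (Y ∩ ed q i j).Nonempty →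
      i ∈ 𝓢.hat p Y ∨ (𝓢.hat p Y)ᶜ = {i} := by
    intro p i j Y hij hc hpi hY hpar hne
    by_contra hcon
    rw [not_or] at hcon
    obtain ⟨x, hx1, hx2⟩ := hne
    rcases hq.mem_edge hc hY hcon.1 hcon.2 with h | ⟨l, hl, h⟩
    · exact Set.eq_empty_iff_forall_notMem.1 h x ⟨hx1, hpi x hx2⟩
    · have h1 := h ⟨hx1, hpi x hx2⟩
      rw [mem_ed, mem_ed.1 hx2, Sym2.eq_iff] at h1
      have hl : l = j := by
        rcases h1 with h1 | h1
        · exact absurd h1.2.symm hij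
        · exact h1.2.symm
      subst hl
      apply hcon.1
      have e1 : Y ∩ cls p i = Y ∩ ed q i l := by
        refine Set.Subset.antisymm (fun x hx => ⟨hx.1, ?_⟩) fun x hx => ⟨hx.1, hpi x hx.2⟩
        rw [ed_comm]; exact h hx
      rw [mem_hat, e1, hpar]
  have key2 : ∀ {p : V → ι} {i j : ι}, i ≠ j → 𝓢.Compat q p → (∀ x, q x = s(i, j) → p x = i) →
      𝓢.par (Y ∩ ed q i j) = 1 → 𝓢.par (Yᶜ ∩ ed q i j) = 1 → (Y ∩ ed q i j).Nonempty →
      (Yᶜ ∩ ed q i j).Nonempty → 𝓢.hat p Y = {i} ∨ 𝓢.hat p Yᶜ = {i} := by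
    intro p i j hij hc hpi h1 h2 h3 h4
    have hh := (hc.tightFibers hq.toPreTorsoid).hat_compl hY
    rcases key1 hij hc hpi hY h1 h3 with h5 | h5
    · rcases key1 hij hc hpi hY.compl h2 h4 with h6 | h6
      · rw [hh] at h6; exact absurd h5 h6
      · rw [hh, compl_compl] at h6; exact Or.inl h6
    · rw [hh]; exact Or.inr h5
  -- if the hat of `Y` is `{i}` for one compatible partition and `{j}` for another one, then `Y`
  -- lies inside the edge set
  have fin : ∀ {Y : Set V} {p p' : V → ι}, 𝓢.Tight Y → 𝓢.Compat q p → 𝓢.Compat q p' →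
      𝓢.hat p Y = {i} → 𝓢.hat p' Y = {j} → Y ⊆ ed q i j := by
    intro Y p p' hY hc hc' h1 h2 x hx
    have hne : ∀ a b : ι, ({a} : Set ι)ᶜ ≠ {b} := by
      intro a b hab
      obtain ⟨l, hl1, hl2⟩ := hq.three a b
      have : l ∈ ({a} : Set ι)ᶜ := hl1
      rw [hab] at this
      exact hl2 this
    obtain ⟨a, ha, ha'⟩ := hq.exists_mem_hat hc hY (by rw [h1]; exact hne _) hx
    obtain ⟨b, hb, hb'⟩ := hq.exists_mem_hat hc' hY (by rw [h2]; exact hne _) hx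
    rw [h1, Set.mem_singleton_iff] at ha
    rw [h2, Set.mem_singleton_iff] at hb
    subst ha hb
    exact (Sym2.mem_and_mem_iff hij).1 ⟨ha', hb'⟩
  have hci := hc.update hq.toPreTorsoid hij
  have hcj := hc.update hq.toPreTorsoid hij.symm
  -- moving the edge set to the other end changes the parity of the trace of `Y` on the class of
  -- this end
  have hflip : ∀ {Y : Set V}, 𝓢.Tight Y → 𝓢.par (Y ∩ ed q i j) = 1 →
      𝓢.hat (fun x => if q x = s(i, j) then i else (σ ∘ q) x) Y = {i} →
      j ∈ 𝓢.hat (fun x => if q x = s(j, i) then j else (σ ∘ q) x) Y := by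
    intro Y hY hpar h1
    have h2 : j ∉ 𝓢.hat (fun x => if q x = s(i, j) then i else (σ ∘ q) x) Y := by
      rw [h1]; exact hij.symm
    rw [notMem_hat] at h2
    rw [mem_hat]
    have e1 : Y ∩ cls (fun x => if q x = s(j, i) then j else (σ ∘ q) x) j =
        (Y ∩ cls (fun x => if q x = s(i, j) then i else (σ ∘ q) x) j) ∪ (Y ∩ ed q i j) := by
      ext x
      simp only [Set.mem_inter_iff, mem_cls, Set.mem_union, mem_ed, Sym2.eq_swap (a := j)]
      split_ifs with h <;> simp [h]
      exact fun h1 _ => h1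
    rw [e1, par_union_of_disjoint, h2, hpar, zero_add]
    · exact hY.finCut.inter ((hci.tightFibers hq.toPreTorsoid) j).finCut
    · exact hY.finCut.inter hE.1
    · refine Set.disjoint_left.2 ?_
      rintro x ⟨-, h3⟩ ⟨-, h4⟩
      rw [mem_cls, if_pos (mem_ed.1 h4)] at h3
      exact hij h3
  have key3 : ∀ {Y : Set V}, 𝓢.Tight Y → 𝓢.par (Y ∩ ed q i j) = 1 →
      𝓢.hat (fun x => if q x = s(i, j) then i else (σ ∘ q) x) Y = {i} →
      (𝓢.hat (fun x => if q x = s(j, i) then j else (σ ∘ q) x) Y = {j} ∨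
      𝓢.hat (fun x => if q x = s(j, i) then j else (σ ∘ q) x) Yᶜ = {j}) → Y ⊆ ed q i j := by
    intro Y hY hpar h1 h2
    refine fin hY hci hcj h1 (h2.resolve_right fun h3 => ?_)
    have h4 := hflip hY hpar h1
    rw [(hcj.tightFibers hq.toPreTorsoid).hat_compl hY] at h3
    have : j ∈ (𝓢.hat (fun x => if q x = s(j, i) then j else (σ ∘ q) x) Y)ᶜ := h3 ▸ rfl
    exact this h4
  have hi := key2 hij hci (fun x hx => if_pos hx) hpar hparc (hne hpar) (hne hparc)
  have hj := key2 hij.symm hcj (fun x hx => if_pos hx) (by rwa [ed_comm]) (by rwa [ed_comm])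
    (by rw [ed_comm]; exact hne hpar) (by rw [ed_comm]; exact hne hparc)
  rcases hi with hi | hi
  · exact Or.inl (key3 hY hpar hi hj)
  · exact Or.inr (key3 hY.compl hparc hi (by rw [compl_compl]; exact hj.symm))

theorem PreTorsoid.tight_union_inter (hq : 𝓢.PreTorsoid q) (hij : i ≠ j) (hY : 𝓢.Tight Y)
    (hd : Disjoint Y (ed q j j)) (hpar : 𝓢.par (Y ∩ ed q i j) = 0) :
    𝓢.Tight (ed q i i ∪ (ed q i j ∩ Y)) := by
  have hZ := hq.tight j i
  have hd' : ∀ x, x ∈ Y → x ∉ ed q j j := fun x h => Set.disjoint_left.1 hd h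
  have e1 : (ed q j j ∪ ed q j i) ∩ Y = Y ∩ ed q i j := by
    rw [ed_comm (i := j) (j := i)]
    ext x
    have := hd' x
    simp only [Set.mem_inter_iff, Set.mem_union]; tauto
  have h1 := hZ.diff hY (by rw [e1]; exact hpar)
  have e2 : (ed q j j ∪ ed q j i) \ Y = ed q j j ∪ (ed q j i \ Y) := by
    ext x
    have := hd' x
    simp only [Set.mem_sdiff, Set.mem_union]; tauto
  rw [e2] at h1
  have h2 := hq.tight_rest hij.symm Set.sdiff_subset h1
  rwa [Set.sdiff_sdiff_right_self, ed_comm (i := j)] at h2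

/-- If a tight set contains the node `i` and avoids the node `j`, then its part in the edge set
of `ij` can be allotted to `i`. -/
theorem Good.tight_node_union (hq : 𝓢.Good q) (hij : i ≠ j) (hY : 𝓢.Tight Y) (hi : ed q i i ⊆ Y)
    (hj : Disjoint Y (ed q j j)) : 𝓢.Tight (ed q i i ∪ (ed q i j ∩ Y)) := by
  refine hq.toPreTorsoid.tight_union_inter hij hY hj ?_
  rw [← par_ne_one_iff]
  intro hpar
  rcases hq.subset_or_compl_subset hY hij hpar with h | h
  · obtain ⟨x, hx⟩ := (hq.toPreTorsoid.node i).nonempty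
    have := h (hi hx)
    rw [mem_ed, mem_ed.1 hx] at this
    simp at this; exact hij this
  · obtain ⟨x, hx⟩ := (hq.toPreTorsoid.node j).nonempty
    have := h fun h' => Set.disjoint_left.1 hj h' hx
    rw [mem_ed, mem_ed.1 hx] at this
    simp at this; exact hij this.symm

end MatchingSystem

end TightCuts

/-! ### Bricks and braces cleave exactly one torsoid -/

namespace TightCuts

namespace MatchingSystem

universe u v

variable {V : Type*} {ι : Type*} {ι' : Type*} {κ : Type*} {𝓢 : MatchingSystem V} {f g h : V → V}
  {t : Set (V → V)}
  {A B S T U W X Y P₁ P₂ P₃ : Set V} {p : V → ι} {p' : V → ι'} {r : V → κ} {q : V → Sym2 ι}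
  {q' : V → Sym2 ι'} {i j k : ι}

theorem par_empty : 𝓢.par ∅ = 0 :=
  (par_eq_zero_of_exits 𝓢.base_mem (by ext; simp [exits])).2

/-- If each class of `r` contains a node of the torsoid `q`, then every node of `q` is a subset
of a class or disjoint from it, according to whether it belongs to the hat of the class. -/
theorem Good.node_subset_or_disjoint (hq : 𝓢.Good q) (hc : 𝓢.Compat q p) (hr : 𝓢.TightFibers r)
    (h3 : ∀ a b : κ, ∃ c, c ≠ a ∧ c ≠ b) (hcl : ∀ c, ∃ i, ed q i i ⊆ cls r c) (c : κ) :
    (∀ j, (𝓢.hat p (cls r c))ᶜ ≠ {j}) ∧ (∀ j ∈ 𝓢.hat p (cls r c), ed q j j ⊆ cls r c) ∧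
      ∀ j ∉ 𝓢.hat p (cls r c), Disjoint (cls r c) (ed q j j) := by
  have hp := hc.tightFibers hq.toPreTorsoid
  choose n hn using hcl
  have hninj : ∀ a b, a ≠ b → ¬ ed q (n a) (n a) ⊆ cls r b := by
    intro a b hab h
    obtain ⟨x, hx⟩ := (hq.toPreTorsoid.node (n a)).nonempty
    exact hab ((mem_cls.1 (hn a hx)).symm.trans (mem_cls.1 (h hx)))
  have h1 : ∀ j, (𝓢.hat p (cls r c))ᶜ ≠ {j} := by
    intro j hj
    have hin : ∀ l, l ≠ j → l ∈ 𝓢.hat p (cls r c) := by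
      intro l hl
      by_contra hc
      have : l ∈ (𝓢.hat p (cls r c))ᶜ := hc
      rw [hj] at this
      exact hl this
    have hsub : ∀ l, l ≠ j → ed q l l ⊆ cls r c := by
      intro l hl
      refine hq.node_subset hc (hr c) (hin l hl) fun h => ?_
      obtain ⟨m, hm1, hm2⟩ := hq.three j l
      have := hin m hm1
      rw [h] at this
      exact hm2 this
    obtain ⟨a, ha, -⟩ := h3 c c
    obtain ⟨b, hb, hba⟩ := h3 c a
    by_cases h : n a = j
    · refine hninj b c hb (hsub _ fun h' => hninj a b hba.symm ?_)
      rw [h, ← h']; exact hn b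
    · exact hninj a c ha (hsub _ h)
  have h2 : ∀ j ∉ 𝓢.hat p (cls r c), Disjoint (cls r c) (ed q j j) :=
    fun j hj => hq.node_disjoint hc (hr c) hj (h1 j)
  refine ⟨h1, fun j hj => ?_, h2⟩
  by_cases hj' : 𝓢.hat p (cls r c) = {j}
  · have : n c ∈ 𝓢.hat p (cls r c) := by
      by_contra h
      obtain ⟨x, hx⟩ := (hq.toPreTorsoid.node (n c)).nonempty
      exact Set.disjoint_left.1 (h2 _ h) (hn c hx) hx
    rw [hj'] at this
    rw [← Set.mem_singleton_iff.1 this]; exact hn c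
  · exact hq.node_subset hc (hr c) hj hj'

/-- If each class of `r` contains a node of the torsoid `q`, then `r` is coarser than some partition
compatible with `q`. -/
theorem Good.exists_refinement (hq : 𝓢.Good q) (hr : 𝓢.TightFibers r)
    (h3 : ∀ a b : κ, ∃ c, c ≠ a ∧ c ≠ b) (hcl : ∀ c, ∃ i, ed q i i ⊆ cls r c) :
    ∃ (p : V → ι) (h : ι → κ), 𝓢.Compat q p ∧ ∀ x, h (p x) = r x := by
  classical
  obtain ⟨σ, hσ, hc⟩ := hq.toPreTorsoid.exists_compat
  -- every node lies in one class of `r`; keep the orientation `σ` of an edge set wherever it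
  -- respects `r`, and change it to the other end elsewhere
  have key := fun c => hq.node_subset_or_disjoint hc hr h3 hcl c
  have hex : ∀ j, ∃ c, ed q j j ⊆ cls r c := by
    intro j
    obtain ⟨x, hx⟩ := (hq.toPreTorsoid.node j).nonempty
    refine ⟨r x, (key (r x)).2.1 j ?_⟩
    by_contra h
    exact Set.disjoint_left.1 ((key (r x)).2.2 j h) rfl hx
  choose h hh using hex
  have hdis : ∀ j c, h j ≠ c → Disjoint (cls r c) (ed q j j) := by
    intro j c hjc
    exact ((disjoint_cls hjc).mono_left (hh j)).symm
  have hhat : ∀ j c, j ∈ 𝓢.hat (σ ∘ q) (cls r c) ↔ h j = c := by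
    intro j c
    obtain ⟨x, hx⟩ := (hq.toPreTorsoid.node j).nonempty
    constructor
    · intro hj
      exact (mem_cls.1 (hh j hx)).symm.trans (mem_cls.1 ((key c).2.1 j hj hx))
    · rintro rfl
      by_contra hj
      exact Set.disjoint_left.1 ((key _).2.2 j hj) (hh j hx) hx
  have hx : ∀ x, ∃ i, h i = r x ∧ i ∈ q x := by
    intro x
    obtain ⟨i, hi, hi'⟩ := hq.exists_mem_hat hc (hr (r x)) (key (r x)).1 (x := x) rfl
    exact ⟨i, (hhat _ _).1 hi, hi'⟩
  choose e he he' using hx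
  have hmem : ∀ x, (if h ((σ ∘ q) x) = r x then (σ ∘ q) x else e x) ∈ q x := by
    intro x
    split_ifs
    · exact hσ _
    · exact he' x
  have hval : ∀ x, h (if h ((σ ∘ q) x) = r x then (σ ∘ q) x else e x) = r x := by
    intro x
    split_ifs with h1
    · exact h1
    · exact he x
  refine ⟨fun x => if h ((σ ∘ q) x) = r x then (σ ∘ q) x else e x, h, ⟨hmem, fun i j => ?_⟩, hval⟩
  by_cases hij : i = j
  · subst hij
    rw [Set.union_eq_left.2 Set.inter_subset_left]; exact hq.toPreTorsoid.node i
  -- an edge set between nodes of the same class of `r` keeps its orientation as a whole, any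
  -- other one is split as `r` splits it
  by_cases hhij : h i = h j
  · have : ∀ x ∈ ed q i j, (if h ((σ ∘ q) x) = r x then (σ ∘ q) x else e x) = σ s(i, j) := by
      intro x hx
      rw [mem_ed] at hx
      have h1 : h ((σ ∘ q) x) = r x := by
        have h2 := hmem x
        have h3 := hval x
        rw [hx, Sym2.mem_iff] at h2
        have h4 : h (σ s(i, j)) = h i := by
          rcases Sym2.mem_iff.1 (hσ s(i, j)) with h5 | h5 <;> rw [h5]
          exact hhij.symm
        rw [Function.comp_apply, hx, h4, ← h3]
        rcases h2 with h2 | h2 <;> rw [h2]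
        exact hhij
      rw [if_pos h1, Function.comp_apply, hx]
    by_cases hs : σ s(i, j) = i
    · have h1 : ed q i j ⊆ cls (fun x => if h ((σ ∘ q) x) = r x then (σ ∘ q) x else e x) i :=
        fun x hx => (this x hx).trans hs
      rw [Set.inter_eq_left.2 h1]
      exact hq.toPreTorsoid.tight i j
    · have h1 : ed q i j ∩ cls (fun x => if h ((σ ∘ q) x) = r x then (σ ∘ q) x else e x) i = ∅ :=
        Set.eq_empty_iff_forall_notMem.2 fun x hx => hs ((this x hx.1).symm.trans hx.2)
      rw [h1, Set.union_empty]
      exact hq.toPreTorsoid.node i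
  · have e1 : ed q i j ∩ cls (fun x => if h ((σ ∘ q) x) = r x then (σ ∘ q) x else e x) i =
        ed q i j ∩ cls r (h i) := by
      ext x
      refine and_congr_right fun hx => ?_
      have h1 := hval x
      have h2 := hmem x
      rw [mem_ed.1 hx, Sym2.mem_iff] at h2
      constructor
      · intro h4
        rw [mem_cls] at h4
        rw [h4] at h1; exact h1.symm
      · intro h4
        refine h2.resolve_right fun h5 => hhij ?_
        rw [h5] at h1
        exact (mem_cls.1 h4).symm.trans h1.symm
    rw [e1]
    exact hq.tight_node_union hij (hr _) (hh i) (hdis j (h i) (Ne.symm hhij))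

theorem TightFibers.mate_comp (hp : 𝓢.TightFibers p) (hr : 𝓢.TightFibers r) {h : ι → κ}
    (hh : ∀ x, h (p x) = r x) (hf : f ∈ 𝓢.carrier) (hi : h (mate p f i) ≠ h i) :
    mate r f (h i) = h (mate p f i) := by
  obtain ⟨x, h1, h2, h4, -⟩ := hp.exists_exit hf i
  refine hr.mate_eq_of hf (x := x) (by rw [← hh, h1]) (by rw [← hh, h2]) hi

theorem TightFibers.exists_mate_comp (hp : 𝓢.TightFibers p) (hr : 𝓢.TightFibers r) {h : ι → κ}
    (hh : ∀ x, h (p x) = r x) (hf : f ∈ 𝓢.carrier) (c : κ) :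
    ∃ i, h i = c ∧ mate r f c = h (mate p f i) := by
  obtain ⟨x, h1, h2, h4, -⟩ := hr.exists_exit hf c
  refine ⟨p x, by rw [hh, h1], ?_⟩
  rw [← h2, ← hh, hp.mate_eq hf]
  intro h5
  rw [← h2, ← h1, ← hh, ← hh, h5] at h4
  exact h4 rfl

/-- A coarsening of a ring with at least three classes is an aligned ring. -/
theorem Ring.coarsen (hp : 𝓢.Ring t p) (hr : 𝓢.TightFibers r)
    (h3 : ∀ a b : κ, ∃ c, c ≠ a ∧ c ≠ b) {h : ι → κ} (hh : ∀ x, h (p x) = r x) : 𝓢.Ring t r := by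
  have hsame : ∀ f ∈ 𝓢.carrier, ∀ g ∈ 𝓢.carrier, (f ∈ t ↔ g ∈ t) → ∀ c, mate r f c = mate r g c := by
    intro f hf g hg hfg c
    obtain ⟨i, hi, h1⟩ := hp.fibers.exists_mate_comp hr hh hf c
    have h2 := (hp.mate_eq f hf g hg i).2 hfg
    have h4 : h (mate p g i) ≠ h i := by
      rw [← h2, ← h1, hi]; exact hr.mate_ne hf c
    rw [h1, ← hi, hp.fibers.mate_comp hr hh hg h4, h2]
  refine ⟨h3, hr, fun f hf g hg c => ⟨fun hfg => ?_, fun hfg => hsame f hf g hg hfg c⟩⟩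
  by_contra hc
  obtain ⟨h', hh', h4⟩ := hr.exists_mate_ne h3 c (mate r f c)
  by_cases h5 : h' ∈ t ↔ f ∈ t
  · exact h4 (hsame _ hh' _ hf h5 c)
  · exact h4 ((hsame _ hh' _ hg (by tauto) c).trans hfg.symm)

theorem Ring.of_coarsen {t' : Set (V → V)} (hp : 𝓢.Ring t p) (hr : 𝓢.Ring t' r) {h : ι → κ}
    (hh : ∀ x, h (p x) = r x) : 𝓢.Ring t' p := by
  have h1 := hp.coarsen hr.fibers hr.three hh
  refine ⟨hp.three, hp.fibers, fun f hf g hg i => ?_⟩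
  obtain ⟨x, hx⟩ := hp.fibers.surjective i
  rw [hp.mate_eq f hf g hg, ← h1.mate_eq f hf g hg (r x), hr.mate_eq f hf g hg]

theorem Ring.not_branching (hp : 𝓢.Ring t p) (i : ι) : ¬ 𝓢.Branching p := by
  intro hb
  obtain ⟨g, hg, h⟩ := hp.exists_other 𝓢.base_mem i
  rw [← hp.mate_eq _ 𝓢.base_mem g hg i] at h
  obtain ⟨f, hf, h1, h2⟩ := hb i (mate p 𝓢.base i) (mate p g i)
  rcases hp.mate_of_ne 𝓢.base_mem hg h hf with h3 | h3
  · exact h1 (by rw [h3])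
  · exact h2 (by rw [h3])

/-- A brick or brace has no proper coarsening with at least three classes. -/
theorem Braced.injective_of_coarsen (hb : 𝓢.Braced p)
    (hr : 𝓢.TightFibers r) (h3 : ∀ a b : κ, ∃ c, c ≠ a ∧ c ≠ b) {h : ι → κ}
    (hh : ∀ x, h (p x) = r x) : Function.Injective h := by
  have hsurj : Function.Surjective h := fun c => by
    obtain ⟨x, hx⟩ := hr.surjective c
    exact ⟨p x, by rw [hh, hx]⟩
  intro i j hij
  have e1 : p ⁻¹' (h ⁻¹' {h i}) = cls r (h i) := by
    ext x
    simp [mem_cls, hh]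
  rcases hb (h ⁻¹' {h i}) (by rw [e1]; exact hr _) with ⟨a, ha⟩ | ⟨a, ha⟩
  · have h1 : i ∈ h ⁻¹' {h i} := rfl
    have h2 : j ∈ h ⁻¹' {h i} := hij.symm
    rw [ha] at h1 h2
    exact Eq.trans h1 (Eq.symm h2)
  · exfalso
    obtain ⟨c, hc, -⟩ := h3 (h i) (h i)
    obtain ⟨d, hd, hdc⟩ := h3 (h i) c
    obtain ⟨x, rfl⟩ := hsurj c
    obtain ⟨y, rfl⟩ := hsurj d
    have h1 : x ∈ (h ⁻¹' {h i})ᶜ := hc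
    have h2 : y ∈ (h ⁻¹' {h i})ᶜ := hd
    rw [ha] at h1 h2
    exact hdc (by rw [Set.mem_singleton_iff.1 h1, Set.mem_singleton_iff.1 h2])

theorem Branching.map (hb : 𝓢.Branching p) (hp : 𝓢.TightFibers p)
    (hr : 𝓢.TightFibers r) {h : ι → κ} (hh : ∀ x, h (p x) = r x) (hi : Function.Injective h) :
    𝓢.Branching r := by
  have hsurj : Function.Surjective h := fun c => by
    obtain ⟨x, hx⟩ := hr.surjective c
    exact ⟨p x, by rw [hh, hx]⟩
  intro a b c
  obtain ⟨i, rfl⟩ := hsurj a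
  obtain ⟨j, rfl⟩ := hsurj b
  obtain ⟨k, rfl⟩ := hsurj c
  obtain ⟨f, hf, h1, h2⟩ := hb i j k
  refine ⟨f, hf, ?_⟩
  rw [hp.mate_comp hr hh hf fun h => hp.mate_ne hf i (hi h)]
  exact ⟨fun h => h1 (hi h), fun h => h2 (hi h)⟩

/-- A partition into tight sets whose classes have the same hats as the classes of a partition
compatible with a torsoid is compatible itself. -/
theorem Good.compat_of_hat (hq : 𝓢.Good q) (hc : 𝓢.Compat q p) {p' : V → ι}
    (hp' : 𝓢.TightFibers p') (hh : ∀ i, 𝓢.hat p (cls p' i) = {i}) : 𝓢.Compat q p' := by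
  have hne : ∀ a b : ι, ({a} : Set ι)ᶜ ≠ {b} := by
    intro a b hab
    obtain ⟨l, hl1, hl2⟩ := hq.three a b
    have : l ∈ ({a} : Set ι)ᶜ := hl1
    rw [hab] at this
    exact hl2 this
  have hd : ∀ i j, i ≠ j → Disjoint (cls p' i) (ed q j j) := fun i j hij =>
    hq.node_disjoint hc (hp' i) (by rw [hh]; exact hij.symm) (by rw [hh]; exact hne _ _)
  have hs : ∀ i, ed q i i ⊆ cls p' i := by
    intro i x hx
    by_contra hcon
    exact Set.disjoint_left.1 (hd (p' x) i hcon) rfl hx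
  refine ⟨fun x => ?_, fun i j => ?_⟩
  · obtain ⟨i, hi, hi'⟩ := hq.exists_mem_hat hc (hp' (p' x)) (by rw [hh]; exact hne _) (x := x) rfl
    rw [hh] at hi
    rwa [← Set.mem_singleton_iff.1 hi]
  · by_cases hij : i = j
    · subst hij
      rw [Set.union_eq_left.2 Set.inter_subset_left]; exact hq.toPreTorsoid.node i
    · exact hq.tight_node_union hij (hp' i) (hs i) (hd i j hij)

/-- Torsoids with similar compatible partitions are equal, up to the names of the nodes. -/
theorem Good.eq_map (hq : 𝓢.Good q) (hq' : 𝓢.Good q') (hc : 𝓢.Compat q p) (hc' : 𝓢.Compat q' p')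
    (σ : ι ≃ ι') (h1 : ∀ i, 𝓢.hat p' (cls p i) = {σ i})
    (h2 : ∀ a, 𝓢.hat p (cls p' a) = {σ.symm a}) (x : V) : q' x = (q x).map σ := by
  have e1 : ∀ i, cls (σ.symm ∘ p') i = cls p' (σ i) := by
    intro i; ext x; simp [mem_cls, Equiv.symm_apply_eq]
  have e2 : ∀ a, cls (σ ∘ p) a = cls p (σ.symm a) := by
    intro i; ext x; simp [mem_cls, Equiv.eq_symm_apply]
  -- each of the two partitions is compatible with both torsoids
  have c1 : 𝓢.Compat q (σ.symm ∘ p') := by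
    refine hq.compat_of_hat hc (fun i => ?_) fun i => ?_
    · rw [e1]; exact (hc'.tightFibers hq'.toPreTorsoid) _
    · rw [e1, h2]; simp
  have c2 : 𝓢.Compat q' (σ ∘ p) := by
    refine hq'.compat_of_hat hc' (fun i => ?_) fun i => ?_
    · rw [e2]; exact (hc.tightFibers hq.toPreTorsoid) _
    · rw [e2, h1]; simp
  -- the edge sets of each torsoid are passable for the classes of the other, so they agree by
  -- fullness
  have hed : ∀ i j, i ≠ j → ed q i j = ed q' (σ i) (σ j) := by
    intro i j hij
    have hij' : σ i ≠ σ j := fun h => hij (σ.injective h)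
    refine Set.Subset.antisymm ?_ ?_
    · have h := c1.pass_ed hq.toPreTorsoid hij
      have h' := c1.ed_subset (i := i) (j := j)
      rw [e1, e1] at h h'
      exact hq'.full _ hc' _ _ hij' _ h' h
    · have h := c2.pass_ed hq'.toPreTorsoid hij'
      have h' := c2.ed_subset (i := σ i) (j := σ j)
      rw [e2, e2, Equiv.symm_apply_apply, Equiv.symm_apply_apply] at h h'
      exact hq.full _ hc _ _ hij _ h' h
  obtain ⟨i, hi⟩ := hc.mem x
  generalize p x = j at hi
  by_cases hij : j = i
  · subst hij
    have hx : x ∈ ed q j j := hi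
    have h4 := (c1.node_subset hx)
    rw [e1] at h4
    have h5 := hc'.mem x
    rw [mem_cls.1 h4] at h5
    obtain ⟨b, hb⟩ := h5
    rw [hi, Sym2.map_mk, hb]
    by_contra hcon
    have h6 : σ j ≠ b := fun h => hcon (by rw [← h])
    have h7 : x ∈ ed q j (σ.symm b) := by
      rw [hed, mem_ed, hb, Equiv.apply_symm_apply]
      intro h; apply h6; rw [h]; simp
    rw [mem_ed, hi] at h7
    simp at h7
    exact h6 (by rw [h7]; simp)
  · have hx : x ∈ ed q' (σ j) (σ i) := by rw [← hed j i hij]; exact hi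
    rw [hi, Sym2.map_mk]
    exact hx

variable (𝓢) in
/-- `q` describes a cyclic torsoid: its edge sets are largest, its nodes form a ring, and this
ring cannot be refined. -/
def Cyclic (q : V → Sym2 ι) : Prop :=
  𝓢.PreTorsoid q ∧ 𝓢.Maxed q ∧ 𝓢.Unsplit q ∧ ∃ t p, 𝓢.Compat q p ∧ 𝓢.Ring t p

variable (𝓢) in
/-- `q` describes a noncyclic torsoid: its edge sets are largest, and its nodes form a brick or
brace other than a cycle of length four. -/
def Noncyclic (q : V → Sym2 ι) : Prop :=
  𝓢.PreTorsoid q ∧ 𝓢.Maxed q ∧ ∃ p, 𝓢.Compat q p ∧ 𝓢.Braced p ∧ 𝓢.Branching p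

theorem Cyclic.good (hq : 𝓢.Cyclic q) : 𝓢.Good q := by
  obtain ⟨h1, h2, h3, t, p, hc, hp⟩ := hq
  exact good_of_ring h1 h2 hc hp h3

theorem Noncyclic.good (hq : 𝓢.Noncyclic q) : 𝓢.Good q := by
  obtain ⟨h1, h2, p, hc, hb, hbr⟩ := hq
  exact good_of_braced h1 h2 hc hb hbr

/-- If `r` cleaves a cyclic torsoid, the collapse of `r` is a cycle. -/
theorem Cyclic.ring_of_cleaves (hq : 𝓢.Cyclic q) (hr : 𝓢.TightFibers r)
    (h3 : ∀ a b : κ, ∃ c, c ≠ a ∧ c ≠ b) (hcl : ∀ c, ∃ i, ed q i i ⊆ cls r c) :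
    ∃ t, 𝓢.Ring t r := by
  obtain ⟨p, h, hc, hh⟩ := hq.good.exists_refinement hr h3 hcl
  obtain ⟨h1, h2, -, t, p', hc', hp⟩ := hq
  exact ⟨t, (hp.compat hc' hc h1).coarsen hr h3 hh⟩

/-- If `r` cleaves a noncyclic torsoid, then `r` is itself compatible with the torsoid, up to the
names of the classes. -/
theorem Noncyclic.exists_bijective (hq : 𝓢.Noncyclic q) (hr : 𝓢.TightFibers r)
    (h3 : ∀ a b : κ, ∃ c, c ≠ a ∧ c ≠ b) (hcl : ∀ c, ∃ i, ed q i i ⊆ cls r c) :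
    ∃ (p : V → ι) (h : ι ≃ κ), 𝓢.Compat q p ∧ 𝓢.Branching p ∧ 𝓢.Braced p ∧ ∀ x, h (p x) = r x := by
  obtain ⟨p, h, hc, hh⟩ := hq.good.exists_refinement hr h3 hcl
  obtain ⟨h1, h2, p', hc', hb, hbr⟩ := hq
  have hp := hc.tightFibers h1
  have hmm : ∀ f ∈ 𝓢.carrier, mate p' f = mate p f := fun _ hf => hc'.mate_eq_mate hc h1 hf
  have hb' := hb.congr (hc'.tightFibers h1) hp hmm
  have hinj := hb'.injective_of_coarsen hr h3 hh
  have hsurj : Function.Surjective h := fun c => by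
    obtain ⟨x, hx⟩ := hr.surjective c
    exact ⟨p x, by rw [hh, hx]⟩
  refine ⟨p, Equiv.ofBijective h ⟨hinj, hsurj⟩, hc, fun i j k => ?_, hb', hh⟩
  obtain ⟨f, hf, h4⟩ := hbr i j k
  exact ⟨f, hf, by rwa [← hmm f hf]⟩

theorem Noncyclic.branching_of_cleaves (hq : 𝓢.Noncyclic q) (hr : 𝓢.TightFibers r)
    (h3 : ∀ a b : κ, ∃ c, c ≠ a ∧ c ≠ b) (hcl : ∀ c, ∃ i, ed q i i ⊆ cls r c) :
    𝓢.Branching r := by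
  obtain ⟨p, h, hc, hb, -, hh⟩ := hq.exists_bijective hr h3 hcl
  exact hb.map (hc.tightFibers hq.1) hr hh h.injective

theorem TightFibers.hat_cls (hp : 𝓢.TightFibers p) (i : ι) : 𝓢.hat p (cls p i) = {i} := by
  ext j
  rw [mem_hat, Set.mem_singleton_iff]
  by_cases h : j = i
  · subst h; simp [(hp j).par]
  · rw [Set.disjoint_iff_inter_eq_empty.1 (disjoint_cls (Ne.symm h)), par_empty]
    simp [h]

/-- A partition into tight sets cleaves at most one noncyclic torsoid. -/
theorem Noncyclic.eq_map (hq : 𝓢.Noncyclic q) (hq' : 𝓢.Noncyclic q') (hr : 𝓢.TightFibers r)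
    (h3 : ∀ a b : κ, ∃ c, c ≠ a ∧ c ≠ b) (hcl : ∀ c, ∃ i, ed q i i ⊆ cls r c)
    (hcl' : ∀ c, ∃ i, ed q' i i ⊆ cls r c) : ∃ σ : ι ≃ ι', ∀ x, q' x = (q x).map σ := by
  obtain ⟨p, h, hc, -, -, hh⟩ := hq.exists_bijective hr h3 hcl
  obtain ⟨p', h', hc', -, -, hh'⟩ := hq'.exists_bijective hr h3 hcl'
  have e1 : ∀ i, cls p i = cls p' (h'.symm (h i)) := by
    intro i
    ext x
    rw [mem_cls, mem_cls, Equiv.eq_symm_apply, hh', ← hh, h.apply_eq_iff_eq]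
  refine ⟨h.trans h'.symm, hq.good.eq_map hq'.good hc hc' _ (fun i => ?_) fun a => ?_⟩
  · rw [e1, (hc'.tightFibers hq'.1).hat_cls]; rfl
  · have e2 : cls p' a = cls p (h.symm (h' a)) := by rw [e1]; simp
    rw [e2, (hc.tightFibers hq.1).hat_cls]; rfl

/-- The compatible partitions of cyclic torsoids that refine the same ring correspond to each
other: a class with a larger hat could be split by `Ring.split_of_hat`. -/
theorem Cyclic.exists_hat_eq (hq : 𝓢.Cyclic q) {t' : Set (V → V)} (hp : 𝓢.Ring t p) (hc : 𝓢.Compat q p)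
    (hp' : 𝓢.Ring t p') {h : ι → κ} {h' : ι' → κ} (h3 : ∀ a b : κ, ∃ c, c ≠ a ∧ c ≠ b)
    (hr : 𝓢.Ring t' r)
    (hh : ∀ x, h (p x) = r x) (hh' : ∀ x, h' (p' x) = r x) (i : ι) :
    ∃ a, 𝓢.hat p' (cls p i) = {a} := by
  by_contra hcon
  push Not at hcon
  obtain ⟨P₁, P₂, P₃, hs⟩ := hp.split_of_hat hp' hcon (by
    intro a ha
    -- the hat lies inside one class of `r`, so its complement has at least two classes
    have key : ∀ x, r x ≠ h i → p' x ∈ (𝓢.hat p' (cls p i))ᶜ := by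
      intro x hx
      rw [Set.mem_compl_iff, notMem_hat]
      have : cls p i ∩ cls p' (p' x) = ∅ := by
        refine Set.eq_empty_iff_forall_notMem.2 ?_
        rintro y ⟨h1, h2⟩
        apply hx
        rw [← mem_cls.1 h1, hh, ← hh', ← mem_cls.1 h2, hh']
      rw [this, par_empty]
    obtain ⟨c, hc1, -⟩ := h3 (h i) (h i)
    obtain ⟨d, hd1, hd2⟩ := h3 (h i) c
    obtain ⟨x, hx⟩ := hr.fibers.surjective c
    obtain ⟨y, hy⟩ := hr.fibers.surjective d
    have k1 := key x (by rwa [hx])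
    have k2 := key y (by rwa [hy])
    rw [ha, Set.mem_singleton_iff] at k1 k2
    apply hd2
    rw [← hx, ← hy, ← hh', ← hh', k1, k2])
  exact hq.2.2.1.not_split hp hc hq.1 hs

/-- A partition into tight sets cleaves at most one cyclic torsoid. -/
theorem Cyclic.eq_map (hq : 𝓢.Cyclic q) (hq' : 𝓢.Cyclic q') (hr : 𝓢.TightFibers r)
    (h3 : ∀ a b : κ, ∃ c, c ≠ a ∧ c ≠ b) (hcl : ∀ c, ∃ i, ed q i i ⊆ cls r c)
    (hcl' : ∀ c, ∃ i, ed q' i i ⊆ cls r c) : ∃ σ : ι ≃ ι', ∀ x, q' x = (q x).map σ := by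
  obtain ⟨t, hrt⟩ := hq.ring_of_cleaves hr h3 hcl
  obtain ⟨p, h, hc, hh⟩ := hq.good.exists_refinement hr h3 hcl
  obtain ⟨p', h', hc', hh'⟩ := hq'.good.exists_refinement hr h3 hcl'
  have hpr : 𝓢.Ring t p := by
    have hq1 := hq.1
    obtain ⟨_, _, _, t, p0, hc0, hp⟩ := hq
    exact (hp.compat hc0 hc hq1).of_coarsen hrt hh
  have hpr' : 𝓢.Ring t p' := by
    have hq1 := hq'.1
    obtain ⟨_, _, _, t, p0, hc0, hp⟩ := hq'
    exact (hp.compat hc0 hc' hq1).of_coarsen hrt hh'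
  choose σ hσ using fun i => hq.exists_hat_eq hpr hc hpr' h3 hrt hh hh' i
  choose τ hτ using fun i => hq'.exists_hat_eq hpr' hc' hpr h3 hrt hh' hh i
  have h1 : ∀ i, τ (σ i) = i := by
    intro i
    have : σ i ∈ 𝓢.hat p' (cls p i) := by rw [hσ]; rfl
    rw [mem_hat, Set.inter_comm, ← mem_hat, hτ] at this
    exact this.symm
  have h2 : ∀ i, σ (τ i) = i := by
    intro i
    have : τ i ∈ 𝓢.hat p (cls p' i) := by rw [hτ]; rfl
    rw [mem_hat, Set.inter_comm, ← mem_hat, hσ] at this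
    exact this.symm
  exact ⟨⟨σ, τ, h1, h2⟩, hq.good.eq_map hq'.good hc hc' _ hσ hτ⟩

/-- A ring is finite, as any two of its members of different types differ at a vertex of every
class. -/
theorem Ring.finite_and_card_le [Nonempty ι] (hp : 𝓢.Ring t p) (hf : f ∈ 𝓢.carrier) (hg : g ∈ 𝓢.carrier)
    (hfg : ¬ (f ∈ t ↔ g ∈ t)) : Finite ι ∧ Nat.card ι ≤ {x | f x ≠ g x}.ncard := by
  have hfin := 𝓢.fin f hf g hg
  have hs : Function.Surjective (fun x : {x | f x ≠ g x} => p x.1) := by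
    intro i
    obtain ⟨x, h1, h2, -⟩ := hp.fibers.exists_exit hf i
    refine ⟨⟨x, fun h => ?_⟩, h1⟩
    have h4 : mate p f i ≠ mate p g i := by rwa [Ne, hp.mate_eq f hf g hg]
    apply h4
    rw [← h2, h]
    refine (hp.fibers.mate_eq_of hg h1 rfl ?_).symm
    rw [← h, h2]; exact hp.fibers.mate_ne hf i
  have : Finite {x | f x ≠ g x} := hfin
  exact ⟨Finite.of_surjective _ hs, by simpa using Nat.card_le_card_of_surjective _ hs⟩

/-- A ring has a refinement that cannot be refined further. -/
theorem Ring.exists_unsplit {κ : Type u} [Nonempty κ] {r : V → κ} (hr : 𝓢.Ring t r) :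
    ∃ (ι : Type u) (_ : Finite ι) (p : V → ι) (h : ι → κ), 𝓢.Ring t p ∧ (∀ x, h (p x) = r x) ∧
      ∀ i P₁ P₂ P₃, ¬ 𝓢.Split p i P₁ P₂ P₃ := by
  obtain ⟨g, hg, hfg⟩ := hr.exists_other 𝓢.base_mem (Classical.arbitrary κ)
  by_contra hcon
  -- otherwise the number of classes would grow without bound
  have key : ∀ n : ℕ, ∃ (ι : Type u) (_ : Finite ι) (_ : Nonempty ι) (p : V → ι) (h : ι → κ),
      𝓢.Ring t p ∧ (∀ x, h (p x) = r x) ∧ n ≤ Nat.card ι := by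
    intro n
    induction n with
    | zero =>
      exact ⟨κ, (hr.finite_and_card_le 𝓢.base_mem hg hfg).1, inferInstance, r, id, hr, fun _ => rfl,
        Nat.zero_le _⟩
    | succ n ih =>
      obtain ⟨ι, _, _, p, h, hp, hh, hn⟩ := ih
      by_cases hs : ∃ i P₁ P₂ P₃, 𝓢.Split p i P₁ P₂ P₃
      · obtain ⟨i, P₁, P₂, P₃, hs⟩ := hs
        refine ⟨ι ⊕ Bool, inferInstance, inferInstance, _, Sum.elim h fun _ => h i, hs.ring hp, ?_, ?_⟩
        · intro x
          have hu : x ∈ P₁ ∪ P₂ ∪ P₃ ↔ x ∈ cls p i := by rw [hs.union_eq]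
          rw [← hh x]
          unfold splitMap
          split_ifs with h1 h2
          · rw [mem_cls.1 (hu.1 (Or.inl (Or.inl h1)))]; rfl
          · rw [mem_cls.1 (hu.1 (Or.inr h2))]; rfl
          · rfl
        · rw [Nat.card_sum]; simp; omega
      · push Not at hs
        exact absurd ⟨ι, inferInstance, p, h, hp, hh, hs⟩ hcon
  obtain ⟨ι, _, _, p, h, hp, -, hn⟩ := key ({x | 𝓢.base x ≠ g x}.ncard + 1)
  have := (hp.finite_and_card_le 𝓢.base_mem hg hfg).2
  omega

/-- Every brick or brace with at least four classes cleaves a torsoid: if it is a cycle of length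
four, it is refined as far as possible, and then the largest passable sets are made the edge
sets. -/
theorem Braced.exists_torsoid {κ : Type u} [Nonempty κ] {r : V → κ} (hb : 𝓢.Braced r)
    (hr : 𝓢.TightFibers r) (h3 : ∀ a b : κ, ∃ c, c ≠ a ∧ c ≠ b) :
    ∃ (ι : Type u) (q : V → Sym2 ι), (∀ c, ∃ i, ed q i i ⊆ cls r c) ∧
      (𝓢.Noncyclic q ∨ 𝓢.Cyclic q ∧ Finite ι) := by
  rcases hb.branching_or_ring hr h3 with hbr | ⟨t, hrt⟩
  · obtain ⟨q, hq, hm, hc⟩ := hbr.exists_trim hr h3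
    exact ⟨κ, q, fun c => ⟨c, hc.node_subset⟩, Or.inl ⟨hq, hm, r, hc, hb, hbr⟩⟩
  · obtain ⟨ι, hfin, p, h, hp, hh, hs⟩ := hrt.exists_unsplit
    obtain ⟨q, hq, hm, hc, hu⟩ := hp.exists_trim hs
    refine ⟨ι, q, fun c => ?_, Or.inr ⟨⟨hq, hm, hu, t, p, hc, hp⟩, hfin⟩⟩
    obtain ⟨x, hx⟩ := hr.surjective c
    refine ⟨p x, hc.node_subset.trans fun y hy => ?_⟩
    rw [mem_cls, ← hh, mem_cls.1 hy, hh, hx]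

end MatchingSystem

end TightCuts

/-! ### Allotting edge sets to nodes -/

namespace TightCuts

namespace MatchingSystem

variable {V : Type*} {ι : Type*} {ι' : Type*} {κ : Type*} {𝓢 : MatchingSystem V} {f g h : V → V}
  {t : Set (V → V)} {𝒟 : Set (Set V)}
  {A B S T U W X Y Z : Set V} {p : V → ι} {p' : V → ι'} {r : V → κ} {q : V → Sym2 ι}
  {q' : V → Sym2 ι'} {i j k : ι}

/-- If a part `U` of the edge set of `ij` can be allotted to `i`, then a matching that does not
match `i` to `j` does not leave `U`. -/
theorem inactive_of_tight_union (hU : U ⊆ ed q i j) (hij : i ≠ j)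
    (h : 𝓢.Tight (ed q i i ∪ U)) (hf : f ∈ 𝓢.carrier) (hm : NodeMatch q f i k) (hkj : k ≠ j) :
    exits f U = ∅ ∧ exits f (ed q i i ∪ U) = exits f (ed q i i) := by
  obtain ⟨hik, a, ha, hfa⟩ := hm
  obtain ⟨y, hy⟩ := h f hf
  have haU : f a ∉ U := by
    intro h1
    have h2 := mem_ed.1 (hU h1)
    rcases hfa with h3 | h3 <;> rw [h2, Sym2.eq_iff] at h3
    · exact hij (h3.elim (fun h => h.1.trans h.2.symm) fun h => h.1.trans h.2.symm)
    · exact h3.elim (fun h => hkj h.2.symm) fun h => hik h.1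
  have hay : a = y := by
    refine eq_of_mem_exits hy (Or.inl (mem_exits_of_eq ha).1) ?_
    rintro (h1 | h1)
    · exact (mem_exits_of_eq ha).2 h1
    · exact haU h1
  refine ⟨Set.eq_empty_iff_forall_notMem.2 ?_, by rw [hy, ha, hay]⟩
  have hdis : ∀ x ∈ U, x ∉ ed q i i := by
    intro x hx h'
    exact Set.disjoint_left.1 (PreTorsoid.disjoint_node hij hU) h' hx
  rintro x ⟨hx, hx'⟩
  by_cases h1 : f x ∈ ed q i i
  · have := eq_of_mem_exits ha h1 (by rw [𝓢.invol f hf]; exact hdis x hx)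
    rw [← this, 𝓢.invol f hf] at haU
    exact haU hx
  · have := eq_of_mem_exits hy (Or.inr hx) fun h => h.elim h1 hx'
    rw [this, ← hay] at hx
    exact hdis a hx (mem_exits_of_eq ha).1

theorem PreTorsoid.exists_nodeMatch_ne (hq : 𝓢.PreTorsoid q) (i j : ι) :
    ∃ f ∈ 𝓢.carrier, ∃ k, NodeMatch q f i k ∧ k ≠ j := by
  obtain ⟨σ, -, hc⟩ := hq.exists_compat
  obtain ⟨f, hf, h⟩ := (hc.tightFibers hq).exists_mate_ne hq.three i j
  exact ⟨f, hf, _, hc.nodeMatch hq hf i, h⟩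

/-- The parts of an edge set that may be allotted to the node `i` are closed under unions. -/
theorem PreTorsoid.tight_union_sUnion (hq : 𝓢.PreTorsoid q) (hij : i ≠ j) {𝒰 : Set (Set V)}
    (h : ∀ U ∈ 𝒰, U ⊆ ed q i j ∧ 𝓢.Tight (ed q i i ∪ U)) : 𝓢.Tight (ed q i i ∪ ⋃₀ 𝒰) := by
  obtain ⟨g, hg, k, hm, hkj⟩ := hq.exists_nodeMatch_ne i j
  have hbin : ∀ A B : Set V, (A ⊆ ed q i j ∧ 𝓢.Tight (ed q i i ∪ A)) →
      (B ⊆ ed q i j ∧ 𝓢.Tight (ed q i i ∪ B)) →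
      (A ∪ B ⊆ ed q i j ∧ 𝓢.Tight (ed q i i ∪ (A ∪ B))) := by
    rintro A B ⟨hA, hA'⟩ ⟨hB, hB'⟩
    refine ⟨Set.union_subset hA hB, ?_⟩
    have e1 : ed q i i ∪ (A ∪ B) = (ed q i i ∪ A) ∪ (ed q i i ∪ B) := by
      ext x; simp only [Set.mem_union]; tauto
    rw [e1]
    refine hA'.union hB' ?_
    have e2 : (ed q i i ∪ A) ∩ (ed q i i ∪ B) = ed q i i ∪ (A ∩ B) :=
      (Set.union_inter_distrib_left _ _ _).symm
    have h1 : exits g (A ∩ B) = ∅ := by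
      refine Set.subset_empty_iff.1 (exits_inter_subset.trans ?_)
      rw [(inactive_of_tight_union hA hij hA' hg hm hkj).1,
        (inactive_of_tight_union hB hij hB' hg hm hkj).1]
      simp
    have h2 := par_eq_zero_of_exits hg h1
    rw [e2, par_union_of_disjoint (hq.node i).finCut h2.1
      (PreTorsoid.disjoint_node hij (Set.inter_subset_left.trans hA)), (hq.node i).par, h2.2, add_zero]
  obtain ⟨a, ha⟩ := hq.node i g hg
  have hsub : ⋃₀ 𝒰 ⊆ ed q i j := Set.sUnion_subset fun U hU => (h U hU).1
  have hfa : g a ∉ ed q i j := by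
    obtain ⟨hik, a', ha', hfa⟩ := hm
    rw [ha, Set.singleton_eq_singleton_iff] at ha'
    subst ha'
    intro h2
    rw [mem_ed] at h2
    rcases hfa with h3 | h3 <;> rw [h2, Sym2.eq_iff] at h3
    · exact hij (h3.elim (fun h => h.1.trans h.2.symm) fun h => h.1.trans h.2.symm)
    · exact h3.elim (fun h => hkj h.2.symm) fun h => hik h.1
  refine tight_of_approx hg (a := a) ?_ fun D hD => ?_
  · refine exits_union_of_inactive ha (exits_sUnion_inactive fun U hU => ?_) fun h' => hfa (hsub h')
    exact (inactive_of_tight_union (h U hU).1 hij (h U hU).2 hg hm hkj).1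
  · obtain ⟨U, hU1, hU2, hU3⟩ := exists_approx_sUnion
      (P := fun A => A ⊆ ed q i j ∧ 𝓢.Tight (ed q i i ∪ A))
      ⟨Set.empty_subset _, by rw [Set.union_empty]; exact hq.node i⟩ hbin h hD
    refine ⟨_, hU1.2, ?_, fun x hx => or_congr_right (hU3 x hx)⟩
    rw [(inactive_of_tight_union hU1.1 hij hU1.2 hg hm hkj).2, ha]

/-- Two sets are nested if one of them or its complement is a subset of the other or of its
complement. -/
def Nest (X Y : Set V) : Prop := Disjoint X Y ∨ X ⊆ Y ∨ Y ⊆ X ∨ X ∪ Y = Set.univ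

variable (𝓢) in
/-- `𝒟` is a maximal nested family of tight sets. It consists of both sides of the cuts of a
maximal nested family of tight cuts. -/
structure MaxNested (𝒟 : Set (Set V)) : Prop where
  tight : ∀ Y ∈ 𝒟, 𝓢.Tight Y
  compl : ∀ Y ∈ 𝒟, Yᶜ ∈ 𝒟
  nest : ∀ X ∈ 𝒟, ∀ Y ∈ 𝒟, Nest X Y
  maximal : ∀ Z, 𝓢.Tight Z → (∀ Y ∈ 𝒟, Nest Z Y) → Z ∈ 𝒟

theorem nest_preimage {p : V → ι} (I : Set ι) (h : Y ⊆ cls p i ∨ Yᶜ ⊆ cls p i) :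
    Nest (p ⁻¹' I) Y := by
  by_cases hi : i ∈ I
  · have h1 : cls p i ⊆ p ⁻¹' I := fun x hx => by rwa [Set.mem_preimage, mem_cls.1 hx]
    rcases h with h | h
    · exact Or.inr (Or.inr (Or.inl (h.trans h1)))
    · refine Or.inr (Or.inr (Or.inr (Set.eq_univ_of_forall fun x => ?_)))
      by_cases hx : x ∈ Y
      · exact Or.inr hx
      · exact Or.inl (h1 (h hx))
  · have h1 : ∀ x ∈ cls p i, x ∉ p ⁻¹' I := fun x hx => by rwa [Set.mem_preimage, mem_cls.1 hx]
    rcases h with h | h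
    · exact Or.inl (Set.disjoint_left.2 fun x hx hx' => h1 x (h hx') hx)
    · refine Or.inr (Or.inl fun x hx => ?_)
      by_contra hx'
      exact h1 x (h hx') hx

/-- A tight set that meets no node lies inside an edge set. -/
theorem Good.exists_subset_edge (hq : 𝓢.Good q) (hY : 𝓢.Tight Y)
    (hd : ∀ i, Disjoint Y (ed q i i)) : ∃ i j, i ≠ j ∧ Y ⊆ ed q i j := by
  classical
  obtain ⟨σ, hσ, hc⟩ := hq.toPreTorsoid.exists_compat
  have hne : ∀ a b : ι, ({a} : Set ι)ᶜ ≠ {b} := by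
    intro a b hab
    obtain ⟨l, hl1, hl2⟩ := hq.three a b
    have : l ∈ ({a} : Set ι)ᶜ := hl1
    rw [hab] at this
    exact hl2 this
  have hat : ∀ {p}, 𝓢.Compat q p → ∃ i, 𝓢.hat p Y = {i} := by
    intro p hc
    obtain ⟨i, hi⟩ := (hc.tightFibers hq.toPreTorsoid).hat_nonempty hY
    refine ⟨i, ?_⟩
    by_contra h
    obtain ⟨x, hx⟩ := (hq.toPreTorsoid.node i).nonempty
    exact Set.disjoint_left.1 (hd i) (hq.node_subset hc hY hi h hx) hx
  obtain ⟨i, hi⟩ := hat hc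
  -- an orientation in which the class of `i` is only the node `i`
  have hσ' : ∀ e : Sym2 ι, ∃ a ∈ e, a = i → e = s(i, i) := by
    intro e
    induction e with | _ x y =>
    by_cases hx : x = i
    · exact ⟨y, by simp, fun hy => by rw [hx, hy]⟩
    · exact ⟨x, by simp, fun h => absurd h hx⟩
  choose τ hτ hτi using hσ'
  have hc' := hq.toPreTorsoid.compat_orientation hτ
  obtain ⟨j, hj⟩ := hat hc'
  have hij : i ≠ j := by
    rintro rfl
    have h1 : Y ∩ cls (τ ∘ q) i = ∅ := Set.eq_empty_iff_forall_notMem.2 fun x hx =>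
      Set.disjoint_left.1 (hd i) hx.1 (hτi _ hx.2)
    have h2 : i ∈ 𝓢.hat (τ ∘ q) Y := by rw [hj]; rfl
    rw [mem_hat, h1, par_empty] at h2
    exact absurd h2 (by decide)
  refine ⟨i, j, hij, fun x hx => ?_⟩
  obtain ⟨a, ha, ha'⟩ := hq.exists_mem_hat hc hY (by rw [hi]; exact hne _) hx
  obtain ⟨b, hb, hb'⟩ := hq.exists_mem_hat hc' hY (by rw [hj]; exact hne _) hx
  rw [hi, Set.mem_singleton_iff] at ha
  rw [hj, Set.mem_singleton_iff] at hb
  subst ha hb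
  exact (Sym2.mem_and_mem_iff hij).1 ⟨ha', hb'⟩

theorem PreTorsoid.tight_of_const (hq : 𝓢.PreTorsoid q) {a : ι} (h : ∀ x ∈ ed q i j, p x = a) :
    𝓢.Tight (ed q i i ∪ (ed q i j ∩ cls p i)) := by
  by_cases hs : a = i
  · have h1 : ed q i j ⊆ cls p i := fun x hx => (h x hx).trans hs
    rw [Set.inter_eq_left.2 h1]
    exact hq.tight i j
  · have h1 : ed q i j ∩ cls p i = ∅ :=
      Set.eq_empty_iff_forall_notMem.2 fun x hx => hs ((h x hx.1).symm.trans hx.2)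
    rw [h1, Set.union_empty]
    exact hq.node i

/-- Given a partition of the nodes into tight sets such that every member of a maximal nested
family respects the partition on the level of nodes, the edge sets can be allotted to the nodes
in such a way that the classes of the resulting partition are members of the family, and all
members respect it. -/
theorem Good.exists_star (hq : 𝓢.Good q) (hD : 𝓢.MaxNested 𝒟) {σ : Sym2 ι → ι} (hσ : ∀ e, σ e ∈ e)
    {c : ι → κ} (hcs : Function.Surjective c) (h3 : ∀ a b : κ, ∃ d, d ≠ a ∧ d ≠ b)
    (hJ : ∀ k, 𝓢.Tight ((σ ∘ q) ⁻¹' (c ⁻¹' {k})))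
    (hH : ∀ Y ∈ 𝒟, ∃ k, 𝓢.hat (σ ∘ q) Y ⊆ c ⁻¹' {k} ∨ (𝓢.hat (σ ∘ q) Y)ᶜ ⊆ c ⁻¹' {k}) :
    ∃ p, 𝓢.Compat q p ∧ (∀ k, cls (c ∘ p) k ∈ 𝒟) ∧
      ∀ Y ∈ 𝒟, ∃ k, Y ⊆ cls (c ∘ p) k ∨ Yᶜ ⊆ cls (c ∘ p) k := by
  classical
  have hpre := hq.toPreTorsoid
  have hc0 := hpre.compat_orientation hσ
  have hp0 := hc0.tightFibers hpre
  -- `F k` consists of the members of `𝒟` that belong to the class `k`: they lie over this class,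
  -- and contain a vertex that cannot be allotted to another class.
  let F : κ → Set (Set V) := fun k =>
    {Y | Y ∈ 𝒟 ∧ (∀ x ∈ Y, ∃ i ∈ q x, c i = k) ∧ ∃ x ∈ Y, ∀ i ∈ q x, c i = k}
  -- for any two classes some node belongs to neither
  have third : ∀ k l, ∃ x m, q x = s(m, m) ∧ c m ≠ k ∧ c m ≠ l := by
    intro k l
    obtain ⟨m, hm1, hm2⟩ := h3 k l
    obtain ⟨i, rfl⟩ := hcs m
    obtain ⟨x, hx⟩ := (hpre.node i).nonempty
    exact ⟨x, i, hx, hm1, hm2⟩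
  have hFd : ∀ k l, k ≠ l → ∀ Y ∈ F k, ∀ Z ∈ F l, Disjoint Y Z := by
    rintro k l hkl Y ⟨hY, hY1, y, hy, hy'⟩ Z ⟨hZ, hZ1, z, hz, hz'⟩
    rcases hD.nest Y hY Z hZ with h | h | h | h
    · exact h
    · obtain ⟨i, hi, hi'⟩ := hZ1 y (h hy)
      exact absurd ((hy' i hi).symm.trans hi') hkl
    · obtain ⟨i, hi, hi'⟩ := hY1 z (h hz)
      exact absurd (hi'.symm.trans (hz' i hi)) hkl
    · exfalso
      obtain ⟨x, m, hx, hm1, hm2⟩ := third k l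
      have : x ∈ Y ∪ Z := h ▸ Set.mem_univ x
      rcases this with h | h
      · obtain ⟨i, hi, hi'⟩ := hY1 x h
        rw [hx] at hi; simp at hi; exact hm1 (hi ▸ hi')
      · obtain ⟨i, hi, hi'⟩ := hZ1 x h
        rw [hx] at hi; simp at hi; exact hm2 (hi ▸ hi')
  have hUd : ∀ {k l x}, x ∈ ⋃₀ F k → x ∈ ⋃₀ F l → k = l := by
    rintro k l x ⟨Y, hY, hxY⟩ ⟨Z, hZ, hxZ⟩
    by_contra hkl
    exact Set.disjoint_left.1 (hFd k l hkl Y hY Z hZ) hxY hxZ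
  -- allot a vertex to the class `k` if a member of `F k` contains it, and as `σ` does otherwise
  obtain ⟨p, hpdef⟩ : ∃ p : V → ι, ∀ x, p x = if h : ∃ i ∈ q x, x ∈ ⋃₀ F (c i) ∧ c i ≠ c ((σ ∘ q) x)
    then h.choose else (σ ∘ q) x := ⟨_, fun x => rfl⟩
  have hmem : ∀ x, p x ∈ q x := by
    intro x
    rw [hpdef]
    split_ifs with h
    · exact h.choose_spec.1
    · exact hσ _
  have hpU : ∀ {k x}, x ∈ ⋃₀ F k → c (p x) = k := by
    intro k x hx
    rw [hpdef]
    split_ifs with h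
    · exact hUd h.choose_spec.2.1 hx
    · by_contra hk
      have hx' := hx
      obtain ⟨Y, hY, hxY⟩ := hx
      obtain ⟨i, hi, rfl⟩ := hY.2.1 x hxY
      exact h ⟨i, hi, hx', Ne.symm hk⟩
  have hpn : ∀ {x}, (∀ i ∈ q x, c i ≠ c ((σ ∘ q) x) → x ∉ ⋃₀ F (c i)) → p x = (σ ∘ q) x := by
    intro x h
    rw [hpdef, dif_neg]
    rintro ⟨i, hi, h1, h2⟩
    exact h i hi h2 h1
  -- the part of an edge set that is covered by the members of `F (c i)` can be allotted to `i`
  have htU : ∀ i j, c i ≠ c j → 𝓢.Tight (ed q i i ∪ (ed q i j ∩ ⋃₀ F (c i))) := by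
    intro i j hij
    have hij' : i ≠ j := fun h => hij (congrArg c h)
    have e1 : ed q i j ∩ ⋃₀ F (c i) = ⋃₀ ((fun Y => ed q i j ∩ Y) '' F (c i)) := by
      ext x
      simp [Set.mem_sUnion]
    rw [e1]
    refine hpre.tight_union_sUnion hij' ?_
    rintro _ ⟨Y, ⟨hY, hY1, y, hy, hy'⟩, rfl⟩
    refine ⟨Set.inter_subset_left, ?_⟩
    have hd : Disjoint Y (ed q j j) := by
      refine Set.disjoint_left.2 fun x hx hx' => ?_
      obtain ⟨l, hl, hl'⟩ := hY1 x hx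
      rw [mem_ed.1 hx'] at hl; simp at hl
      exact hij (hl ▸ hl'.symm)
    refine hpre.tight_union_inter hij' (hD.tight Y hY) hd ?_
    rw [← par_ne_one_iff]
    intro hpar
    rcases hq.subset_or_compl_subset (hD.tight Y hY) hij' hpar with h | h
    · have := mem_ed.1 (h hy)
      exact hij (hy' j (by rw [this]; simp)).symm
    · obtain ⟨x, hx⟩ := (hpre.node j).nonempty
      have := h fun h' => Set.disjoint_left.1 hd h' hx
      rw [mem_ed, mem_ed.1 hx] at this
      simp at this; exact hij' this.symm
  have hconst : ∀ {i j : ι}, c i = c j → ∀ l, l = i ∨ l = j → c l = c i := by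
    rintro i j hij l (h | h) <;> rw [h]
    exact hij.symm
  have hc : 𝓢.Compat q p := by
    refine ⟨hmem, fun i j => ?_⟩
    by_cases hij : i = j
    · subst hij
      rw [Set.union_eq_left.2 Set.inter_subset_left]; exact hpre.node i
    by_cases hcij : c i = c j
    · refine hpre.tight_of_const (a := σ s(i, j)) fun x hx => ?_
      rw [hpn, Function.comp_apply, mem_ed.1 hx]
      intro l hl hl'
      exfalso
      apply hl'
      rw [Function.comp_apply, mem_ed.1 hx]
      rw [mem_ed.1 hx, Sym2.mem_iff] at hl
      rw [hconst hcij l hl, hconst hcij _ (Sym2.mem_iff.1 (hσ s(i, j)))]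
    -- between different classes, `σ` gives the edge set to one end, and the other end takes its
    -- covered part
    rcases Sym2.mem_iff.1 (hσ s(i, j)) with hs | hs
    · have h1 := hpre.tight_rest (Ne.symm hij) Set.inter_subset_left (htU j i (Ne.symm hcij))
      rw [ed_comm (i := j), Set.sdiff_self_inter] at h1
      convert h1 using 2
      ext x
      refine and_congr_right fun hx => ?_
      constructor
      · intro h2 h3
        have := hpU h3
        rw [mem_cls.1 h2] at this
        exact hcij this
      · intro h2
        rw [mem_cls, hpn, Function.comp_apply, mem_ed.1 hx, hs]
        intro l hl hl'
        rw [Function.comp_apply, mem_ed.1 hx, hs] at hl'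
        rw [mem_ed.1 hx, Sym2.mem_iff] at hl
        rcases hl with rfl | rfl
        · exact absurd rfl hl'
        · exact h2
    · convert htU i j hcij using 2
      ext x
      refine and_congr_right fun hx => ?_
      have hpx := hmem x
      rw [mem_ed.1 hx, Sym2.mem_iff] at hpx
      constructor
      · intro h2
        by_contra h3
        rw [mem_cls, hpn, Function.comp_apply, mem_ed.1 hx, hs] at h2
        · exact hij h2.symm
        · intro l hl hl'
          rw [Function.comp_apply, mem_ed.1 hx, hs] at hl'
          rw [mem_ed.1 hx, Sym2.mem_iff] at hl
          rcases hl with rfl | rfl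
          · exact h3
          · exact absurd rfl hl'
      · intro h2
        refine hpx.resolve_right fun h3 => hcij ?_
        rw [← hpU h2, h3]
  -- A member `Y` of `𝒟` with hat over the class `k` either belongs to `F k`, or lies inside an
  -- edge set. In the second case it lies inside a member of some `F l` or avoids all of them.
  have hresp : ∀ Y ∈ 𝒟, ∀ k, 𝓢.hat (σ ∘ q) Y ⊆ c ⁻¹' {k} → ∃ k, Y ⊆ cls (c ∘ p) k := by
    intro Y hY k hk
    have hYt := hD.tight Y hY
    have hco : ∀ j, (𝓢.hat (σ ∘ q) Y)ᶜ ≠ {j} := by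
      intro j hj
      obtain ⟨a, ha, -⟩ := h3 k k
      obtain ⟨b, hb, hb'⟩ := h3 k a
      obtain ⟨x, rfl⟩ := hcs a
      obtain ⟨y, rfl⟩ := hcs b
      have hx : x ∈ (𝓢.hat (σ ∘ q) Y)ᶜ := fun h => ha (hk h)
      have hy : y ∈ (𝓢.hat (σ ∘ q) Y)ᶜ := fun h => hb (hk h)
      rw [hj, Set.mem_singleton_iff] at hx hy
      exact hb' (by rw [hx, hy])
    have hYk : ∀ x ∈ Y, ∃ i ∈ q x, c i = k := by
      intro x hx
      obtain ⟨i, hi, hi'⟩ := hq.exists_mem_hat hc0 hYt hco hx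
      exact ⟨i, hi', hk hi⟩
    by_cases hcore : ∃ x ∈ Y, ∀ i ∈ q x, c i = k
    · exact ⟨k, fun x hx => hpU ⟨Y, ⟨hY, hYk, hcore⟩, hx⟩⟩
    push Not at hcore
    obtain ⟨i, j, hij, hYe⟩ := hq.exists_subset_edge hYt (by
      intro i
      refine Set.disjoint_left.2 fun x hx hx' => ?_
      obtain ⟨l, hl, hl'⟩ := hcore x hx
      obtain ⟨m, hm, hm'⟩ := hYk x hx
      rw [mem_ed.1 hx'] at hl hm
      simp at hl hm
      rw [hl] at hl'
      rw [hm] at hm'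
      exact hl' hm')
    have hcij : c i ≠ c j := by
      intro hcij
      obtain ⟨x, hx⟩ := hYt.nonempty
      obtain ⟨l, hl, hl'⟩ := hcore x hx
      obtain ⟨m, hm, hm'⟩ := hYk x hx
      rw [mem_ed.1 (hYe hx), Sym2.mem_iff] at hl hm
      exact hl' ((hconst hcij l hl).trans ((hconst hcij m hm).symm.trans hm'))
    have hmeet : ∀ a b, a ≠ b → Y ⊆ {x | a ∈ q x ∧ b ∈ q x} → c a ≠ c b → (Y ∩ ⋃₀ F (c a)).Nonempty →
        ∃ k, Y ⊆ cls (c ∘ p) k := by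
      rintro a b hab hYab hcab ⟨x, hx, Z, hZ, hxZ⟩
      refine ⟨c a, fun y hy => hpU ⟨Z, hZ, ?_⟩⟩
      obtain ⟨hZD, hZ1, z, hz, hz'⟩ := hZ
      rcases hD.nest Y hY Z hZD with h | h | h | h
      · exact absurd hxZ (Set.disjoint_left.1 h hx)
      · exact h hy
      · exact absurd (hz' b (hYab (h hz)).2).symm hcab
      · exfalso
        obtain ⟨w, m, hw, hm1, hm2⟩ := third (c a) (c b)
        have : w ∈ Y ∪ Z := h ▸ Set.mem_univ w
        rcases this with h | h
        · have := (hYab h).1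
          rw [hw] at this; simp at this
          exact hm1 (by rw [this])
        · obtain ⟨l, hl, hl'⟩ := hZ1 w h
          rw [hw] at hl; simp at hl
          exact hm1 (hl ▸ hl')
    by_cases h1 : (Y ∩ ⋃₀ F (c i)).Nonempty
    · exact hmeet i j hij (fun x hx => by rw [Set.mem_ofPred_eq, mem_ed.1 (hYe hx)]; simp) hcij h1
    by_cases h2 : (Y ∩ ⋃₀ F (c j)).Nonempty
    · exact hmeet j i (Ne.symm hij) (fun x hx => by rw [Set.mem_ofPred_eq, mem_ed.1 (hYe hx)]; simp)
        (Ne.symm hcij) h2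
    refine ⟨c (σ s(i, j)), fun x hx => ?_⟩
    rw [mem_cls, Function.comp_apply, hpn, Function.comp_apply, mem_ed.1 (hYe hx)]
    intro l hl _ h4
    rw [mem_ed.1 (hYe hx), Sym2.mem_iff] at hl
    rcases hl with rfl | rfl
    · exact h1 ⟨x, hx, h4⟩
    · exact h2 ⟨x, hx, h4⟩
  have hall : ∀ Y ∈ 𝒟, ∃ k, Y ⊆ cls (c ∘ p) k ∨ Yᶜ ⊆ cls (c ∘ p) k := by
    intro Y hY
    obtain ⟨k, hk | hk⟩ := hH Y hY
    · obtain ⟨k, h⟩ := hresp Y hY k hk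
      exact ⟨k, Or.inl h⟩
    · rw [← hp0.hat_compl (hD.tight Y hY)] at hk
      obtain ⟨k, h⟩ := hresp Yᶜ (hD.compl Y hY) k hk
      exact ⟨k, Or.inr h⟩
  -- since all members of `𝒟` respect the partition, its classes are nested with them, and
  -- maximality of `𝒟` makes them members
  refine ⟨p, hc, fun k => hD.maximal _ ?_ fun Y hY => ?_, hall⟩
  · have := tight_preimage_congr hp0 (hc.tightFibers hpre) (fun f hf => hc0.mate_eq_mate hc hpre hf)
      (hJ k)
    exact this
  · obtain ⟨l, hl⟩ := hall Y hY
    exact nest_preimage {k} hl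

end MatchingSystem

end TightCuts

/-! ### Torsos of a maximal nested family -/

namespace TightCuts

namespace MatchingSystem

universe u

variable {V : Type*} {ι : Type*} {ι' : Type*} {κ κ' : Type*} {𝓢 : MatchingSystem V} {f g h : V → V}
  {t : Set (V → V)} {𝒟 : Set (Set V)}
  {A B S T U W X Y Z : Set V} {p : V → ι} {p' : V → ι'} {r : V → κ} {r' : V → κ'} {q : V → Sym2 ι}
  {q' : V → Sym2 ι'} {i j k : ι}

variable (𝓢) in
/-- The classes of `r` are the vertices of a torso of the family `𝒟`. At least three classes
means at least four, by `TightFibers.exists_fourth`. -/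
structure StarMap (𝒟 : Set (Set V)) (r : V → κ) : Prop where
  three : ∀ a b : κ, ∃ c, c ≠ a ∧ c ≠ b
  fibers : 𝓢.TightFibers r
  braced : 𝓢.Braced r
  mem : ∀ c, cls r c ∈ 𝒟

/-- A member of the family or its complement lies inside a single class of a torso. -/
theorem StarMap.exists_subset (hr : 𝓢.StarMap 𝒟 r) (hD : 𝓢.MaxNested 𝒟) (hY : Y ∈ 𝒟) :
    ∃ c, Y ⊆ cls r c ∨ Yᶜ ⊆ cls r c := by
  have key : ∀ Y ∈ 𝒟, ∀ c, 𝓢.hat r Y = {c} → Y ⊆ cls r c := by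
    intro Y hY c hc
    have hno : ∀ d, d ≠ c → 𝓢.par (Y ∩ cls r d) = 0 := by
      intro d hd
      rw [← notMem_hat, hc]; exact hd
    have hsub : ∀ d, d ≠ c → ¬ cls r d ⊆ Y := by
      intro d hd h
      have := hno d hd
      rw [Set.inter_eq_right.2 h, (hr.fibers d).par] at this
      exact absurd this (by decide)
    have hdis : ∀ d, d ≠ c → Disjoint Y (cls r d) := by
      intro d hd
      rcases hD.nest Y hY _ (hr.mem d) with h | h | h | h
      · exact h
      · exfalso
        have h1 : c ∈ 𝓢.hat r Y := by rw [hc]; rfl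
        rw [mem_hat, Set.disjoint_iff_inter_eq_empty.1 ((disjoint_cls hd).mono_left h), par_empty] at h1
        exact absurd h1 (by decide)
      · exact absurd h (hsub d hd)
      · exfalso
        obtain ⟨e, he1, he2⟩ := hr.three c d
        refine hsub e he1 fun x hx => ?_
        have : x ∈ Y ∪ cls r d := h ▸ Set.mem_univ x
        exact this.resolve_right fun h' => he2 ((mem_cls.1 hx).symm.trans h')
    intro x hx
    by_contra hx'
    exact Set.disjoint_left.1 (hdis (r x) hx') hx rfl
  rcases hr.braced _ (hr.fibers.tight_hat (hD.tight Y hY)) with ⟨c, hc⟩ | ⟨c, hc⟩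
  · exact ⟨c, Or.inl (key Y hY c hc)⟩
  · rw [← hr.fibers.hat_compl (hD.tight Y hY)] at hc
    exact ⟨c, Or.inr (key _ (hD.compl Y hY) c hc)⟩

theorem range_cls_subset (hr : 𝓢.TightFibers r)
    (h1 : ∀ c, ∃ c', cls r c ⊆ cls r' c') (h2 : ∀ c', ∃ c, cls r' c' ⊆ cls r c) :
    Set.range (cls r) ⊆ Set.range (cls r') := by
  rintro _ ⟨c, rfl⟩
  obtain ⟨c', hc'⟩ := h1 c
  obtain ⟨d, hd⟩ := h2 c'
  obtain ⟨x, hx⟩ := (hr c).nonempty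
  have : c = d := (mem_cls.1 hx).symm.trans (mem_cls.1 (hd (hc' hx)))
  subst this
  exact ⟨c', Set.Subset.antisymm hd hc'⟩

theorem range_cls_eq (hr : 𝓢.TightFibers r) (hr' : 𝓢.TightFibers r')
    (h1 : ∀ c, ∃ c', cls r c ⊆ cls r' c') (h2 : ∀ c', ∃ c, cls r' c' ⊆ cls r c) :
    Set.range (cls r) = Set.range (cls r') :=
  Set.Subset.antisymm (range_cls_subset hr h1 h2) (range_cls_subset hr' h2 h1)

/-- Every noncyclic torsoid is cleaved by a torso. -/
theorem Noncyclic.exists_starMap (hq : 𝓢.Noncyclic q) (hD : 𝓢.MaxNested 𝒟) :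
    ∃ p : V → ι, 𝓢.StarMap 𝒟 p ∧ ∀ i, ed q i i ⊆ cls p i := by
  have hg := hq.good
  obtain ⟨σ, hσ, hc⟩ := hg.toPreTorsoid.exists_compat
  have hp := hc.tightFibers hg.toPreTorsoid
  obtain ⟨-, -, p', hc', hb, -⟩ := hq
  have hb0 := hb.congr (hc'.tightFibers hg.toPreTorsoid) hp
    fun f hf => hc'.mate_eq_mate hc hg.toPreTorsoid hf
  obtain ⟨p, hcp, hmem, -⟩ := hg.exists_star hD hσ (c := id) Function.surjective_id hg.three
    (fun k => hp k) (fun Y hY => by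
      rcases hb0 _ (hp.tight_hat (hD.tight Y hY)) with ⟨i, hi⟩ | ⟨i, hi⟩
      · exact ⟨i, Or.inl hi.subset⟩
      · exact ⟨i, Or.inr hi.subset⟩)
  exact ⟨p, ⟨hg.three, hcp.tightFibers hg.toPreTorsoid,
    hb0.congr hp (hcp.tightFibers hg.toPreTorsoid)
      fun f hf => hc.mate_eq_mate hcp hg.toPreTorsoid hf, hmem⟩, fun i => hcp.node_subset⟩

theorem Noncyclic.exists_cls_subset (hq : 𝓢.Noncyclic q) (hD : 𝓢.MaxNested 𝒟)
    (hr : 𝓢.StarMap 𝒟 r) (hr' : 𝓢.StarMap 𝒟 r') (hcl : ∀ c, ∃ i, ed q i i ⊆ cls r c)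
    (hcl' : ∀ c, ∃ i, ed q i i ⊆ cls r' c) (c' : κ') : ∃ c, cls r' c' ⊆ cls r c := by
  obtain ⟨p, h, hc, -, -, hh⟩ := hq.exists_bijective hr.fibers hr.three hcl
  obtain ⟨c, hc' | hc'⟩ := hr.exists_subset hD (hr'.mem c')
  · exact ⟨c, hc'⟩
  · exfalso
    obtain ⟨d, hd, -⟩ := hr'.three c' c'
    obtain ⟨e, he, hed⟩ := hr'.three c' d
    have key : ∀ d, d ≠ c' → ∃ x, r' x = d ∧ p x = h.symm c := by
      intro d hd
      obtain ⟨i, hi⟩ := hcl' d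
      obtain ⟨x, hx⟩ := (hq.1.node i).nonempty
      refine ⟨x, hi hx, ?_⟩
      have h1 : r x = c := hc' fun h' => hd ((mem_cls.1 (hi hx)).symm.trans h')
      rw [Equiv.eq_symm_apply, hh, h1]
    obtain ⟨i, hi⟩ := hcl' d
    obtain ⟨j, hj⟩ := hcl' e
    obtain ⟨x, hx⟩ := (hq.1.node i).nonempty
    obtain ⟨y, hy⟩ := (hq.1.node j).nonempty
    have h1 : r x = c := hc' fun h' => hd ((mem_cls.1 (hi hx)).symm.trans h')
    have h2 : r y = c := hc' fun h' => he ((mem_cls.1 (hj hy)).symm.trans h')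
    have h3 : i = j := by
      apply h.injective
      rw [← mem_cls.1 (hc.node_subset hx), ← mem_cls.1 (hc.node_subset hy), hh, hh, h1, h2]
    subst h3
    exact hed ((mem_cls.1 (hj hx)).symm.trans (mem_cls.1 (hi hx)))

/-- Two torsos that cleave the same noncyclic torsoid are equal. -/
theorem Noncyclic.range_eq (hq : 𝓢.Noncyclic q) (hD : 𝓢.MaxNested 𝒟) (hr : 𝓢.StarMap 𝒟 r)
    (hr' : 𝓢.StarMap 𝒟 r') (hcl : ∀ c, ∃ i, ed q i i ⊆ cls r c)
    (hcl' : ∀ c, ∃ i, ed q i i ⊆ cls r' c) : Set.range (cls r) = Set.range (cls r') :=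
  range_cls_eq hr.fibers hr'.fibers (hq.exists_cls_subset hD hr' hr hcl' hcl)
    (hq.exists_cls_subset hD hr hr' hcl hcl')

/-- The hat of a tight set that contains a node and is disjoint from another node consists of the
nodes that the tight set contains, and the tight set is disjoint from all other nodes. -/
theorem Good.hat_eq_nodes (hq : 𝓢.Good q) (hc : 𝓢.Compat q p) (hY : 𝓢.Tight Y)
    (hi : ed q i i ⊆ Y) (hj : Disjoint Y (ed q j j)) :
    (∀ l, l ∈ 𝓢.hat p Y ↔ ed q l l ⊆ Y) ∧ ∀ l, l ∉ 𝓢.hat p Y → Disjoint Y (ed q l l) := by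
  have hne : ∀ l, ed q l l ⊆ Y → ¬ Disjoint Y (ed q l l) := by
    intro l h1 h2
    obtain ⟨x, hx⟩ := (hq.toPreTorsoid.node l).nonempty
    exact Set.disjoint_left.1 h2 (h1 hx) hx
  have h1 : ∀ l ∉ 𝓢.hat p Y, Disjoint Y (ed q l l) := by
    intro l hl
    by_cases h : (𝓢.hat p Y)ᶜ = {l}
    · by_cases hjl : j = l
      · rwa [← hjl]
      · exfalso
        have hjh : j ∈ 𝓢.hat p Y := by
          by_contra h'
          have : j ∈ (𝓢.hat p Y)ᶜ := h'
          rw [h] at this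
          exact hjl this
        refine hne j (hq.node_subset hc hY hjh fun h' => ?_) hj
        obtain ⟨m, hm1, hm2⟩ := hq.three l j
        have : m ∉ 𝓢.hat p Y := by rw [h']; exact hm2
        have : m ∈ (𝓢.hat p Y)ᶜ := this
        rw [h] at this
        exact hm1 this
    · exact hq.node_disjoint hc hY hl h
  refine ⟨fun l => ⟨fun hl => ?_, fun hl => ?_⟩, h1⟩
  · by_cases h : 𝓢.hat p Y = {l}
    · have : i ∈ 𝓢.hat p Y := by
        by_contra h'
        exact hne i hi (h1 i h')
      rw [h] at this
      rw [← Set.mem_singleton_iff.1 this]; exact hi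
    · exact hq.node_subset hc hY hl h
  · by_contra h'
    exact hne l hl (h1 l h')

/-- In a finite family of sets in which every set with more than one element is partitioned by
three other members such that all its proper subsets in the family lie inside one of the three,
the number of such sets below a member `K` is determined by the size of `K`. -/
theorem two_mul_ncard_add_one {α : Type*} [Finite α] {𝓛 : Set (Set α)} (hne : ∀ L ∈ 𝓛, L.Nonempty)
    (h3 : ∀ K ∈ 𝓛, K.Nontrivial → ∃ A ∈ 𝓛, ∃ B ∈ 𝓛, ∃ C ∈ 𝓛, Disjoint A B ∧ Disjoint A C ∧
      Disjoint B C ∧ A ∪ B ∪ C = K ∧ ∀ L ∈ 𝓛, L ⊂ K → L ⊆ A ∨ L ⊆ B ∨ L ⊆ C) :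
    ∀ K ∈ 𝓛, 2 * {L | L ∈ 𝓛 ∧ L.Nontrivial ∧ L ⊆ K}.ncard + 1 = K.ncard := by
  suffices h : ∀ n, ∀ K ∈ 𝓛, K.ncard = n →
      2 * {L | L ∈ 𝓛 ∧ L.Nontrivial ∧ L ⊆ K}.ncard + 1 = K.ncard from fun K hK => h _ K hK rfl
  intro n
  induction n using Nat.strong_induction_on with
  | _ n ih =>
    rintro K hK rfl
    by_cases hnt : K.Nontrivial
    · obtain ⟨A, hA, B, hB, C, hC, hAB, hAC, hBC, hu, hsub⟩ := h3 K hK hnt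
      have hd : ∀ {A B}, B ∈ 𝓛 → Disjoint A B → B ⊆ K → A ⊆ K → A.ncard < K.ncard := by
        intro A B hB hAB hBK hAK
        refine Set.ncard_lt_ncard (Set.ssubset_iff_subset_ne.2 ⟨hAK, ?_⟩)
        rintro rfl
        obtain ⟨x, hx⟩ := hne B hB
        exact Set.disjoint_left.1 hAB (hBK hx) hx
      have hAK : A ⊆ K := by rw [← hu]; exact Set.subset_union_left.trans Set.subset_union_left
      have hBK : B ⊆ K := by rw [← hu]; exact Set.subset_union_right.trans Set.subset_union_left
      have hCK : C ⊆ K := by rw [← hu]; exact Set.subset_union_right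
      have hKc : K.ncard = A.ncard + B.ncard + C.ncard := by
        rw [← hu, Set.ncard_union_eq (Set.disjoint_union_left.2 ⟨hAC, hBC⟩), Set.ncard_union_eq hAB]
      have iA := ih _ (hd hB hAB hBK hAK) A hA rfl
      have iB := ih _ (hd hA hAB.symm hAK hBK) B hB rfl
      have iC := ih _ (hd hA hAC.symm hAK hCK) C hC rfl
      -- the members with more than one element below `K` are `K` itself and those below the three
      -- parts
      have hset : {L | L ∈ 𝓛 ∧ L.Nontrivial ∧ L ⊆ K} = {K} ∪ ({L | L ∈ 𝓛 ∧ L.Nontrivial ∧ L ⊆ A} ∪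
          {L | L ∈ 𝓛 ∧ L.Nontrivial ∧ L ⊆ B} ∪ {L | L ∈ 𝓛 ∧ L.Nontrivial ∧ L ⊆ C}) := by
        ext L
        constructor
        · rintro ⟨h1, h2, h4⟩
          by_cases hLK : L = K
          · exact Or.inl hLK
          · right
            rcases hsub L h1 (Set.ssubset_iff_subset_ne.2 ⟨h4, hLK⟩) with h | h | h
            · exact Or.inl (Or.inl ⟨h1, h2, h⟩)
            · exact Or.inl (Or.inr ⟨h1, h2, h⟩)
            · exact Or.inr ⟨h1, h2, h⟩
        · rintro (rfl | (⟨h1, h2, h⟩ | ⟨h1, h2, h⟩) | ⟨h1, h2, h⟩)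
          · exact ⟨hK, hnt, Set.Subset.rfl⟩
          · exact ⟨h1, h2, h.trans hAK⟩
          · exact ⟨h1, h2, h.trans hBK⟩
          · exact ⟨h1, h2, h.trans hCK⟩
      have hdis : ∀ {A B : Set α}, Disjoint A B → Disjoint {L | L ∈ 𝓛 ∧ L.Nontrivial ∧ L ⊆ A}
          {L | L ∈ 𝓛 ∧ L.Nontrivial ∧ L ⊆ B} := by
        intro A B hAB
        refine Set.disjoint_left.2 ?_
        rintro L ⟨h1, h2, h4⟩ ⟨-, -, h5⟩
        obtain ⟨x, hx⟩ := hne L h1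
        exact Set.disjoint_left.1 hAB (h4 hx) (h5 hx)
      have hnK : ∀ {A}, A.ncard < K.ncard → K ∉ {L | L ∈ 𝓛 ∧ L.Nontrivial ∧ L ⊆ A} := by
        rintro A hA ⟨-, -, h⟩
        exact absurd (Set.ncard_le_ncard h) (by omega)
      rw [hset, Set.ncard_union_eq, Set.ncard_union_eq, Set.ncard_union_eq (hdis hAB),
        Set.ncard_singleton]
      · omega
      · exact Set.disjoint_union_left.2 ⟨hdis hAC, hdis hBC⟩
      · rw [Set.disjoint_singleton_left]
        rintro ((h | h) | h)
        · exact hnK (hd hB hAB hBK hAK) h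
        · exact hnK (hd hA hAB.symm hAK hBK) h
        · exact hnK (hd hA hAC.symm hAK hCK) h
    · have h0 : {L | L ∈ 𝓛 ∧ L.Nontrivial ∧ L ⊆ K} = ∅ := by
        refine Set.eq_empty_iff_forall_notMem.2 ?_
        rintro L ⟨-, h1, h2⟩
        exact hnt (h1.mono h2)
      obtain ⟨a, ha⟩ := hne K hK
      have : K = {a} := (Set.not_nontrivial_iff.1 hnt).eq_singleton_of_mem ha
      rw [h0, this]; simp

/-- The parity of a union of finitely many classes is that of the number of classes. -/
theorem TightFibers.par_preimage (hp : 𝓢.TightFibers p) {I : Set ι} (hI : I.Finite) :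
    𝓢.FinCut (p ⁻¹' I) ∧ 𝓢.par (p ⁻¹' I) = I.ncard := by
  induction I, hI using Set.Finite.induction_on with
  | empty => 
    have : exits 𝓢.base (p ⁻¹' (∅ : Set ι)) = ∅ := by ext; simp [exits]
    simpa using par_eq_zero_of_exits 𝓢.base_mem this
  | @insert a s ha hs ih =>
    have e1 : p ⁻¹' (insert a s) = cls p a ∪ p ⁻¹' s := by ext x; simp [mem_cls]
    have hd : Disjoint (cls p a) (p ⁻¹' s) := by
      refine Set.disjoint_left.2 fun x hx hx' => ha ?_
      rw [← mem_cls.1 hx]; exact hx'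
    rw [e1, par_union_of_disjoint (hp a).finCut ih.1 hd, ih.2, (hp a).par,
      Set.ncard_insert_of_notMem ha hs]
    exact ⟨(hp a).finCut.union ih.1, by push_cast; ring⟩

/-- A partition into four tight sets has only trivial tight sets of classes, by parity. -/
theorem TightFibers.braced_of_four (hp : 𝓢.TightFibers p) {a b c d : ι}
    (h : ∀ x, x = a ∨ x = b ∨ x = c ∨ x = d) : 𝓢.Braced p := by
  have hu : (Set.univ : Set ι) = {a, b, c, d} := by
    ext x; simpa using h x
  have hfin : Finite ι := Set.finite_univ_iff.1 (hu ▸ Set.toFinite _)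
  have hodd : ∀ I : Set ι, 𝓢.Tight (p ⁻¹' I) → I.ncard % 2 = 1 := by
    intro I hI
    have := (hp.par_preimage (Set.toFinite I)).2
    rw [hI.par] at this
    have h1 : ((1 : ℕ) : ZMod 2) = (I.ncard : ZMod 2) := by simpa using this
    rw [ZMod.natCast_eq_natCast_iff'] at h1
    omega
  intro I hI
  have h1 := hodd I hI
  have h2 := hodd Iᶜ hI.compl
  have h4 := Set.ncard_add_ncard_compl I
  have h5 : Nat.card ι ≤ 4 := by
    rw [← Set.ncard_univ, hu]
    refine (Set.ncard_insert_le _ _).trans ?_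
    have := Set.ncard_insert_le b {c, d}
    have := Set.ncard_insert_le c {d}
    rw [Set.ncard_singleton] at this
    omega
  have h6 : I.ncard = 1 ∨ Iᶜ.ncard = 1 := by omega
  rcases h6 with h6 | h6
  · exact Or.inl (Set.ncard_eq_one.1 h6)
  · exact Or.inr (Set.ncard_eq_one.1 h6)

end MatchingSystem

end TightCuts

/-! ### Hats of the family on a cyclic torsoid -/

namespace TightCuts

namespace MatchingSystem

universe u

variable {V : Type*} {ι : Type*} {κ κ' : Type*} {𝓢 : MatchingSystem V} {f g h : V → V}
  {t : Set (V → V)} {𝒟 : Set (Set V)}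
  {A B S T U W X Y Z : Set V} {p : V → ι} {r : V → κ} {r' : V → κ'} {q : V → Sym2 ι} {i j k o : ι}

/-- If the torso `r` cleaves the torsoid `q`, every node of `q` lies in exactly one class of `r`. -/
theorem StarMap.exists_nodeMap (hr : 𝓢.StarMap 𝒟 r) (hq : 𝓢.Good q)
    (hcl : ∀ c, ∃ i, ed q i i ⊆ cls r c) :
    ∃ h : ι → κ, Function.Surjective h ∧ ∀ i c, (ed q i i ⊆ cls r c ↔ h i = c) ∧
      (h i ≠ c → Disjoint (cls r c) (ed q i i)) := by
  obtain ⟨p, h, hc, hh⟩ := hq.exists_refinement hr.fibers hr.three hcl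
  have h1 : ∀ i, ed q i i ⊆ cls r (h i) := fun i x hx => by
    rw [mem_cls, ← hh, mem_cls.1 (hc.node_subset hx)]
  refine ⟨h, fun c => ?_, fun i c => ⟨⟨fun h2 => ?_, fun h2 => h2 ▸ h1 i⟩, fun h2 => ?_⟩⟩
  · obtain ⟨x, hx⟩ := hr.fibers.surjective c
    exact ⟨p x, by rw [hh, hx]⟩
  · obtain ⟨x, hx⟩ := (hq.toPreTorsoid.node i).nonempty
    exact (mem_cls.1 (h1 i hx)).symm.trans (mem_cls.1 (h2 hx))
  · exact ((disjoint_cls h2).mono_left (h1 i)).symm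

variable (𝓢) in
/-- The sets of classes of `p` that avoid `o` and are hats of members of the family `𝒟` or
trivial, that is, singletons or the complement of `o`. -/
def hats (𝒟 : Set (Set V)) (p : V → ι) (o : ι) : Set (Set ι) :=
  {K | o ∉ K ∧ ((∃ i, K = {i}) ∨ K = {o}ᶜ ∨ ∃ Y ∈ 𝒟, K = 𝓢.hat p Y)}

theorem MaxNested.tight_of_mem_hats (hD : 𝓢.MaxNested 𝒟) (hp : 𝓢.TightFibers p) {K : Set ι}
    (hK : K ∈ 𝓢.hats 𝒟 p o) : 𝓢.Tight (p ⁻¹' K) := by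
  obtain ⟨-, ⟨i, rfl⟩ | rfl | ⟨Y, hY, rfl⟩⟩ := hK
  · exact hp i
  · exact (hp o).compl
  · exact hp.tight_hat (hD.tight Y hY)

theorem MaxNested.nonempty_of_mem_hats (hD : 𝓢.MaxNested 𝒟) (hp : 𝓢.TightFibers p) {K : Set ι}
    (hK : K ∈ 𝓢.hats 𝒟 p o) : K.Nonempty := by
  obtain ⟨x, hx⟩ := (hD.tight_of_mem_hats hp hK).nonempty
  exact ⟨p x, hx⟩

/-- The hats form a laminar family. -/
theorem Good.laminar_hats (hq : 𝓢.Good q) (hD : 𝓢.MaxNested 𝒟) (hc : 𝓢.Compat q p) {K L : Set ι}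
    (hK : K ∈ 𝓢.hats 𝒟 p o) (hL : L ∈ 𝓢.hats 𝒟 p o) : Disjoint K L ∨ K ⊆ L ∨ L ⊆ K := by
  have triv : ∀ {K L : Set ι}, o ∉ L → ((∃ i, K = {i}) ∨ K = {o}ᶜ) →
      Disjoint K L ∨ K ⊆ L ∨ L ⊆ K := by
    rintro K L hL (⟨i, rfl⟩ | rfl)
    · by_cases hi : i ∈ L
      · exact Or.inr (Or.inl (Set.singleton_subset_iff.2 hi))
      · exact Or.inl (Set.disjoint_singleton_left.2 hi)
    · exact Or.inr (Or.inr fun x hx hx' => hL (Set.mem_singleton_iff.1 hx' ▸ hx))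
  by_cases hK1 : (∃ i, K = {i}) ∨ K = {o}ᶜ
  · exact triv hL.1 hK1
  by_cases hL1 : (∃ i, L = {i}) ∨ L = {o}ᶜ
  · rcases triv hK.1 hL1 with h | h | h
    · exact Or.inl h.symm
    · exact Or.inr (Or.inr h)
    · exact Or.inr (Or.inl h)
  -- a nontrivial hat consists of the nodes inside the member of `𝒟` that it comes from
  have key : ∀ {K}, K ∈ 𝓢.hats 𝒟 p o → ¬ ((∃ i, K = {i}) ∨ K = {o}ᶜ) → ∃ Y ∈ 𝒟,
      (∀ i ∈ K, ed q i i ⊆ Y) ∧ ∀ i ∉ K, Disjoint Y (ed q i i) := by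
    rintro K ⟨ho, hK⟩ hK1
    obtain ⟨Y, hY, rfl⟩ := (hK.resolve_left fun h => hK1 (Or.inl h)).resolve_left
      fun h => hK1 (Or.inr h)
    rw [not_or] at hK1
    refine ⟨Y, hY, fun i hi => hq.node_subset hc (hD.tight Y hY) hi fun h => hK1.1 ⟨i, h⟩,
      fun i hi => hq.node_disjoint hc (hD.tight Y hY) hi fun h => hK1.2 ?_⟩
    have : o ∈ (𝓢.hat p Y)ᶜ := ho
    rw [h] at this
    rw [Set.mem_singleton_iff.1 this, ← h, compl_compl]
  obtain ⟨Y, hY, hY1, hY2⟩ := key hK hK1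
  obtain ⟨Z, hZ, hZ1, hZ2⟩ := key hL hL1
  have hn : ∀ i, ∃ x, x ∈ ed q i i := fun i => (hq.toPreTorsoid.node i).nonempty
  rcases hD.nest Y hY Z hZ with h | h | h | h
  · left
    refine Set.disjoint_left.2 fun i hi hi' => ?_
    obtain ⟨x, hx⟩ := hn i
    exact Set.disjoint_left.1 h (hY1 i hi hx) (hZ1 i hi' hx)
  · refine Or.inr (Or.inl fun i hi => ?_)
    obtain ⟨x, hx⟩ := hn i
    by_contra hi'
    exact Set.disjoint_left.1 (hZ2 i hi') (h (hY1 i hi hx)) hx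
  · refine Or.inr (Or.inr fun i hi => ?_)
    obtain ⟨x, hx⟩ := hn i
    by_contra hi'
    exact Set.disjoint_left.1 (hY2 i hi') (h (hZ1 i hi hx)) hx
  · exfalso
    obtain ⟨x, hx⟩ := hn o
    have : x ∈ Y ∪ Z := h ▸ Set.mem_univ x
    rcases this with h' | h'
    · exact Set.disjoint_left.1 (hY2 o hK.1) h' hx
    · exact Set.disjoint_left.1 (hZ2 o hL.1) h' hx

/-- The classes of a torso that cleaves a cyclic torsoid: the nodes outside the class `c₀` with
the node `o` form a hat, and the other classes are three, whose nodes form the maximal hats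
properly below it. -/
theorem Cyclic.hats_of_starMap (hq : 𝓢.Cyclic q) (hD : 𝓢.MaxNested 𝒟) (hc : 𝓢.Compat q p)
    (hr : 𝓢.StarMap 𝒟 r) (hcl : ∀ c, ∃ i, ed q i i ⊆ cls r c) {c₀ : κ} (ho : ed q o o ⊆ cls r c₀) :
    {i | ¬ ed q i i ⊆ cls r c₀} ∈ 𝓢.hats 𝒟 p o ∧ {i | ¬ ed q i i ⊆ cls r c₀}.Nontrivial ∧
    ∃ A ∈ 𝓢.hats 𝒟 p o, ∃ B ∈ 𝓢.hats 𝒟 p o, ∃ C ∈ 𝓢.hats 𝒟 p o, Disjoint A B ∧ Disjoint A C ∧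
      Disjoint B C ∧ A ∪ B ∪ C = {i | ¬ ed q i i ⊆ cls r c₀} ∧
      ∀ L ∈ 𝓢.hats 𝒟 p o, L ⊂ {i | ¬ ed q i i ⊆ cls r c₀} → L ⊆ A ∨ L ⊆ B ∨ L ⊆ C := by
  have hg := hq.good
  have hp := hc.tightFibers hg.toPreTorsoid
  obtain ⟨t, hrt⟩ := hq.ring_of_cleaves hr.fibers hr.three hcl
  obtain ⟨h, hs, hh⟩ := hr.exists_nodeMap hg hcl
  have hho : h o = c₀ := (hh o c₀).1.1 ho
  obtain ⟨g, hg', hfg⟩ := hrt.exists_other 𝓢.base_mem c₀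
  rw [← hrt.mate_eq _ 𝓢.base_mem g hg' c₀] at hfg
  -- the collapse of `r` is a cycle of length four, consisting of `c₀`, its neighbours `j`, `k`,
  -- and `l`
  obtain ⟨-, hj, hk, l, hl1, hl2, hl3, hall⟩ := Braced.ring_of_mates hr.fibers hr.braced hr.three hfg
    fun f hf => (hrt.mate_of_ne 𝓢.base_mem hg' hfg hf).imp (fun h => by rw [h]) fun h => by rw [h]
  set j := mate r 𝓢.base c₀
  set k := mate r g c₀
  have hN : ∀ c, {i | ed q i i ⊆ cls r c} = h ⁻¹' {c} := by
    intro c; ext i; exact (hh i c).1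
  have hhat : ∀ c, 𝓢.hat p (cls r c) = h ⁻¹' {c} := by
    intro c
    obtain ⟨i, hi⟩ := hs c
    obtain ⟨d, hd, -⟩ := hr.three c c
    obtain ⟨m, hm⟩ := hs d
    rw [← hN]
    ext x
    exact (hg.hat_eq_nodes hc (hr.fibers c) ((hh i c).1.2 hi)
      ((hh m c).2 (by rw [hm]; exact hd))).1 x
  have hK : {i | ¬ ed q i i ⊆ cls r c₀} = (h ⁻¹' {c₀})ᶜ := by rw [← hN]; rfl
  have hmem : ∀ c, c ≠ c₀ → h ⁻¹' {c} ∈ 𝓢.hats 𝒟 p o := fun c hc' =>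
    ⟨fun h' => hc' ((show h o = c from h').symm.trans hho),
      Or.inr (Or.inr ⟨_, hr.mem c, (hhat c).symm⟩)⟩
  have hdis : ∀ c d, c ≠ d → Disjoint (h ⁻¹' {c}) (h ⁻¹' {d}) := fun c d hcd =>
    Disjoint.preimage h (by simpa using hcd)
  rw [hK]
  refine ⟨⟨fun h' => h' hho, Or.inr (Or.inr ⟨_, hD.compl _ (hr.mem c₀), ?_⟩)⟩, ?_,
    _, hmem j hj, _, hmem k hk, _, hmem l hl1, hdis _ _ hfg, hdis _ _ hl2.symm, hdis _ _ hl3.symm,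
    ?_, ?_⟩
  · rw [hp.hat_compl (hr.fibers c₀), hhat]
  · obtain ⟨a, ha⟩ := hs j
    obtain ⟨b, hb⟩ := hs k
    refine ⟨a, ?_, b, ?_, ?_⟩
    · rw [Set.mem_compl_iff, Set.mem_preimage, ha]; exact hj
    · rw [Set.mem_compl_iff, Set.mem_preimage, hb]; exact hk
    · rintro rfl; exact hfg (ha.symm.trans hb)
  · ext i
    simp only [Set.mem_union, Set.mem_preimage, Set.mem_singleton_iff, Set.mem_compl_iff]
    have := hall (h i)
    constructor
    · rintro ((h1 | h1) | h1) <;> rw [h1] <;> assumption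
    · tauto
  -- `L` comes from a member of `𝒟`, which lies inside one class of `r`
  · intro L hL hLK
    by_cases hL1 : ∃ i, L = {i}
    · obtain ⟨i, rfl⟩ := hL1
      have h1 : h i ≠ c₀ := hLK.1 rfl
      simp only [Set.singleton_subset_iff, Set.mem_preimage, Set.mem_singleton_iff]
      have := hall (h i)
      tauto
    obtain ⟨hoL, ⟨i, rfl⟩ | rfl | ⟨Y, hY, rfl⟩⟩ := hL
    · exact absurd ⟨i, rfl⟩ hL1
    · exfalso
      refine hLK.2 fun i hi hi' => hi ?_
      rw [Set.mem_singleton_iff.1 hi']; exact hho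
    have hYt := hD.tight Y hY
    have hsub : ∀ i ∈ 𝓢.hat p Y, ed q i i ⊆ Y := fun i hi =>
      hg.node_subset hc hYt hi fun h' => hL1 ⟨i, h'⟩
    obtain ⟨c, hcY | hcY⟩ := hr.exists_subset hD hY
    · have h1 : 𝓢.hat p Y ⊆ h ⁻¹' {c} := fun i hi => (hh i c).1.1 ((hsub i hi).trans hcY)
      have h2 : c ≠ c₀ := by
        rintro rfl
        obtain ⟨i, hi⟩ := hp.hat_nonempty hYt
        exact hLK.1 hi (h1 hi)
      rcases hall c with h4 | h4 | h4 | h4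
      · exact absurd h4 h2
      · exact Or.inl (h4 ▸ h1)
      · exact Or.inr (Or.inl (h4 ▸ h1))
      · exact Or.inr (Or.inr (h4 ▸ h1))
    · exfalso
      -- the complement of `Y` contains the node `o`
      have hco : ∀ m ∉ 𝓢.hat p Y, (𝓢.hat p Y)ᶜ ≠ {m} := by
        intro m hm h'
        have h1 : 𝓢.hat p Y = {m}ᶜ := by rw [← h', compl_compl]
        have h2 : o = m := by
          by_contra h2
          exact hoL (h1 ▸ h2)
        refine hLK.2 fun i hi => ?_
        rw [h1, ← h2]
        rintro rfl
        exact hi hho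
      have hdY : ∀ m ∉ 𝓢.hat p Y, ed q m m ⊆ Yᶜ := fun m hm =>
        Set.disjoint_left.1 (hg.node_disjoint hc hYt hm (hco m hm)).symm
      have h1 : h o = c := (hh o c).1.1 ((hdY o hoL).trans hcY)
      refine hLK.2 fun i hi => ?_
      by_contra hi'
      apply hi
      rw [Set.mem_preimage, Set.mem_singleton_iff, ← hho, h1]
      exact (hh i c).1.1 ((hdY i hi').trans hcY)

theorem three_of_distinct {α : Type*} {x y z : α} (hxy : x ≠ y) (hxz : x ≠ z) (hyz : y ≠ z) (a b : α) :
    ∃ c, c ≠ a ∧ c ≠ b := by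
  by_cases h1 : x ≠ a ∧ x ≠ b
  · exact ⟨x, h1⟩
  by_cases h2 : y ≠ a ∧ y ≠ b
  · exact ⟨y, h2⟩
  by_cases h3 : z ≠ a ∧ z ≠ b
  · exact ⟨z, h3⟩
  exfalso
  rw [not_and_or, not_ne_iff, not_ne_iff] at h1 h2 h3
  rcases h1 with h1 | h1 <;> rcases h2 with h2 | h2 <;> rcases h3 with h3 | h3 <;> subst_vars <;>
    first | exact hxy rfl | exact hxz rfl | exact hyz rfl

/-- Every hat with more than one class arises from a torso. -/
theorem Cyclic.exists_starMap {ι : Type u} {q : V → Sym2 ι} {o : ι} [Finite ι] (hq : 𝓢.Cyclic q)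
    (hD : 𝓢.MaxNested 𝒟) {σ : Sym2 ι → ι} (hσ : ∀ e, σ e ∈ e) {K : Set ι}
    (hK : K ∈ 𝓢.hats 𝒟 (σ ∘ q) o) (hnt : K.Nontrivial) :
    ∃ (κ : Type u) (r : V → κ), 𝓢.StarMap 𝒟 r ∧ (∀ c, ∃ i, ed q i i ⊆ cls r c) ∧
      ∃ c₀, ed q o o ⊆ cls r c₀ ∧ {i | ¬ ed q i i ⊆ cls r c₀} = K := by
  classical
  have hg := hq.good
  have hc := hg.toPreTorsoid.compat_orientation hσ
  have hp := hc.tightFibers hg.toPreTorsoid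
  set p := σ ∘ q with hpdef
  have hlam := fun {K L : Set ι} (hK : K ∈ 𝓢.hats 𝒟 p o) (hL : L ∈ 𝓢.hats 𝒟 p o) =>
    hg.laminar_hats hD hc hK hL
  -- `m i` is the largest hat properly below `K` that contains `i`
  have hex : ∀ i, ∃ m, i ∈ K → m ∈ 𝓢.hats 𝒟 p o ∧ i ∈ m ∧ m ⊂ K ∧
      ∀ L ∈ 𝓢.hats 𝒟 p o, i ∈ L → L ⊂ K → L ⊆ m := by
    intro i
    by_cases hi : i ∈ K
    · have hsing : {i} ∈ {L | L ∈ 𝓢.hats 𝒟 p o ∧ i ∈ L ∧ L ⊂ K} := by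
        refine ⟨⟨fun h => hK.1 (Set.mem_singleton_iff.1 h ▸ hi), Or.inl ⟨i, rfl⟩⟩, rfl, ?_⟩
        refine Set.ssubset_iff_subset_ne.2 ⟨Set.singleton_subset_iff.2 hi, ?_⟩
        rintro rfl
        exact Set.not_nontrivial_singleton hnt
      obtain ⟨m, -, hm⟩ := (Set.toFinite {L | L ∈ 𝓢.hats 𝒟 p o ∧ i ∈ L ∧ L ⊂ K}).exists_le_maximal
        hsing
      refine ⟨m, fun _ => ⟨hm.1.1, hm.1.2.1, hm.1.2.2, fun L hL hiL hLK => ?_⟩⟩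
      rcases hlam hL hm.1.1 with h | h | h
      · exact absurd hm.1.2.1 (Set.disjoint_left.1 h hiL)
      · exact h
      · exact hm.2 ⟨hL, hiL, hLK⟩ h
    · exact ⟨∅, fun h => absurd h hi⟩
  choose m hm using hex
  have hmm : ∀ i ∈ K, ∀ j ∈ m i, m j = m i := by
    intro i hi j hj
    obtain ⟨h1, h2, h3, h4⟩ := hm i hi
    obtain ⟨g1, g2, g3, g4⟩ := hm j (h3.1 hj)
    have h5 := g4 _ h1 hj h3
    exact Set.Subset.antisymm (h4 _ g1 (h5 h2) g3) h5
  -- the sets `m i` partition `K`; together with the complement of `K` they partition the nodes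
  let c : ι → Set ι := fun i => if i ∈ K then m i else Kᶜ
  have cK : ∀ i ∈ K, c i = m i := fun i hi => if_pos hi
  have cK' : ∀ i ∉ K, c i = Kᶜ := fun i hi => if_neg hi
  have hcc : ∀ i j, c j = c i ↔ j ∈ c i := by
    intro i j
    by_cases hi : i ∈ K
    · rw [cK i hi]
      obtain ⟨h1, h2, h3, h4⟩ := hm i hi
      constructor
      · intro h
        by_cases hj : j ∈ K
        · rw [cK j hj] at h
          rw [← h]; exact (hm j hj).2.1
        · rw [cK' j hj] at h
          rw [← h]; exact hj
      · intro h
        rw [cK j (h3.1 h)]; exact hmm i hi j h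
    · rw [cK' i hi]
      constructor
      · intro h
        by_cases hj : j ∈ K
        · rw [cK j hj] at h
          rw [← h]; exact (hm j hj).2.1
        · exact hj
      · intro h; exact cK' j h
  let c' : ι → Set.range c := Set.rangeFactorization c
  have hcs : Function.Surjective c' := Set.rangeFactorization_surjective
  have hc' : ∀ i j, c' i = c' j ↔ c i = c j := fun i j => Subtype.ext_iff
  have hfib : ∀ i, c' ⁻¹' {c' i} = c i := by
    intro i; ext j
    rw [Set.mem_preimage, Set.mem_singleton_iff, hc', hcc]
  have ho := hK.1
  obtain ⟨x, hx⟩ := hnt.nonempty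
  obtain ⟨y, hy, hyx⟩ := Set.exists_of_ssubset (hm x hx).2.2.1
  have h3 : ∀ a b : Set.range c, ∃ d, d ≠ a ∧ d ≠ b := by
    have hne : ∀ i ∈ K, c' o ≠ c' i := by
      intro i hi h
      rw [hc', hcc, cK i hi] at h
      exact ho ((hm i hi).2.2.1.1 h)
    refine three_of_distinct (hne x hx) (hne y hy) fun h => hyx ?_
    rw [hc', eq_comm, hcc, cK x hx] at h
    exact h
  -- by laminarity every member of `𝒟` respects this partition of the nodes, so `Good.exists_star`
  -- applies
  obtain ⟨p', hcp, hmem, hresp⟩ := hg.exists_star hD hσ hcs h3 (fun k => by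
      obtain ⟨i, rfl⟩ := hcs k
      rw [hfib]
      by_cases hi : i ∈ K
      · rw [cK i hi]; exact hD.tight_of_mem_hats hp (hm i hi).1
      · rw [cK' i hi]; exact (hD.tight_of_mem_hats hp hK).compl)
    (by
      have key : ∀ Y ∈ 𝒟, o ∉ 𝓢.hat p Y → ∃ k, 𝓢.hat p Y ⊆ c' ⁻¹' {k} ∨ (𝓢.hat p Y)ᶜ ⊆ c' ⁻¹' {k} := by
        intro Y hY hoY
        have hL : 𝓢.hat p Y ∈ 𝓢.hats 𝒟 p o := ⟨hoY, Or.inr (Or.inr ⟨Y, hY, rfl⟩)⟩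
        have hoc : c' ⁻¹' {c' o} = Kᶜ := by rw [hfib, cK' o ho]
        by_cases hsub : K ⊆ 𝓢.hat p Y
        · exact ⟨c' o, Or.inr (by rw [hoc]; exact Set.compl_subset_compl.2 hsub)⟩
        rcases hlam hL hK with h | h | h
        · exact ⟨c' o, Or.inl (by rw [hoc]; exact Set.subset_compl_iff_disjoint_right.2 h)⟩
        · obtain ⟨i, hi⟩ := hp.hat_nonempty (hD.tight Y hY)
          refine ⟨c' i, Or.inl ?_⟩
          rw [hfib, cK i (h hi)]
          exact (hm i (h hi)).2.2.2 _ hL hi ⟨h, hsub⟩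
        · exact absurd h hsub
      intro Y hY
      by_cases hoY : o ∈ 𝓢.hat p Y
      · have h1 := hp.hat_compl (hD.tight Y hY)
        obtain ⟨k, hk⟩ := key Yᶜ (hD.compl Y hY) (by rw [h1]; exact fun h => h hoY)
        rw [h1, compl_compl] at hk
        exact ⟨k, hk.symm⟩
      · exact key Y hY hoY)
  have hpc := hcp.tightFibers hg.toPreTorsoid
  have hP : 𝓢.TightFibers (c' ∘ p') := fun k => hD.tight _ (hmem k)
  have hnode : ∀ i, ed q i i ⊆ cls (c' ∘ p') (c' i) := by
    intro i z hz
    rw [mem_cls, Function.comp_apply, mem_cls.1 (hcp.node_subset hz)]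
  have hnode' : ∀ i a, c' i ≠ a → Disjoint (cls (c' ∘ p') a) (ed q i i) := fun i a hia =>
    ((disjoint_cls hia).mono_left (hnode i)).symm
  obtain ⟨t, hrt⟩ := hq.ring_of_cleaves hP h3 fun k => by
    obtain ⟨i, rfl⟩ := hcs k
    exact ⟨i, hnode i⟩
  set P := c' ∘ p' with hPdef
  obtain ⟨g, hg', hfg⟩ := hrt.exists_other 𝓢.base_mem (c' o)
  -- The classes form a ring. A class `a` that is not adjacent to the class of `o` is, together
  -- with its two neighbours, a member of `𝒟`. The hat of this member lies below `K` and is not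
  -- below a single `m i`, so it is `K`. Hence there are only four classes.
  obtain ⟨a, ha1, ha2, ha3⟩ := hP.exists_fourth h3 (c' o) (mate P 𝓢.base (c' o)) (mate P g (c' o))
  have hfga : mate P 𝓢.base a ≠ mate P g a := by
    rwa [Ne, hrt.mate_eq _ 𝓢.base_mem g hg']
  have hbo : mate P 𝓢.base a ≠ c' o := fun h =>
    ha2 ((hP.mate_eq_comm 𝓢.base_mem).1 h).symm
  have hdo : mate P g a ≠ c' o := fun h => ha3 ((hP.mate_eq_comm hg').1 h).symm
  have hba := hP.mate_ne 𝓢.base_mem a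
  have hda := hP.mate_ne hg' a
  set b := mate P 𝓢.base a
  set d := mate P g a
  have hZ := hP.tight_triple hba hda hfga
    fun f hf => (hrt.mate_of_ne 𝓢.base_mem hg' hfga hf).imp (fun h => by rw [h]) fun h => by rw [h]
  have hZD : P ⁻¹' {a, b, d} ∈ 𝒟 := hD.maximal _ hZ fun Y hY => by
    obtain ⟨k, hk⟩ := hresp Y hY
    exact nest_preimage _ hk
  obtain ⟨i, hi⟩ := hcs a
  obtain ⟨j, hj⟩ := hcs b
  have hoab : c' o ∉ ({a, b, d} : Set (Set.range c)) := by
    rintro (h | h | h)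
    · exact ha1 h.symm
    · exact hbo h.symm
    · exact hdo h.symm
  have hsubZ : ∀ l, c' l ∈ ({a, b, d} : Set (Set.range c)) → ed q l l ⊆ P ⁻¹' {a, b, d} := by
    intro l hl z hz
    have := hnode l hz
    rw [Set.mem_preimage, mem_cls.1 this]; exact hl
  have hdisZ : ∀ l, c' l ∉ ({a, b, d} : Set (Set.range c)) → Disjoint (P ⁻¹' {a, b, d}) (ed q l l) := by
    intro l hl
    refine Set.disjoint_left.2 fun z hz hz' => hl ?_
    rwa [Set.mem_preimage, mem_cls.1 (hnode l hz')] at hz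
  have hhatZ : 𝓢.hat p (P ⁻¹' {a, b, d}) = c' ⁻¹' {a, b, d} := by
    have h1 := (hg.hat_eq_nodes hc hZ (hsubZ i (by rw [hi]; simp)) (hdisZ o hoab)).1
    ext l
    rw [h1]
    constructor
    · intro h2
      by_contra h4
      obtain ⟨z, hz⟩ := (hg.toPreTorsoid.node l).nonempty
      exact Set.disjoint_left.1 (hdisZ l h4) (h2 hz) hz
    · exact hsubZ l
  have hQ : c' ⁻¹' {a, b, d} ∈ 𝓢.hats 𝒟 p o := ⟨hoab, Or.inr (Or.inr ⟨_, hZD, hhatZ.symm⟩)⟩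
  have hQK : c' ⁻¹' {a, b, d} ⊆ K := by
    intro l hl
    by_contra hlK
    have : c' l = c' o := by rw [hc', cK' l hlK, cK' o ho]
    rw [Set.mem_preimage, this] at hl
    exact hoab hl
  have hQe : K ⊆ c' ⁻¹' {a, b, d} := by
    by_contra hcon
    have hiQ : i ∈ c' ⁻¹' {a, b, d} := by rw [Set.mem_preimage, hi]; simp
    have h1 := (hm i (hQK hiQ)).2.2.2 _ hQ hiQ ⟨hQK, hcon⟩
    have hjQ : j ∈ c' ⁻¹' {a, b, d} := by rw [Set.mem_preimage, hj]; simp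
    have h2 := h1 hjQ
    rw [← cK i (hQK hiQ), ← hcc, ← hc', hi, hj] at h2
    exact hba h2
  have hall : ∀ k, k = c' o ∨ k = a ∨ k = b ∨ k = d := by
    intro k
    obtain ⟨l, rfl⟩ := hcs k
    by_cases hl : l ∈ K
    · exact Or.inr (hQe hl)
    · left
      rw [hc', cK' l hl, cK' o ho]
  refine ⟨_, P, ⟨h3, hP, hP.braced_of_four hall, hmem⟩, fun k => ?_, c' o, hnode o, ?_⟩
  · obtain ⟨l, rfl⟩ := hcs k
    exact ⟨l, hnode l⟩
  · ext l
    constructor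
    · intro hl
      by_contra hlK
      apply hl
      have : c' l = c' o := by rw [hc', cK' l hlK, cK' o ho]
      rw [← this]; exact hnode l
    · intro hl h
      obtain ⟨z, hz⟩ := (hg.toPreTorsoid.node l).nonempty
      have h1 : c' l = c' o := (mem_cls.1 (hnode l hz)).symm.trans (mem_cls.1 (h hz))
      rw [hc', hcc, cK' o ho] at h1
      exact h1 hl

end MatchingSystem

end TightCuts

/-! ### Counting the torsos of a cyclic torsoid -/

namespace TightCuts

namespace MatchingSystem

universe u

variable {V : Type*} {ι : Type*} {κ κ' : Type*} {𝓢 : MatchingSystem V} {f g h : V → V}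
  {t : Set (V → V)} {𝒟 : Set (Set V)}
  {A B S T U W X Y Z : Set V} {p : V → ι} {r : V → κ} {r' : V → κ'} {q : V → Sym2 ι} {i j k o : ι}

/-- Two torsos that cleave the same torsoid and have the same nodes in the class of the node `o`
refine each other: the nodes outside this class, and the classes that contain them, keep the
members of `𝒟` apart. -/
theorem StarMap.exists_cls_subset (hq : 𝓢.Good q) (hD : 𝓢.MaxNested 𝒟) (hr : 𝓢.StarMap 𝒟 r)
    (hr' : 𝓢.StarMap 𝒟 r') (hcl : ∀ c, ∃ i, ed q i i ⊆ cls r c)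
    (hcl' : ∀ c, ∃ i, ed q i i ⊆ cls r' c) {c₀ : κ} {c₀' : κ'} (ho : ed q o o ⊆ cls r c₀)
    (ho' : ed q o o ⊆ cls r' c₀') (hK : ∀ i, ed q i i ⊆ cls r c₀ ↔ ed q i i ⊆ cls r' c₀') (c : κ) :
    ∃ c', cls r c ⊆ cls r' c' := by
  obtain ⟨h, hs, hh⟩ := hr.exists_nodeMap hq hcl
  obtain ⟨h', hs', hh'⟩ := hr'.exists_nodeMap hq hcl'
  obtain ⟨c', hc | hc⟩ := hr'.exists_subset hD (hr.mem c)
  · exact ⟨c', hc⟩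
  exfalso
  have h1 : ∀ i, h i ≠ c → h' i = c' := fun i hi =>
    (hh' i c').1.1 ((Set.subset_compl_iff_disjoint_left.2 ((hh i c).2 hi)).trans hc)
  have hK' : ∀ i, h i = c₀ ↔ h' i = c₀' := fun i => by rw [← (hh i _).1, ← (hh' i _).1, hK]
  by_cases hcc : c = c₀
  · -- the nodes outside the class of `o` would all lie in a single class
    obtain ⟨d, hd, hd'⟩ := hr'.three c' c₀'
    obtain ⟨i, rfl⟩ := hs' d
    exact hd (h1 i fun h2 => hd' ((hK' i).1 (h2.trans hcc)))
  · have h2 : c' = c₀' := by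
      rw [← (hh' o _).1.1 ho']
      exact (h1 o (by rw [(hh o _).1.1 ho]; exact Ne.symm hcc)).symm
    obtain ⟨d, hd, hd'⟩ := hr.three c c₀
    obtain ⟨i, rfl⟩ := hs d
    exact hd' ((hK' i).2 ((h1 i hd).trans h2))

/-- A cyclic torsoid with `n` nodes is cleaved by `n / 2 - 1` torsos. A torso is determined by
the set of nodes outside the class that contains a fixed node `o`, and by
`Cyclic.hats_of_starMap` and `Cyclic.exists_starMap` the sets arising in this way are the hats
with more than one node. They are counted by `two_mul_ncard_add_one`. -/
theorem Cyclic.two_mul_ncard_add_two {ι : Type u} {q : V → Sym2 ι} [Finite ι] [Nonempty ι]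
    (hq : 𝓢.Cyclic q) (hD : 𝓢.MaxNested 𝒟) :
    {P : Set (Set V) | ∃ (κ : Type u) (r : V → κ), 𝓢.StarMap 𝒟 r ∧
      (∀ c, ∃ i, ed q i i ⊆ cls r c) ∧ P = Set.range (cls r)}.Finite ∧
    2 * {P : Set (Set V) | ∃ (κ : Type u) (r : V → κ), 𝓢.StarMap 𝒟 r ∧
      (∀ c, ∃ i, ed q i i ⊆ cls r c) ∧ P = Set.range (cls r)}.ncard + 2 = Nat.card ι := by
  set 𝓟 := {P : Set (Set V) | ∃ (κ : Type u) (r : V → κ), 𝓢.StarMap 𝒟 r ∧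
      (∀ c, ∃ i, ed q i i ⊆ cls r c) ∧ P = Set.range (cls r)} with h𝓟
  have hg := hq.good
  obtain ⟨σ, hσ, hc⟩ := hg.toPreTorsoid.exists_compat
  have hp := hc.tightFibers hg.toPreTorsoid
  obtain ⟨o⟩ := ‹Nonempty ι›
  have hcls : ∀ {κ : Type u} {r : V → κ}, 𝓢.StarMap 𝒟 r → (∀ c, ∃ i, ed q i i ⊆ cls r c) →
      ∃ c₀, ed q o o ⊆ cls r c₀ := by
    intro κ r hr hcl
    obtain ⟨h, hs, hh⟩ := hr.exists_nodeMap hg hcl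
    exact ⟨h o, (hh o _).1.2 rfl⟩
  have hΦ : ∀ {κ : Type u} {r : V → κ}, 𝓢.StarMap 𝒟 r → (∀ c, ∃ i, ed q i i ⊆ cls r c) → ∀ {c₀},
      ed q o o ⊆ cls r c₀ → {i | ∀ X ∈ Set.range (cls r), ed q o o ⊆ X → ¬ ed q i i ⊆ X} =
        {i | ¬ ed q i i ⊆ cls r c₀} := by
    intro κ r hr hcl c₀ ho
    ext i
    constructor
    · intro h; exact h _ ⟨c₀, rfl⟩ ho
    · rintro h _ ⟨c, rfl⟩ hoc
      obtain ⟨x, hx⟩ := (hg.toPreTorsoid.node o).nonempty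
      rwa [← (mem_cls.1 (hoc hx)).symm.trans (mem_cls.1 (ho hx))] at h
  -- a torso corresponds to the set of nodes outside its class that contains `o`
  have hbij : Set.BijOn (fun P : Set (Set V) => {i | ∀ X ∈ P, ed q o o ⊆ X → ¬ ed q i i ⊆ X}) 𝓟
      {L | L ∈ 𝓢.hats 𝒟 (σ ∘ q) o ∧ L.Nontrivial ∧ L ⊆ {o}ᶜ} := by
    refine ⟨?_, ?_, ?_⟩
    · rintro _ ⟨κ, r, hr, hcl, rfl⟩
      obtain ⟨c₀, ho⟩ := hcls hr hcl
      obtain ⟨h1, h2, -⟩ := hq.hats_of_starMap hD hc hr hcl ho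
      simp only [hΦ hr hcl ho]
      exact ⟨h1, h2, fun i hi hi' => h1.1 (Set.mem_singleton_iff.1 hi' ▸ hi)⟩
    · rintro _ ⟨κ, r, hr, hcl, rfl⟩ _ ⟨κ', r', hr', hcl', rfl⟩ heq
      obtain ⟨c₀, ho⟩ := hcls hr hcl
      obtain ⟨c₀', ho'⟩ := hcls hr' hcl'
      simp only [hΦ hr hcl ho, hΦ hr' hcl' ho'] at heq
      have h1 : ∀ i, ed q i i ⊆ cls r c₀ ↔ ed q i i ⊆ cls r' c₀' := fun i =>
        not_iff_not.1 (Set.ext_iff.1 heq i)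
      exact range_cls_eq hr.fibers hr'.fibers
        (StarMap.exists_cls_subset hg hD hr hr' hcl hcl' ho ho' h1)
        (StarMap.exists_cls_subset hg hD hr' hr hcl' hcl ho' ho fun i => (h1 i).symm)
    · rintro K ⟨hK, hnt, -⟩
      obtain ⟨κ, r, hr, hcl, c₀, ho, hK'⟩ := hq.exists_starMap hD hσ hK hnt
      exact ⟨_, ⟨κ, r, hr, hcl, rfl⟩, (hΦ hr hcl ho).trans hK'⟩
  have hfin : 𝓟.Finite := Set.Finite.of_finite_image
    (Set.toFinite _) hbij.injOn
  refine ⟨hfin, ?_⟩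
  -- count below the largest hat, which is the set of all nodes other than `o`
  have hcard := two_mul_ncard_add_one (𝓛 := 𝓢.hats 𝒟 (σ ∘ q) o)
    (fun L hL => hD.nonempty_of_mem_hats hp hL) (fun K hK hnt => by
      obtain ⟨κ, r, hr, hcl, c₀, ho, hK'⟩ := hq.exists_starMap hD hσ hK hnt
      have := (hq.hats_of_starMap hD hc hr hcl ho).2.2
      rwa [hK'] at this) {o}ᶜ ⟨fun h => h rfl, Or.inr (Or.inl rfl)⟩
  rw [← hbij.image_eq, hbij.injOn.ncard_image] at hcard
  have h1 := Set.ncard_add_ncard_compl ({o} : Set ι)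
  rw [Set.ncard_singleton] at h1
  omega

end MatchingSystem

end TightCuts

/-! ### The matching system of a graph -/

namespace TightCuts

variable {V W : Type*} {G : SimpleGraph V} {M M' N : G.Subgraph} {H : SimpleGraph W}
  {f g : V → V} {𝓢 : MatchingSystem V} {X Y : Set V}

/-- `f` sends every vertex to its partner in the perfect matching `M`. -/
def IsPartnerMap (M : G.Subgraph) (f : V → V) : Prop := ∀ x y, M.Adj x y ↔ f x = y

theorem exists_isPartnerMap (h : M.IsPerfectMatching) : ∃ f, IsPartnerMap M f := by
  rw [SimpleGraph.Subgraph.isPerfectMatching_iff] at h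
  choose f hf using h
  exact ⟨f, fun x y => ⟨fun h => ((hf x).2 y h).symm, fun h => h ▸ (hf x).1⟩⟩

theorem IsPartnerMap.adj (h : IsPartnerMap M f) (x : V) : M.Adj x (f x) := (h x _).2 rfl

theorem IsPartnerMap.invol (h : IsPartnerMap M f) (x : V) : f (f x) = x :=
  (h _ _).1 (h.adj x).symm

theorem IsPartnerMap.isPerfectMatching (h : IsPartnerMap M f) : M.IsPerfectMatching :=
  SimpleGraph.Subgraph.isPerfectMatching_iff.2 fun x => ⟨f x, h.adj x, fun _ hy => ((h x _).1 hy).symm⟩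

theorem IsPartnerMap.mem_edgeSet (h : IsPartnerMap M f) (x y : V) : s(x, y) ∈ M.edgeSet ↔ f x = y := by
  rw [SimpleGraph.Subgraph.mem_edgeSet, h]

theorem IsPartnerMap.finite_iff (hf : IsPartnerMap M f) (hg : IsPartnerMap N g) :
    (symmDiff M.edgeSet N.edgeSet).Finite ↔ {x | f x ≠ g x}.Finite := by
  constructor
  · intro h
    have h1 : (⋃ e ∈ symmDiff M.edgeSet N.edgeSet, {x | x ∈ e}).Finite := by
      refine h.biUnion fun e _ => ?_
      induction e with | _ a b
      refine (Set.toFinite {a, b}).subset fun x hx => ?_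
      simpa using hx
    refine h1.subset fun x hx => ?_
    simp only [Set.mem_iUnion, exists_prop]
    refine ⟨s(x, f x), Or.inl ⟨(hf.mem_edgeSet _ _).2 rfl, fun h => hx ?_⟩, Sym2.mem_mk_left _ _⟩
    exact ((hg.mem_edgeSet _ _).1 h).symm
  · intro h
    refine ((h.image fun x => s(x, f x)).union (h.image fun x => s(x, g x))).subset ?_
    intro e
    induction e with | _ a b
    rintro (⟨h1, h2⟩ | ⟨h1, h2⟩)
    · rw [hf.mem_edgeSet] at h1
      rw [hg.mem_edgeSet] at h2
      exact Or.inl ⟨a, fun h => h2 (h.symm.trans h1), by simp only [h1]⟩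
    · rw [hg.mem_edgeSet] at h1
      rw [hf.mem_edgeSet] at h2
      exact Or.inr ⟨a, fun h => h2 (h.trans h1), by simp only [h1]⟩

theorem IsPartnerMap.mem_perfectMatchings_iff (hf : IsPartnerMap M f) :
    M' ∈ perfectMatchings G M ↔ ∃ g, IsPartnerMap M' g ∧ {x | g x ≠ f x}.Finite := by
  constructor
  · rintro ⟨h1, h2⟩
    obtain ⟨g, hg⟩ := exists_isPartnerMap h1
    exact ⟨g, hg, (hg.finite_iff hf).1 h2⟩
  · rintro ⟨g, hg, h2⟩
    exact ⟨hg.isPerfectMatching, (hg.finite_iff hf).2 h2⟩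

/-- The subgraph formed by the edges that join a vertex to its image under an involution. -/
def partnerSubgraph (G : SimpleGraph V) (f : V → V) (hf : ∀ x, f (f x) = x)
    (hG : ∀ x, G.Adj x (f x)) : G.Subgraph where
  verts := Set.univ
  Adj x y := f x = y
  adj_sub := by rintro x _ rfl; exact hG x
  edge_vert := fun _ => Set.mem_univ _
  symm := ⟨by rintro x _ rfl; exact hf x⟩

theorem isPartnerMap_partnerSubgraph (hf : ∀ x, f (f x) = x) (hG : ∀ x, G.Adj x (f x)) :
    IsPartnerMap (partnerSubgraph G f hf hG) f := fun _ _ => Iff.rfl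

namespace MatchingSystem

/-- The members of `𝓢` are the perfect matchings of `G` with finite symmetric difference to `M`, and
they cover `G`. -/
structure Models (𝓢 : MatchingSystem V) (G : SimpleGraph V) (M : G.Subgraph) : Prop where
  adj : ∀ x y, G.Adj x y ↔ ∃ f ∈ 𝓢.carrier, f x = y
  matching : ∃ f ∈ 𝓢.carrier, IsPartnerMap M f

theorem _root_.TightCuts.IsMatchingCovered.exists_models (h : IsMatchingCovered G M) :
    ∃ 𝓢 : MatchingSystem V, 𝓢.Models G M := by
  obtain ⟨f₀, hf₀⟩ := exists_isPartnerMap h.isPerfectMatching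
  have hcov : ∀ x y, G.Adj x y → ∃ f : V → V, ((∀ x, f (f x) = x) ∧ (∀ x, G.Adj x (f x)) ∧
      {x | f x ≠ f₀ x}.Finite) ∧ f x = y := by
    intro x y hxy
    obtain ⟨M', hM', he⟩ := h.covered s(x, y) hxy
    obtain ⟨g, hg, hfin⟩ := hf₀.mem_perfectMatchings_iff.1 hM'
    exact ⟨g, ⟨hg.invol, fun x => M'.adj_sub (hg.adj x), hfin⟩, (hg.mem_edgeSet _ _).1 he⟩
  refine ⟨{
    carrier := {f | (∀ x, f (f x) = x) ∧ (∀ x, G.Adj x (f x)) ∧ {x | f x ≠ f₀ x}.Finite}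
    nonempty := ⟨f₀, hf₀.invol, fun x => M.adj_sub (hf₀.adj x), by simp⟩
    invol := fun f hf => hf.1
    ne := fun f hf x => (hf.2.1 x).ne'
    fin := fun f hf g hg => (hf.2.2.union hg.2.2).subset fun x hx => by
      by_contra hcon
      rw [Set.mem_union, not_or, Set.mem_ofPred_eq, Set.mem_ofPred_eq, not_ne_iff, not_ne_iff] at hcon
      exact hx (hcon.1.trans hcon.2.symm)
    conn := fun A ⟨x, hx⟩ hA => by
      obtain ⟨y, hy⟩ := (Set.ne_univ_iff_exists_notMem A).1 hA
      obtain ⟨w⟩ := h.connected.preconnected x y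
      obtain ⟨d, -, h1, h2⟩ := w.exists_boundary_dart A hx hy
      obtain ⟨f, hf, hfd⟩ := hcov _ _ d.adj
      exact ⟨f, hf, _, h1, by rwa [hfd]⟩
    glue := fun g hg F hF hloc hfin => ⟨hF, fun x => by
      obtain ⟨f, hf, hfx⟩ := hloc x
      rw [hfx]; exact hf.2.1 x, (hfin.union hg.2.2).subset fun _ hx => by
      by_contra hcon
      rw [Set.mem_union, not_or, Set.mem_ofPred_eq, Set.mem_ofPred_eq, not_ne_iff, not_ne_iff] at hcon
      exact hx (hcon.1.trans hcon.2)⟩ }, ?_, ?_⟩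
  · intro x y
    exact ⟨hcov x y, by rintro ⟨f, hf, rfl⟩; exact hf.2.1 x⟩
  · exact ⟨f₀, ⟨hf₀.invol, fun x => M.adj_sub (hf₀.adj x), by simp⟩, hf₀⟩

theorem Models.mem_perfectMatchings_iff (h : 𝓢.Models G M) :
    M' ∈ perfectMatchings G M ↔ ∃ f ∈ 𝓢.carrier, IsPartnerMap M' f := by
  obtain ⟨f₀, hf₀, hM⟩ := h.matching
  rw [hM.mem_perfectMatchings_iff]
  constructor
  · rintro ⟨g, hg, hfin⟩
    refine ⟨g, 𝓢.glue f₀ hf₀ g hg.invol (fun x => ?_) hfin, hg⟩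
    obtain ⟨f, hf, hfx⟩ := (h.adj _ _).1 (M'.adj_sub (hg.adj x))
    exact ⟨f, hf, hfx.symm⟩
  · rintro ⟨f, hf, hfM⟩
    exact ⟨f, hfM, 𝓢.fin f hf f₀ hf₀⟩

theorem Models.exists_subgraph (h : 𝓢.Models G M) (hf : f ∈ 𝓢.carrier) :
    ∃ M' ∈ perfectMatchings G M, IsPartnerMap M' f :=
  have h1 := isPartnerMap_partnerSubgraph (G := G) (𝓢.invol f hf) fun _ => (h.adj _ _).2 ⟨f, hf, rfl⟩
  ⟨_, h.mem_perfectMatchings_iff.2 ⟨f, hf, h1⟩, h1⟩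

theorem Models.isMatchingCovered [Nonempty V] (h : 𝓢.Models G M) : IsMatchingCovered G M := by
  refine ⟨⟨fun x y => ?_⟩, ?_, ?_⟩
  · by_contra hxy
    obtain ⟨f, hf, z, hz, hz'⟩ := 𝓢.conn {z | G.Reachable x z} ⟨x, SimpleGraph.Reachable.refl x⟩
      fun h => hxy (h ▸ Set.mem_univ y : y ∈ {z | G.Reachable x z})
    exact hz' (SimpleGraph.Reachable.trans hz ((h.adj _ _).2 ⟨f, hf, rfl⟩).reachable)
  · obtain ⟨f₀, hf₀, hM⟩ := h.matching
    exact hM.isPerfectMatching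
  · intro e
    induction e with | _ x y
    intro he
    obtain ⟨f, hf, hxy⟩ := (h.adj x y).1 he
    obtain ⟨M', h1, h2⟩ := h.exists_subgraph hf
    exact ⟨M', h1, (h2.mem_edgeSet _ _).2 hxy⟩

theorem encard_inter_cut (hf : IsPartnerMap M f) (X : Set V) :
    (M.edgeSet ∩ cut G X).encard = (exits f X).encard := by
  have h1 : M.edgeSet ∩ cut G X = (fun x => s(x, f x)) '' exits f X := by
    ext e
    constructor
    · rintro ⟨h1, -, x, hx, y, hy, rfl⟩
      rw [hf.mem_edgeSet] at h1
      subst h1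
      exact ⟨x, ⟨hx, hy⟩, rfl⟩
    · rintro ⟨x, ⟨hx, hx'⟩, rfl⟩
      exact ⟨hf.adj x, M.adj_sub (hf.adj x), x, hx, f x, hx', rfl⟩
  rw [h1, Set.InjOn.encard_image]
  rintro x ⟨hx, hx'⟩ y ⟨hy, hy'⟩ hxy
  rcases Sym2.eq_iff.1 hxy with h | h
  · exact h.1
  · exact absurd (h.1 ▸ hx) hy'

theorem Models.isTight_iff (h : 𝓢.Models G M) : IsTight G M X ↔ 𝓢.Tight X := by
  constructor
  · intro hX f hf
    obtain ⟨M', h1, h2⟩ := h.exists_subgraph hf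
    have := hX M' h1
    rwa [encard_inter_cut h2, Set.encard_eq_one] at this
  · intro hX M' hM'
    obtain ⟨f, hf, h2⟩ := h.mem_perfectMatchings_iff.1 hM'
    rw [encard_inter_cut h2, Set.encard_eq_one]
    exact hX f hf

theorem mem_cut_iff {x y : V} : s(x, y) ∈ cut G X ↔ G.Adj x y ∧ ¬ (x ∈ X ↔ y ∈ X) := by
  constructor
  · rintro ⟨h1, a, ha, b, hb, he⟩
    refine ⟨h1, ?_⟩
    rcases Sym2.eq_iff.1 he with ⟨rfl, rfl⟩ | ⟨rfl, rfl⟩ <;> tauto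
  · rintro ⟨h1, h2⟩
    by_cases hx : x ∈ X
    · exact ⟨h1, x, hx, y, by tauto, rfl⟩
    · exact ⟨h1, y, by tauto, x, hx, Sym2.eq_swap⟩

theorem cut_compl : cut G Xᶜ = cut G X := by
  ext e
  induction e with | _ x y
  rw [mem_cut_iff, mem_cut_iff, Set.mem_compl_iff, Set.mem_compl_iff]
  tauto

/-- In a connected graph a cut determines its sides. -/
theorem Models.cut_eq_iff (h : 𝓢.Models G M) : cut G X = cut G Y ↔ X = Y ∨ X = Yᶜ := by
  refine ⟨fun he => ?_, ?_⟩
  · by_cases h1 : {x | x ∈ X ↔ x ∈ Y} = Set.univ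
    · exact Or.inl (Set.ext fun x => (h1 ▸ Set.mem_univ x : x ∈ {x | x ∈ X ↔ x ∈ Y}))
    by_cases h2 : {x | x ∈ X ↔ x ∈ Y}.Nonempty
    · exfalso
      obtain ⟨f, hf, x, hx, hx'⟩ := 𝓢.conn _ h2 h1
      have h3 := Set.ext_iff.1 he s(x, f x)
      have h4 := (h.adj x (f x)).2 ⟨f, hf, rfl⟩
      rw [mem_cut_iff, mem_cut_iff] at h3
      simp only [Set.mem_ofPred_eq] at hx hx'
      tauto
    · right
      ext x
      by_contra hcon
      exact h2 ⟨x, by simp only [Set.mem_ofPred_eq]; rw [Set.mem_compl_iff] at hcon; tauto⟩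
  · rintro (rfl | rfl)
    · rfl
    · exact cut_compl

theorem Models.nested_iff (h : 𝓢.Models G M) : Nested G (cut G X) (cut G Y) ↔ Nest X Y := by
  constructor
  · rintro ⟨A, B, hd, hA, hB⟩
    rcases h.cut_eq_iff.1 hA with rfl | rfl <;> rcases h.cut_eq_iff.1 hB with rfl | rfl
    · exact Or.inl hd
    · exact Or.inr (Or.inl (Set.subset_compl_iff_disjoint_right.2 hd))
    · exact Or.inr (Or.inr (Or.inl (Set.subset_compl_iff_disjoint_left.2 hd)))
    · refine Or.inr (Or.inr (Or.inr ?_))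
      rw [← Set.compl_inter, Set.disjoint_iff_inter_eq_empty.1 hd, Set.compl_empty]
  · rintro (hd | hd | hd | hd)
    · exact ⟨X, Y, hd, rfl, rfl⟩
    · exact ⟨X, Yᶜ, Set.disjoint_compl_right_iff_subset.2 hd, rfl, cut_compl.symm⟩
    · exact ⟨Xᶜ, Y, (Set.disjoint_compl_right_iff_subset.2 hd).symm, cut_compl.symm, rfl⟩
    · refine ⟨Xᶜ, Yᶜ, ?_, cut_compl.symm, cut_compl.symm⟩
      rw [Set.disjoint_iff_inter_eq_empty, ← Set.compl_union, hd, Set.compl_univ]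

theorem Models.maxNested (h : 𝓢.Models G M) {𝒞 : Set (Set (Sym2 V))}
    (h𝒞 : IsMaximalNestedFamily G M 𝒞) : 𝓢.MaxNested {Y | cut G Y ∈ 𝒞} := by
  have ht : ∀ Y, cut G Y ∈ 𝒞 → 𝓢.Tight Y := by
    intro Y hY
    obtain ⟨X, hX, he⟩ := h𝒞.1.1 _ hY
    rw [h.isTight_iff] at hX
    rcases h.cut_eq_iff.1 he with rfl | rfl
    · exact hX
    · exact hX.compl
  refine ⟨ht, fun Y hY => ?_, fun X hX Y hY => ?_, fun Z hZ hn => ?_⟩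
  · rwa [Set.mem_ofPred_eq, cut_compl]
  · by_cases he : cut G X = cut G Y
    · rcases h.cut_eq_iff.1 he with rfl | rfl
      · exact Or.inr (Or.inl subset_rfl)
      · exact Or.inl disjoint_compl_left
    · exact h.nested_iff.1 (h𝒞.1.2 hX hY he)
  · have h1 : insert (cut G Z) 𝒞 ≤ 𝒞 := h𝒞.2 ⟨?_, ?_⟩ (Set.subset_insert _ _)
    · exact h1 (Set.mem_insert _ _)
    · rintro C (rfl | hC)
      · exact ⟨Z, h.isTight_iff.2 hZ, rfl⟩
      · exact h𝒞.1.1 C hC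
    · have hN : ∀ C ∈ 𝒞, Nested G (cut G Z) C := by
        intro C hC
        obtain ⟨Y, -, rfl⟩ := h𝒞.1.1 C hC
        exact h.nested_iff.2 (hn Y hC)
      rintro C (rfl | hC) D (rfl | hD) hne
      · exact absurd rfl hne
      · exact hN D hD
      · obtain ⟨A, B, hd, hA, hB⟩ := hN C hC
        exact ⟨B, A, hd.symm, hB, hA⟩
      · exact h𝒞.1.2 hC hD hne

end MatchingSystem

end TightCuts

/-! ### Cycle graphs -/

namespace TightCuts

variable {V W : Type*} {G : SimpleGraph V} {M : G.Subgraph} {H : SimpleGraph W}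

/-- A finite connected graph in which every vertex has exactly two neighbours is a cycle. -/
theorem nonempty_iso_cycleGraph [Finite W] (hc : H.Connected)
    (h2 : ∀ v, (H.neighborSet v).ncard = 2) :
    3 ≤ Nat.card W ∧ Nonempty (H ≃g SimpleGraph.cycleGraph (Nat.card W)) := by
  obtain ⟨v⟩ := hc.nonempty
  have hne : ∀ v, (H.neighborSet v).Nonempty := fun v =>
    Set.nonempty_of_ncard_ne_zero (by rw [h2]; decide)
  obtain ⟨p, hp, hverts⟩ :=
    SimpleGraph.IsCycles.exists_cycle_toSubgraph_verts_eq_connectedComponentSupp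
      (c := H.connectedComponentMk v) (fun v _ => h2 v) rfl (hne v)
  have hlen := hp.three_le_length
  have hsupp : ∀ w, w ∈ p.support := by
    intro w
    have : w ∈ (H.connectedComponentMk v).supp :=
      SimpleGraph.ConnectedComponent.sound (hc.preconnected w v)
    rw [← hverts] at this
    simpa using this
  obtain ⟨m, hm⟩ : ∃ m, p.length = m + 3 := ⟨p.length - 3, by omega⟩
  let φ : Fin (m + 3) → W := fun i => p.getVert i
  have hinj : Function.Injective φ := by
    intro i j hij
    refine Fin.ext (hp.getVert_injOn' ?_ ?_ hij) <;>
    · simp only [Set.mem_ofPred_eq, hm]; omega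
  have hsurj : Function.Surjective φ := by
    intro w
    obtain ⟨i, hi, hi'⟩ := SimpleGraph.Walk.mem_support_iff_exists_getVert.1 (hsupp w)
    by_cases h : i < m + 3
    · exact ⟨⟨i, h⟩, hi⟩
    · refine ⟨0, ?_⟩
      have : i = p.length := by omega
      rw [← hi, this]
      simp [φ]
  have hsucc : ∀ i j : Fin (m + 3), j - i = 1 → H.Adj (φ i) (φ j) := by
    intro i j hij
    have hj : j = i + 1 := by rw [← hij]; abel
    subst hj
    have h1 := p.adj_getVert_succ (i := i) (by omega)
    by_cases hi : i = Fin.last (m + 2)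
    · subst hi
      have h3 : p.getVert (m + 2 + 1) = v := by
        rw [show m + 2 + 1 = p.length by omega, p.getVert_length]
      simp only [Fin.val_last, h3] at h1
      simpa [φ] using h1
    · have h4 : ((i + 1 : Fin (m + 3)) : ℕ) = i + 1 := Fin.val_add_one_of_lt (lt_of_le_of_ne (Fin.le_last i) hi)
      simp only [φ, h4]
      exact h1
  have hhom : ∀ i j : Fin (m + 3), (SimpleGraph.cycleGraph (m + 3)).Adj i j → H.Adj (φ i) (φ j) := by
    intro i j h
    rcases SimpleGraph.cycleGraph_adj.1 h with h | h
    · exact (hsucc j i h).symm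
    · exact hsucc i j h
  -- the neighbours on the cycle are all the neighbours in `H`, as there are two in either case
  have hiff : ∀ i j : Fin (m + 3), H.Adj (φ i) (φ j) ↔ (SimpleGraph.cycleGraph (m + 3)).Adj i j := by
    intro i j
    refine ⟨fun h => ?_, hhom i j⟩
    have h1 : φ '' (SimpleGraph.cycleGraph (m + 3)).neighborSet i = H.neighborSet (φ i) := by
      refine Set.eq_of_subset_of_ncard_le ?_ ?_ (Set.toFinite _)
      · rintro _ ⟨j, hj, rfl⟩; exact hhom i j hj
      · have hd := SimpleGraph.cycleGraph_degree_three_le (n := m) (v := i)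
        rw [h2, Set.ncard_image_of_injective _ hinj, ← Nat.card_coe_set_eq,
          Nat.card_eq_fintype_card, SimpleGraph.card_neighborSet_eq_degree, hd]
    have h3 : φ j ∈ H.neighborSet (φ i) := h
    rw [← h1] at h3
    obtain ⟨k, hk, hkj⟩ := h3
    rw [← hinj hkj]; exact hk
  have hcard : Nat.card W = m + 3 := by
    rw [← Nat.card_eq_of_bijective φ ⟨hinj, hsurj⟩, Nat.card_fin]
  rw [hcard]
  exact ⟨by omega, ⟨(RelIso.mk (Equiv.ofBijective φ ⟨hinj, hsurj⟩) (fun {i j} => hiff i j)).symm⟩⟩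

theorem IsCycleGraph.exists_two (h : IsCycleGraph H) (v : W) :
    ∃ a b, ∀ w, H.Adj v w → w = a ∨ w = b := by
  obtain ⟨n, hn, ⟨φ⟩⟩ := h
  obtain ⟨m, rfl⟩ : ∃ m, n = m + 3 := ⟨n - 3, by omega⟩
  refine ⟨φ.symm (φ v - 1), φ.symm (φ v + 1), fun w hw => ?_⟩
  have h1 : φ w ∈ (SimpleGraph.cycleGraph (m + 1 + 2)).neighborSet (φ v) := φ.map_adj_iff.2 hw
  rw [SimpleGraph.cycleGraph_neighborSet] at h1
  rcases h1 with h1 | h1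
  · left; rw [← h1, φ.symm_apply_apply]
  · right; rw [← Set.mem_singleton_iff.1 h1, φ.symm_apply_apply]

theorem IsCycleGraph.finite (h : IsCycleGraph H) : Finite W := by
  obtain ⟨n, hn, ⟨φ⟩⟩ := h
  exact Finite.of_equiv _ φ.symm.toEquiv

theorem IsC4.isCycleGraph (h : IsC4 H) : IsCycleGraph H := ⟨4, by decide, h⟩

namespace MatchingSystem

variable {κ : Type*} {𝓢 : MatchingSystem V} {r : V → κ} {t : Set (V → V)} {K : SimpleGraph κ}

theorem Ring.ncard_neighborSet (hr : 𝓢.Ring t r)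
    (hK : ∀ c d, K.Adj c d ↔ ∃ f ∈ 𝓢.carrier, mate r f c = d) (c : κ) :
    (K.neighborSet c).ncard = 2 := by
  obtain ⟨g, hg, hfg⟩ := hr.exists_other 𝓢.base_mem c
  rw [← hr.mate_eq _ 𝓢.base_mem g hg c] at hfg
  have : K.neighborSet c = {mate r 𝓢.base c, mate r g c} := by
    ext d
    rw [SimpleGraph.mem_neighborSet, hK]
    constructor
    · rintro ⟨f, hf, rfl⟩
      rcases hr.mate_of_ne 𝓢.base_mem hg hfg hf with h | h <;> rw [h]
      · exact Or.inl rfl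
      · exact Or.inr rfl
    · rintro (h | h)
      · exact ⟨_, 𝓢.base_mem, h.symm⟩
      · exact ⟨g, hg, (Set.mem_singleton_iff.1 h).symm⟩
  rw [this, Set.ncard_pair hfg]

theorem TightFibers.connected (hr : 𝓢.TightFibers r) [Nonempty κ]
    (hK : ∀ c d, K.Adj c d ↔ ∃ f ∈ 𝓢.carrier, mate r f c = d) : K.Connected := by
  refine ⟨fun x y => ?_⟩
  by_contra hxy
  obtain ⟨_, ⟨f, hf, rfl⟩, z, hz, hz'⟩ := (𝓢.collapseSystem r hr).conn {z | K.Reachable x z}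
    ⟨x, SimpleGraph.Reachable.refl x⟩ fun h => hxy (h ▸ Set.mem_univ y : y ∈ {z | K.Reachable x z})
  exact hz' (SimpleGraph.Reachable.trans hz ((hK _ _).2 ⟨f, hf, rfl⟩).reachable)

theorem Ring.isCycleGraph [Finite κ] [Nonempty κ] (hr : 𝓢.Ring t r)
    (hK : ∀ c d, K.Adj c d ↔ ∃ f ∈ 𝓢.carrier, mate r f c = d) : IsCycleGraph K :=
  ⟨_, nonempty_iso_cycleGraph (hr.fibers.connected hK) (hr.ncard_neighborSet hK)⟩

/-- A brick or brace whose matchings form a ring has four vertices. -/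
theorem Ring.isC4_of_braced [Nonempty κ] (hr : 𝓢.Ring t r) (hb : 𝓢.Braced r)
    (hK : ∀ c d, K.Adj c d ↔ ∃ f ∈ 𝓢.carrier, mate r f c = d) : IsC4 K := by
  classical
  obtain ⟨i⟩ := ‹Nonempty κ›
  obtain ⟨g, hg, hfg⟩ := hr.exists_other 𝓢.base_mem i
  rw [← hr.mate_eq _ 𝓢.base_mem g hg i] at hfg
  obtain ⟨-, hj, hk, l, hl1, hl2, hl3, hall⟩ := Braced.ring_of_mates hr.fibers hb hr.three hfg
    fun f hf => (hr.mate_of_ne 𝓢.base_mem hg hfg hf).imp (fun h => by rw [h]) fun h => by rw [h]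
  have huniv : (Set.univ : Set κ) = {i, mate r 𝓢.base i, mate r g i, l} := by
    ext x; simpa using hall x
  have hfin : Finite κ := Set.finite_univ_iff.1 (huniv ▸ Set.toFinite _)
  have hcard : Nat.card κ = 4 := by
    rw [← Set.ncard_univ, huniv, Set.ncard_eq_toFinset_card']
    simp [hj.symm, hk.symm, hl1.symm, hl2.symm, hl3.symm, hfg]
  have : Nonempty κ := ⟨i⟩
  obtain ⟨-, h⟩ := nonempty_iso_cycleGraph (hr.fibers.connected hK) (hr.ncard_neighborSet hK)
  rwa [hcard] at h

theorem Branching.not_isCycleGraph [Nonempty κ] (hr : 𝓢.Branching r)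
    (hK : ∀ c d, K.Adj c d ↔ ∃ f ∈ 𝓢.carrier, mate r f c = d) : ¬ IsCycleGraph K := by
  intro h
  obtain ⟨i⟩ := ‹Nonempty κ›
  obtain ⟨a, b, hab⟩ := h.exists_two i
  obtain ⟨f, hf, h1, h2⟩ := hr i a b
  exact (hab _ ((hK _ _).2 ⟨f, hf, rfl⟩)).elim h1 h2

end MatchingSystem

end TightCuts

/-! ### Torsos of a graph -/

namespace TightCuts

namespace MatchingSystem

variable {V : Type*} {G : SimpleGraph V} {M : G.Subgraph} {𝒞 : Set (Set (Sym2 V))}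
  {κ κ' : Type*} {𝓢 : MatchingSystem V} {r : V → κ} {t : Set (V → V)} {P : Set (Set V)}
  {K : SimpleGraph κ} {N : K.Subgraph} {f : V → V}

/-- If two classes are adjacent exactly when they are matched by some member of `𝓢`, and likewise
for `M`, then tightness in the quotient graph is tightness of unions of classes. -/
theorem TightFibers.models (hr : 𝓢.TightFibers r)
    (hK : ∀ c d, K.Adj c d ↔ ∃ f ∈ 𝓢.carrier, mate r f c = d) (hf : f ∈ 𝓢.carrier)
    (hN : ∀ c d, N.Adj c d ↔ mate r f c = d) : (𝓢.collapseSystem r hr).Models K N := by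
  refine ⟨fun c d => ?_, _, ⟨f, hf, rfl⟩, hN⟩
  rw [hK]
  constructor
  · rintro ⟨g, hg, h⟩; exact ⟨_, ⟨g, hg, rfl⟩, h⟩
  · rintro ⟨_, ⟨g, hg, rfl⟩, h⟩; exact ⟨g, hg, h⟩

theorem TightFibers.isBrickOrBrace_iff [Nonempty κ] (hr : 𝓢.TightFibers r)
    (h : (𝓢.collapseSystem r hr).Models K N) : IsBrickOrBrace K N ↔ 𝓢.Braced r := by
  simp only [IsBrickOrBrace, h.isMatchingCovered, true_and, h.isTight_iff, hr.tight_collapse_iff,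
    Set.encard_eq_one, Braced]

theorem exists_third {α : Type*} {A : Set α} (h4 : 4 ≤ A.encard) (a b : A) :
    ∃ c : A, c ≠ a ∧ c ≠ b := by
  by_contra hcon
  push Not at hcon
  have h1 : A ⊆ {a.1, b.1} := by
    intro x hx
    by_cases h : (⟨x, hx⟩ : A) = a
    · left; rw [← h]
    · right; rw [Set.mem_singleton_iff, ← hcon _ h]
  have h2 := h4.trans ((Set.encard_le_encard h1).trans (Set.encard_insert_le _ _))
  rw [Set.encard_singleton] at h2
  exact absurd h2 (by decide)

theorem TightFibers.four_le {α : Type*} {A : Set α} {r : V → A} (hr : 𝓢.TightFibers r) [Nonempty A]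
    (h3 : ∀ a b : A, ∃ c, c ≠ a ∧ c ≠ b) : 4 ≤ A.encard := by
  obtain ⟨a⟩ := ‹Nonempty A›
  obtain ⟨b, hb, -⟩ := h3 a a
  obtain ⟨c, hc, hc'⟩ := h3 a b
  obtain ⟨d, hd1, hd2, hd3⟩ := hr.exists_fourth h3 a b c
  have h1 : ({a.1, b.1, c.1, d.1} : Set α) ⊆ A := by
    rintro x (rfl | rfl | rfl | rfl) <;> exact Subtype.coe_prop _
  refine le_trans ?_ (Set.encard_le_encard h1)
  have h : ∀ {x y : A}, x ≠ y → x.1 ≠ y.1 := fun h h' => h (Subtype.ext h')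
  rw [Set.encard_insert_of_notMem, Set.encard_insert_of_notMem, Set.encard_pair (h hd3.symm)]
  · norm_num
  · simp [h hc'.symm, h hd2.symm]
  · simp [h hb.symm, h hc.symm, h hd1.symm]

/-- `r` sends every vertex to its class in the partition `P`. -/
theorem exists_classMap (hP : Setoid.IsPartition P) :
    ∃ r : V → P, ∀ c : P, cls r c = c.1 := by
  choose c hc hc' using hP.2
  refine ⟨fun x => ⟨c x, (hc x).1⟩, fun d => ?_⟩
  ext x
  rw [mem_cls, Subtype.ext_iff]
  exact ⟨fun h => h ▸ (hc x).2, fun h => (hc' x d.1 ⟨d.2, h⟩).symm⟩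

section Star

variable {r : V → P}

theorem range_cls (hrP : ∀ c : P, cls r c = c.1) : Set.range (cls r) = P := by
  rw [show cls r = Subtype.val from funext hrP, Subtype.range_coe]

theorem isPartition_of_cls (hr : 𝓢.TightFibers r) (hrP : ∀ c : P, cls r c = c.1) :
    Setoid.IsPartition P := by
  refine ⟨fun h => ?_, fun x => ⟨(r x).1, ⟨(r x).2, ?_⟩, ?_⟩⟩
  · obtain ⟨x, hx⟩ := (hr ⟨∅, h⟩).nonempty
    rw [hrP] at hx
    exact hx
  · rw [← hrP]; rfl
  · rintro A ⟨hA, hx⟩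
    have : x ∈ cls r ⟨A, hA⟩ := by rw [hrP]; exact hx
    rw [mem_cls.1 this]

theorem mate_eq_iff_exists (hr : 𝓢.TightFibers r) (hrP : ∀ c : P, cls r c = c.1)
    (hf : f ∈ 𝓢.carrier) (c d : P) :
    mate r f c = d ↔ c ≠ d ∧ ∃ x ∈ c.1, ∃ y ∈ d.1, f x = y := by
  simp only [← hrP, mem_cls]
  constructor
  · rintro rfl
    obtain ⟨x, h1, h2, h3, -⟩ := hr.exists_exit hf c
    exact ⟨h3.symm, x, h1, _, h2, rfl⟩
  · rintro ⟨hne, x, hx, _, hy, rfl⟩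
    exact hr.mate_eq_of hf hx hy hne.symm

theorem Models.collapse_adj (hG : 𝓢.Models G M) (hr : 𝓢.TightFibers r)
    (hrP : ∀ c : P, cls r c = c.1) (c d : P) :
    (collapse G P).Adj c d ↔ ∃ f ∈ 𝓢.carrier, mate r f c = d := by
  constructor
  · rintro ⟨hne, x, hx, y, hy, hxy⟩
    obtain ⟨f, hf, h⟩ := (hG.adj x y).1 hxy
    exact ⟨f, hf, (mate_eq_iff_exists hr hrP hf c d).2 ⟨hne, x, hx, y, hy, h⟩⟩
  · rintro ⟨f, hf, h⟩
    obtain ⟨hne, x, hx, y, hy, h⟩ := (mate_eq_iff_exists hr hrP hf c d).1 h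
    exact ⟨hne, x, hx, y, hy, (hG.adj x y).2 ⟨f, hf, h⟩⟩

theorem Models.isBrickOrBrace_collapse_iff (hG : 𝓢.Models G M) [Nonempty P] (hr : 𝓢.TightFibers r)
    (hrP : ∀ c : P, cls r c = c.1) :
    IsBrickOrBrace (collapse G P) (collapseMatching M P) ↔ 𝓢.Braced r := by
  obtain ⟨f₀, hf₀, hM⟩ := hG.matching
  refine hr.isBrickOrBrace_iff (hr.models (hG.collapse_adj hr hrP) hf₀ fun c d => ?_)
  rw [mate_eq_iff_exists hr hrP hf₀]
  simp only [← hM _ _]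
  rfl

theorem Models.isMaximalStar_iff (hG : 𝓢.Models G M) [Nonempty P]
    (hrP : ∀ c : P, cls r c = c.1) :
    IsMaximalStar G M 𝒞 P ↔ 𝓢.StarMap {Y | cut G Y ∈ 𝒞} r := by
  constructor
  · rintro ⟨⟨h1, h2⟩, h3, h4, h5⟩
    have hr : 𝓢.TightFibers r := fun c => by
      rw [hrP, ← hG.isTight_iff]; exact h2 _ c.2
    exact ⟨exists_third h3, hr, (hG.isBrickOrBrace_collapse_iff hr hrP).1 h4, fun c => by
      rw [Set.mem_ofPred_eq, hrP]; exact h5 _ c.2⟩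
  · rintro ⟨h1, hr, h3, h4⟩
    refine ⟨⟨isPartition_of_cls hr hrP, fun X hX => ?_⟩, hr.four_le h1,
      (hG.isBrickOrBrace_collapse_iff hr hrP).2 h3, fun X hX => ?_⟩
    · have := hr ⟨X, hX⟩
      rwa [hrP, ← hG.isTight_iff] at this
    · have := h4 ⟨X, hX⟩
      rwa [Set.mem_ofPred_eq, hrP] at this

end Star

theorem Models.exists_starMap (hG : 𝓢.Models G M) [Nonempty V] (S : Torso G M 𝒞) :
    ∃ r : V → S.star, 𝓢.StarMap {Y | cut G Y ∈ 𝒞} r ∧ ∀ c, cls r c = c.1 := by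
  obtain ⟨r, hr⟩ := exists_classMap S.isMaximalStar.isTightSetPartition.1
  have : Nonempty S.star := ⟨r (Classical.arbitrary V)⟩
  exact ⟨r, (hG.isMaximalStar_iff hr).1 S.isMaximalStar, hr⟩

theorem TightFibers.cls_injective (hr : 𝓢.TightFibers r) : Function.Injective (cls r) := by
  intro c d h
  obtain ⟨x, hx⟩ := hr.surjective c
  have : x ∈ cls r d := h ▸ hx
  exact hx.symm.trans this

theorem Models.exists_torso (hG : 𝓢.Models G M) [Nonempty V]
    (hr : 𝓢.StarMap {Y | cut G Y ∈ 𝒞} r) : ∃ S : Torso G M 𝒞, S.star = Set.range (cls r) := by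
  let e : κ → Set.range (cls r) := Set.rangeFactorization (cls r)
  have he : Function.Injective e := fun c d h => hr.fibers.cls_injective (Subtype.ext_iff.1 h)
  have hs : Function.Surjective e := Set.rangeFactorization_surjective
  have hcls : ∀ c, cls (e ∘ r) (e c) = cls r c := fun c => by
    ext x; exact ⟨fun h => he h, fun h => congrArg e h⟩
  have : Nonempty (Set.range (cls r)) := ⟨e (r (Classical.arbitrary V))⟩
  refine ⟨⟨_, (hG.isMaximalStar_iff (r := e ∘ r) (hs.forall.2 hcls)).2 ⟨?_, ?_, ?_, ?_⟩⟩, rfl⟩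
  · refine hs.forall.2 fun a => hs.forall.2 fun b => ?_
    obtain ⟨c, h1, h2⟩ := hr.three a b
    exact ⟨e c, he.ne h1, he.ne h2⟩
  · exact hs.forall.2 fun c => by rw [hcls]; exact hr.fibers c
  · intro I hI
    have hI' : I = e '' (e ⁻¹' I) := (Set.image_preimage_eq I hs).symm
    rcases hr.braced (e ⁻¹' I) hI with ⟨i, hi⟩ | ⟨i, hi⟩
    · exact Or.inl ⟨e i, by rw [hI', hi, Set.image_singleton]⟩
    · refine Or.inr ⟨e i, ?_⟩
      rw [← Set.image_preimage_eq Iᶜ hs, Set.preimage_compl, hi, Set.image_singleton]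
  · exact hs.forall.2 fun c => by rw [hcls]; exact hr.mem c

end MatchingSystem

end TightCuts

/-! ### The labelling of a torsoid -/

namespace TightCuts

open MatchingSystem

variable {V : Type*} {G : SimpleGraph V} {M : G.Subgraph} {𝓢 : MatchingSystem V}
  {T T' : Torsoid G M} {f : V → V}

/-- The matching induced by a member `f` of `𝓢` joins the nodes that `f` matches. -/
theorem inducedMatching_adj_iff {W : Set (Set V)} {H : SimpleGraph W} {ε : H.edgeSet → Set V}
    {q : V → Sym2 W} {p : V → W} (hp : 𝓢.PreTorsoid q) (hnode : ∀ v, ed q v v = v.1)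
    (hedge : ∀ v w (h : H.Adj v w), ed q v w = ε ⟨s(v, w), h⟩) (hc : 𝓢.Compat q p)
    (hf : f ∈ 𝓢.carrier) (hadj : ∀ v w, NodeMatch q f v w → H.Adj v w) (hM : IsPartnerMap M f)
    (v w : W) : (inducedMatching M H ε).Adj v w ↔ mate p f v = w := by
  have key : ∀ {v w : W} (h : H.Adj v w),
      (∃ x ∈ v.1, ∃ y ∈ ε ⟨s(v, w), h⟩ ∪ w.1, M.Adj x y) ↔ NodeMatch q f v w := by
    intro v w h
    rw [← hnode v, ← hnode w, ← hedge v w h]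
    constructor
    · rintro ⟨x, hx, y, hy, hxy⟩
      rw [hM] at hxy
      subst hxy
      refine ⟨h.ne, x, ?_, hy.symm⟩
      obtain ⟨a, ha⟩ := hp.node v f hf
      obtain rfl : x = a := by
        refine eq_of_mem_exits ha hx fun h' => ?_
        rw [mem_ed] at h'
        rcases hy with hy | hy <;> rw [mem_ed, h'] at hy <;> simp at hy
        · exact h.ne hy
        · exact h.ne hy
      exact ha
    · rintro ⟨-, a, ha, h'⟩
      exact ⟨a, (mem_exits_of_eq ha).1, f a, h'.symm, hM.adj a⟩
  rw [hc.mate_eq_iff hp hf]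
  constructor
  · rintro ⟨⟨e, he⟩, rfl, h⟩
    have he' : H.Adj v w := he
    rcases h with h | h
    · exact (key he').1 h
    · have h1 : (⟨s(v, w), he⟩ : H.edgeSet) = ⟨s(w, v), he'.symm⟩ := Subtype.ext Sym2.eq_swap
      rw [h1] at h
      have h2 := (key he'.symm).1 h
      rw [← hc.mate_eq_iff hp hf] at h2 ⊢
      exact ((hc.tightFibers hp).mate_eq_comm hf).1 h2
  · intro h
    have he := hadj v w h
    exact ⟨⟨s(v, w), he⟩, rfl, Or.inl ((key he).2 h)⟩

namespace Torsoid

/-- `q` encodes the torsoid `T`: it sends the elements of a vertex `v` to the pair `s(v, v)`, and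
those of the set carried by an edge to this edge. -/
structure IsCode (T : Torsoid G M) (q : V → Sym2 T.verts) : Prop where
  node : ∀ v, ed q v v = v.1
  edge : ∀ v w (h : T.graph.Adj v w), ed q v w = T.edgeSets ⟨s(v, w), h⟩
  empty : ∀ v w, v ≠ w → ¬ T.graph.Adj v w → ed q v w = ∅

theorem exists_isCode (T : Torsoid G M) : ∃ q, T.IsCode q := by
  have hex : ∀ x, ∃ z : Sym2 T.verts, (∃ v : T.verts, x ∈ v.1 ∧ z = s(v, v)) ∨
      ∃ e : T.graph.edgeSet, x ∈ T.edgeSets e ∧ z = e.1 := by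
    intro x
    have hx : x ∈ ⋃₀ T.verts ∪ ⋃ e, T.edgeSets e := T.cover ▸ Set.mem_univ x
    rcases hx with ⟨v, hv, hx⟩ | hx
    · exact ⟨_, Or.inl ⟨⟨v, hv⟩, hx, rfl⟩⟩
    · obtain ⟨e, he⟩ := Set.mem_iUnion.1 hx
      exact ⟨_, Or.inr ⟨e, he, rfl⟩⟩
  -- the label of a vertex is determined by the set of the torsoid that contains it
  choose q hq using hex
  have hdiag : ∀ (e : T.graph.edgeSet) v, e.1 ≠ s(v, v) := by
    rintro ⟨e, he⟩ v rfl
    exact T.graph.irrefl he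
  refine ⟨q, fun v => ?_, fun v w h => ?_, fun v w hne h => ?_⟩
  · ext x
    rw [mem_ed]
    rcases hq x with ⟨u, hu, hz⟩ | ⟨e, he, hz⟩ <;> rw [hz]
    · constructor
      · intro h'
        obtain rfl : u = v := by simpa using h'
        exact hu
      · intro hx
        by_contra hne
        exact Set.disjoint_left.1 (T.disjoint_verts u.2 v.2 fun h => hne (by
          rw [Subtype.ext h])) hu hx
    · exact ⟨fun h' => absurd h' (hdiag e v), fun hx =>
        absurd he (Set.disjoint_left.1 (T.disjoint_verts_edgeSets v v.2 e) hx)⟩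
  · ext x
    rw [mem_ed]
    rcases hq x with ⟨u, hu, hz⟩ | ⟨e, he, hz⟩ <;> rw [hz]
    · exact ⟨fun h' => absurd h'.symm (hdiag ⟨s(v, w), h⟩ u), fun hx =>
        absurd hx (Set.disjoint_left.1 (T.disjoint_verts_edgeSets u u.2 _) hu)⟩
    · constructor
      · intro h'
        have : e = ⟨s(v, w), h⟩ := Subtype.ext h'
        rwa [← this]
      · intro hx
        by_contra hne
        exact Set.disjoint_left.1 (T.disjoint_edgeSets fun h' => hne (congrArg Subtype.val h')) he hx
  · refine Set.eq_empty_iff_forall_notMem.2 fun x hx => ?_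
    rw [mem_ed] at hx
    rcases hq x with ⟨u, hu, hz⟩ | ⟨e, he, hz⟩ <;> rw [hz] at hx
    · simp at hx
      rcases hx with ⟨h1, h2⟩ | ⟨h1, h2⟩
      · exact hne (h1.symm.trans h2)
      · exact hne (h2.symm.trans h1)
    · have := e.2
      rw [hx] at this
      exact h this

variable {q : V → Sym2 T.verts} {p : V → T.verts} {v w : T.verts}

theorem IsCode.preTorsoid (hq : T.IsCode q) (hG : 𝓢.Models G M) : 𝓢.PreTorsoid q := by
  refine ⟨exists_third T.four_le, fun v w => ?_⟩
  have hv := hG.isTight_iff.1 (T.isTight v.1 v.2)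
  by_cases hvw : v = w
  · subst hvw
    rw [Set.union_self, hq.node]; exact hv
  by_cases h : T.graph.Adj v w
  · rw [hq.node, hq.edge v w h, ← hG.isTight_iff]
    exact (T.isGreatest v w h).1.2.1.2
  · rw [hq.node, hq.empty v w hvw h, Set.union_empty]; exact hv

theorem IsCode.adj_of_nodeMatch (hq : T.IsCode q) (hG : 𝓢.Models G M) (hf : f ∈ 𝓢.carrier)
    (h : NodeMatch q f v w) : T.graph.Adj v w := by
  obtain ⟨hne, a, ha, h'⟩ := h
  by_contra hcon
  have h1 := mem_exits_of_eq ha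
  rcases h' with h' | h'
  · refine T.no_edge v w hne hcon a ?_ (f a) ?_ ((hG.adj _ _).2 ⟨f, hf, rfl⟩)
    · rw [← hq.node]; exact h1.1
    · rw [← hq.node]; exact h'
  · have h2 : f a ∈ ed q v w := h'
    rw [hq.empty v w hne hcon] at h2
    exact h2

theorem IsCode.adj_iff (hq : T.IsCode q) (hG : 𝓢.Models G M) :
    T.graph.Adj v w ↔ ∃ f ∈ 𝓢.carrier, NodeMatch q f v w := by
  classical
  have hp := hq.preTorsoid hG
  refine ⟨fun h => ?_, fun ⟨f, hf, h⟩ => hq.adj_of_nodeMatch hG hf h⟩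
  obtain ⟨x, hx, y, hy, hxy⟩ := T.exists_edge v w h
  obtain ⟨f, hf, rfl⟩ := (hG.adj x y).1 hxy
  refine ⟨f, hf, ?_⟩
  -- orient the edge `vw` towards `v`
  have hc : 𝓢.Compat q ((fun e => if e = s(v, w) then v else e.out.1) ∘ q) :=
    hp.compat_orientation fun e => by
      split_ifs with h
      · rw [h]; simp
      · exact Sym2.out_fst_mem e
  rw [← hc.mate_eq_iff hp hf]
  refine (hc.tightFibers hp).mate_eq_of hf (x := x) ?_ ?_ h.ne'
  · rw [← hq.node, ← hq.edge v w h] at hx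
    rcases hx with hx | hx
    · exact hc.node_subset hx
    · rw [Function.comp_apply, mem_ed.1 hx, if_pos rfl]
  · rw [← hq.node] at hy
    exact hc.node_subset hy

theorem IsCode.adj_iff_mate (hq : T.IsCode q) (hG : 𝓢.Models G M) (hc : 𝓢.Compat q p) :
    T.graph.Adj v w ↔ ∃ f ∈ 𝓢.carrier, mate p f v = w := by
  rw [hq.adj_iff hG]
  exact exists_congr fun f => and_congr_right fun hf => (hc.mate_eq_iff (hq.preTorsoid hG) hf).symm

theorem IsCode.maxed (hq : T.IsCode q) (hG : 𝓢.Models G M) : 𝓢.Maxed q := by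
  intro f hf v w h S hS hpass
  have he := hq.adj_of_nodeMatch hG hf h
  rw [hq.node, hq.node] at hpass hS
  rw [hq.edge v w he] at hS ⊢
  refine (T.isGreatest v w he).2 ⟨hS, ⟨?_, ?_⟩, ?_, ?_⟩ <;> rw [hG.isTight_iff]
  exacts [hpass.1, hpass.2.1, hpass.2.2.1, hpass.2.2.2]

theorem nonempty_verts (T : Torsoid G M) : Nonempty T.verts := by
  by_contra h
  have := T.four_le
  rw [Set.not_nonempty_iff_eq_empty'.1 h, Set.encard_empty] at this
  exact absurd this (by decide)

theorem IsCode.noncyclic (hq : T.IsCode q) (hG : 𝓢.Models G M) (hT : ¬ T.IsCyclic) :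
    𝓢.Noncyclic q := by
  have := T.nonempty_verts
  have hp := hq.preTorsoid hG
  obtain ⟨σ, -, hc⟩ := hp.exists_compat
  obtain ⟨f₀, hf₀, hM⟩ := hG.matching
  have hF := hc.tightFibers hp
  have hK := fun c d => hq.adj_iff_mate (v := c) (w := d) hG hc
  have hb : 𝓢.Braced (σ ∘ q) := (hF.isBrickOrBrace_iff (hF.models hK hf₀
    (inducedMatching_adj_iff hp hq.node hq.edge hc hf₀
      (fun _ _ => hq.adj_of_nodeMatch hG hf₀) hM))).1 (T.brickOrBrace_or_cycle.resolve_right hT)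
  refine ⟨hp, hq.maxed hG, _, hc, hb, ?_⟩
  exact (hb.branching_or_ring hF hp.three).resolve_right fun ⟨t, ht⟩ =>
    hT (ht.isC4_of_braced hb hK).isCycleGraph

theorem IsCode.cyclic (hq : T.IsCode q) (hG : 𝓢.Models G M) (hT : T.IsCyclic) :
    𝓢.Cyclic q := by
  have hp := hq.preTorsoid hG
  obtain ⟨σ, -, hc⟩ := hp.exists_compat
  have hF := hc.tightFibers hp
  have hK := fun c d => hq.adj_iff_mate (v := c) (w := d) hG hc
  obtain ⟨t, ht⟩ := hF.ring_of_two_mates hp.three fun i => by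
    obtain ⟨a, b, hab⟩ := IsCycleGraph.exists_two hT i
    exact ⟨a, b, fun f hf => hab _ ((hK _ _).2 ⟨f, hf, rfl⟩)⟩
  refine ⟨hp, hq.maxed hG, ?_, t, _, hc, ht⟩
  rintro v u w huw ⟨f, hf, hfu⟩ ⟨g, hg, hgw⟩ ⟨P₁, P₂, P₃, t1, t2, t3, d1, d2, d3, hu, t4, t5⟩
  have huv := (hq.adj_of_nodeMatch hG hf hfu).symm
  have hvw := hq.adj_of_nodeMatch hG hg hgw
  refine T.no_refinement hT u v w huv hvw huw ⟨P₁, P₂, P₃, hG.isTight_iff.2 t1, hG.isTight_iff.2 t2,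
    hG.isTight_iff.2 t3, d1, d2, d3, ?_, ?_, ?_⟩
  · rw [hu, ed_comm (i := v) (j := u), hq.edge u v huv, hq.edge v w hvw, hq.node]
  · rw [hG.isTight_iff, ← hq.node u]; exact t4
  · rw [hG.isTight_iff, ← hq.node w]; exact t5

/-- Torsoids with isomorphic codes are equal. -/
theorem IsCode.eq_of_map {q' : V → Sym2 T'.verts} (hq : T.IsCode q) (hq' : T'.IsCode q')
    (hG : 𝓢.Models G M) (σ : T.verts ≃ T'.verts) (h : ∀ x, q' x = (q x).map σ) : T = T' := by
  have hσ : ∀ v, (σ v).1 = v.1 := by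
    intro v
    rw [← hq.node, ← hq'.node]
    ext x
    rw [mem_ed, mem_ed, h, ← Sym2.map_mk, (Sym2.map.injective σ.injective).eq_iff]
  have hv : T.verts = T'.verts := by
    ext v
    constructor
    · intro hv
      have := (σ ⟨v, hv⟩).2
      rwa [hσ] at this
    · intro hv
      have := (σ.symm ⟨v, hv⟩).2
      rwa [← hσ, Equiv.apply_symm_apply] at this
  have hadj := fun v w => hq.adj_iff (v := v) (w := w) hG
  have hadj' := fun v w => hq'.adj_iff (v := v) (w := w) hG
  have hedge := hq.edge
  have hedge' := hq'.edge
  clear hq hq'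
  obtain ⟨W, H, ε⟩ := T
  obtain ⟨W', H', ε'⟩ := T'
  obtain rfl : W = W' := hv
  obtain rfl : q' = q := by
    funext x
    rw [h, show (σ : W → W) = id from funext fun v => Subtype.ext (hσ v), Sym2.map_id, id]
  obtain rfl : H = H' := by
    ext v w
    exact (hadj v w).trans (hadj' v w).symm
  obtain rfl : ε = ε' := by
    funext ⟨e, he⟩
    induction e with | _ v w
    exact (hedge v w he).symm.trans (hedge' v w he)
  rfl

end Torsoid

end TightCuts

/-! ### The torsoid of a labelling -/

namespace TightCuts

namespace MatchingSystem

variable {V : Type*} {ι κ : Type*} {G : SimpleGraph V} {M : G.Subgraph} {𝓢 : MatchingSystem V}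
  {f : V → V} {q : V → Sym2 ι} {p : V → ι} {i j : ι}

section Map

variable (e : ι ≃ κ)

theorem ed_map (i j : ι) : ed (fun x => (q x).map e) (e i) (e j) = ed q i j := by
  ext x
  rw [mem_ed, mem_ed, ← Sym2.map_mk, (Sym2.map.injective e.injective).eq_iff]

theorem cls_map (i : ι) : cls (e ∘ p) (e i) = cls p i := by
  ext x; exact e.injective.eq_iff

theorem nodeMatch_map : NodeMatch (fun x => (q x).map e) f (e i) (e j) ↔ NodeMatch q f i j := by
  simp only [NodeMatch, ed_map, ← Sym2.map_mk, (Sym2.map.injective e.injective).eq_iff,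
    e.injective.ne_iff]

theorem PreTorsoid.map (hq : 𝓢.PreTorsoid q) : 𝓢.PreTorsoid (fun x => (q x).map e) := by
  refine ⟨e.surjective.forall₂.2 fun i j => ?_, e.surjective.forall₂.2 fun i j => ?_⟩
  · obtain ⟨k, h1, h2⟩ := hq.three i j
    exact ⟨e k, e.injective.ne h1, e.injective.ne h2⟩
  · rw [ed_map, ed_map]; exact hq.tight i j

theorem Compat.map (hc : 𝓢.Compat q p) : 𝓢.Compat (fun x => (q x).map e) (e ∘ p) := by
  refine ⟨fun x => Sym2.mem_map.2 ⟨_, hc.mem x, rfl⟩, e.surjective.forall₂.2 fun i j => ?_⟩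
  rw [ed_map, ed_map, cls_map]; exact hc.tight i j

theorem Maxed.map (hq : 𝓢.Maxed q) : 𝓢.Maxed (fun x => (q x).map e) := by
  intro f hf
  refine e.surjective.forall₂.2 fun i j => ?_
  rw [nodeMatch_map, ed_map, ed_map, ed_map]
  exact hq f hf i j

theorem Unsplit.map (hq : 𝓢.Unsplit q) : 𝓢.Unsplit (fun x => (q x).map e) := by
  refine e.surjective.forall₂.2 fun i j => e.surjective.forall.2 fun k => ?_
  simp only [nodeMatch_map, ed_map, e.injective.ne_iff]
  exact hq i j k

theorem TightFibers.map (hp : 𝓢.TightFibers p) : 𝓢.TightFibers (e ∘ p) :=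
  e.surjective.forall.2 fun i => by rw [cls_map]; exact hp i

theorem Braced.map (hp : 𝓢.Braced p) : 𝓢.Braced (e ∘ p) := by
  intro I hI
  refine (hp (e ⁻¹' I) hI).imp ?_ ?_ <;>
  · rintro ⟨i, hi⟩
    refine ⟨e i, ?_⟩
    rw [← Set.image_singleton, ← hi]
    exact (Set.image_preimage_eq _ e.surjective).symm

theorem Noncyclic.map (hq : 𝓢.Noncyclic q) : 𝓢.Noncyclic (fun x => (q x).map e) := by
  obtain ⟨h1, h2, p, hc, hb, hbr⟩ := hq
  have hp := hc.tightFibers h1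
  exact ⟨h1.map e, h2.map e, _, hc.map e, hb.map e,
    hbr.map hp (hp.map e) (fun _ => rfl) e.injective⟩

theorem Cyclic.map (hq : 𝓢.Cyclic q) : 𝓢.Cyclic (fun x => (q x).map e) := by
  obtain ⟨h1, h2, h3, t, p, hc, ht⟩ := hq
  exact ⟨h1.map e, h2.map e, h3.map e, t, _, hc.map e,
    ht.coarsen (ht.fibers.map e) (h1.map e).three fun _ => rfl⟩

end Map

theorem PreTorsoid.nodeMatch_comm (hq : 𝓢.PreTorsoid q) (hf : f ∈ 𝓢.carrier) :
    NodeMatch q f i j ↔ NodeMatch q f j i := by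
  obtain ⟨σ, -, hc⟩ := hq.exists_compat
  rw [← hc.mate_eq_iff hq hf, ← hc.mate_eq_iff hq hf]
  exact (hc.tightFibers hq).mate_eq_comm hf

/-- The graph on the nodes of a pretorsoid in which two nodes are adjacent if some member of `𝓢`
matches them. -/
def PreTorsoid.graph (hq : 𝓢.PreTorsoid q) : SimpleGraph ι where
  Adj i j := ∃ f ∈ 𝓢.carrier, NodeMatch q f i j
  symm := ⟨fun _ _ ⟨f, hf, h⟩ => ⟨f, hf, (hq.nodeMatch_comm hf).1 h⟩⟩
  loopless := ⟨fun _ ⟨_, _, h⟩ => h.1 rfl⟩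

theorem PreTorsoid.graph_adj_iff (hq : 𝓢.PreTorsoid q) (hc : 𝓢.Compat q p) (i j : ι) :
    hq.graph.Adj i j ↔ ∃ f ∈ 𝓢.carrier, mate p f i = j :=
  exists_congr fun _ => and_congr_right fun hf => (hc.mate_eq_iff hq hf).symm

/-- A labelling by pairs of vertex sets that describes a torsoid, and whose nodes are the vertex
sets themselves, arises from a torsoid. -/
theorem Models.exists_torsoid_of_code (hG : 𝓢.Models G M) [Nonempty V] {W : Set (Set V)}
    {q : V → Sym2 W} (hnode : ∀ v, ed q v v = v.1)
    (h : 𝓢.Noncyclic q ∨ 𝓢.Cyclic q ∧ Finite W) : ∃ T : Torsoid G M, T.verts = W := by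
  have hq : 𝓢.PreTorsoid q := h.elim (fun h => h.1) fun h => h.1.1
  have hm : 𝓢.Maxed q := h.elim (fun h => h.2.1) fun h => h.1.2.1
  obtain ⟨σ, -, hc⟩ := hq.exists_compat
  obtain ⟨f₀, hf₀, hM⟩ := hG.matching
  have hF := hc.tightFibers hq
  have hW : Nonempty W := ⟨(σ ∘ q) (Classical.arbitrary V)⟩
  have hK := hq.graph_adj_iff hc
  let ε : hq.graph.edgeSet → Set V := fun e => {x | q x = e.1}
  have hmod := hF.models hK hf₀ (inducedMatching_adj_iff (ε := ε) hq hnode (fun _ _ _ => rfl) hc hf₀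
    (fun v w h => ⟨f₀, hf₀, h⟩) hM)
  have hnode' : ∀ v (hv : v ∈ W), ed q ⟨v, hv⟩ ⟨v, hv⟩ = v := fun v hv => hnode ⟨v, hv⟩
  have hcyc : 𝓢.Noncyclic q → ¬ IsCycleGraph hq.graph := by
    rintro ⟨-, -, p', hc', -, hbr⟩
    exact hbr.not_isCycleGraph (hq.graph_adj_iff hc')
  refine ⟨{
    verts := W
    graph := hq.graph
    edgeSets := ε
    four_le := hF.four_le hq.three
    isMatchingCovered := hmod.isMatchingCovered
    brickOrBrace_or_cycle := ?_
    isTight := fun v hv => ?_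
    disjoint_verts := fun v hv w hw hvw => ?_
    disjoint_edgeSets := fun e e' he => ?_
    disjoint_verts_edgeSets := fun v hv e => ?_
    cover := ?_
    exists_edge := fun v w he => ?_
    isGreatest := fun v w he => ?_
    no_edge := fun v w hvw he x hx y hy hxy => ?_
    no_refinement := fun hcg u v w huv hvw huw => ?_ }, rfl⟩
  · rcases h with ⟨-, -, p', hc', hb, -⟩ | ⟨⟨-, -, -, t, p', hc', ht⟩, hfin⟩
    · have hmm : ∀ f ∈ 𝓢.carrier, mate p' f = mate (σ ∘ q) f := fun _ hf => hc'.mate_eq_mate hc hq hf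
      exact Or.inl ((hF.isBrickOrBrace_iff hmod).2 (hb.congr (hc'.tightFibers hq) hF hmm))
    · exact Or.inr (ht.isCycleGraph (hq.graph_adj_iff hc'))
  · rw [hG.isTight_iff, ← hnode' v hv]; exact hq.node _
  · have : (⟨v, hv⟩ : W) ≠ ⟨w, hw⟩ := fun h => hvw (congrArg Subtype.val h)
    rw [← hnode' v hv, ← hnode' w hw]
    exact disjoint_ed (by simpa using this)
  · exact Set.disjoint_left.2 fun x h1 h2 => he (Subtype.ext (h1.symm.trans h2))
  · rw [← hnode' v hv]
    refine Set.disjoint_left.2 fun x h1 h2 => ?_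
    have h3 := e.2
    rw [← show q x = e.1 from h2, show q x = _ from h1] at h3
    exact hq.graph.irrefl h3
  · refine Set.eq_univ_of_forall fun x => ?_
    obtain ⟨v, w, hvw⟩ : ∃ v w, q x = s(v, w) := by
      induction hx : q x with | _ v w
      exact ⟨v, w, rfl⟩
    by_cases hne : v = w
    · subst hne
      exact Or.inl ⟨v.1, v.2, by rw [← hnode]; exact hvw⟩
    · right
      by_cases he : hq.graph.Adj v w
      · exact Set.mem_iUnion.2 ⟨⟨s(v, w), he⟩, hvw⟩
      · exfalso
        have h1 := hc.ed_eq_empty hq hne fun f hf h' => he ((hK v w).2 ⟨f, hf, h'⟩)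
        exact Set.eq_empty_iff_forall_notMem.1 h1 x hvw
  · obtain ⟨f, hf, hvw⟩ := he
    obtain ⟨-, a, ha, h'⟩ := (hq.nodeMatch_comm hf).1 hvw
    refine ⟨f a, ?_, a, ?_, ((hG.adj _ _).2 ⟨f, hf, rfl⟩).symm⟩
    · rw [← hnode]
      refine h'.imp id fun h' => ?_
      rw [Sym2.eq_swap] at h'
      exact h'
    · rw [← hnode]; exact (mem_exits_of_eq ha).1
  · have hpass : ∀ v w : W, v ≠ w → IsPassable G M (ed q v w) v.1 := by
      intro v w hne
      rw [IsPassable, hG.isTight_iff, hG.isTight_iff, ← hnode]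
      refine ⟨?_, hq.tight v w⟩
      rw [(disjoint_ed (by simpa using hne)).sdiff_eq_left]
      exact hq.node v
    refine ⟨⟨Set.subset_union_right.trans Set.subset_union_left, hpass v w he.ne, ?_⟩, ?_⟩
    · have := hpass w v he.ne'
      rwa [ed_comm] at this
    · rintro S ⟨hS, h1, h2⟩
      obtain ⟨f, hf, hvw⟩ := he
      refine hm f hf v w hvw S ?_ ?_
      · rw [hnode, hnode]; exact hS
      · rw [hnode, hnode]
        exact ⟨hG.isTight_iff.1 h1.1, hG.isTight_iff.1 h1.2, hG.isTight_iff.1 h2.1,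
          hG.isTight_iff.1 h2.2⟩
  · obtain ⟨f, hf, rfl⟩ := (hG.adj x y).1 hxy
    rw [← hnode] at hx hy
    obtain ⟨a, ha⟩ := hq.node v f hf
    obtain rfl : x = a := eq_of_mem_exits ha hx fun h' => by
      rw [mem_ed, mem_ed.1 hy] at h'
      simp at h'
      exact hvw h'.symm
    exact he ⟨f, hf, hvw, x, ha, Or.inl hy⟩
  · rintro ⟨P₁, P₂, P₃, t1, t2, t3, d1, d2, d3, hu, t4, t5⟩
    rcases h with h | ⟨⟨-, -, hun, -⟩, -⟩
    · exact hcyc h hcg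
    refine hun v u w huw huv.symm hvw ⟨P₁, P₂, P₃, hG.isTight_iff.1 t1, hG.isTight_iff.1 t2,
      hG.isTight_iff.1 t3, d1, d2, d3, ?_, ?_, ?_⟩
    · rw [hu, ed_comm (i := v) (j := u), hnode]; rfl
    · rw [hnode]; exact hG.isTight_iff.1 t4
    · rw [hnode]; exact hG.isTight_iff.1 t5

theorem Models.exists_torsoid (hG : 𝓢.Models G M) [Nonempty V]
    (h : 𝓢.Noncyclic q ∨ 𝓢.Cyclic q ∧ Finite ι) :
    ∃ T : Torsoid G M, ∀ i, ed q i i ∈ T.verts := by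
  have hq : 𝓢.PreTorsoid q := h.elim (fun h => h.1) fun h => h.1.1
  have hinj : Function.Injective fun i => ed q i i := by
    intro i j hij
    obtain ⟨x, hx⟩ := (hq.node i).nonempty
    have h1 : x ∈ ed q j j := (show ed q i i = ed q j j from hij) ▸ hx
    rw [mem_ed, mem_ed.1 hx] at h1
    simpa using h1
  let e : ι ≃ Set.range fun i => ed q i i := Equiv.ofInjective _ hinj
  obtain ⟨T, hT⟩ := hG.exists_torsoid_of_code (q := fun x => (q x).map e)
    (e.surjective.forall.2 fun i => by rw [ed_map]; rfl)
    (h.imp (fun h => h.map e) fun h => ⟨h.1.map e, @Finite.of_equiv _ _ h.2 e⟩)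
  exact ⟨T, fun i => by rw [hT]; exact ⟨i, rfl⟩⟩

end MatchingSystem

end TightCuts

/-! ### Torsos and torsoids of a graph -/

namespace TightCuts

open MatchingSystem

universe u

variable {V : Type u} {G : SimpleGraph V} {M : G.Subgraph} {𝒞 : Set (Set (Sym2 V))}
  {𝓢 : MatchingSystem V} {S S' : Torso G M 𝒞} {T T' : Torsoid G M}

theorem Torso.ext (h : S.star = S'.star) : S = S' := by
  cases S; cases S'; congr

theorem Torsoid.IsCode.cleaves_iff {q : V → Sym2 T.verts} {κ : Type*} {r : V → κ} (hq : T.IsCode q)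
    (hS : S.star = Set.range (cls r)) : S.Cleaves T ↔ ∀ c, ∃ i, ed q i i ⊆ cls r c := by
  rw [Torso.Cleaves, hS, Set.forall_mem_range]
  refine forall_congr' fun c => ?_
  constructor
  · rintro ⟨v, hv, h⟩
    refine ⟨⟨v, hv⟩, ?_⟩
    rw [hq.node]; exact h
  · rintro ⟨v, h⟩
    refine ⟨v.1, v.2, ?_⟩
    rw [← hq.node]; exact h

namespace MatchingSystem

variable [Nonempty V]

/-- Every torso cleaves exactly one torsoid. -/
theorem Models.existsUnique_cleaves (hG : 𝓢.Models G M) (S : Torso G M 𝒞) :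
    ∃! T : Torsoid G M, S.Cleaves T := by
  obtain ⟨r, hr, hrP⟩ := hG.exists_starMap S
  have hS := (range_cls hrP).symm
  have : Nonempty S.star := ⟨r (Classical.arbitrary V)⟩
  obtain ⟨ι, q₀, hcl₀, hq₀⟩ := hr.braced.exists_torsoid hr.fibers hr.three
  obtain ⟨T, hT⟩ := hG.exists_torsoid hq₀
  have hST : S.Cleaves T := by
    intro X hX
    obtain ⟨i, hi⟩ := hcl₀ ⟨X, hX⟩
    exact ⟨_, hT i, by rwa [hrP] at hi⟩
  refine ⟨T, hST, fun T' hST' => ?_⟩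
  obtain ⟨q, hq⟩ := T.exists_isCode
  obtain ⟨q', hq'⟩ := T'.exists_isCode
  have hcl := (hq.cleaves_iff hS).1 hST
  have hcl' := (hq'.cleaves_iff hS).1 hST'
  have c₀ : S.star := Classical.arbitrary _
  by_cases hc : T.IsCyclic <;> by_cases hc' : T'.IsCyclic
  · obtain ⟨σ, hσ⟩ := (hq'.cyclic hG hc').eq_map (hq.cyclic hG hc) hr.fibers hr.three hcl' hcl
    exact hq'.eq_of_map hq hG σ hσ
  · obtain ⟨t, ht⟩ := (hq.cyclic hG hc).ring_of_cleaves hr.fibers hr.three hcl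
    exact absurd ((hq'.noncyclic hG hc').branching_of_cleaves hr.fibers hr.three hcl')
      (ht.not_branching c₀)
  · obtain ⟨t, ht⟩ := (hq'.cyclic hG hc').ring_of_cleaves hr.fibers hr.three hcl'
    exact absurd ((hq.noncyclic hG hc).branching_of_cleaves hr.fibers hr.three hcl)
      (ht.not_branching c₀)
  · obtain ⟨σ, hσ⟩ := (hq'.noncyclic hG hc').eq_map (hq.noncyclic hG hc) hr.fibers hr.three hcl' hcl
    exact hq'.eq_of_map hq hG σ hσ

/-- Every noncyclic torsoid is cleaved by exactly one torso. -/
theorem Models.existsUnique_torso (hG : 𝓢.Models G M) (h𝒞 : IsMaximalNestedFamily G M 𝒞)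
    (hT : ¬ T.IsCyclic) : ∃! S : Torso G M 𝒞, S.Cleaves T := by
  have hD := hG.maxNested h𝒞
  obtain ⟨q, hq⟩ := T.exists_isCode
  have hn := hq.noncyclic hG hT
  obtain ⟨p, hp, hpq⟩ := hn.exists_starMap hD
  obtain ⟨S, hS⟩ := hG.exists_torso hp
  refine ⟨S, (hq.cleaves_iff hS).2 fun c => ⟨c, hpq c⟩, fun S' hS' => ?_⟩
  obtain ⟨r, hr, hrP⟩ := hG.exists_starMap S'
  have hr' := (range_cls hrP).symm
  exact Torso.ext (by
    rw [hr', hS]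
    exact hn.range_eq hD hr hp ((hq.cleaves_iff hr').1 hS') fun c => ⟨c, hpq c⟩)

theorem Models.not_isC4 (hG : 𝓢.Models G M) (hT : ¬ T.IsCyclic) (hS : S.Cleaves T) :
    ¬ IsC4 S.graph := by
  obtain ⟨q, hq⟩ := T.exists_isCode
  obtain ⟨r, hr, hrP⟩ := hG.exists_starMap S
  have : Nonempty S.star := ⟨r (Classical.arbitrary V)⟩
  exact fun h => ((hq.noncyclic hG hT).branching_of_cleaves hr.fibers hr.three
    ((hq.cleaves_iff (range_cls hrP).symm).1 hS)).not_isCycleGraph (hG.collapse_adj hr.fibers hrP)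
      h.isCycleGraph

theorem Models.isC4 (hG : 𝓢.Models G M) (hT : T.IsCyclic) (hS : S.Cleaves T) :
    IsC4 S.graph := by
  obtain ⟨q, hq⟩ := T.exists_isCode
  obtain ⟨r, hr, hrP⟩ := hG.exists_starMap S
  have : Nonempty S.star := ⟨r (Classical.arbitrary V)⟩
  obtain ⟨t, ht⟩ := (hq.cyclic hG hT).ring_of_cleaves hr.fibers hr.three
    ((hq.cleaves_iff (range_cls hrP).symm).1 hS)
  exact ht.isC4_of_braced hr.braced (hG.collapse_adj hr.fibers hrP)

/-- A cyclic torsoid with `n` vertices is cleaved by `n / 2 - 1` torsos. -/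
theorem Models.two_mul_ncard_cleaves (hG : 𝓢.Models G M) (h𝒞 : IsMaximalNestedFamily G M 𝒞)
    (hT : T.IsCyclic) : {S : Torso G M 𝒞 | S.Cleaves T}.Finite ∧
      2 * {S : Torso G M 𝒞 | S.Cleaves T}.ncard + 2 = T.verts.ncard := by
  have hD := hG.maxNested h𝒞
  obtain ⟨q, hq⟩ := T.exists_isCode
  have := T.nonempty_verts
  have := IsCycleGraph.finite hT
  obtain ⟨h1, h2⟩ := (hq.cyclic hG hT).two_mul_ncard_add_two hD
  have hinj : Set.InjOn Torso.star {S : Torso G M 𝒞 | S.Cleaves T} := fun _ _ _ _ h => Torso.ext h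
  have himg : Torso.star '' {S : Torso G M 𝒞 | S.Cleaves T} =
      {P : Set (Set V) | ∃ (κ : Type u) (r : V → κ), 𝓢.StarMap {Y | cut G Y ∈ 𝒞} r ∧
      (∀ c, ∃ i, ed q i i ⊆ cls r c) ∧ P = Set.range (cls r)} := by
    ext P
    constructor
    · rintro ⟨S, hS, rfl⟩
      obtain ⟨r, hr, hrP⟩ := hG.exists_starMap S
      have hr' := (range_cls hrP).symm
      exact ⟨_, r, hr, (hq.cleaves_iff hr').1 hS, hr'⟩
    · rintro ⟨κ, r, hr, hcl, rfl⟩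
      obtain ⟨S, hS⟩ := hG.exists_torso hr
      exact ⟨S, (hq.cleaves_iff hS).2 hcl, hS⟩
  rw [← himg] at h1 h2
  refine ⟨h1.of_finite_image hinj, ?_⟩
  rw [hinj.ncard_image, Nat.card_coe_set_eq] at h2
  exact h2

end MatchingSystem

end TightCuts

theorem mainTheorem1 {V : Type*} (G : SimpleGraph V) (M : G.Subgraph)
    (hG : TightCuts.IsMatchingCovered G M) (𝒞 : Set (Set (Sym2 V)))
    (h𝒞 : TightCuts.IsMaximalNestedFamily G M 𝒞) :
    ∃ κ : TightCuts.Torso G M 𝒞 → TightCuts.Torsoid G M,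
      (∀ S T, S.Cleaves T ↔ κ S = T) ∧
      (∀ T : TightCuts.Torsoid G M, ¬ T.IsCyclic →
        ∃ S : TightCuts.Torso G M 𝒞, κ ⁻¹' {T} = {S} ∧ ¬ TightCuts.IsC4 S.graph) ∧
      (∀ T : TightCuts.Torsoid G M, T.IsCyclic →
        (κ ⁻¹' {T}).Finite ∧
        ((κ ⁻¹' {T}).ncard : ℚ) = (T.verts.ncard : ℚ) / 2 - 1 ∧
        ∀ S ∈ κ ⁻¹' {T}, TightCuts.IsC4 S.graph) := by
  have := hG.connected.nonempty
  obtain ⟨𝓢, h𝓢⟩ := hG.exists_models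
  choose κ hκ hκ' using fun S : TightCuts.Torso G M 𝒞 => h𝓢.existsUnique_cleaves S
  have key : ∀ S T, S.Cleaves T ↔ κ S = T := fun S T =>
    ⟨fun h => (hκ' S T h).symm, fun h => h ▸ hκ S⟩
  have hpre : ∀ T, κ ⁻¹' {T} = {S | S.Cleaves T} := fun T => Set.ext fun S => (key S T).symm
  refine ⟨κ, key, fun T hT => ?_, fun T hT => ?_⟩
  · obtain ⟨S, hS, huniq⟩ := h𝓢.existsUnique_torso h𝒞 hT
    refine ⟨S, ?_, h𝓢.not_isC4 hT hS⟩
    rw [hpre]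
    exact Set.eq_singleton_iff_unique_mem.2 ⟨hS, huniq⟩
  · rw [hpre]
    obtain ⟨h1, h2⟩ := h𝓢.two_mul_ncard_cleaves h𝒞 hT
    refine ⟨h1, ?_, fun S hS => h𝓢.isC4 hT hS⟩
    have h3 : (2 * ({S : TightCuts.Torso G M 𝒞 | S.Cleaves T}.ncard : ℚ) + 2) = T.verts.ncard := by
      exact_mod_cast h2
    linarith
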